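/- **Setting.** Let $V$ be a finite-dimensional Euclidean space and $R\subset V$ a reduced irreducible crystallographic root system, normalized so that long roots have squared length $2$; let $\alpha^\vee=2\alpha/\langle\alpha,\alpha\rangle$, let $W_0$ be the Weyl group, $\alpha_1,\dots,\alpha_N$ simple roots, $\varphi$ the highest root, $P^\vee=\{\lambda\in V:\langle\lambda,\alpha\rangle\in\mathbb Z\ \forall\alpha\in R\}$ and $W=W_0\ltimes P^\vee$, with translations $\mathrm t(\lambda)$. $W$ acts on affine roots $\alpha+rc$ ($\alpha\in R$, $r\in\mathbb Z$) by $w(\alpha+rc)=w\alpha+rc$ for $w\in W_0$ and $\mathrm t(\lambda)(\alpha+rc)=\alpha+(r-\langle\alpha,\lambda\rangle)c$. Put $a_0=-\varphi+c$, $a_i=\alpha_i$ for $1\le i\le N$, with reflections $s_i$, where $s_{\alpha+rc}=\mathrm t(-r\alpha^\vee)s_\alpha$; let $\ell$ be the length function of $W$ (the number of positive affine roots sent to negative ones) and $\Omega=\{w\in W:\ell(w)=0\}$. Fix $0<q<1$ and a $W$-invariant map $a\mapsto k_a\in\mathbb C^\times$ on the affine roots, and put $k_i=k_{a_i}$. Let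 $T=\mathrm{Hom}(P^\vee,\mathbb C^\times)$, and write $t^\lambda$ for the value of $t\in T$ at $\lambda$. Let $q^\lambda\in T$ be the point $\mu\mapsto q^{\langle\lambda,\mu\rangle}$; $W$ acts on $T$ by $(wt)^\mu=t^{w^{-1}\mu}$ for $w\in W_0$ and $\mathrm t(\lambda)t=q^\lambda t$, and on functions by transposition. For an affine root $a=\alpha+rc$ let $t^{\pm a^\vee}=q^{\pm 2r/\langle\alpha,\alpha\rangle}t^{\pm\alpha^\vee}$. In the smash product $\mathbb C(T)\#_qW$ write $f(X)$ for multiplication by $f\in\mathbb C(T)$, and let $T_i=k_i+c_i(X)(s_i-1)$ with $c_i(t)=(k_i^{-1}-k_it^{a_i^\vee})/(1-t^{a_i^\vee})$, $0\le i\le N$. Let $H$ be the subalgebra generated by $T_0,\dots,T_N$ and $\Omega$ (the affine Hecke algebra), $H_0$ the one generated by $T_1,\dots,T_N$, and $\mathbb H$ the one generated by $H$ and $\mathbb C[T]$ (the double affine Hecke algebra). For a reduced expression $w=\omega s_{i_1}\cdots s_{i_r}$ let $T_w=\omega T_{i_1}\cdots T_{i_r}$; for $\lambda=\mu-\nu$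 with $\mu,\nu$ dominant let $Y^\lambda=T_{\mathrm t(\mu)}T_{\mathrm t(\nu)}^{-1}$; and let $h\mapsto h^*$ be Cherednik's duality anti-involution of $\mathbb H$, determined by $T_w^*=T_{w^{-1}}$ ($w\in W_0$), $(Y^\lambda)^*=X^{-\lambda}$, $(X^\lambda)^*=Y^{-\lambda}$. Put $d_i(t)=k_i-k_i^{-1}t^{-a_i^\vee}$ and $\widetilde S_i=d_i(X)s_i\in\mathbb H$. For a reduced expression $w=s_{i_1}\cdots s_{i_r}\omega$ put $\widetilde S_w=\widetilde S_{i_1}\cdots\widetilde S_{i_r}\omega$ and $d_w=d_{i_1}(s_{i_1}d_{i_2})\cdots(s_{i_1}\cdots s_{i_{r-1}}d_{i_r})$, so that $\widetilde S_w=d_w(X)w$; and $d_w^\diamond(t)=d_w(t^{-1})$. Let $\mathbb W=\mathbb Z_2\ltimes(W\times W)$, where the generator $\iota$ of $\mathbb Z_2$ interchanges the factors, and $\mathbb W_0=\mathbb Z_2\ltimes(W_0\times W_0)$. $\mathbb W$ acts on $T\times T$ by $(w,w')(t,\gamma)=(wt,w'^\diamond\gamma)$ and $\iota(t,\gamma)=(\gamma^{-1},t^{-1})$,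 where ${}^\diamond$ is the automorphism of $W$ that fixes $W_0$ pointwise and sends $\mathrm t(\lambda)$ to $\mathrm t(-\lambda)$; it acts on the field $\mathbb K$ of meromorphic functions on $T\times T$ by $(\mathrm wf)(t,\gamma)=f(\mathrm w^{-1}(t,\gamma))$. Let $\mathbb L=\mathbb C[T]\otimes\mathbb C[T]$ act on $\mathbb H$ by $(f\otimes g)\cdot h=f(X)\,h\,g(Y)$, so that $H_0^{\mathbb K}:=\mathbb K\otimes H_0\simeq\mathbb K\otimes_{\mathbb L}\mathbb H$, and let $\sigma_{(w,w')}$ and $\sigma_\iota$ be the semilinear extensions to $H_0^{\mathbb K}$ (with respect to the actions of $(w,w')$ and of $\iota$ on $\mathbb K$) of the maps $h\mapsto\widetilde S_wh\widetilde S_{w'}^*$ and $h\mapsto h^*$ of $\mathbb H$. Let $\tau$ be the representation of $\mathbb W$ on $H_0^{\mathbb K}$ with $$\tau(w,w')f=d_w(t)^{-1}\,d_{w'}^\diamond(\gamma)^{-1}\,\sigma_{(w,w')}(f),\qquad \tau(\iota)=\sigma_\iota .$$ Put $C_{\mathrm w}=\tau(\mathrm w)\mathrm w^{-1}$ for $\mathrm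 w\in\mathbb W$, where $\mathrm w^{-1}$ acts on the first tensor factor of $\mathbb K\otimes H_0$; this is a $\mathbb K$-linear map, that is, an $\mathrm{End}(H_0)$-valued meromorphic function on $T\times T$. Write $C_{(\lambda,\mu)}=C_{(\mathrm t(\lambda),\mathrm t(\mu))}$. The bispectral quantum KZ (BqKZ) equations for $f\in H_0^{\mathbb K}$ are $$C_{(\lambda,\mu)}(t,\gamma)\,f(q^{-\lambda}t,q^{\mu}\gamma)=f(t,\gamma)\qquad\text{for all }\lambda,\mu\in P^\vee .$$ Let $\mathrm{SOL}\subset H_0^{\mathbb K}$ be the set of their solutions, and $\mathbb F=\{f\in\mathbb K:(\mathrm t(\lambda),\mathrm t(\mu))f=f\ \forall\lambda,\mu\in P^\vee\}$, a subfield of $\mathbb K$. **Statement.** (i) The BqKZ equations form a holonomic system of $q$-difference equations, that is, for all $\lambda,\mu,\nu,\xi\in P^\vee$, $$C_{(\lambda,\mu)}(t,\gamma)\,C_{(\nu,\xi)}(q^{-\lambda}t,q^{\mu}\gamma)=C_{(\nu,\xi)}(t,\gamma)\,C_{(\lambda,\mu)}(q^{-\nu}t,q^{\xi}\gamma)$$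 as $\mathrm{End}(H_0)$-valued meromorphic functions of $(t,\gamma)\in T\times T$. (ii) The solution space $\mathrm{SOL}$ is a $\tau(\mathbb W_0)$-invariant $\mathbb F$-subspace of $H_0^{\mathbb K}$. -/

import Mathlib

open scoped TensorProduct RealInnerProductSpace

noncomputable section

/-- The standing data.  `V` is a Euclidean space and `P` a reduced irreducible (crystallographic)
root system in it; the pairing of `P` is the inner product, so that the coroots are the vectors
`α^∨ = 2α/⟨α,α⟩` of `V` and the reflections are the orthogonal ones; the long roots have squared
length `2`.  `b` is a basis of simple roots and `φ` is the highest root.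
Moreover `0 < q < 1`, and `k` is a multiplicity label with values in `ℂ \ {0}`.
A `W`-invariant label on the affine roots `α + rc` is the same as a `W₀`-invariant label
`α ↦ k_α` on the roots, with `k_{α+rc} = k_α`; it is given here in this form. -/
structure BqKZDatum (ι V : Type*) [NormedAddCommGroup V] [InnerProductSpace ℝ V] where
  finite : Finite ι
  P : RootPairing ι ℝ V V
  isRootSystem : P.IsRootSystem
  isCrystallographic : P.IsCrystallographic
  isReduced : P.IsReduced
  isIrreducible : P.IsIrreducible
  pairing_eq_inner : ∀ v w : V, P.toLinearMap v w = ⟪v, w⟫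
  coroot_eq : ∀ i, P.coroot i = (2 / ⟪P.root i, P.root i⟫) • P.root i
  normSq_le_two : ∀ i, ⟪P.root i, P.root i⟫ ≤ 2
  exists_normSq_eq_two : ∃ i, ⟪P.root i, P.root i⟫ = 2
  b : P.Base
  φ : ι
  isHighest : ∀ i, P.root φ - P.root i ∈ AddSubmonoid.closure (P.root '' b.support)
  q : ℝ
  q_pos : 0 < q
  q_lt_one : q < 1
  k : ι → ℂˣ
  k_invariant : ∀ i j, k (P.reflectionPerm i j) = k j

namespace BqKZDatum

variable {ι V : Type*} [NormedAddCommGroup V] [InnerProductSpace ℝ V] (D : BqKZDatum ι V)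

/-! ### The Weyl group, the coweight lattice and the extended affine Weyl group -/

/-- The finite Weyl group `W₀`, acting on `V`. -/
abbrev W0 : Type _ := D.P.weylGroup

lemma inner_reflection (i : ι) (u v : V) :
    ⟪D.P.reflection i u, D.P.reflection i v⟫ = ⟪u, v⟫ := by
  have hne : ⟪D.P.root i, D.P.root i⟫ ≠ 0 := by
    rw [Ne, inner_self_eq_zero]
    exact D.P.ne_zero i
  simp only [RootPairing.reflection_apply, RootPairing.coroot', LinearMap.flip_apply,
    D.pairing_eq_inner, D.coroot_eq, inner_sub_left, inner_sub_right, inner_smul_left,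
    inner_smul_right, real_inner_comm v (D.P.root i)]
  simp only [real_inner_comm (D.P.root i) u, real_inner_comm (D.P.root i) v, RCLike.conj_to_real]
  field_simp
  ring

lemma inner_smul_smul (w : D.W0) (u v : V) : ⟪w • u, w • v⟫ = ⟪u, v⟫ := by
  revert u v
  obtain ⟨g, hg⟩ := w
  induction hg using RootPairing.weylGroup.induction with
  | mem i => exact fun u v => D.inner_reflection i u v
  | one => exact fun u v => rfl
  | mul g₁ g₂ hg₁ hg₂ h₁ h₂ =>
    intro u v
    rw [← Submonoid.mk_mul_mk _ _ _ hg₁ hg₂, mul_smul, mul_smul, h₁, h₂]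

/-- The coweight lattice `P^∨ = {μ ∈ V | ⟨μ,α⟩ ∈ ℤ for all roots α}`. -/
def Pv : AddSubgroup V where
  carrier := {μ | ∀ i, ∃ n : ℤ, ⟪μ, D.P.root i⟫ = n}
  zero_mem' i := ⟨0, by simp⟩
  add_mem' {a c} ha hc i := by
    obtain ⟨m, hm⟩ := ha i
    obtain ⟨n, hn⟩ := hc i
    exact ⟨m + n, by rw [inner_add_left, hm, hn]; push_cast; rfl⟩
  neg_mem' {a} ha i := by
    obtain ⟨m, hm⟩ := ha i
    exact ⟨-m, by rw [inner_neg_left, hm]; push_cast; rfl⟩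

lemma smul_mem_Pv (w : D.W0) {μ : V} (hμ : μ ∈ D.Pv) : w • μ ∈ D.Pv := by
  intro i
  have h : ⟪w • μ, D.P.root i⟫ = ⟪μ, w⁻¹ • D.P.root i⟫ := by
    rw [← D.inner_smul_smul w μ, smul_inv_smul]
  rw [h, RootPairing.weylGroup_apply_root]
  exact hμ _

lemma coroot_mem_Pv (i : ι) : D.P.coroot i ∈ D.Pv := by
  intro j
  have := D.isCrystallographic
  obtain ⟨n, hn⟩ := D.isCrystallographic.exists_value j i
  refine ⟨n, ?_⟩
  rw [real_inner_comm, ← D.pairing_eq_inner]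
  exact hn.symm

/-- The coroot `α^∨` as an element of `P^∨`. -/
def corootPv (i : ι) : D.Pv := ⟨D.P.coroot i, D.coroot_mem_Pv i⟩

instance : DistribMulAction D.W0 D.Pv where
  smul w μ := ⟨w • (μ : V), D.smul_mem_Pv w μ.2⟩
  one_smul μ := Subtype.ext (one_smul _ (μ : V))
  mul_smul v w μ := Subtype.ext (mul_smul v w (μ : V))
  smul_zero w := Subtype.ext (smul_zero w)
  smul_add w μ ν := Subtype.ext (smul_add w (μ : V) (ν : V))

@[simp] lemma coe_smul_Pv (w : D.W0) (μ : D.Pv) : ((w • μ : D.Pv) : V) = w • (μ : V) := rfl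

/-- The action of `W₀` on the (multiplicatively written) lattice `P^∨`. -/
def latticeAction : D.W0 →* MulAut (Multiplicative D.Pv) :=
  (MulAutMultiplicative D.Pv).symm.toMonoidHom.comp (DistribMulAction.toAddAut D.W0 D.Pv)

/-- The extended affine Weyl group `W = W₀ ⋉ P^∨`; the element `⟨λ, w⟩` stands for `t(λ) w`. -/
abbrev W : Type _ := Multiplicative D.Pv ⋊[D.latticeAction] D.W0

/-- The translation `t(λ)`. -/
def trans (l : D.Pv) : D.W := SemidirectProduct.inl (Multiplicative.ofAdd l)

/-- The translation part `λ` of `t(λ) w`. -/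
def tr (g : D.W) : D.Pv := Multiplicative.toAdd g.left

@[simp] lemma tr_one : D.tr 1 = 0 := rfl

@[simp] lemma tr_mul (g h : D.W) : D.tr (g * h) = D.tr g + g.right • D.tr h := rfl

/-- The group involution `w^⋄ = w` (`w ∈ W₀`), `λ^⋄ = -λ` (`λ ∈ P^∨`). -/
def diamond : D.W →* D.W where
  toFun g := ⟨g.left⁻¹, g.right⟩
  map_one' := by ext <;> simp
  map_mul' g h := by
    refine SemidirectProduct.ext ?_ rfl
    simp [mul_comm]

@[simp] lemma tr_diamond (g : D.W) : D.tr (D.diamond g) = -D.tr g := rfl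

@[simp] lemma right_diamond (g : D.W) : (D.diamond g).right = g.right := rfl

/-! ### Affine roots and length

The affine linear function `v + rc` is written as the pair `(v, r)`. -/

/-- The action `w(v + rc) = w(v) + rc`, `t(λ)(v + rc) = v + (r - ⟨v,λ⟩)c`. -/
def affAct (g : D.W) (a : V × ℝ) : V × ℝ :=
  (g.right • a.1, a.2 - ⟪g.right • a.1, (D.tr g : V)⟫)

/-- The affine root system `S = {α + rc | α ∈ R, r ∈ ℤ}`. -/
def affRoots : Set (V × ℝ) := {a | ∃ i : ι, ∃ r : ℤ, a = (D.P.root i, (r : ℝ))}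

open Classical in
/-- The positive affine roots `α + rc`, with `r ≥ 0` if `α ∈ R₊` and `r ≥ 1` if `α ∈ R₋`. -/
def posAffRoots : Set (V × ℝ) :=
  {a | ∃ i : ι, ∃ r : ℤ, a = (D.P.root i, (r : ℝ)) ∧ (if D.b.IsPos i then 0 else 1) ≤ r}

/-- The negative affine roots. -/
def negAffRoots : Set (V × ℝ) := D.affRoots \ D.posAffRoots

lemma affAct_neg (g : D.W) (a : V × ℝ) : D.affAct g (-a) = -D.affAct g a := by
  refine Prod.ext ?_ ?_
  · simp [affAct]
  · simp [affAct]
    ring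

lemma affAct_affAct (g h : D.W) (a : V × ℝ) : D.affAct g (D.affAct h a) = D.affAct (g * h) a := by
  refine Prod.ext ?_ ?_
  · simp [affAct, mul_smul]
  · simp only [affAct, tr_mul, SemidirectProduct.mul_right, AddSubgroup.coe_add, coe_smul_Pv,
      inner_add_right, mul_smul, D.inner_smul_smul]
    ring

lemma affAct_one (a : V × ℝ) : D.affAct 1 a = a := by simp [affAct]

lemma neg_mem_affRoots {a : V × ℝ} (ha : a ∈ D.affRoots) : -a ∈ D.affRoots := by
  obtain ⟨i, r, rfl⟩ := ha
  exact ⟨D.P.reflectionPerm i i, -r, by simp⟩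

lemma posAffRoots_subset : D.posAffRoots ⊆ D.affRoots := by
  rintro _ ⟨i, r, rfl, -⟩
  exact ⟨i, r, rfl⟩

lemma mk_mem_posAffRoots (i : ι) (r : ℤ) [Decidable (D.b.IsPos i)] :
    (D.P.root i, (r : ℝ)) ∈ D.posAffRoots ↔ (if D.b.IsPos i then 0 else 1) ≤ r := by
  constructor
  · rintro ⟨j, t, h, ht⟩
    obtain rfl : i = j := D.P.root.injective (congrArg Prod.fst h)
    obtain rfl : r = t := Int.cast_injective (α := ℝ) (congrArg Prod.snd h)
    convert ht
  · intro h
    refine ⟨i, r, rfl, ?_⟩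
    convert h

/-- The negative affine roots are the negatives of the positive ones. -/
lemma mem_negAffRoots_iff (a : V × ℝ) : a ∈ D.negAffRoots ↔ -a ∈ D.posAffRoots := by
  classical
  have key : ∀ i : ι, ∀ r : ℤ, (D.P.root i, (r : ℝ)) ∈ D.negAffRoots ↔
      -(D.P.root i, (r : ℝ)) ∈ D.posAffRoots := by
    intro i r
    have h1 : -(D.P.root i, (r : ℝ)) =
        (D.P.root (D.P.reflectionPerm i i), ((-r : ℤ) : ℝ)) := by simp
    have h2 : (D.P.root i, (r : ℝ)) ∈ D.affRoots := ⟨i, r, rfl⟩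
    have h3 : D.b.IsPos (D.P.reflectionPerm i i) ↔ ¬ D.b.IsPos i :=
      RootPairing.Base.IsPos.neg_iff_not D.b i
    rw [h1, mk_mem_posAffRoots, negAffRoots, Set.mem_sdiff, mk_mem_posAffRoots]
    by_cases hp : D.b.IsPos i
    · simp only [h2, h3, hp, not_true_eq_false, if_true, if_false, true_and]
      omega
    · simp only [h2, h3, hp, not_false_eq_true, if_true, if_false, true_and]
      omega
  constructor
  · intro ha
    obtain ⟨i, r, rfl⟩ := ha.1
    exact (key i r).1 ha
  · intro ha
    obtain ⟨i, r, h⟩ := D.neg_mem_affRoots (D.posAffRoots_subset ha)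
    rw [neg_neg] at h
    subst h
    exact (key i r).2 ha

/-- The length `ℓ(w) = #(S₊ ∩ w⁻¹ S₋)`. -/
def len (g : D.W) : ℕ := Set.ncard {a | a ∈ D.posAffRoots ∧ D.affAct g a ∈ D.negAffRoots}

lemma len_inv (g : D.W) : D.len g⁻¹ = D.len g := by
  have h : {a | a ∈ D.posAffRoots ∧ D.affAct g⁻¹ a ∈ D.negAffRoots} =
      (fun a => -D.affAct g a) '' {a | a ∈ D.posAffRoots ∧ D.affAct g a ∈ D.negAffRoots} := by
    ext a
    constructor
    · rintro ⟨h1, h2⟩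
      refine ⟨-D.affAct g⁻¹ a, ⟨(D.mem_negAffRoots_iff _).1 h2, ?_⟩, ?_⟩
      · rw [affAct_neg, affAct_affAct, mul_inv_cancel, affAct_one, mem_negAffRoots_iff, neg_neg]
        exact h1
      · simp only [affAct_neg, affAct_affAct, mul_inv_cancel, affAct_one, neg_neg]
    · rintro ⟨a, ⟨h1, h2⟩, rfl⟩
      refine ⟨(D.mem_negAffRoots_iff _).1 h2, ?_⟩
      simp only
      rw [affAct_neg, affAct_affAct, inv_mul_cancel, affAct_one, mem_negAffRoots_iff, neg_neg]
      exact h1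
  rw [len, len, h]
  refine Set.ncard_image_of_injective _ fun a c hac => ?_
  have := congrArg (D.affAct g⁻¹) (neg_injective hac)
  simpa only [affAct_affAct, inv_mul_cancel, affAct_one] using this

/-- The set `Ω` of elements of length zero. -/
def Om : Type _ := {g : D.W // D.len g = 0}

instance : Nonempty D.Om := by
  refine ⟨⟨1, ?_⟩⟩
  have h : {a | a ∈ D.posAffRoots ∧ D.affAct 1 a ∈ D.negAffRoots} = ∅ := by
    ext a
    simp only [Set.mem_ofPred_eq, affAct_one, negAffRoots, Set.mem_sdiff, Set.mem_empty_iff_false, iff_false]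
    tauto
  rw [len, h, Set.ncard_empty]

/-- The index set `{0, 1, …, N}`, with `none` in the role of `0`. -/
abbrev I : Type _ := Option D.b.support

/-- The simple affine root `a_i = α + rc`, given by the index of `α` and by `r`:
`a_0 = -φ + c`, and `a_i = α_i` for `i ≠ 0`. -/
def simpleAff : D.I → ι × ℤ
  | none => (D.P.reflectionPerm D.φ D.φ, 1)
  | some i => (i, 0)

/-- For the affine root `a = α + rc` the reflection `s_a(v) = v - a(v) α^∨`,
that is, `s_a = t(-r α^∨) s_α`. -/
def affRefl (a : ι × ℤ) : D.W :=
  ⟨Multiplicative.ofAdd (-(a.2 • D.corootPv a.1)), RootPairing.weylGroup.ofIdx D.P a.1⟩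

/-- The simple reflection `s_i`. -/
def s (i : D.I) : D.W := D.affRefl (D.simpleAff i)

/-- The parameter `k_i`. -/
def ki (i : D.I) : ℂˣ := D.k (D.simpleAff i).1

/-- A reduced expression `w = ω s_{i₁} ⋯ s_{i_r}`, `r = ℓ(w)` (arbitrarily chosen). -/
def redExprL (g : D.W) : List D.I × D.Om :=
  Classical.epsilon fun p : List D.I × D.Om =>
    g = p.2.1 * (p.1.map D.s).prod ∧ p.1.length = D.len g

/-- A reduced expression `w = s_{i₁} ⋯ s_{i_r} ω`, `r = ℓ(w)` (arbitrarily chosen). -/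
def redExprR (g : D.W) : List D.I × D.Om :=
  Classical.epsilon fun p : List D.I × D.Om =>
    g = (p.1.map D.s).prod * p.2.1 ∧ p.1.length = D.len g

/-! ### The torus -/

/-- The complex torus `T = Hom(P^∨, ℂ^×)`; the value of `t` at `λ` is `t^λ`. -/
abbrev T : Type _ := Multiplicative D.Pv →* ℂˣ

/-- `x ↦ q^x` on the real numbers (positive branch). -/
def qpow : Multiplicative ℝ →* ℂˣ where
  toFun x := Units.mk0 ((D.q ^ (Multiplicative.toAdd x) : ℝ) : ℂ)
    (by exact_mod_cast (Real.rpow_pos_of_pos D.q_pos _).ne')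
  map_one' := by ext; simp
  map_mul' x y := by ext; simp [Real.rpow_add D.q_pos]

/-- The point `q^λ` of `T`, with `q^λ(μ) = q^{⟨λ,μ⟩}`. -/
def qchar (l : D.Pv) : D.T where
  toFun m := D.qpow (Multiplicative.ofAdd ⟪(l : V), ((Multiplicative.toAdd m : D.Pv) : V)⟫)
  map_one' := by simp
  map_mul' m n := by
    rw [← map_mul, ← ofAdd_add, ← inner_add_right]
    rfl

lemma qchar_apply (l : D.Pv) (m : Multiplicative D.Pv) :
    D.qchar l m = D.qpow (Multiplicative.ofAdd ⟪(l : V), ((Multiplicative.toAdd m : D.Pv) : V)⟫) := rfl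

lemma qchar_zero : D.qchar 0 = 1 := by
  refine MonoidHom.ext fun m => ?_
  simp [qchar_apply]

lemma qchar_add (l m : D.Pv) : D.qchar (l + m) = D.qchar l * D.qchar m := by
  refine MonoidHom.ext fun n => ?_
  rw [MonoidHom.mul_apply]
  simp only [qchar_apply, AddSubgroup.coe_add, inner_add_left, ofAdd_add, map_mul]

lemma qchar_neg (l : D.Pv) : D.qchar (-l) = (D.qchar l)⁻¹ := by
  refine MonoidHom.ext fun n => ?_
  rw [MonoidHom.inv_apply]
  simp only [qchar_apply, AddSubgroup.coe_neg, inner_neg_left, ofAdd_neg, map_inv]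

/-- The action `(wt)^μ = t^{w⁻¹μ}` of `W₀` on `T`. -/
def finAct (w : D.W0) (t : D.T) : D.T :=
  t.comp (D.latticeAction w⁻¹).toMonoidHom

lemma finAct_apply (w : D.W0) (t : D.T) (m : Multiplicative D.Pv) :
    D.finAct w t m = t (Multiplicative.ofAdd (w⁻¹ • Multiplicative.toAdd m)) := rfl

lemma finAct_mul (w : D.W0) (t u : D.T) : D.finAct w (t * u) = D.finAct w t * D.finAct w u := rfl

lemma finAct_inv (w : D.W0) (t : D.T) : D.finAct w t⁻¹ = (D.finAct w t)⁻¹ := rfl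

lemma finAct_qchar (w : D.W0) (l : D.Pv) : D.finAct w (D.qchar l) = D.qchar (w • l) := by
  refine MonoidHom.ext fun m => ?_
  simp only [finAct_apply, qchar_apply, toAdd_ofAdd, coe_smul_Pv]
  rw [← D.inner_smul_smul w (l : V), smul_inv_smul]

/-- The action of `W` on `T`: `w ∈ W₀` acts as above and `t(λ) t = q^λ t`. -/
instance : MulAction D.W D.T where
  smul g t := D.qchar (D.tr g) * D.finAct g.right t
  one_smul t := by
    change D.qchar 0 * D.finAct 1 t = t
    refine MonoidHom.ext fun m => ?_
    rw [qchar_zero, MonoidHom.mul_apply, finAct_apply]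
    simp
  mul_smul g h t := by
    change D.qchar (D.tr g + g.right • D.tr h) * D.finAct (g.right * h.right) t =
      D.qchar (D.tr g) * D.finAct g.right (D.qchar (D.tr h) * D.finAct h.right t)
    rw [qchar_add, finAct_mul, finAct_qchar]
    refine MonoidHom.ext fun m => ?_
    simp only [MonoidHom.mul_apply, finAct_apply, mul_inv_rev, mul_smul, toAdd_ofAdd, mul_assoc]

lemma smul_T_def (g : D.W) (t : D.T) : g • t = D.qchar (D.tr g) * D.finAct g.right t := rfl

lemma inv_inv_T (t : D.T) : t⁻¹⁻¹ = t := by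
  refine MonoidHom.ext fun m => ?_
  simp only [MonoidHom.inv_apply, inv_inv]

lemma diamond_diamond (g : D.W) : D.diamond (D.diamond g) = g :=
  SemidirectProduct.ext (inv_inv g.left) rfl

lemma smul_inv_T (g : D.W) (t : D.T) : (g • t⁻¹)⁻¹ = D.diamond g • t := by
  rw [smul_T_def, smul_T_def, finAct_inv, tr_diamond, right_diamond, qchar_neg]
  refine MonoidHom.ext fun m => ?_
  simp only [MonoidHom.mul_apply, MonoidHom.inv_apply, mul_inv_rev, inv_inv, mul_comm]

/-! ### Regular and rational functions on the torus, and `q`-difference reflection operators -/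

/-- The algebra `ℂ[T]` of regular functions on `T`: the group algebra of `P^∨`,
with `x^λ = single λ 1` standing for the function `t ↦ t^λ`. -/
abbrev CT : Type _ := AddMonoidAlgebra ℂ D.Pv

instance : UniqueSums D.Pv :=
  have : Module ℚ V := Module.compHom V (algebraMap ℚ ℝ)
  UniqueSums.of_injective_addHom (D.Pv.subtype : D.Pv →+ V).toAddHom
    Subtype.val_injective inferInstance

lemma algHom_ext_CT {B : Type*} [Semiring B] [Algebra ℂ B] {f g : D.CT →ₐ[ℂ] B}
    (h : ∀ l, f (AddMonoidAlgebra.single l 1) = g (AddMonoidAlgebra.single l 1)) : f = g :=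
  AddMonoidAlgebra.algHom_ext h (Subsingleton.elim _ _)

/-- The algebra map of `ℂ[T]` with `x^λ ↦ q^{-⟨wλ,ν⟩} x^{wλ}` for `g = t(ν) w`. -/
def regAct (g : D.W) : D.CT →ₐ[ℂ] D.CT :=
  AddMonoidAlgebra.lift ℂ D.CT D.Pv
    { toFun := fun m => AddMonoidAlgebra.single (g.right • Multiplicative.toAdd m)
        ((D.qpow (Multiplicative.ofAdd
          (-⟪g.right • ((Multiplicative.toAdd m : D.Pv) : V), (D.tr g : V)⟫)) : ℂˣ) : ℂ)
      map_one' := by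
        simp [AddMonoidAlgebra.one_def]
      map_mul' := fun m n => by
        rw [AddMonoidAlgebra.single_mul_single, ← Units.val_mul, ← map_mul, ← ofAdd_add, toAdd_mul,
          smul_add, AddSubgroup.coe_add, smul_add, inner_add_left, neg_add] }

lemma regAct_single (g : D.W) (l : D.Pv) (c : ℂ) :
    D.regAct g (AddMonoidAlgebra.single l c) = AddMonoidAlgebra.single (g.right • l)
      (c * (D.qpow (Multiplicative.ofAdd (-⟪g.right • (l : V), (D.tr g : V)⟫)) : ℂˣ)) := by
  simp [regAct, AddMonoidAlgebra.lift_single]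

/-- The action `(wf)(t) = f(w⁻¹t)` of `W` on `ℂ[T]`. -/
instance : MulSemiringAction D.W D.CT where
  smul g f := D.regAct g f
  one_smul f := by
    change D.regAct 1 f = f
    have : D.regAct 1 = AlgHom.id ℂ D.CT := by
      refine D.algHom_ext_CT fun l => ?_
      simp [regAct_single]
    rw [this]; rfl
  mul_smul g h f := by
    change D.regAct (g * h) f = D.regAct g (D.regAct h f)
    have : D.regAct (g * h) = (D.regAct g).comp (D.regAct h) := by
      refine D.algHom_ext_CT fun l => ?_
      simp only [AlgHom.comp_apply, regAct_single, SemidirectProduct.mul_right, mul_smul, tr_mul,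
        one_mul, coe_smul_Pv, AddSubgroup.coe_add]
      rw [← Units.val_mul, ← map_mul, ← ofAdd_add, inner_add_right, D.inner_smul_smul, neg_add_rev]
    rw [this]; rfl
  smul_zero g := map_zero (D.regAct g)
  smul_add g := map_add (D.regAct g)
  smul_one g := map_one (D.regAct g)
  smul_mul g := map_mul (D.regAct g)

lemma smul_CT_def (g : D.W) (f : D.CT) : g • f = D.regAct g f := rfl

/-- The field `ℂ(T)` of rational functions on `T`. -/
def RatT : Type _ := FractionRing D.CT

instance : Field D.RatT := inferInstanceAs (Field (FractionRing D.CT))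

instance : Algebra D.CT D.RatT := inferInstanceAs (Algebra D.CT (FractionRing D.CT))

instance : IsFractionRing D.CT D.RatT := inferInstanceAs (IsFractionRing D.CT (FractionRing D.CT))

instance : Algebra ℂ D.RatT := inferInstanceAs (Algebra ℂ (FractionRing D.CT))

instance : IsScalarTower ℂ D.CT D.RatT := IsScalarTower.of_algebraMap_eq fun _ => rfl

/-- The `W`-action on `ℂ(T)`. -/
instance : MulSemiringAction D.W D.RatT := IsFractionRing.mulSemiringAction D.W D.CT D.RatT

instance : SMulDistribClass D.W D.CT D.RatT := IsFractionRing.smulDistribClass D.W D.CT D.RatT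

lemma smul_algebraMap_RatT (g : D.W) (f : D.CT) :
    g • algebraMap D.CT D.RatT f = algebraMap D.CT D.RatT (g • f) := by
  rw [Algebra.algebraMap_eq_smul_one, smul_distrib_smul, smul_one, Algebra.algebraMap_eq_smul_one]

instance : SMulCommClass D.W ℂ D.RatT where
  smul_comm g c f := by
    have h : g • algebraMap ℂ D.RatT c = algebraMap ℂ D.RatT c := by
      rw [IsScalarTower.algebraMap_apply ℂ D.CT D.RatT, smul_algebraMap_RatT, smul_CT_def,
        AlgHom.commutes]
    rw [Algebra.smul_def, Algebra.smul_def, smul_mul', h]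

/-- The smash product `ℂ(T) #_q W`, the algebra of `q`-difference reflection operators. -/
abbrev A : Type _ := SkewMonoidAlgebra D.RatT D.W

/-- The multiplication operator `f(X)` for a rational function `f`. -/
def mulOp : D.RatT →+* D.A where
  toFun f := SkewMonoidAlgebra.single 1 f
  map_one' := rfl
  map_mul' f g := by rw [SkewMonoidAlgebra.single_mul_single, one_smul, mul_one]
  map_zero' := SkewMonoidAlgebra.single_zero_right 1
  map_add' := SkewMonoidAlgebra.single_add 1

/-- The multiplication operator `f(X)` for a regular function `f`. -/
def X : D.CT →ₐ[ℂ] D.A :=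
  { D.mulOp.comp (algebraMap D.CT D.RatT) with
    commutes' := fun c => by
      change SkewMonoidAlgebra.single 1 (algebraMap D.CT D.RatT (algebraMap ℂ D.CT c)) = _
      rw [← IsScalarTower.algebraMap_apply]
      rfl }

/-- The inclusion of the group `W` in `ℂ(T) #_q W`. -/
def wOp : D.W →* D.A := SkewMonoidAlgebra.of D.RatT D.W

/-- The monomial `x^λ`. -/
def mono (l : D.Pv) : D.CT := AddMonoidAlgebra.single l 1

/-- For `a = α + rc` and `ε ∈ ℤ` the monomial `x^{ε a^∨} = q^{2εr/⟨α,α⟩} x^{εα^∨}`,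
where `a^∨ = 2a/⟨a,a⟩`. -/
def monoCo (a : ι × ℤ) (ε : ℤ) : D.CT :=
  AddMonoidAlgebra.single (ε • D.corootPv a.1)
    ((D.q ^ (ε * (2 * a.2 / ⟪D.P.root a.1, D.P.root a.1⟫)) : ℝ) : ℂ)

/-! ### The affine Hecke algebra inside `ℂ(T) #_q W`, and the double affine Hecke algebra -/

/-- The rational function `c_i = (k_i⁻¹ - k_i x^{a_i^∨})/(1 - x^{a_i^∨})`. -/
def c (i : D.I) : D.RatT :=
  (algebraMap ℂ D.RatT ((D.ki i)⁻¹ : ℂˣ) -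
      algebraMap ℂ D.RatT (D.ki i) * algebraMap D.CT D.RatT (D.monoCo (D.simpleAff i) 1)) /
    (1 - algebraMap D.CT D.RatT (D.monoCo (D.simpleAff i) 1))

/-- The operator `T_i = k_i + c_i(X)(s_i - 1)`. -/
def Top (i : D.I) : D.A :=
  algebraMap ℂ D.A (D.ki i) + D.mulOp (D.c i) * (D.wOp (D.s i) - 1)

lemma affRefl_smul_monoCo (a : ι × ℤ) :
    D.affRefl a • D.monoCo a 1 = D.monoCo a (-1) := by
  have hne : ⟪D.P.root a.1, D.P.root a.1⟫ ≠ 0 := by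
    rw [Ne, inner_self_eq_zero]
    exact D.P.ne_zero a.1
  have hrefl : (D.affRefl a).right • (D.corootPv a.1 : V) = -(D.corootPv a.1 : V) := by
    change D.P.reflection a.1 (D.P.coroot a.1) = -D.P.coroot a.1
    rw [D.coroot_eq, map_smul, RootPairing.reflection_apply_self, smul_neg]
  have htr : (D.tr (D.affRefl a) : V) = -(a.2 • D.P.coroot a.1) := rfl
  have hco : ⟪D.P.coroot a.1, D.P.coroot a.1⟫ = 4 / ⟪D.P.root a.1, D.P.root a.1⟫ := by
    rw [D.coroot_eq, inner_smul_left, inner_smul_right]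
    simp only [RCLike.conj_to_real]
    field_simp
    norm_num
  rw [smul_CT_def, monoCo, regAct_single, monoCo]
  congr 1
  · apply Subtype.ext
    simpa using hrefl
  · rw [one_smul, hrefl, htr]
    simp only [qpow, MonoidHom.coe_mk, OneHom.coe_mk, Units.val_mk0, toAdd_ofAdd]
    rw [← Complex.ofReal_mul, ← Real.rpow_add D.q_pos]
    congr 2
    have : ((D.corootPv a.1 : D.Pv) : V) = D.P.coroot a.1 := rfl
    rw [this, ← Int.cast_smul_eq_zsmul ℝ, inner_neg_left, inner_neg_right, inner_smul_right, hco]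
    field_simp
    push_cast
    ring

lemma monoCo_ne_one (a : ι × ℤ) : algebraMap D.CT D.RatT (D.monoCo a 1) ≠ 1 := by
  intro h
  have h1 : D.monoCo a 1 = 1 := by
    apply IsFractionRing.injective D.CT D.RatT
    rw [h, map_one]
  have h2 := congrArg (fun f : D.CT => f.coeff 0) h1
  have hne : D.corootPv a.1 ≠ 0 := fun h0 => D.P.ne_zero' a.1 (congrArg Subtype.val h0)
  simp [monoCo, AddMonoidAlgebra.one_def, hne] at h2

lemma monoCo_mul_neg (a : ι × ℤ) : D.monoCo a 1 * D.monoCo a (-1) = 1 := by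
  rw [monoCo, monoCo, AddMonoidAlgebra.single_mul_single, AddMonoidAlgebra.one_def,
    ← Complex.ofReal_mul, ← Real.rpow_add D.q_pos]
  congr 1
  · simp
  · simp

lemma c_add_smul_c (i : D.I) :
    D.c i + D.s i • D.c i =
      algebraMap ℂ D.RatT (D.ki i) + algebraMap ℂ D.RatT ((D.ki i)⁻¹ : ℂˣ) := by
  have hz : algebraMap D.CT D.RatT (D.monoCo (D.simpleAff i) 1) ≠ 1 := D.monoCo_ne_one _
  have hzw : algebraMap D.CT D.RatT (D.monoCo (D.simpleAff i) 1) *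
      algebraMap D.CT D.RatT (D.monoCo (D.simpleAff i) (-1)) = 1 := by
    rw [← map_mul, D.monoCo_mul_neg, map_one]
  have hs : D.s i • algebraMap D.CT D.RatT (D.monoCo (D.simpleAff i) 1) =
      algebraMap D.CT D.RatT (D.monoCo (D.simpleAff i) (-1)) := by
    rw [smul_algebraMap_RatT]
    exact congrArg _ (D.affRefl_smul_monoCo _)
  have hc : ∀ x : ℂ, D.s i • algebraMap ℂ D.RatT x = algebraMap ℂ D.RatT x := fun x => by
    rw [Algebra.algebraMap_eq_smul_one, smul_comm, smul_one]
  rw [c, smul_div₀', smul_sub, smul_sub, smul_mul', hc, hc, smul_one, hs]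
  generalize algebraMap D.CT D.RatT (D.monoCo (D.simpleAff i) 1) = z at *
  generalize algebraMap D.CT D.RatT (D.monoCo (D.simpleAff i) (-1)) = w at *
  generalize algebraMap ℂ D.RatT (D.ki i) = x
  generalize algebraMap ℂ D.RatT ((D.ki i)⁻¹ : ℂˣ) = y
  have h1 : 1 - z ≠ 0 := sub_ne_zero.mpr (Ne.symm hz)
  have hz0 : z ≠ 0 := left_ne_zero_of_mul_eq_one hzw
  obtain rfl : w = z⁻¹ := eq_inv_of_mul_eq_one_right hzw
  have h2 : 1 - z⁻¹ ≠ 0 := by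
    rw [sub_ne_zero]
    exact fun h => hz (inv_eq_one.mp h.symm)
  have h3 : z - 1 ≠ 0 := sub_ne_zero.mpr hz
  field_simp
  ring

lemma affRefl_mul_self (a : ι × ℤ) : D.affRefl a * D.affRefl a = 1 := by
  refine SemidirectProduct.ext ?_ ?_
  · have hrefl : RootPairing.weylGroup.ofIdx D.P a.1 • D.corootPv a.1 = -D.corootPv a.1 := by
      apply Subtype.ext
      change D.P.reflection a.1 (D.P.coroot a.1) = -D.P.coroot a.1
      rw [D.coroot_eq, map_smul, RootPairing.reflection_apply_self, smul_neg]
    change -(a.2 • D.corootPv a.1) +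
      RootPairing.weylGroup.ofIdx D.P a.1 • -(a.2 • D.corootPv a.1) = 0
    rw [smul_neg, smul_comm, hrefl]
    simp
  · apply Subtype.ext
    change RootPairing.Equiv.reflection D.P a.1 * RootPairing.Equiv.reflection D.P a.1 = 1
    rw [mul_eq_one_iff_eq_inv, RootPairing.Equiv.reflection_inv]

lemma heckeRing_aux {R : Type*} [Ring R] (x y C C' S : R) (hxy : x * y = 1)
    (hx : ∀ z : R, z * x = x * z) (hy : ∀ z : R, z * y = y * z) (hC : C + C' = x + y)
    (hS : S * S = 1) (hSC : S * C = C' * S) :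
    (x + C * (S - 1)) * (x + C * (S - 1) - x + y) = 1 := by
  have h1 : (S - 1) * C * (S - 1) = -((x + y) * (S - 1)) := by
    have e : (S - 1) * C * (S - 1) = C' * (S * S) - C * S - C' * S + C := by
      rw [sub_mul, hSC, one_mul, sub_mul, mul_sub, mul_sub, mul_assoc C' S S, mul_one, mul_one]
      abel
    rw [e, hS, ← hC, mul_one, mul_sub, add_mul, mul_one]
    abel
  have h2 : (x + C * (S - 1)) * (x + C * (S - 1) - x + y) =
      x * y + x * (C * (S - 1)) + (C * (S - 1)) * y + C * ((S - 1) * C * (S - 1)) := by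
    rw [add_sub_cancel_left, add_mul, mul_add, mul_add]
    simp only [mul_assoc]
    abel
  rw [h2, h1, hxy, hy, mul_neg, ← mul_assoc C, mul_add C x y, hx C, hy C, add_mul, mul_assoc x C,
    mul_assoc y C]
  abel

lemma Top_mul_inv (i : D.I) :
    D.Top i * (D.Top i - algebraMap ℂ D.A (D.ki i) + algebraMap ℂ D.A ((D.ki i)⁻¹ : ℂˣ)) = 1 := by
  have hS : D.wOp (D.s i) * D.wOp (D.s i) = 1 := by
    rw [← map_mul, s, D.affRefl_mul_self, map_one]
  have hSC : D.wOp (D.s i) * D.mulOp (D.c i) = D.mulOp (D.s i • D.c i) * D.wOp (D.s i) := by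
    simp [wOp, mulOp, SkewMonoidAlgebra.of_apply, SkewMonoidAlgebra.single_mul_single]
  have hCC : D.mulOp (D.c i) + D.mulOp (D.s i • D.c i) =
      algebraMap ℂ D.A (D.ki i) + algebraMap ℂ D.A ((D.ki i)⁻¹ : ℂˣ) := by
    rw [← map_add, D.c_add_smul_c, map_add]
    rfl
  have hκ : algebraMap ℂ D.A (D.ki i) * algebraMap ℂ D.A ((D.ki i)⁻¹ : ℂˣ) = 1 := by
    rw [← map_mul, ← Units.val_mul, mul_inv_cancel, Units.val_one, map_one]
  have hcomm : ∀ (x : ℂ) (y : D.A), y * algebraMap ℂ D.A x = algebraMap ℂ D.A x * y :=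
    fun x y => (Algebra.commutes x y).symm
  rw [Top]
  generalize hx : algebraMap ℂ D.A (D.ki i) = x at *
  generalize hy : algebraMap ℂ D.A ((D.ki i)⁻¹ : ℂˣ) = y at *
  have hxc : ∀ z : D.A, z * x = x * z := fun z => by rw [← hx]; exact hcomm _ z
  have hyc : ∀ z : D.A, z * y = y * z := fun z => by rw [← hy]; exact hcomm _ z
  generalize D.mulOp (D.c i) = C at *
  generalize D.mulOp (D.s i • D.c i) = C' at *
  generalize D.wOp (D.s i) = S at *
  exact heckeRing_aux x y C C' S hκ hxc hyc hCC hS hSC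

/-- The invertible element `T_i`; its inverse is `T_i - k_i + k_i⁻¹`. -/
def TUnit (i : D.I) : D.Aˣ where
  val := D.Top i
  inv := D.Top i - algebraMap ℂ D.A (D.ki i) + algebraMap ℂ D.A ((D.ki i)⁻¹ : ℂˣ)
  val_inv := D.Top_mul_inv i
  inv_val := by
    have h : ∀ x : ℂ, algebraMap ℂ D.A x * D.Top i = D.Top i * algebraMap ℂ D.A x :=
      fun x => Algebra.commutes x _
    rw [add_mul, sub_mul, h, h, ← mul_sub, ← mul_add]
    exact D.Top_mul_inv i

/-- The elements of `W` as invertible elements of `ℂ(T) #_q W`. -/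
def wUnit : D.W →* D.Aˣ := D.wOp.toHomUnits

/-- `T_w = ω T_{i₁} ⋯ T_{i_r}` for a reduced expression `w = ω s_{i₁} ⋯ s_{i_r}`. -/
def Tw (g : D.W) : D.Aˣ :=
  D.wUnit (D.redExprL g).2.1 * ((D.redExprL g).1.map D.TUnit).prod

/-- Dominant coweights. -/
def IsDominant (l : D.Pv) : Prop := ∀ i ∈ D.b.support, 0 ≤ ⟪(l : V), D.P.root i⟫

/-- `Y^λ = T_{t(μ)} T_{t(ν)}⁻¹`, where `λ = μ - ν` with `μ, ν` dominant (arbitrarily chosen). -/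
def Y (l : D.Pv) : D.Aˣ :=
  let p : D.Pv × D.Pv := Classical.epsilon fun p : D.Pv × D.Pv =>
    D.IsDominant p.1 ∧ D.IsDominant p.2 ∧ l = p.1 - p.2
  D.Tw (D.trans p.1) * (D.Tw (D.trans p.2))⁻¹

/-- The affine Hecke algebra `H`, realized in `ℂ(T) #_q W` by Cherednik's representation:
the subalgebra generated by `T_0, …, T_N` and `Ω`. -/
def H : Subalgebra ℂ D.A :=
  Algebra.adjoin ℂ (Set.range D.Top ∪ Set.range fun ω : D.Om => D.wOp ω.1)

/-- The finite Hecke algebra `H₀`, generated by `T_1, …, T_N`. -/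
def H0 : Subalgebra ℂ D.A := Algebra.adjoin ℂ (Set.range fun i : D.b.support => D.Top (some i))

/-- The double affine Hecke algebra, generated by `H` and the `f(X)` with `f ∈ ℂ[T]`. -/
def DAHA : Subalgebra ℂ D.A := Algebra.adjoin ℂ ((D.H : Set D.A) ∪ Set.range D.X)

lemma H_le_DAHA : D.H ≤ D.DAHA := fun _ hx => Algebra.subset_adjoin (Or.inl hx)

lemma X_mem_DAHA (f : D.CT) : D.X f ∈ D.DAHA := Algebra.subset_adjoin (Or.inr ⟨f, rfl⟩)

lemma Top_mem_H (i : D.I) : D.Top i ∈ D.H := Algebra.subset_adjoin (Or.inl ⟨i, rfl⟩)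

lemma H0_le_H : D.H0 ≤ D.H := by
  refine Algebra.adjoin_le ?_
  rintro _ ⟨i, rfl⟩
  exact D.Top_mem_H _

lemma omega_mem_H (ω : D.Om) : D.wOp ω.1 ∈ D.H := Algebra.subset_adjoin (Or.inr ⟨ω, rfl⟩)

/-- The group of units `u` of `ℂ(T) #_q W` such that `u` and `u⁻¹` lie in `H`. -/
def HUnits : Subgroup D.Aˣ := D.H.toSubmonoid.units

lemma mem_HUnits {u : D.Aˣ} : u ∈ D.HUnits ↔ (u : D.A) ∈ D.H ∧ ((u⁻¹ : D.Aˣ) : D.A) ∈ D.H := by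
  rw [HUnits, Submonoid.mem_units_iff]
  rfl

lemma TUnit_mem (i : D.I) : D.TUnit i ∈ D.HUnits := by
  rw [mem_HUnits]
  refine ⟨D.Top_mem_H i, ?_⟩
  exact add_mem (sub_mem (D.Top_mem_H i) (D.H.algebraMap_mem _)) (D.H.algebraMap_mem _)

lemma Tw_mem (g : D.W) : D.Tw g ∈ D.HUnits := by
  refine mul_mem ?_ (list_prod_mem ?_)
  · rw [mem_HUnits]
    refine ⟨D.omega_mem_H _, ?_⟩
    rw [← map_inv]
    exact D.omega_mem_H ⟨_, (D.len_inv _).trans (D.redExprL g).2.2⟩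
  · intro u hu
    obtain ⟨i, -, rfl⟩ := List.mem_map.1 hu
    exact D.TUnit_mem i

lemma Y_mem (l : D.Pv) : D.Y l ∈ D.HUnits := mul_mem (D.Tw_mem _) (inv_mem (D.Tw_mem _))

/-- The operator `f(X)` as an element of the double affine Hecke algebra. -/
def XH (f : D.CT) : D.DAHA := ⟨D.X f, D.X_mem_DAHA f⟩

/-- `Y^λ` as an element of the double affine Hecke algebra. -/
def YH (l : D.Pv) : D.DAHA := ⟨D.Y l, D.H_le_DAHA (D.mem_HUnits.1 (D.Y_mem l)).1⟩

/-- `T_w` as an element of the double affine Hecke algebra. -/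
def TwH (g : D.W) : D.DAHA := ⟨D.Tw g, D.H_le_DAHA (D.mem_HUnits.1 (D.Tw_mem g)).1⟩

/-- The inclusion of `H₀` in the double affine Hecke algebra. -/
def inclH0 : D.H0 →ₐ[ℂ] D.DAHA := Subalgebra.inclusion (D.H0_le_H.trans D.H_le_DAHA)

/-- The linear map `f ↦ f(X)`. -/
def evalX : D.CT →ₗ[ℂ] D.DAHA :=
  (D.X.codRestrict D.DAHA D.X_mem_DAHA).toLinearMap

/-- The linear map `f ↦ f(Y)`, where `f(Y) = ∑ a_λ Y^λ` if `f = ∑ a_λ x^λ`. -/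
def evalY : D.CT →ₗ[ℂ] D.DAHA :=
  Finsupp.linearCombination ℂ D.YH ∘ₗ (AddMonoidAlgebra.coeffLinearEquiv ℂ).toLinearMap

/-! ### Duality and renormalized intertwiners -/

/-- The characterization of Cherednik's duality anti-involution `*`. -/
structure IsDuality (σ : D.DAHA →ₗ[ℂ] D.DAHA) : Prop where
  map_one : σ 1 = 1
  map_mul : ∀ h h' : D.DAHA, σ (h * h') = σ h' * σ h
  involutive : ∀ h : D.DAHA, σ (σ h) = h
  map_Tw : ∀ w : D.W0, σ (D.TwH (SemidirectProduct.inr w)) = D.TwH (SemidirectProduct.inr w⁻¹)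
  map_Y : ∀ l : D.Pv, σ (D.YH l) = D.XH (D.mono (-l))
  map_X : ∀ l : D.Pv, σ (D.XH (D.mono l)) = D.YH (-l)

open Classical in
/-- The duality anti-involution `h ↦ h^*` of the double affine Hecke algebra: the unique
anti-algebra involution with the above values on `T_w`, `Y^λ` and `X^λ`. -/
def dual : D.DAHA →ₗ[ℂ] D.DAHA := if h : ∃ σ, D.IsDuality σ then h.choose else 0

/-- The regular function `d_i = k_i - k_i⁻¹ x^{-a_i^∨}`. -/
def d (i : D.I) : D.CT :=
  algebraMap ℂ D.CT (D.ki i) -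
    algebraMap ℂ D.CT ((D.ki i)⁻¹ : ℂˣ) * D.monoCo (D.simpleAff i) (-1)

/-- The intertwiner `S̃_i = (k_i - k_i⁻¹ X^{-a_i^∨}) s_i`. -/
def St (i : D.I) : D.A := D.X (D.d i) * D.wOp (D.s i)

/-- `S̃_i = (1 - X^{-a_i^∨}) T_i + (k_i - k_i⁻¹) X^{-a_i^∨}`. -/
lemma St_eq (i : D.I) :
    D.St i = (1 - D.X (D.monoCo (D.simpleAff i) (-1))) * D.Top i +
      (algebraMap ℂ D.A (D.ki i) - algebraMap ℂ D.A ((D.ki i)⁻¹ : ℂˣ)) *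
        D.X (D.monoCo (D.simpleAff i) (-1)) := by
  have hz : algebraMap D.CT D.RatT (D.monoCo (D.simpleAff i) 1) ≠ 1 := D.monoCo_ne_one _
  have hzw : algebraMap D.CT D.RatT (D.monoCo (D.simpleAff i) 1) *
      algebraMap D.CT D.RatT (D.monoCo (D.simpleAff i) (-1)) = 1 := by
    rw [← map_mul, D.monoCo_mul_neg, map_one]
  have hA : ∀ x : ℂ, algebraMap ℂ D.A x = D.mulOp (algebraMap ℂ D.RatT x) := fun x => rfl
  have hX : ∀ f : D.CT, D.X f = D.mulOp (algebraMap D.CT D.RatT f) := fun f => rfl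
  have hd : algebraMap D.CT D.RatT (D.d i) = algebraMap ℂ D.RatT (D.ki i) -
      algebraMap ℂ D.RatT ((D.ki i)⁻¹ : ℂˣ) *
        algebraMap D.CT D.RatT (D.monoCo (D.simpleAff i) (-1)) := by
    rw [d, map_sub, map_mul, ← IsScalarTower.algebraMap_apply, ← IsScalarTower.algebraMap_apply]
  have h1 : (1 - algebraMap D.CT D.RatT (D.monoCo (D.simpleAff i) (-1))) * D.c i =
      algebraMap D.CT D.RatT (D.d i) := by
    rw [hd, c]
    generalize algebraMap D.CT D.RatT (D.monoCo (D.simpleAff i) 1) = z at *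
    generalize algebraMap D.CT D.RatT (D.monoCo (D.simpleAff i) (-1)) = w at *
    generalize algebraMap ℂ D.RatT (D.ki i) = x
    generalize algebraMap ℂ D.RatT ((D.ki i)⁻¹ : ℂˣ) = y
    have h1 : 1 - z ≠ 0 := sub_ne_zero.mpr (Ne.symm hz)
    have hz0 : z ≠ 0 := left_ne_zero_of_mul_eq_one hzw
    obtain rfl : w = z⁻¹ := eq_inv_of_mul_eq_one_right hzw
    field_simp
    ring
  rw [St, Top, hX, hX, hA, hA, mul_add, ← mul_assoc, ← map_one D.mulOp, ← map_sub, ← map_sub,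
    ← map_mul, ← map_mul, ← map_mul, h1, hd]
  simp only [map_sub, map_mul, map_one]
  have hc : D.mulOp (algebraMap D.CT D.RatT (D.monoCo (D.simpleAff i) (-1))) *
      D.mulOp (algebraMap ℂ D.RatT (D.ki i)) = D.mulOp (algebraMap ℂ D.RatT (D.ki i)) *
      D.mulOp (algebraMap D.CT D.RatT (D.monoCo (D.simpleAff i) (-1))) := by
    rw [← map_mul, mul_comm, map_mul]
  generalize D.mulOp (algebraMap D.CT D.RatT (D.monoCo (D.simpleAff i) (-1))) = w at *
  generalize D.mulOp (algebraMap ℂ D.RatT (D.ki i)) = x at *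
  generalize D.mulOp (algebraMap ℂ D.RatT ((D.ki i)⁻¹ : ℂˣ)) = y at *
  rw [mul_sub, sub_mul 1 w, sub_mul x y w, one_mul, mul_one, hc]
  abel

lemma St_mem (i : D.I) : D.St i ∈ D.DAHA := by
  rw [St_eq]
  exact add_mem (mul_mem (sub_mem (one_mem _) (D.X_mem_DAHA _)) (D.H_le_DAHA (D.Top_mem_H i)))
    (mul_mem (sub_mem (D.DAHA.algebraMap_mem _) (D.DAHA.algebraMap_mem _)) (D.X_mem_DAHA _))

/-- `S̃_w = S̃_{i₁} ⋯ S̃_{i_r} ω` for a reduced expression `w = s_{i₁} ⋯ s_{i_r} ω`. -/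
def Stw (g : D.W) : D.DAHA :=
  ((D.redExprR g).1.map fun i => (⟨D.St i, D.St_mem i⟩ : D.DAHA)).prod *
    ⟨D.wOp (D.redExprR g).2.1, D.H_le_DAHA (D.omega_mem_H _)⟩

/-- `d_{i₁} (s_{i₁} d_{i₂}) ⋯ (s_{i₁} ⋯ s_{i_{r-1}} d_{i_r})` for a word `i₁, …, i_r`. -/
def dWord : List D.I → D.CT
  | [] => 1
  | i :: l => D.d i * D.s i • dWord l

/-- The regular function `d_w`, with `S̃_w = d_w(X) w`. -/
def dw (g : D.W) : D.CT := D.dWord (D.redExprR g).1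

/-- The complex linear map `σ_{(w,w')}(h) = S̃_w h S̃_{w'}^*`. -/
def sigma (g g' : D.W) : D.DAHA →ₗ[ℂ] D.DAHA :=
  LinearMap.mulLeft ℂ (D.Stw g) ∘ₗ LinearMap.mulRight ℂ (D.dual (D.Stw g'))

/-! ### The group `𝕎` and its action on `T × T` -/

/-- The homomorphism from the two-group `{1, -1}` sending `-1` to an involution `x`. -/
def involHom {G : Type*} [Group G] (x : G) (hx : x * x = 1) : ℤˣ →* G where
  toFun u := if u = 1 then 1 else x
  map_one' := if_pos rfl
  map_mul' u v := by
    have h : (-1 : ℤˣ) ≠ 1 := by decide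
    rcases Int.units_eq_one_or u with rfl | rfl <;> rcases Int.units_eq_one_or v with rfl | rfl <;>
      simp [h, hx]

@[simp] lemma involHom_neg_one {G : Type*} [Group G] (x : G) (hx : x * x = 1) :
    involHom x hx (-1) = x := by
  have h : (-1 : ℤˣ) ≠ 1 := by decide
  simp [involHom, h]

/-- The action of the two-group on `W × W` by interchanging the factors. -/
def swapAction : ℤˣ →* MulAut (D.W × D.W) :=
  involHom (MulEquiv.prodComm : MulAut (D.W × D.W)) (MulEquiv.ext fun _ => rfl)

lemma swapAction_neg_one (p : D.W × D.W) : D.swapAction (-1) p = (p.2, p.1) := by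
  rw [swapAction, involHom_neg_one]
  rfl

/-- The group `𝕎 = ℤ₂ ⋉ (W × W)`; the element `⟨(w, w'), ε⟩` stands for `(w, w') ε`, and the
nontrivial element `ι` of `ℤ₂` is `-1`. -/
abbrev WW : Type _ := (D.W × D.W) ⋊[D.swapAction] ℤˣ

/-- The element `(w, w')` of `𝕎`. -/
def pair (g g' : D.W) : D.WW := SemidirectProduct.inl (g, g')

/-- The element `ι` of `𝕎`. -/
def inv : D.WW := SemidirectProduct.inr (-1)

/-- The subgroup `𝕎₀ = ℤ₂ ⋉ (W₀ × W₀)` of `𝕎`. -/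
def WW0 : Subgroup D.WW where
  carrier := {g | g.left.1.left = 1 ∧ g.left.2.left = 1}
  one_mem' := ⟨rfl, rfl⟩
  mul_mem' {g h} hg hh := by
    rw [Set.mem_ofPred_eq] at hg hh ⊢
    rw [SemidirectProduct.mul_left]
    rcases Int.units_eq_one_or g.right with h1 | h1
    · rw [h1, map_one]
      simp [hg, hh]
    · rw [h1, swapAction_neg_one]
      simp [hg, hh]
  inv_mem' {g} hg := by
    rw [Set.mem_ofPred_eq] at hg ⊢
    rw [SemidirectProduct.inv_left]
    rcases Int.units_eq_one_or g.right with h1 | h1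
    · rw [h1, inv_one, map_one]
      simp [hg]
    · rw [h1, Int.units_inv_eq_self, swapAction_neg_one]
      simp [hg]

/-- The permutation `(t, γ) ↦ (γ⁻¹, t⁻¹)` of `T × T`. -/
def swapInv : Equiv.Perm (D.T × D.T) where
  toFun p := (p.2⁻¹, p.1⁻¹)
  invFun p := (p.2⁻¹, p.1⁻¹)
  left_inv p := by simp only [inv_inv_T]
  right_inv p := by simp only [inv_inv_T]

/-- The action `(w, w')(t, γ) = (wt, w'^⋄ γ)` of `W × W` on `T × T`. -/
def pairAction : D.W × D.W →* Equiv.Perm (D.T × D.T) where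
  toFun g := Equiv.prodCongr (MulAction.toPerm g.1) (MulAction.toPerm (D.diamond g.2))
  map_one' := by ext p <;> simp
  map_mul' g h := by
    refine Equiv.ext fun p => Prod.ext ?_ ?_
    · exact mul_smul g.1 h.1 p.1
    · change D.diamond (g.2 * h.2) • p.2 = D.diamond g.2 • D.diamond h.2 • p.2
      rw [map_mul, mul_smul]

/-- The action of `𝕎` on `T × T`, with `ι(t, γ) = (γ⁻¹, t⁻¹)`. -/
def torusAction : D.WW →* Equiv.Perm (D.T × D.T) :=
  SemidirectProduct.lift D.pairAction
    (involHom D.swapInv (Equiv.ext fun p => D.swapInv.left_inv p)) (by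
      intro e
      rcases Int.units_eq_one_or e with rfl | rfl
      · ext g p <;> simp
      · rw [involHom_neg_one]
        refine MonoidHom.ext fun g => Equiv.ext fun p => Prod.ext ?_ ?_
        · change g.2 • p.1 = (D.diamond g.2 • p.1⁻¹)⁻¹
          rw [smul_inv_T, diamond_diamond]
        · change D.diamond g.1 • p.2 = (g.1 • p.2⁻¹)⁻¹
          rw [smul_inv_T])

instance : MulAction D.WW (D.T × D.T) where
  smul g p := D.torusAction g p
  one_smul p := by
    change D.torusAction 1 p = p
    rw [map_one]
    rfl
  mul_smul g h p := by
    change D.torusAction (g * h) p = D.torusAction g (D.torusAction h p)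
    rw [map_mul]
    rfl

lemma pair_smul (g g' : D.W) (t γ : D.T) :
    D.pair g g' • (t, γ) = (g • t, D.diamond g' • γ) := by
  change (D.pairAction (g, g') * involHom _ _ 1) (t, γ) = _
  rw [map_one]
  rfl

lemma inv_smul_torus (t γ : D.T) : D.inv • (t, γ) = (γ⁻¹, t⁻¹) := by
  change (D.pairAction 1 * involHom _ _ (-1)) (t, γ) = _
  rw [map_one, involHom_neg_one]
  rfl

/-! ### Analytic and meromorphic functions on `T × T` -/

/-- The complex vector space `Hom_ℝ(V, ℂ)`, the universal cover of `T`. -/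
abbrev Lie (_ : BqKZDatum ι V) : Type _ := V →L[ℝ] ℂ

/-- The covering map `z ↦ (λ ↦ exp z(λ))`, a local coordinate system near every point of `T`. -/
def expT (z : D.Lie) : D.T where
  toFun m := Units.mk0 (Complex.exp (z ((Multiplicative.toAdd m : D.Pv) : V))) (Complex.exp_ne_zero _)
  map_one' := by ext; simp
  map_mul' m n := by ext; simp [Complex.exp_add]

lemma coe_expT (z : D.Lie) (m : Multiplicative D.Pv) :
    (D.expT z m : ℂ) = Complex.exp (z ((Multiplicative.toAdd m : D.Pv) : V)) := rfl

/-- The algebra `𝒪(T × T)` of analytic functions on `T × T`. -/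
def Hol : Subalgebra ℂ (D.T × D.T → ℂ) where
  carrier := {f | AnalyticOnNhd ℂ (fun z : D.Lie × D.Lie => f (D.expT z.1, D.expT z.2)) Set.univ}
  mul_mem' hf hg := AnalyticOnNhd.mul hf hg
  add_mem' hf hg := AnalyticOnNhd.add hf hg
  algebraMap_mem' _ := analyticOnNhd_const

/-- The action of `w ∈ W₀` on `V` as a continuous linear map. -/
def actCLM (w : D.W0) : V →L[ℝ] V :=
  LinearMap.mkContinuous
    { toFun := fun v => w • v
      map_add' := smul_add w
      map_smul' := fun r v => smul_comm w.1 r v } 1 (fun v => by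
    change ‖w • v‖ ≤ 1 * ‖v‖
    rw [one_mul, @norm_eq_sqrt_real_inner V, @norm_eq_sqrt_real_inner V, D.inner_smul_smul])

lemma norm_actCLM_le (w : D.W0) : ‖D.actCLM w‖ ≤ 1 := LinearMap.mkContinuous_norm_le _ zero_le_one _

/-- The action of `w ∈ W₀` on the universal cover of `T`. -/
def lieAct (w : D.W0) : D.Lie →L[ℂ] D.Lie :=
  LinearMap.mkContinuous
    { toFun := fun z => z.comp (D.actCLM w⁻¹)
      map_add' := fun z z' => ContinuousLinearMap.add_comp z z' _
      map_smul' := fun r z => ContinuousLinearMap.smul_comp r z _ } 1 (fun z => by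
    change ‖z.comp (D.actCLM w⁻¹)‖ ≤ 1 * ‖z‖
    refine (ContinuousLinearMap.opNorm_comp_le _ _).trans ?_
    rw [mul_comm]
    exact mul_le_mul_of_nonneg_right (D.norm_actCLM_le _) (norm_nonneg _))

/-- A logarithm of `q^λ`. -/
def logq (l : D.Pv) : D.Lie := Real.log D.q • (Complex.ofRealCLM.comp (innerSL ℝ (l : V)))

lemma smul_expT (g : D.W) (z : D.Lie) :
    g • D.expT z = D.expT (D.lieAct g.right z + D.logq (D.tr g)) := by
  refine MonoidHom.ext fun m => Units.ext ?_
  rw [smul_T_def, MonoidHom.mul_apply, finAct_apply, Units.val_mul, coe_expT, coe_expT, qchar_apply]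
  have h : ∀ x : ℝ, ((D.q ^ x : ℝ) : ℂ) = Complex.exp ((Real.log D.q * x : ℝ) : ℂ) := fun x => by
    rw [Real.rpow_def_of_pos D.q_pos, Complex.ofReal_exp]
  simp only [qpow, MonoidHom.coe_mk, OneHom.coe_mk, Units.val_mk0, toAdd_ofAdd, h]
  rw [← Complex.exp_add, add_comm]
  simp [lieAct, actCLM, logq]

lemma inv_expT (z : D.Lie) : (D.expT z)⁻¹ = D.expT (-z) := by
  refine MonoidHom.ext fun m => Units.ext ?_
  rw [MonoidHom.inv_apply, Units.val_inv_eq_inv_val, coe_expT, coe_expT, ← Complex.exp_neg]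
  rfl

/-- The exponential map is surjective. -/
lemma expT_surjective : Function.Surjective D.expT := by
  classical
  intro t
  have := D.finite
  have := D.isRootSystem
  have hcr := D.isCrystallographic
  have : FiniteDimensional ℝ V := Module.Finite.of_basis D.b.toWeightBasis
  have hB : ∀ i : D.b.support, D.b.toWeightBasis i = D.P.root i := D.b.toWeightBasis_apply
  let e : D.b.support → V := fun i =>
    (InnerProductSpace.toDual ℝ V).symm (LinearMap.toContinuousLinearMap (D.b.toWeightBasis.coord i))
  have he : ∀ i v, ⟪e i, v⟫ = D.b.toWeightBasis.coord i v := fun i v => by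
    simp [e, InnerProductSpace.toDual_symm_apply]
  have hmem : ∀ i, e i ∈ D.Pv := by
    intro i j
    rw [he]
    have hj := D.b.root_mem_span_int j
    generalize D.P.root j = y at hj
    induction hj using Submodule.span_induction with
    | mem x hx =>
      obtain ⟨k, hk, rfl⟩ := hx
      refine ⟨if (⟨k, hk⟩ : D.b.support) = i then 1 else 0, ?_⟩
      have : D.P.root k = D.b.toWeightBasis ⟨k, hk⟩ := (hB ⟨k, hk⟩).symm
      rw [this, Module.Basis.coord_apply, Module.Basis.repr_self, Finsupp.single_apply]
      split_ifs <;> simp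
    | zero => exact ⟨0, by simp⟩
    | add x y _ _ hx hy =>
      obtain ⟨m, hm⟩ := hx
      obtain ⟨n, hn⟩ := hy
      exact ⟨m + n, by rw [map_add, hm, hn]; push_cast; rfl⟩
    | smul a x _ hx =>
      obtain ⟨m, hm⟩ := hx
      exact ⟨a * m, by rw [map_zsmul, hm]; simp⟩
  let tt : D.b.support → ℂ := fun i => (t (Multiplicative.ofAdd ⟨e i, hmem i⟩) : ℂ)
  let z : D.Lie := ∑ i : D.b.support,
    Complex.log (tt i) • (Complex.ofRealCLM.comp (innerSL ℝ (D.P.root i)))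
  refine ⟨z, MonoidHom.ext fun m => Units.ext ?_⟩
  obtain ⟨l, hlm⟩ : ∃ l : D.Pv, m = Multiplicative.ofAdd l := ⟨Multiplicative.toAdd m, rfl⟩
  have hl2 := l.2
  choose n hn using fun i : D.b.support => hl2 i
  have hl : l = ∑ i : D.b.support, n i • (⟨e i, hmem i⟩ : D.Pv) := by
    apply Subtype.ext
    rw [AddSubgroup.val_finsetSum]
    refine InnerProductSpace.ext_inner_right_basis D.b.toWeightBasis fun j => ?_
    rw [hB, hn, sum_inner, Finset.sum_eq_single j]
    · rw [AddSubgroup.coe_zsmul, ← Int.cast_smul_eq_zsmul ℝ, inner_smul_left, he, ← hB]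
      simp
    · intro i _ hij
      rw [AddSubgroup.coe_zsmul, ← Int.cast_smul_eq_zsmul ℝ, inner_smul_left, he, ← hB]
      simp [hij.symm]
    · simp
  rw [coe_expT, hlm, toAdd_ofAdd]
  have hz : z (l : V) = ∑ i : D.b.support, (n i : ℂ) * Complex.log (tt i) := by
    rw [sum_apply]
    refine Finset.sum_congr rfl fun i _ => ?_
    change Complex.log (tt i) * ((⟪D.P.root i, (l : V)⟫ : ℝ) : ℂ) = _
    rw [real_inner_comm, hn, mul_comm]
    simp
  rw [hz, Complex.exp_sum]
  conv_rhs => rw [hl, ofAdd_sum, map_prod, Units.coe_prod]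
  refine Finset.prod_congr rfl fun i _ => ?_
  rw [Complex.exp_int_mul, Complex.exp_log (Units.ne_zero _), ofAdd_zsmul, map_zpow,
    Units.val_zpow_eq_zpow_val]

instance : IsDomain D.Hol := by
  have : NoZeroDivisors D.Hol := by
    refine ⟨fun {f g} hfg => ?_⟩
    by_contra! hne
    obtain ⟨hf, hg⟩ := hne
    apply hg
    have hex : ∃ z : D.Lie × D.Lie, f.1 (D.expT z.1, D.expT z.2) ≠ 0 := by
      by_contra! h0
      apply hf
      refine Subtype.ext (funext fun p => ?_)
      obtain ⟨z, hz⟩ := D.expT_surjective p.1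
      obtain ⟨z', hz'⟩ := D.expT_surjective p.2
      have := h0 (z, z')
      simp only [hz, hz'] at this
      exact this
    obtain ⟨z, hz⟩ := hex
    have hfc : ∀ᶠ y in nhds z, f.1 (D.expT y.1, D.expT y.2) ≠ 0 :=
      (f.2 z (Set.mem_univ z)).continuousAt.eventually_ne hz
    have hg0 : (fun y : D.Lie × D.Lie => g.1 (D.expT y.1, D.expT y.2)) =ᶠ[nhds z] 0 := by
      filter_upwards [hfc] with y hy
      have := congrFun (congrArg Subtype.val hfg) (D.expT y.1, D.expT y.2)
      exact (mul_eq_zero.1 this).resolve_left hy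
    have hgz := AnalyticOnNhd.eqOn_zero_of_preconnected_of_eventuallyEq_zero g.2
      isPreconnected_univ (Set.mem_univ z) hg0
    refine Subtype.ext (funext fun p => ?_)
    obtain ⟨y, hy⟩ := D.expT_surjective p.1
    obtain ⟨y', hy'⟩ := D.expT_surjective p.2
    have := hgz (Set.mem_univ (y, y'))
    simp only [hy, hy'] at this
    exact this
  have : Nontrivial D.Hol := by
    refine ⟨0, 1, fun h => ?_⟩
    have := congrFun (congrArg Subtype.val h) (1, 1)
    exact zero_ne_one this
  exact NoZeroDivisors.to_isDomain _

lemma comp_pair_mem_Hol (g g' : D.W) {f : D.T × D.T → ℂ} (hf : f ∈ D.Hol) :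
    (fun p => f (D.pair g g' • p)) ∈ D.Hol := by
  have h : (fun z : D.Lie × D.Lie => f (D.pair g g' • (D.expT z.1, D.expT z.2))) =
      (fun z : D.Lie × D.Lie => f (D.expT z.1, D.expT z.2)) ∘
      (fun z : D.Lie × D.Lie => (D.lieAct g.right z.1 + D.logq (D.tr g),
        D.lieAct g'.right z.2 + D.logq (-D.tr g'))) := by
    funext z
    simp only [pair_smul, smul_expT, Function.comp, tr_diamond, right_diamond]
  change AnalyticOnNhd ℂ (fun z : D.Lie × D.Lie => f (D.pair g g' • (D.expT z.1, D.expT z.2))) _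
  rw [h]
  refine AnalyticOnNhd.comp hf ?_ (Set.mapsTo_univ _ _)
  refine AnalyticOnNhd.prod (AnalyticOnNhd.add ?_ analyticOnNhd_const)
    (AnalyticOnNhd.add ?_ analyticOnNhd_const)
  · exact ((D.lieAct g.right).comp (ContinuousLinearMap.fst ℂ D.Lie D.Lie)).analyticOnNhd _
  · exact ((D.lieAct g'.right).comp (ContinuousLinearMap.snd ℂ D.Lie D.Lie)).analyticOnNhd _

lemma comp_inv_mem_Hol {f : D.T × D.T → ℂ} (hf : f ∈ D.Hol) :
    (fun p => f (D.inv • p)) ∈ D.Hol := by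
  have h : (fun z : D.Lie × D.Lie => f (D.inv • (D.expT z.1, D.expT z.2))) =
      (fun z : D.Lie × D.Lie => f (D.expT z.1, D.expT z.2)) ∘
      (fun z : D.Lie × D.Lie => (-z.2, -z.1)) := by
    funext z
    simp only [inv_smul_torus, inv_expT, Function.comp]
  change AnalyticOnNhd ℂ (fun z : D.Lie × D.Lie => f (D.inv • (D.expT z.1, D.expT z.2))) _
  rw [h]
  refine AnalyticOnNhd.comp hf ?_ (Set.mapsTo_univ _ _)
  refine AnalyticOnNhd.prod ?_ ?_
  · exact (-(ContinuousLinearMap.snd ℂ D.Lie D.Lie)).analyticOnNhd _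
  · exact (-(ContinuousLinearMap.fst ℂ D.Lie D.Lie)).analyticOnNhd _

lemma comp_mem_Hol (g : D.WW) {f : D.T × D.T → ℂ} (hf : f ∈ D.Hol) :
    (fun p => f (g • p)) ∈ D.Hol := by
  obtain ⟨⟨a, c⟩, e⟩ := g
  rcases Int.units_eq_one_or e with rfl | rfl
  · exact D.comp_pair_mem_Hol a c hf
  · have h : (⟨(a, c), -1⟩ : D.WW) = D.pair a c * D.inv := SemidirectProduct.mk_eq_inl_mul_inr _ _
    rw [h]
    simp only [mul_smul]
    exact D.comp_inv_mem_Hol (D.comp_pair_mem_Hol a c hf)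

/-- The action `(wf)(t, γ) = f(w⁻¹(t, γ))` of `𝕎` on `𝒪(T × T)`. -/
instance : MulSemiringAction D.WW D.Hol where
  smul g f := ⟨fun p => f.1 (g⁻¹ • p), D.comp_mem_Hol g⁻¹ f.2⟩
  one_smul f := Subtype.ext (funext fun p => congrArg f.1 (by rw [inv_one, one_smul]))
  mul_smul g h f := Subtype.ext (funext fun p => congrArg f.1 (by rw [mul_inv_rev, mul_smul]))
  smul_zero _ := rfl
  smul_add _ _ _ := rfl
  smul_one _ := rfl
  smul_mul _ _ _ := rfl

lemma smul_Hol_apply (g : D.WW) (f : D.Hol) (p : D.T × D.T) : (g • f).1 p = f.1 (g⁻¹ • p) := rfl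

/-- The field `𝕂` of meromorphic functions on `T × T`: as `T × T` is a connected Stein manifold
(it is isomorphic to `(ℂ \ {0})^{2N}`), this is the field of fractions of `𝒪(T × T)`. -/
def K : Type _ := FractionRing D.Hol

instance : Field D.K := inferInstanceAs (Field (FractionRing D.Hol))

instance : Algebra D.Hol D.K := inferInstanceAs (Algebra D.Hol (FractionRing D.Hol))

instance : IsFractionRing D.Hol D.K := inferInstanceAs (IsFractionRing D.Hol (FractionRing D.Hol))

instance : Algebra ℂ D.K := inferInstanceAs (Algebra ℂ (FractionRing D.Hol))

instance : IsScalarTower ℂ D.Hol D.K := IsScalarTower.of_algebraMap_eq fun _ => rfl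

/-- The action of `𝕎` on `𝕂` by field automorphisms. -/
instance : MulSemiringAction D.WW D.K := IsFractionRing.mulSemiringAction D.WW D.Hol D.K

instance : SMulDistribClass D.WW D.Hol D.K := IsFractionRing.smulDistribClass D.WW D.Hol D.K

lemma smul_algebraMap_K (g : D.WW) (f : D.Hol) :
    g • algebraMap D.Hol D.K f = algebraMap D.Hol D.K (g • f) := by
  rw [Algebra.algebraMap_eq_smul_one, smul_distrib_smul, smul_one, Algebra.algebraMap_eq_smul_one]

instance : SMulCommClass D.WW ℂ D.K where
  smul_comm g c f := by
    have h : g • algebraMap ℂ D.K c = algebraMap ℂ D.K c := by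
      rw [IsScalarTower.algebraMap_apply ℂ D.Hol D.K, smul_algebraMap_K]
      rfl
    rw [Algebra.smul_def, Algebra.smul_def, smul_mul', h]

/-- Evaluation at `v` as a continuous complex linear form on the universal cover of `T`. -/
def evCLM (v : V) : D.Lie →L[ℂ] ℂ :=
  LinearMap.mkContinuous
    { toFun := fun z => z v
      map_add' := fun _ _ => rfl
      map_smul' := fun _ _ => rfl } ‖v‖ fun z => by
    rw [mul_comm]
    exact z.le_opNorm v

/-- The analytic function `(t, γ) ↦ t^λ γ^μ`. -/
def holMono (l m : D.Pv) : D.Hol :=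
  ⟨fun p => (p.1 (Multiplicative.ofAdd l) : ℂ) * (p.2 (Multiplicative.ofAdd m) : ℂ), by
    change AnalyticOnNhd ℂ (fun z : D.Lie × D.Lie => Complex.exp (z.1 l) * Complex.exp (z.2 m)) _
    have h1 : AnalyticOnNhd ℂ (fun z : D.Lie × D.Lie => z.1 (l : V)) Set.univ :=
      ((D.evCLM l).comp (ContinuousLinearMap.fst ℂ D.Lie D.Lie)).analyticOnNhd _
    have h2 : AnalyticOnNhd ℂ (fun z : D.Lie × D.Lie => z.2 (m : V)) Set.univ :=
      ((D.evCLM m).comp (ContinuousLinearMap.snd ℂ D.Lie D.Lie)).analyticOnNhd _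
    exact h1.cexp.mul h2.cexp⟩

lemma holMono_add (l m l' m' : D.Pv) :
    D.holMono (l + l') (m + m') = D.holMono l m * D.holMono l' m' := by
  refine Subtype.ext (funext fun p => ?_)
  change (p.1 (Multiplicative.ofAdd (l + l')) : ℂ) * (p.2 (Multiplicative.ofAdd (m + m')) : ℂ) =
    (p.1 (Multiplicative.ofAdd l) : ℂ) * (p.2 (Multiplicative.ofAdd m) : ℂ) *
      ((p.1 (Multiplicative.ofAdd l') : ℂ) * (p.2 (Multiplicative.ofAdd m') : ℂ))
  rw [ofAdd_add, ofAdd_add, map_mul, map_mul, Units.val_mul, Units.val_mul]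
  ring

lemma holMono_zero : D.holMono 0 0 = 1 := by
  refine Subtype.ext (funext fun p => ?_)
  change (p.1 1 : ℂ) * (p.2 1 : ℂ) = 1
  simp

/-- The function `f(x) : (t, γ) ↦ f(t)` for `f ∈ ℂ[T]`. -/
def toKx : D.CT →ₐ[ℂ] D.K :=
  AddMonoidAlgebra.lift ℂ D.K D.Pv
    { toFun := fun m => algebraMap D.Hol D.K (D.holMono (Multiplicative.toAdd m) 0)
      map_one' := by rw [toAdd_one, holMono_zero, map_one]
      map_mul' := fun m n => by rw [← map_mul, ← holMono_add, toAdd_mul, add_zero] }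

/-- The function `f(y) : (t, γ) ↦ f(γ)` for `f ∈ ℂ[T]`. -/
def toKy : D.CT →ₐ[ℂ] D.K :=
  AddMonoidAlgebra.lift ℂ D.K D.Pv
    { toFun := fun m => algebraMap D.Hol D.K (D.holMono 0 (Multiplicative.toAdd m))
      map_one' := by rw [toAdd_one, holMono_zero, map_one]
      map_mul' := fun m n => by rw [← map_mul, ← holMono_add, toAdd_mul, add_zero] }

/-- `f^⋄(t) = f(t⁻¹)` for `f ∈ ℂ[T]`. -/
def diamondCT : D.CT →ₐ[ℂ] D.CT :=
  AddMonoidAlgebra.lift ℂ D.CT D.Pv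
    { toFun := fun m => D.mono (-Multiplicative.toAdd m)
      map_one' := by simp [mono, AddMonoidAlgebra.one_def]
      map_mul' := fun m n => by
        rw [mono, mono, mono, AddMonoidAlgebra.single_mul_single, toAdd_mul, neg_add, mul_one] }

/-! ### The space `H₀^𝕂` and the representation `τ` -/

/-- `H₀^𝕂 = 𝕂 ⊗ H₀`, the space of `H₀`-valued meromorphic functions on `T × T`. -/
abbrev H0K : Type _ := D.K ⊗[ℂ] D.H0

/-- The action of `w ∈ 𝕎` on `𝕂` as a complex linear map. -/
def actK (w : D.WW) : D.K →ₗ[ℂ] D.K where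
  toFun f := w • f
  map_add' := smul_add w
  map_smul' r f := smul_comm w r f

/-- The action of `w ∈ 𝕎` on the first tensor leg of `𝕂 ⊗ H₀`; on functions it is
`(w f)(t, γ) = f(w⁻¹(t, γ))`. -/
def leg (w : D.WW) : D.H0K →ₗ[ℂ] D.H0K := LinearMap.rTensor D.H0 (D.actK w)

/-- The map `𝕃 ⊗ H₀ → ℍ`, `(f ⊗ g) ⊗ h ↦ f(X) h g(Y)`, where `𝕃 = ℂ[T] ⊗ ℂ[T]`;
by the Poincaré-Birkhoff-Witt theorem for the double affine Hecke algebra it is bijective. -/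
def pbw : (D.CT ⊗[ℂ] D.CT) ⊗[ℂ] D.H0 →ₗ[ℂ] D.DAHA :=
  TensorProduct.lift <| TensorProduct.lift <| LinearMap.mk₂ ℂ
    (fun f g => LinearMap.mulRight ℂ (D.evalY g) ∘ₗ LinearMap.mulLeft ℂ (D.evalX f) ∘ₗ
      D.inclH0.toLinearMap)
    (fun f f' g => by ext h; simp [add_mul])
    (fun r f g => by ext h; simp)
    (fun f g g' => by ext h; simp [mul_add])
    (fun r f g => by ext h; simp)

open Classical in
/-- The canonical map `ℍ → 𝕂 ⊗_𝕃 ℍ ≃ H₀^𝕂`, that is, `f(X) h g(Y) ↦ f(x) g(y) ⊗ h`. -/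
def toH0K : D.DAHA →ₗ[ℂ] D.H0K :=
  if h : Function.Bijective D.pbw then
    LinearMap.rTensor D.H0 (Algebra.TensorProduct.productMap D.toKx D.toKy).toLinearMap ∘ₗ
      (LinearEquiv.ofBijective D.pbw h).symm.toLinearMap
  else 0

/-- The extension of a map `σ : ℍ → ℍ` to a `w`-semilinear map of `H₀^𝕂 ≃ 𝕂 ⊗_𝕃 ℍ`:
`F ⊗ h ↦ (w F) ⊗ σ(h)`. -/
def semiExt (w : D.WW) (σ : D.DAHA →ₗ[ℂ] D.DAHA) : D.H0K →ₗ[ℂ] D.H0K :=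
  TensorProduct.lift <| LinearMap.mk₂ ℂ
    (fun (F : D.K) (h : D.H0) => (w • F) • D.toH0K (σ (D.inclH0 h)))
    (fun F F' h => by rw [smul_add, add_smul])
    (fun r F h => by rw [smul_comm w r F, smul_assoc])
    (fun F h h' => by rw [map_add, map_add, map_add, smul_add])
    (fun r F h => by rw [map_smul, map_smul, map_smul, smul_comm])

lemma semiExt_tmul (w : D.WW) (σ : D.DAHA →ₗ[ℂ] D.DAHA) (F : D.K) (h : D.H0) :
    D.semiExt w σ (F ⊗ₜ h) = (w • F) • D.toH0K (σ (D.inclH0 h)) := rfl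

lemma semiExt_smul (w : D.WW) (σ : D.DAHA →ₗ[ℂ] D.DAHA) (F : D.K) (f : D.H0K) :
    D.semiExt w σ (F • f) = (w • F) • D.semiExt w σ f := by
  induction f using TensorProduct.induction_on with
  | zero => simp
  | tmul G h =>
    rw [TensorProduct.smul_tmul', semiExt_tmul, semiExt_tmul, smul_eq_mul, smul_mul', mul_smul]
  | add f g hf hg => rw [smul_add, map_add, hf, hg, map_add, smul_add]

/-- `τ(w, w') = d_w(x)⁻¹ d_{w'}^⋄(y)⁻¹ σ_{(w,w')}`. -/
def tauPair (g g' : D.W) : D.H0K →ₗ[ℂ] D.H0K where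
  toFun f := ((D.toKx (D.dw g))⁻¹ * (D.toKy (D.diamondCT (D.dw g')))⁻¹) •
    D.semiExt (D.pair g g') (D.sigma g g') f
  map_add' f f' := by rw [map_add, smul_add]
  map_smul' r f := by rw [map_smul, smul_comm]; rfl

/-- `τ(ι) = σ_ι`, the extension of the anti-involution `h ↦ h^*`. -/
def tauInv : D.H0K →ₗ[ℂ] D.H0K := D.semiExt D.inv D.dual

/-- The representation `τ` of `𝕎` on `H₀^𝕂`: `τ((w, w')) = d_w(x)⁻¹ d_{w'}^⋄(y)⁻¹ σ_{(w,w')}`,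
and `τ((w, w') ι) = τ((w, w')) τ(ι)` with `τ(ι) = σ_ι`. -/
def tau (w : D.WW) : D.H0K →ₗ[ℂ] D.H0K :=
  D.tauPair w.left.1 w.left.2 ∘ₗ (if w.right = 1 then LinearMap.id else D.tauInv)

lemma tau_smul (w : D.WW) (F : D.K) (f : D.H0K) : D.tau w (F • f) = (w • F) • D.tau w f := by
  have hp : ∀ (g g' : D.W) (F : D.K) (f : D.H0K),
      D.tauPair g g' (F • f) = (D.pair g g' • F) • D.tauPair g g' f := fun g g' F f => by
    simp only [tauPair, LinearMap.coe_mk, AddHom.coe_mk]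
    rw [semiExt_smul, smul_comm]
  obtain ⟨⟨a, c⟩, e⟩ := w
  rcases Int.units_eq_one_or e with rfl | rfl
  · change D.tauPair a c (F • f) = _ • D.tauPair a c f
    exact hp a c F f
  · have h : (⟨(a, c), -1⟩ : D.WW) = D.pair a c * D.inv := SemidirectProduct.mk_eq_inl_mul_inr _ _
    have h' : ∀ x, D.tau ⟨(a, c), -1⟩ x = D.tauPair a c (D.tauInv x) := fun x => by
      have h1 : (-1 : ℤˣ) ≠ 1 := by decide
      simp only [tau, h1, if_false, LinearMap.comp_apply]
    rw [h', h', tauInv, semiExt_smul, hp, h, mul_smul]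

lemma leg_smul (w : D.WW) (F : D.K) (f : D.H0K) : D.leg w (F • f) = (w • F) • D.leg w f := by
  induction f using TensorProduct.induction_on with
  | zero => simp
  | tmul G h =>
    change (w • (F * G)) ⊗ₜ h = (w • F) • ((w • G) ⊗ₜ[ℂ] h)
    rw [smul_mul', TensorProduct.smul_tmul', smul_eq_mul]
  | add f g hf hg => rw [smul_add, map_add, hf, hg, map_add, smul_add]

/-- The cocycle `C_w = τ(w) w⁻¹`, a `𝕂`-linear endomorphism of `H₀^𝕂 = 𝕂 ⊗ H₀`, that is, an
`End(H₀)`-valued meromorphic function on `T × T`. -/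
def C (w : D.WW) : Module.End D.K D.H0K where
  toFun f := D.tau w (D.leg w⁻¹ f)
  map_add' f g := by rw [map_add, map_add]
  map_smul' F f := by rw [leg_smul, tau_smul, smul_inv_smul]; rfl

/-- The action of `w ∈ 𝕎` on `End(H₀)`-valued meromorphic functions:
`(w C)(t, γ) = C(w⁻¹(t, γ))`, that is, `w C = w ∘ C ∘ w⁻¹`. -/
def legEnd (w : D.WW) (C : Module.End D.K D.H0K) : Module.End D.K D.H0K where
  toFun f := D.leg w (C (D.leg w⁻¹ f))
  map_add' f g := by rw [map_add, map_add, map_add]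
  map_smul' F f := by rw [leg_smul, map_smul, leg_smul, smul_inv_smul]; rfl

/-! ### The bispectral quantum KZ equations -/

/-- The element `(t(λ), t(μ))` of `𝕎`. -/
def transPair (l m : D.Pv) : D.WW := D.pair (D.trans l) (D.trans m)

/-- `(t(λ), t(μ))⁻¹ (t, γ) = (q^{-λ} t, q^μ γ)`, so that the action of `(t(λ), t(μ))` on
functions is `f(t, γ) ↦ f(q^{-λ} t, q^μ γ)`. -/
lemma transPair_inv_smul (l m : D.Pv) (t γ : D.T) :
    (D.transPair l m)⁻¹ • (t, γ) = (D.qchar (-l) * t, D.qchar m * γ) := by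
  have h1 : ∀ t : D.T, D.finAct 1 t = t := fun t => by
    refine MonoidHom.ext fun a => ?_
    simp [finAct_apply]
  have h2 : ∀ (n : D.Pv) (t : D.T), D.qchar n * (D.qchar (-n) * t) = t := fun n t => by
    refine MonoidHom.ext fun a => ?_
    rw [qchar_neg, MonoidHom.mul_apply, MonoidHom.mul_apply, MonoidHom.inv_apply, mul_inv_cancel_left]
  have h3 : D.qchar (-m) * (D.qchar m * γ) = γ := by
    have := h2 (-m) γ
    rwa [neg_neg] at this
  rw [inv_smul_eq_iff, transPair, pair_smul, smul_T_def, smul_T_def, tr_diamond, right_diamond]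
  change _ = (D.qchar l * D.finAct 1 (D.qchar (-l) * t), D.qchar (-m) * D.finAct 1 (D.qchar m * γ))
  rw [h1, h1, h2, h3]

/-- The connection matrix `C_{(λ,μ)} = C_{(t(λ),t(μ))}`. -/
def Cq (l m : D.Pv) : Module.End D.K D.H0K := D.C (D.transPair l m)

/-- The `End(H₀)`-valued function `(t, γ) ↦ C(q^{-λ} t, q^μ γ)`. -/
def shiftEnd (l m : D.Pv) (C : Module.End D.K D.H0K) : Module.End D.K D.H0K :=
  D.legEnd (D.transPair l m) C

/-- The `H₀`-valued function `(t, γ) ↦ f(q^{-λ} t, q^μ γ)`. -/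
def shift (l m : D.Pv) (f : D.H0K) : D.H0K := D.leg (D.transPair l m) f

/-- The set of solutions `f ∈ H₀^𝕂` of the bispectral quantum KZ equations
`C_{(λ,μ)}(t, γ) f(q^{-λ} t, q^μ γ) = f(t, γ)` for all `λ, μ ∈ P^∨`. -/
def SOL : Set D.H0K := {f | ∀ l m : D.Pv, D.Cq l m (D.shift l m f) = f}

/-- The field `𝔽` of all `f ∈ 𝕂` with `(t(λ), t(μ)) f = f` for all `λ, μ ∈ P^∨`. -/
def F : Subfield D.K where
  carrier := {f | ∀ l m : D.Pv, D.transPair l m • f = f}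
  mul_mem' ha hb l m := by rw [smul_mul', ha, hb]
  one_mem' l m := smul_one _
  add_mem' ha hb l m := by rw [smul_add, ha, hb]
  zero_mem' l m := smul_zero _
  neg_mem' ha l m := by rw [smul_neg, ha]
  inv_mem' a ha l m := by rw [smul_inv'', ha]

end BqKZDatum

end

/-!
Both statements follow from the single fact that `τ` is a representation of `𝕎`. Then
`C_w = τ(w) w⁻¹` is a cocycle (`BqKZDatum.C_mul`), so that the two sides of (i) are both equal to
`C_{(λ+ν, μ+ξ)}`. A solution of the BqKZ equations is the same as an element of `H₀^𝕂` fixed by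
`τ` of all translations (`BqKZDatum.mem_SOL`), and the translations form a normal subgroup of `𝕎`,
whence (ii).

Multiplicativity of `τ` (`BqKZDatum.tau_mul`) is checked on the image of `ℍ` in `H₀^𝕂`, which
contains `1 ⊗ H₀` and hence determines semilinear maps. There it reduces to `S̃_w = d_w(X) w`, so
that the intertwiners are multiplicative up to the rational factors which the normalization of `τ`
cancels, and to the corresponding statement for their images under the duality. Everything
therefore rests on two structural results about `ℍ`, which are proved here: the
Poincaré-Birkhoff-Witt theorem `ℂ[T] ⊗ H₀ ⊗ ℂ[T] ≃ ℍ` (`BqKZDatum.pbw_bijective`) and the existence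
of the duality anti-involution (`BqKZDatum.isDuality_dual`).

* The elements `T_w` do not depend on the reduced expression (`BqKZDatum.IsT.unique`). By induction
  on the length this reduces to the braid relations of two operators `T_i`, `T_j`, and only to those
  pairs for which `s_i s_j` has finite order. These relations are verified in rank two, for the
  types `A₁ × A₁`, `A₂`, `B₂` and `G₂`, by comparing the coefficients of alternating words
  (`altWord_braid_two` and its companions).
* The elements `Y^λ` commute and satisfy the Bernstein relations with `T_1, …, T_N`. These follow
  from the additivity of the length for suitable elements of `W`
  (`BqKZDatum.TUnit_mul_Y_of_eq_zero`, `BqKZDatum.TUnit_inv_mul_Y_of_eq_one`).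
* For the duality one also needs the relations of `Y^λ` with the would-be images of `T_0` and of the
  elements of `Ω`, namely `T_{s_φ}⁻¹ X^{-φ}` and `T_u⁻¹ X^{-λ}` for `ω = t(λ)u`. They come from the
  elements `Ψ(g) = Y^{-λ} T_{t(λ)g}`, with `λ` deep in the dominant chamber. If `g` is built up from
  simple reflections, `Ψ(g)` is a product of factors `T_i^{±1}` whose exponents are given by the
  signs of gradients. For minuscule `λ`, and for `φ` inside the strip `0 < φ < 1`, moving `X^λ`
  through this product changes the exponents just as passing from `Ψ(g)` to `Ψ(vg)` does, for a
  suitable `v ∈ W₀` (`BqKZDatum.Psi_crossing`).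
* The `T_w` are independent over `ℂ(T)` because `T_w` is triangular with respect to the length.
  Multiplication by a deep `Y^ν` turns products `X^λ T_u Y^μ` into products `X^λ T_w`, so they are
  linearly independent. They span since their span is stable under left multiplication by the
  generators.
* The duality is defined on the basis `X^λ T_u Y^μ`. The elements `a` with `(ab)^* = b^* a^*` for
  all `b` form a subalgebra, which contains the generators `T_i`, `ω` and `f(X)` by the relations
  above (`BqKZDatum.leftAnti_eq_top`).
-/

open scoped TensorProduct RealInnerProductSpace

/-! ### Simple affine roots and reduced expressions -/

namespace BqKZDatum

variable {ι V : Type*} [NormedAddCommGroup V] [InnerProductSpace ℝ V] (D : BqKZDatum ι V)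

/-- The coordinates of the vectors `v + rc` in the basis of the simple affine roots; their
existence expresses that `c = φ + a_0`. -/
noncomputable def affCoord : D.I → V × ℝ →ₗ[ℝ] ℝ :=
  haveI := D.isRootSystem
  fun i => i.elim (LinearMap.snd ℝ V ℝ) fun j =>
    D.b.toWeightBasis.coord j ∘ₗ LinearMap.fst ℝ V ℝ +
      D.b.toWeightBasis.coord j (D.P.root D.φ) • LinearMap.snd ℝ V ℝ

/-- The simple affine root `a_i` as a vector of `V × ℝ`. -/
def affSimple (i : D.I) : V × ℝ := (D.P.root (D.simpleAff i).1, ((D.simpleAff i).2 : ℝ))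

lemma affAct_add (g : D.W) (a b : V × ℝ) :
    D.affAct g (a + b) = D.affAct g a + D.affAct g b := by
  refine Prod.ext ?_ ?_
  · simp [affAct]
  · simp only [affAct, Prod.fst_add, Prod.snd_add, smul_add, inner_add_left]
    ring

lemma affAct_smul (g : D.W) (r : ℝ) (a : V × ℝ) : D.affAct g (r • a) = r • D.affAct g a := by
  have h : g.right • (r • a.1) = r • (g.right • a.1) := smul_comm g.right.1 r a.1
  refine Prod.ext h ?_
  simp only [affAct, Prod.smul_fst, Prod.smul_snd, h, inner_smul_left, RCLike.conj_to_real,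
    smul_eq_mul]
  ring

/-- The action of `g` on affine linear functions as a linear map. -/
noncomputable def affActLin (g : D.W) : V × ℝ →ₗ[ℝ] V × ℝ where
  toFun := D.affAct g
  map_add' := D.affAct_add g
  map_smul' r a := D.affAct_smul g r a

@[simp] lemma affActLin_apply (g : D.W) (a : V × ℝ) : D.affActLin g a = D.affAct g a := rfl

lemma affAct_inv_affAct (g : D.W) (a : V × ℝ) : D.affAct g⁻¹ (D.affAct g a) = a := by
  rw [affAct_affAct, inv_mul_cancel, affAct_one]

lemma affAct_affAct_inv (g : D.W) (a : V × ℝ) : D.affAct g (D.affAct g⁻¹ a) = a := by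
  rw [affAct_affAct, mul_inv_cancel, affAct_one]

lemma affAct_mem_affRoots (g : D.W) {a : V × ℝ} (ha : a ∈ D.affRoots) :
    D.affAct g a ∈ D.affRoots := by
  obtain ⟨i, r, rfl⟩ := ha
  have hw : g.right • D.P.root i = D.P.root _ := D.P.weylGroup_apply_root g.right i
  simp only [affAct, hw]
  obtain ⟨n, hn⟩ := (D.tr g).2 ((D.P.weylGroupToPerm g.right) i)
  rw [real_inner_comm, hn]
  exact ⟨_, r - n, by push_cast; rfl⟩

lemma affAct_affRefl (x : ι × ℤ) (a : V × ℝ) :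
    D.affAct (D.affRefl x) a = a - ⟪a.1, D.P.coroot x.1⟫ • ((D.P.root x.1, (x.2 : ℝ)) : V × ℝ) := by
  have h1 : (D.affRefl x).right • a.1 = a.1 - ⟪a.1, D.P.coroot x.1⟫ • D.P.root x.1 := by
    change D.P.reflection x.1 a.1 = _
    rw [RootPairing.reflection_apply, RootPairing.coroot', LinearMap.flip_apply, D.pairing_eq_inner]
  have htr : (D.tr (D.affRefl x) : V) = -(x.2 • D.P.coroot x.1) := rfl
  have h2 : ⟪D.P.root x.1, D.P.coroot x.1⟫ = 2 := by
    rw [← D.pairing_eq_inner]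
    exact D.P.root_coroot_two x.1
  refine Prod.ext h1 ?_
  simp only [affAct, h1, htr, Prod.snd_sub, Prod.smul_snd, smul_eq_mul]
  rw [← Int.cast_smul_eq_zsmul ℝ, inner_neg_right, inner_smul_right, inner_sub_left,
    inner_smul_left, h2, RCLike.conj_to_real]
  ring

lemma affCoord_none (a : V × ℝ) : D.affCoord none a = a.2 := rfl

lemma affCoord_some (j : D.b.support) (a : V × ℝ) :
    haveI := D.isRootSystem
    D.affCoord (some j) a = D.b.toWeightBasis.coord j a.1 +
      D.b.toWeightBasis.coord j (D.P.root D.φ) * a.2 := rfl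

open Classical in
lemma affCoord_affSimple (i j : D.I) : D.affCoord i (D.affSimple j) = if i = j then 1 else 0 := by
  have := D.isRootSystem
  rcases i with _ | i <;> rcases j with _ | j
  · simp [affCoord_none, affSimple, simpleAff]
  · simp [affCoord_none, affSimple, simpleAff]
  · simp [affCoord_some, affSimple, simpleAff]
  · simp only [affCoord_some, affSimple, simpleAff, Int.cast_zero, mul_zero, add_zero,
      Option.some.injEq]
    rw [← D.b.toWeightBasis_apply, Module.Basis.coord_apply, Module.Basis.repr_self,
      Finsupp.single_apply]
    simp only [eq_comm]

lemma eq_zero_of_affCoord {a : V × ℝ} (h : ∀ i, D.affCoord i a = 0) : a = 0 := by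
  have := D.isRootSystem
  have h2 : a.2 = 0 := h none
  refine Prod.ext ?_ h2
  refine D.b.toWeightBasis.ext_elem fun j => ?_
  have := h (some j)
  rw [affCoord_some, h2, mul_zero, add_zero] at this
  simpa using this

lemma eq_sum_affCoord (a : V × ℝ) : a = ∑ i, D.affCoord i a • D.affSimple i := by
  classical
  rw [← sub_eq_zero]
  refine D.eq_zero_of_affCoord fun j => ?_
  rw [map_sub, map_sum, Finset.sum_eq_single j (fun i _ hi => ?_) (by simp)]
  · simp [affCoord_affSimple]
  · simp [affCoord_affSimple, hi.symm]

lemma coord_nonneg_of_mem_closure {v : V}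
    (hv : v ∈ AddSubmonoid.closure (D.P.root '' D.b.support)) (j : D.b.support) :
    haveI := D.isRootSystem
    0 ≤ D.b.toWeightBasis.coord j v := by
  classical
  have := D.isRootSystem
  induction hv using AddSubmonoid.closure_induction with
  | mem x hx =>
    obtain ⟨k, hk, rfl⟩ := hx
    have : D.P.root k = D.b.toWeightBasis ⟨k, hk⟩ := (D.b.toWeightBasis_apply ⟨k, hk⟩).symm
    rw [this, Module.Basis.coord_apply, Module.Basis.repr_self, Finsupp.single_apply]
    split_ifs <;> norm_num
  | zero => simp
  | add x y _ _ hx hy =>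
    rw [map_add]
    exact add_nonneg hx hy

lemma coord_root_nonneg_of_isPos {i : ι} (hi : D.b.IsPos i) (j : D.b.support) :
    haveI := D.isRootSystem
    0 ≤ D.b.toWeightBasis.coord j (D.P.root i) := by
  have := D.isRootSystem
  rcases D.b.root_mem_or_neg_mem i with h | h
  · exact D.coord_nonneg_of_mem_closure h j
  · exfalso
    obtain ⟨f, -, h' | h'⟩ := D.b.exists_root_eq_sum_nat_or_neg i
    · have h2 : D.P.root i = 0 := by
        refine D.b.toWeightBasis.ext_elem fun k => ?_
        have h1 := D.coord_nonneg_of_mem_closure h k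
        have h3 : D.P.root i ∈ AddSubmonoid.closure (D.P.root '' D.b.support) := by
          rw [h']
          exact sum_mem fun j hj =>
            nsmul_mem (AddSubmonoid.subset_closure (Set.mem_image_of_mem _ hj)) _
        have h4 := D.coord_nonneg_of_mem_closure h3 k
        rw [map_neg] at h1
        simp only [Module.Basis.coord_apply, map_zero, Finsupp.coe_zero, Pi.zero_apply] at *
        linarith
      exact D.P.ne_zero i h2
    · have h2 : D.P.root i = ∑ j ∈ D.b.support, (fun j => -(f j : ℤ)) j • D.P.root j := by
        rw [h']
        simp
      have h3 := RootPairing.Base.height_eq_sum h2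
      have h4 : 0 < D.b.height i := hi
      have h5 : ∑ j ∈ D.b.support, -(f j : ℤ) ≤ 0 := Finset.sum_nonpos fun j _ => by simp
      omega

/-- Positive affine roots have nonnegative coordinates. For `α + rc` with `α` negative this holds
because `r ≥ 1` and `φ` is the highest root. -/
lemma affCoord_nonneg {a : V × ℝ} (ha : a ∈ D.posAffRoots) (i : D.I) : 0 ≤ D.affCoord i a := by
  classical
  have := D.isRootSystem
  obtain ⟨m, r, rfl, hr⟩ := ha
  have hr0 : 0 ≤ r := by split_ifs at hr <;> omega
  rcases i with _ | j
  · change (0 : ℝ) ≤ (r : ℝ)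
    exact_mod_cast hr0
  rw [affCoord_some]
  have hφ (m : ι) := D.coord_nonneg_of_mem_closure (D.isHighest m) j
  have hφ1 := hφ m
  have hφ2 := hφ (D.P.reflectionPerm m m)
  rw [map_sub] at hφ1 hφ2
  rw [RootPairing.root_reflectionPerm, RootPairing.reflection_apply_self, map_neg] at hφ2
  have hφ0 : 0 ≤ D.b.toWeightBasis.coord j (D.P.root D.φ) := by linarith
  have hr0' : (0 : ℝ) ≤ r := by exact_mod_cast hr0
  by_cases hp : D.b.IsPos m
  · exact add_nonneg (D.coord_root_nonneg_of_isPos hp j) (mul_nonneg hφ0 hr0')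
  · rw [if_neg hp] at hr
    have hr1 : (1 : ℝ) ≤ r := by exact_mod_cast hr
    have := mul_le_mul_of_nonneg_left hr1 hφ0
    change 0 ≤ _ + _ * (r : ℝ)
    linarith

lemma pos_or_neg {a : V × ℝ} (ha : a ∈ D.affRoots) : a ∈ D.posAffRoots ∨ a ∈ D.negAffRoots := by
  by_cases h : a ∈ D.posAffRoots
  · exact Or.inl h
  · exact Or.inr ⟨ha, h⟩

lemma ne_zero_of_mem_affRoots {a : V × ℝ} (ha : a ∈ D.affRoots) : a ≠ 0 := by
  obtain ⟨i, r, rfl⟩ := ha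
  exact fun h => D.P.ne_zero i (congrArg Prod.fst h)

lemma mem_pos_of_affCoord_pos {a : V × ℝ} (ha : a ∈ D.affRoots) {i : D.I}
    (hi : 0 < D.affCoord i a) : a ∈ D.posAffRoots := by
  refine (D.pos_or_neg ha).resolve_right fun h => ?_
  have := D.affCoord_nonneg ((D.mem_negAffRoots_iff a).1 h) i
  rw [map_neg] at this
  linarith

lemma mem_pos_of_affCoord_nonneg {a : V × ℝ} (ha : a ∈ D.affRoots)
    (h : ∀ i, 0 ≤ D.affCoord i a) : a ∈ D.posAffRoots := by
  by_contra hn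
  refine D.ne_zero_of_mem_affRoots ha (D.eq_zero_of_affCoord fun i => ?_)
  refine le_antisymm (not_lt.1 fun hi => hn (D.mem_pos_of_affCoord_pos ha hi)) (h i)

lemma affSimple_mem_affRoots (i : D.I) : D.affSimple i ∈ D.affRoots := ⟨_, _, rfl⟩

lemma affSimple_mem_pos (i : D.I) : D.affSimple i ∈ D.posAffRoots := by
  classical
  refine D.mem_pos_of_affCoord_pos (D.affSimple_mem_affRoots i) (i := i) ?_
  simp [affCoord_affSimple]

lemma affAct_s (i : D.I) (a : V × ℝ) :
    D.affAct (D.s i) a = a - ⟪a.1, D.P.coroot (D.simpleAff i).1⟫ • D.affSimple i :=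
  D.affAct_affRefl _ a

lemma affAct_s_self (i : D.I) : D.affAct (D.s i) (D.affSimple i) = -D.affSimple i := by
  have h2 : ⟪D.P.root (D.simpleAff i).1, D.P.coroot (D.simpleAff i).1⟫ = 2 := by
    rw [← D.pairing_eq_inner]
    exact D.P.root_coroot_two _
  rw [affAct_s]
  change _ - ⟪D.P.root (D.simpleAff i).1, _⟫ • _ = _
  rw [h2, two_smul]
  abel

/-- A positive affine root which is a multiple of a simple one is equal to it. -/
lemma eq_affSimple_of_affCoord {a : V × ℝ} (ha : a ∈ D.posAffRoots) (i : D.I)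
    (h : ∀ j, j ≠ i → D.affCoord j a = 0) : a = D.affSimple i := by
  have := D.finite
  have hred := D.isReduced
  have hsum : a = D.affCoord i a • D.affSimple i := by
    conv_lhs => rw [D.eq_sum_affCoord a]
    refine Finset.sum_eq_single i (fun j _ hj => ?_) (by simp)
    rw [h j hj, zero_smul]
  have hpos : 0 ≤ D.affCoord i a := D.affCoord_nonneg ha i
  obtain ⟨m, r, rfl, hr⟩ := ha
  generalize D.affCoord i _ = x at *
  have h1 : D.P.root m = x • D.P.root (D.simpleAff i).1 := congrArg Prod.fst hsum
  have hm : m = (D.simpleAff i).1 := by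
    by_contra hne
    by_cases hne' : D.P.root m = -D.P.root (D.simpleAff i).1
    · rw [hne'] at h1
      have h3 : (x + 1) • D.P.root (D.simpleAff i).1 = 0 := by
        rw [add_smul, one_smul, ← h1, neg_add_cancel]
      rcases smul_eq_zero.1 h3 with h4 | h4
      · linarith
      · exact D.P.ne_zero _ h4
    · have := RootPairing.IsReduced.linearIndependent D.P hne hne'
      rw [LinearIndependent.pair_iff] at this
      have := (this 1 (-x) (by rw [h1]; simp)).1
      norm_num at this
  have hx : x = 1 := by
    rw [hm] at h1
    have h3 : (x - 1) • D.P.root (D.simpleAff i).1 = 0 := by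
      rw [sub_smul, one_smul, ← h1, sub_self]
    rcases smul_eq_zero.1 h3 with h4 | h4
    · linarith
    · exact absurd h4 (D.P.ne_zero _)
  rw [hsum, hx, one_smul]

/-- The simple reflection `s_i` permutes the positive affine roots different from `a_i`. -/
lemma affAct_s_mem_pos {i : D.I} {a : V × ℝ} (ha : a ∈ D.posAffRoots) (hne : a ≠ D.affSimple i) :
    D.affAct (D.s i) a ∈ D.posAffRoots := by
  classical
  obtain ⟨j, hj, hj'⟩ : ∃ j, j ≠ i ∧ D.affCoord j a ≠ 0 := by
    by_contra! h
    exact hne (D.eq_affSimple_of_affCoord ha i h)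
  refine D.mem_pos_of_affCoord_pos (i := j)
    (D.affAct_mem_affRoots _ (D.posAffRoots_subset ha)) ?_
  rw [affAct_s, map_sub, map_smul, affCoord_affSimple, if_neg hj, smul_zero, sub_zero]
  exact lt_of_le_of_ne (D.affCoord_nonneg ha j) hj'.symm

/-- The positive affine roots that `g` maps to negative ones. -/
def invSet (g : D.W) : Set (V × ℝ) := {a | a ∈ D.posAffRoots ∧ D.affAct g a ∈ D.negAffRoots}

lemma s_mul_s (i : D.I) : D.s i * D.s i = 1 := D.affRefl_mul_self _

/-- If `g⁻¹` makes `a_i` negative, then `s_i g` loses exactly the inversion `-g⁻¹(a_i)` of `g`. -/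
lemma invSet_s_mul {g : D.W} {i : D.I} (h : D.affAct g⁻¹ (D.affSimple i) ∈ D.negAffRoots) :
    D.invSet (D.s i * g) = D.invSet g \ {-D.affAct g⁻¹ (D.affSimple i)} := by
  have hcan : ∀ a, D.affAct (D.s i) (D.affAct (D.s i) a) = a := fun a => by
    rw [affAct_affAct, s_mul_s, affAct_one]
  ext a
  simp only [invSet, Set.mem_ofPred_eq, Set.mem_sdiff, Set.mem_singleton_iff]
  rw [← affAct_affAct]
  constructor
  · rintro ⟨ha, hn⟩
    refine ⟨⟨ha, ?_⟩, ?_⟩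
    · refine (D.pos_or_neg (D.affAct_mem_affRoots g (D.posAffRoots_subset ha))).resolve_left
        fun hp => ?_
      by_cases he : D.affAct g a = D.affSimple i
      · rw [← he, affAct_inv_affAct] at h
        exact h.2 ha
      · exact hn.2 (D.affAct_s_mem_pos hp he)
    · rintro rfl
      rw [affAct_neg, affAct_affAct_inv, affAct_neg, affAct_s_self, neg_neg] at hn
      exact hn.2 (D.affSimple_mem_pos i)
  · rintro ⟨⟨ha, hn⟩, hne⟩
    refine ⟨ha, ?_⟩
    rw [mem_negAffRoots_iff, ← affAct_neg]
    refine D.affAct_s_mem_pos ((D.mem_negAffRoots_iff _).1 hn) fun he => hne ?_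
    rw [← he, affAct_neg, affAct_inv_affAct, neg_neg]

lemma len_s_mul_of_neg {g : D.W} (hg : (D.invSet g).Finite) {i : D.I}
    (h : D.affAct g⁻¹ (D.affSimple i) ∈ D.negAffRoots) :
    D.len (D.s i * g) + 1 = D.len g := by
  have hmem : -D.affAct g⁻¹ (D.affSimple i) ∈ D.invSet g := by
    refine ⟨(D.mem_negAffRoots_iff _).1 h, ?_⟩
    rw [affAct_neg, affAct_affAct_inv, mem_negAffRoots_iff, neg_neg]
    exact D.affSimple_mem_pos i
  change (D.invSet (D.s i * g)).ncard + 1 = (D.invSet g).ncard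
  rw [D.invSet_s_mul h]
  exact Set.ncard_sdiff_singleton_add_one hmem hg

/-- Otherwise `g⁻¹` would map all simple affine roots, and with them all positive ones, to positive
affine roots. -/
lemma exists_neg_of_len_ne_zero {g : D.W} (h : D.len g ≠ 0) :
    ∃ i, D.affAct g⁻¹ (D.affSimple i) ∈ D.negAffRoots := by
  by_contra! hall
  obtain ⟨a, ha, hn⟩ := Set.nonempty_of_ncard_ne_zero h
  have hb := (D.mem_negAffRoots_iff _).1 hn
  set b := -D.affAct g a with hbdef
  have hba : D.affAct g⁻¹ b = -a := by rw [hbdef, affAct_neg, affAct_inv_affAct]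
  have hpos : D.affAct g⁻¹ b ∈ D.posAffRoots := by
    refine D.mem_pos_of_affCoord_nonneg (D.affAct_mem_affRoots _ (D.posAffRoots_subset hb))
      fun j => ?_
    have he : D.affAct g⁻¹ b = ∑ i, D.affCoord i b • D.affAct g⁻¹ (D.affSimple i) := by
      have := congrArg (D.affActLin g⁻¹) (D.eq_sum_affCoord b)
      simpa only [map_sum, map_smul, affActLin_apply] using this
    rw [he, map_sum]
    refine Finset.sum_nonneg fun i _ => ?_
    rw [map_smul, smul_eq_mul]
    refine mul_nonneg (D.affCoord_nonneg hb i) (D.affCoord_nonneg ?_ j)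
    exact (D.pos_or_neg (D.affAct_mem_affRoots _ (D.affSimple_mem_affRoots i))).resolve_right
      (hall i)
  rw [hba] at hpos
  have : -a ∈ D.negAffRoots := by
    rw [mem_negAffRoots_iff, neg_neg]
    exact ha
  exact this.2 hpos

/-- Every element of the extended affine Weyl group has a reduced expression. -/
lemma exists_redExprR (g : D.W) :
    ∃ p : List D.I × D.Om, g = (p.1.map D.s).prod * p.2.1 ∧ p.1.length = D.len g := by
  induction hn : D.len g generalizing g with
  | zero => exact ⟨([], ⟨g, hn⟩), by simp, rfl⟩
  | succ n ih =>
    obtain ⟨i, hi⟩ := D.exists_neg_of_len_ne_zero (g := g) (by omega)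
    have hfin : (D.invSet g).Finite := Set.finite_of_ncard_ne_zero (by
      change D.len g ≠ 0
      omega)
    have hl := D.len_s_mul_of_neg hfin hi
    obtain ⟨p, hp, hlen⟩ := ih (D.s i * g) (by omega)
    refine ⟨(i :: p.1, p.2), ?_, by simp [hlen]⟩
    rw [List.map_cons, List.prod_cons, mul_assoc, ← hp, ← mul_assoc, s_mul_s, one_mul]

lemma redExprR_spec (g : D.W) :
    g = ((D.redExprR g).1.map D.s).prod * (D.redExprR g).2.1 ∧
      (D.redExprR g).1.length = D.len g :=
  Classical.epsilon_spec (D.exists_redExprR g)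

end BqKZDatum

namespace BqKZDatum

variable {ι V : Type*} [NormedAddCommGroup V] [InnerProductSpace ℝ V] (D : BqKZDatum ι V)

/-! ### Intertwiners -/

lemma wOp_mul_X (g : D.W) (f : D.CT) : D.wOp g * D.X f = D.X (g • f) * D.wOp g := by
  change SkewMonoidAlgebra.single g 1 * SkewMonoidAlgebra.single 1 (algebraMap D.CT D.RatT f) =
    SkewMonoidAlgebra.single 1 (algebraMap D.CT D.RatT (g • f)) * SkewMonoidAlgebra.single g 1
  rw [SkewMonoidAlgebra.single_mul_single, SkewMonoidAlgebra.single_mul_single,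
    smul_algebraMap_RatT, one_smul, mul_one, one_mul, one_mul, mul_one]

lemma prod_St (l : List D.I) :
    (l.map D.St).prod = D.X (D.dWord l) * D.wOp (l.map D.s).prod := by
  induction l with
  | nil => simp [dWord]
  | cons i l ih =>
    simp only [List.map_cons, List.prod_cons, ih, dWord, map_mul, St]
    rw [mul_assoc, ← mul_assoc (D.wOp _), wOp_mul_X]
    simp only [mul_assoc]

/-- `S̃_w = d_w(X) w`. -/
lemma coe_Stw (g : D.W) : (D.Stw g : D.A) = D.X (D.dw g) * D.wOp g := by
  have hg : D.wOp g = D.wOp ((D.redExprR g).1.map D.s).prod * D.wOp (D.redExprR g).2.1 := by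
    rw [← map_mul, ← (D.redExprR_spec g).1]
  have h : ∀ l : List D.I,
      (((l.map fun i => (⟨D.St i, D.St_mem i⟩ : D.DAHA)).prod : D.DAHA) : D.A) =
        (l.map D.St).prod := by
    intro l
    induction l with
    | nil => rfl
    | cons i l ih => simp only [List.map_cons, List.prod_cons, MulMemClass.coe_mul, ih]
  rw [Stw, MulMemClass.coe_mul, h, prod_St, hg, ← mul_assoc]
  rfl

lemma Stw_mul_XH (g : D.W) (f : D.CT) : D.Stw g * D.XH f = D.XH (g • f) * D.Stw g := by
  refine Subtype.ext ?_
  simp only [MulMemClass.coe_mul, coe_Stw, XH]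
  rw [mul_assoc, wOp_mul_X, ← mul_assoc, ← mul_assoc, ← map_mul, ← map_mul, mul_comm]

lemma XH_mul (f g : D.CT) : D.XH (f * g) = D.XH f * D.XH g := Subtype.ext (map_mul D.X f g)

/-- The product of two renormalized intertwiners, up to rational factors. -/
lemma Stw_mul_Stw (g h : D.W) :
    D.XH (D.dw (g * h)) * (D.Stw g * D.Stw h) =
      D.XH (D.dw g * g • D.dw h) * D.Stw (g * h) := by
  refine Subtype.ext ?_
  simp only [MulMemClass.coe_mul, coe_Stw, XH]
  have h1 : D.X (D.dw g) * D.wOp g * (D.X (D.dw h) * D.wOp h) =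
      D.X (D.dw g * g • D.dw h) * D.wOp (g * h) := by
    rw [mul_assoc, ← mul_assoc (D.wOp g), wOp_mul_X, map_mul, map_mul]
    simp only [mul_assoc]
  rw [h1, ← mul_assoc, ← mul_assoc, ← map_mul, ← map_mul, mul_comm]

/-! ### The action of `𝕎` on functions of one of the variables -/

lemma toKx_single (l : D.Pv) (r : ℂ) :
    D.toKx (AddMonoidAlgebra.single l r) = r • algebraMap D.Hol D.K (D.holMono l 0) := by
  simp [toKx, AddMonoidAlgebra.lift_single]

lemma toKy_single (l : D.Pv) (r : ℂ) :
    D.toKy (AddMonoidAlgebra.single l r) = r • algebraMap D.Hol D.K (D.holMono 0 l) := by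
  simp [toKy, AddMonoidAlgebra.lift_single]

lemma diamondCT_single (l : D.Pv) (r : ℂ) :
    D.diamondCT (AddMonoidAlgebra.single l r) = AddMonoidAlgebra.single (-l) r := by
  simp [diamondCT, AddMonoidAlgebra.lift_single, mono]

lemma diamondCT_diamondCT (f : D.CT) : D.diamondCT (D.diamondCT f) = f := by
  have : D.diamondCT.comp D.diamondCT = AlgHom.id ℂ D.CT :=
    D.algHom_ext_CT fun l => by simp [diamondCT_single]
  exact DFunLike.congr_fun this f

/-- The algebra endomorphism of `𝕂` given by `w ∈ 𝕎`. -/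
noncomputable def actKAlg (w : D.WW) : D.K →ₐ[ℂ] D.K :=
  AlgHom.ofLinearMap (D.actK w) (smul_one w) (smul_mul' w)

lemma actKAlg_apply (w : D.WW) (f : D.K) : D.actKAlg w f = w • f := rfl

lemma smul_inv_torus_apply (g : D.W) (t : D.T) (l : D.Pv) :
    ((g⁻¹ • t) (Multiplicative.ofAdd l) : ℂ) =
      (D.qpow (Multiplicative.ofAdd (-⟪g.right • (l : V), (D.tr g : V)⟫)) : ℂˣ) *
        (t (Multiplicative.ofAdd (g.right • l)) : ℂ) := by
  have h1 : D.tr g⁻¹ = -(g.right⁻¹ • D.tr g) := by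
    have h := D.tr_mul g⁻¹ g
    rw [inv_mul_cancel, tr_one] at h
    exact eq_neg_of_add_eq_zero_left h.symm
  rw [smul_T_def, MonoidHom.mul_apply, finAct_apply, qchar_apply, Units.val_mul, h1]
  simp only [toAdd_ofAdd, SemidirectProduct.inv_right, inv_inv, AddSubgroup.coe_neg, coe_smul_Pv]
  rw [inner_neg_left, ← D.inner_smul_smul g.right, smul_inv_smul, real_inner_comm]

lemma pair_inv (g g' : D.W) : (D.pair g g')⁻¹ = D.pair g⁻¹ g'⁻¹ := by
  rw [pair, pair, ← map_inv]
  rfl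

lemma algebraMap_smul_Hol (r : ℂ) (f : D.Hol) :
    r • algebraMap D.Hol D.K f = algebraMap D.Hol D.K (r • f) :=
  ((Algebra.linearMap D.Hol D.K).restrictScalars ℂ).map_smul r f |>.symm

lemma pair_smul_toKx (g g' : D.W) (f : D.CT) : D.pair g g' • D.toKx f = D.toKx (g • f) := by
  have : (D.actKAlg (D.pair g g')).comp D.toKx = D.toKx.comp (D.regAct g) := by
    refine D.algHom_ext_CT fun l => ?_
    rw [AlgHom.comp_apply, AlgHom.comp_apply, toKx_single, regAct_single, toKx_single, one_smul,
      one_mul, actKAlg_apply, smul_algebraMap_K, algebraMap_smul_Hol]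
    refine congrArg _ (Subtype.ext (funext fun p => ?_))
    rw [smul_Hol_apply, pair_inv]
    change ((D.pair g⁻¹ g'⁻¹ • (p.1, p.2)).1 (Multiplicative.ofAdd l) : ℂ) *
      ((D.pair g⁻¹ g'⁻¹ • (p.1, p.2)).2 1 : ℂ) = _ * ((p.1 _ : ℂ) * (p.2 1 : ℂ))
    rw [pair_smul, smul_inv_torus_apply, map_one, map_one]
    simp
  exact DFunLike.congr_fun this f

lemma pair_smul_toKy (g g' : D.W) (f : D.CT) :
    D.pair g g' • D.toKy f = D.toKy (D.diamondCT (g' • D.diamondCT f)) := by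
  have : (D.actKAlg (D.pair g g')).comp D.toKy =
      D.toKy.comp (D.diamondCT.comp ((D.regAct g').comp D.diamondCT)) := by
    refine D.algHom_ext_CT fun l => ?_
    simp only [AlgHom.comp_apply]
    rw [toKy_single, diamondCT_single, regAct_single, diamondCT_single, toKy_single, one_smul,
      one_mul, actKAlg_apply, smul_algebraMap_K, algebraMap_smul_Hol]
    refine congrArg _ (Subtype.ext (funext fun p => ?_))
    rw [smul_Hol_apply, pair_inv]
    change ((D.pair g⁻¹ g'⁻¹ • (p.1, p.2)).1 1 : ℂ) *
      ((D.pair g⁻¹ g'⁻¹ • (p.1, p.2)).2 (Multiplicative.ofAdd l) : ℂ) =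
        _ * ((p.1 1 : ℂ) * (p.2 _ : ℂ))
    rw [pair_smul, map_inv, smul_inv_torus_apply, map_one, map_one]
    simp
  exact DFunLike.congr_fun this f

lemma inv_inv_WW : (D.inv)⁻¹ = D.inv := by
  rw [inv, ← map_inv]
  rfl

lemma inv_smul_toKx (f : D.CT) : D.inv • D.toKx f = D.toKy (D.diamondCT f) := by
  have : (D.actKAlg D.inv).comp D.toKx = D.toKy.comp D.diamondCT := by
    refine D.algHom_ext_CT fun l => ?_
    rw [AlgHom.comp_apply, AlgHom.comp_apply, toKx_single, diamondCT_single, toKy_single, one_smul,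
      one_smul, actKAlg_apply, smul_algebraMap_K]
    refine congrArg _ (Subtype.ext (funext fun p => ?_))
    rw [smul_Hol_apply, inv_inv_WW]
    change ((D.inv • (p.1, p.2)).1 (Multiplicative.ofAdd l) : ℂ) * ((D.inv • (p.1, p.2)).2 1 : ℂ) =
      (p.1 1 : ℂ) * (p.2 (Multiplicative.ofAdd (-l)) : ℂ)
    rw [inv_smul_torus, ofAdd_neg, map_one, map_one, map_inv]
    simp
  exact DFunLike.congr_fun this f

lemma inv_smul_toKy (f : D.CT) : D.inv • D.toKy f = D.toKx (D.diamondCT f) := by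
  have h := D.inv_smul_toKx (D.diamondCT f)
  rw [diamondCT_diamondCT] at h
  rw [← h, smul_eq_iff_eq_inv_smul, inv_inv_WW]

/-- `d_i` is not constant: its values at `1` and at `μ ↦ exp⟨m,μ⟩` differ, where `x^m` is the
monomial occurring in it. -/
lemma toKx_d_ne_zero (i : D.I) : D.toKx (D.d i) ≠ 0 := by
  intro h
  obtain ⟨m, r, x, hm, hr, hx, hd⟩ : ∃ (m : D.Pv) (r x : ℂ), m ≠ 0 ∧ r ≠ 0 ∧ x ≠ 0 ∧
      D.d i = algebraMap ℂ D.CT x - AddMonoidAlgebra.single m r := by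
    refine ⟨(-1 : ℤ) • D.corootPv (D.simpleAff i).1, ((D.ki i)⁻¹ : ℂˣ) * _, D.ki i, ?_, ?_,
      (D.ki i).ne_zero, by rw [d, monoCo, ← Algebra.smul_def, AddMonoidAlgebra.smul_single,
        smul_eq_mul]⟩
    · intro h0
      have h1 : (-1 : ℤ) • D.P.coroot (D.simpleAff i).1 = 0 := congrArg Subtype.val h0
      have : D.P.coroot (D.simpleAff i).1 = 0 := by simpa using h1
      exact D.P.ne_zero' _ this
    · refine mul_ne_zero (Units.ne_zero _) ?_
      exact_mod_cast (Real.rpow_pos_of_pos D.q_pos _).ne'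
  rw [hd, map_sub, toKx_single, AlgHom.commutes, IsScalarTower.algebraMap_apply ℂ D.Hol D.K,
    algebraMap_smul_Hol, ← map_sub, map_eq_zero_iff _ (IsFractionRing.injective D.Hol D.K)] at h
  have hv : ∀ t : D.T, x = r * (t (Multiplicative.ofAdd m) : ℂ) := fun t => by
    have h1 : x - r * ((t (Multiplicative.ofAdd m) : ℂ) * ((1 : D.T) 1 : ℂ)) = 0 :=
      congrFun (congrArg Subtype.val h) (t, 1)
    rw [MonoidHom.one_apply, Units.val_one, mul_one] at h1
    exact sub_eq_zero.1 h1
  have h1 := hv 1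
  have h2 := hv (D.expT (Complex.ofRealCLM.comp (innerSL ℝ (m : V))))
  rw [MonoidHom.one_apply, Units.val_one, mul_one] at h1
  rw [h1, coe_expT] at h2
  have h3 : Complex.exp ((⟪(m : V), (m : V)⟫ : ℝ) : ℂ) = 1 := (mul_left_cancel₀ hr (by
    rw [mul_one]
    exact h2)).symm
  rw [← Complex.ofReal_exp] at h3
  have h4 : Real.exp ⟪(m : V), (m : V)⟫ = 1 := by exact_mod_cast h3
  rw [Real.exp_eq_one_iff, inner_self_eq_zero] at h4
  exact hm (Subtype.ext h4)

lemma toKx_dw_ne_zero (g : D.W) : D.toKx (D.dw g) ≠ 0 := by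
  rw [dw]
  generalize (D.redExprR g).1 = l
  induction l with
  | nil => simp [dWord]
  | cons i l ih =>
    rw [dWord, map_mul, ← D.pair_smul_toKx (D.s i) 1]
    exact mul_ne_zero (D.toKx_d_ne_zero i) ((smul_ne_zero_iff_ne _).2 ih)

lemma toKy_diamond_dw_ne_zero (g : D.W) : D.toKy (D.diamondCT (D.dw g)) ≠ 0 := by
  rw [← inv_smul_toKx]
  exact (smul_ne_zero_iff_ne _).2 (D.toKx_dw_ne_zero g)

lemma evalY_single (l : D.Pv) (r : ℂ) : D.evalY (AddMonoidAlgebra.single l r) = r • D.YH l := by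
  simp [evalY]

lemma pbw_tmul (f g : D.CT) (h : D.H0) :
    D.pbw ((f ⊗ₜ g) ⊗ₜ h) = D.XH f * D.inclH0 h * D.evalY g := rfl

end BqKZDatum

/-! ### Braid relations for deformed reflections in a dihedral group -/

section DihedralBraid

variable {A F : Type*} [Ring A] [Field F]

/-- The alternating product `σ τ σ ⋯` with `n` factors. -/
def altWord {M : Type*} [Monoid M] (σ τ : M) : ℕ → M
  | 0 => 1
  | n + 1 => σ * altWord τ σ n

lemma map_altWord {M N : Type*} [Monoid M] [Monoid N] (f : M →* N) (σ τ : M) (n : ℕ) :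
    f (altWord σ τ n) = altWord (f σ) (f τ) n := by
  induction n generalizing σ τ with
  | zero => exact map_one f
  | succ n ih => rw [altWord, map_mul, ih, altWord]

/-- A linear combination of alternating words of length at most `n` in `σ` and `τ`:
`a k` is the coefficient of `σ τ ⋯` and `b k` the one of `τ σ ⋯` (`k` factors).  The two words of
length `n` are meant to coincide, and likewise those of length `0`. -/
def altSum (m : F →+* A) (σ τ : A) (n : ℕ) (a b : ℕ → F) : A :=
  ∑ k ∈ Finset.range n, (m (a (k + 1)) * altWord σ τ (k + 1) + m (b k) * altWord τ σ k)

lemma altSum_swap (m : F →+* A) {σ τ : A} {n : ℕ} (h : altWord σ τ n = altWord τ σ n)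
    {a b : ℕ → F} (h0 : a 0 = b 0) (hn : a n = b n) :
    altSum m σ τ n a b = altSum m τ σ n b a := by
  have h1 (σ τ : A) (a b : ℕ → F) : altSum m σ τ n a b + m (a 0) =
      ∑ k ∈ Finset.range (n + 1), m (a k) * altWord σ τ k +
        ∑ k ∈ Finset.range n, m (b k) * altWord τ σ k := by
    rw [Finset.sum_range_succ', altSum, Finset.sum_add_distrib, altWord, mul_one]
    abel
  rw [← add_left_inj (m (a 0)), h1]
  conv_rhs => rw [h0, h1]
  rw [Finset.sum_range_succ, Finset.sum_range_succ, h, hn]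
  abel

/-- Coefficients of `(p + σ) x` at the words starting with `σ`. -/
def stepA (s : F →+* F) (p e : F) (a b : ℕ → F) : ℕ → F
  | 0 => p * b 0 + e * s (a 1)
  | k + 1 => p * a (k + 1) + s (b k)

/-- Coefficients of `(p + σ) x` at the words starting with `τ`. -/
def stepB (s : F →+* F) (p e : F) (n : ℕ) (a b : ℕ → F) (k : ℕ) : F :=
  if k = n then stepA s p e a b n else p * b k + e * s (a (k + 1))

lemma mul_altSum (m : F →+* A) {σ τ : A} {s : F →+* F} {p e : F}
    (hσ : ∀ f, σ * m f = m (s f) * σ) (hσ2 : σ * σ = m e) (n : ℕ) (a b : ℕ → F) :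
    (m p + σ) * altSum m σ τ n a b =
      altSum m σ τ n (stepA s p e a b) (stepB s p e n a b) := by
  rw [altSum, altSum, Finset.mul_sum]
  refine Finset.sum_congr rfl fun k hk => ?_
  have hk' : k ≠ n := (Finset.mem_range.1 hk).ne
  simp only [stepA, stepB, if_neg hk', altWord]
  have h (f : F) (z : A) : σ * (m f * z) = m (s f) * (σ * z) := by
    rw [← mul_assoc, hσ, mul_assoc]
  have h2 (z : A) : σ * (σ * z) = m e * z := by rw [← mul_assoc, hσ2]
  have h3 (z : A) : m (s (a (k + 1))) * (m e * z) = m e * (m (s (a (k + 1))) * z) := by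
    rw [← mul_assoc, ← map_mul, mul_comm, map_mul, mul_assoc]
  simp only [mul_add, add_mul, h, h2, map_add, map_mul, mul_assoc, h3]
  abel

/-- The alternating product of `p + σ` and `q + τ` in terms of the words in `σ` and `τ`. -/
def braidCoeff (s t : F →+* F) (p e q g : F) (n : ℕ) : ℕ → (ℕ → F) × (ℕ → F)
  | 0 => (fun k => if k = 0 then 1 else 0, fun k => if k = 0 then 1 else 0)
  | j + 1 =>
    let x := braidCoeff t s q g p e n j
    (stepA s p e x.2 x.1, stepB s p e n x.2 x.1)

/-- Expansion of the alternating product of `p + σ` and `q + τ`, when `σ` and `τ` satisfy the braid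
relation of length `n`, move scalars by `s` and `t`, and have scalar squares. -/
lemma altWord_eq_altSum (m : F →+* A) {σ τ : A} {s t : F →+* F} {p e q g : F}
    (hσ : ∀ f, σ * m f = m (s f) * σ) (hσ2 : σ * σ = m e)
    (hτ : ∀ f, τ * m f = m (t f) * τ) (hτ2 : τ * τ = m g) {n : ℕ} (hn : n ≠ 0)
    (h : altWord σ τ n = altWord τ σ n) (j : ℕ) :
    altWord (m p + σ) (m q + τ) j =
      altSum m σ τ n (braidCoeff s t p e q g n j).1 (braidCoeff s t p e q g n j).2 := by
  have hinv (s t : F →+* F) (p e q g : F) (j : ℕ) :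
      (braidCoeff s t p e q g n j).1 0 = (braidCoeff s t p e q g n j).2 0 ∧
      (braidCoeff s t p e q g n j).1 n = (braidCoeff s t p e q g n j).2 n := by
    cases j with
    | zero => exact ⟨rfl, rfl⟩
    | succ j => simp [braidCoeff, stepB, hn.symm, stepA]
  induction j generalizing σ τ s t p e q g with
  | zero =>
    obtain ⟨n, rfl⟩ := Nat.exists_eq_succ_of_ne_zero hn
    simp [altWord, braidCoeff, altSum]
  | succ j ih =>
    rw [altWord, ih hτ hτ2 hσ hσ2 h.symm, altSum_swap m h.symm (hinv _ _ _ _ _ _ _).1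
      (hinv _ _ _ _ _ _ _).2, mul_altSum m hσ hσ2]
    rfl

/-- The braid relation passes from `σ`, `τ` to `p + σ`, `q + τ` once the coefficients agree. -/
lemma altWord_braid (m : F →+* A) {σ τ : A} {s t : F →+* F} {p e q g : F}
    (hσ : ∀ f, σ * m f = m (s f) * σ) (hσ2 : σ * σ = m e)
    (hτ : ∀ f, τ * m f = m (t f) * τ) (hτ2 : τ * τ = m g) {n : ℕ} (hn : n ≠ 0)
    (h : altWord σ τ n = altWord τ σ n)
    (h1 : ∀ k < n, (braidCoeff s t p e q g n n).1 (k + 1) = (braidCoeff t s q g p e n n).2 (k + 1))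
    (h2 : ∀ k < n, (braidCoeff s t p e q g n n).2 k = (braidCoeff t s q g p e n n).1 k) :
    altWord (m p + σ) (m q + τ) n = altWord (m q + τ) (m p + σ) n := by
  have hinv : (braidCoeff t s q g p e n n).1 0 = (braidCoeff t s q g p e n n).2 0 ∧
      (braidCoeff t s q g p e n n).1 n = (braidCoeff t s q g p e n n).2 n := by
    obtain ⟨n, rfl⟩ := Nat.exists_eq_succ_of_ne_zero hn
    simp [braidCoeff, stepB, stepA]
  rw [altWord_eq_altSum m hσ hσ2 hτ hτ2 hn h, altWord_eq_altSum m hτ hτ2 hσ hσ2 hn h.symm,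
    altSum_swap m h.symm hinv.1 hinv.2]
  refine Finset.sum_congr rfl fun k hk => ?_
  have hk' := Finset.mem_range.1 hk
  rw [h1 k hk', h2 k hk']

/-- The coefficient `c s(d) st(c) ⋯` (`n` factors) of `S S' ⋯` in the alternating product of
`c S` and `d S'`. -/
def altTwist (s t : F →+* F) (c d : F) : ℕ → F
  | 0 => 1
  | n + 1 => c * s (altTwist t s d c n)

lemma altWord_twist (m : F →+* A) {S S' : A} {s t : F →+* F} (hS : ∀ f, S * m f = m (s f) * S)
    (hS' : ∀ f, S' * m f = m (t f) * S') (c d : F) (n : ℕ) :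
    altWord (m c * S) (m d * S') n = m (altTwist s t c d n) * altWord S S' n := by
  induction n generalizing S S' s t c d with
  | zero => simp [altWord, altTwist]
  | succ n ih =>
    rw [altWord, ih hS' hS, altWord, altTwist, map_mul, mul_assoc, ← mul_assoc S, hS]
    simp only [mul_assoc]

/-- The braid relation of length `n` for `p + c S` and `q + d S'` follows from the one for `S` and
`S'` once the coefficients of all alternating words agree. -/
lemma altWord_braid_twist (m : F →+* A) {S S' : A} {s t : F →+* F} {p q c d : F}
    (hS : ∀ f, S * m f = m (s f) * S) (hS2 : S * S = 1)
    (hS' : ∀ f, S' * m f = m (t f) * S') (hS2' : S' * S' = 1) {n : ℕ} (hn : n ≠ 0)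
    (h : altWord S S' n = altWord S' S n)
    (hc : c * s c = 1 + p * s p) (hd : d * t d = 1 + q * t q)
    (ht : altTwist s t c d n = altTwist t s d c n)
    (h1 : ∀ k < n, (braidCoeff s t p (1 + p * s p) q (1 + q * t q) n n).1 (k + 1) =
      (braidCoeff t s q (1 + q * t q) p (1 + p * s p) n n).2 (k + 1))
    (h2 : ∀ k < n, (braidCoeff s t p (1 + p * s p) q (1 + q * t q) n n).2 k =
      (braidCoeff t s q (1 + q * t q) p (1 + p * s p) n n).1 k) :
    altWord (m p + m c * S) (m q + m d * S') n = altWord (m q + m d * S') (m p + m c * S) n := by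
  refine altWord_braid m (s := s) (t := t) (fun f => ?_) ?_ (fun f => ?_) ?_ hn ?_ h1 h2
  · rw [mul_assoc, hS, ← mul_assoc, ← mul_assoc, ← map_mul, ← map_mul, mul_comm]
  · rw [mul_assoc, ← mul_assoc S, hS, mul_assoc, hS2, mul_one, ← map_mul, hc]
  · rw [mul_assoc, hS', ← mul_assoc, ← mul_assoc, ← map_mul, ← map_mul, mul_comm]
  · rw [mul_assoc, ← mul_assoc S', hS', mul_assoc, hS2', mul_one, ← map_mul, hd]
  · rw [altWord_twist m hS hS', altWord_twist m hS' hS, ht, h]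

/-- The function `u / (1 - x)` entering the deformed reflections. -/
lemma reflect_coeff {x u : F} (hx0 : x ≠ 0) (hx : x ≠ 1) : u / (1 - x⁻¹) = u - u / (1 - x) := by
  have h1 : 1 - x ≠ 0 := sub_ne_zero.2 hx.symm
  have h2 : x - 1 ≠ 0 := sub_ne_zero.2 hx
  field_simp
  ring

set_option linter.unusedSimpArgs false in
/-- The braid relation of type `A₁ × A₁` for two deformed reflections. Here `x = x^{α^∨}` and
`y = x^{β^∨}` for the two simple coroots, and `u = k - k⁻¹`, `v = l - l⁻¹`. The proof writes all
coefficients as polynomials in the functions `u/(1 - z)` or `v/(1 - z)`, with `z` running over the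
positive coroots; these are named `A0, A1, …` for the orbit of `x` and `B0, B1, …` for that of
`y`. -/
lemma altWord_braid_two (m : F →+* A) {S S' : A} {s t : F →+* F} {x y u v k l : F}
    (hS : ∀ f, S * m f = m (s f) * S) (hS2 : S * S = 1)
    (hS' : ∀ f, S' * m f = m (t f) * S') (hS2' : S' * S' = 1)
    (h : altWord S S' 2 = altWord S' S 2)
    (hx0 : x ≠ 0) (hx : x ≠ 1) (hy0 : y ≠ 0) (hy : y ≠ 1)
    (hsu : s u = u) (hsv : s v = v) (htu : t u = u) (htv : t v = v)
    (hsk : s k = k) (hsl : s l = l) (htk : t k = k) (htl : t l = l)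
    (hk : k * (k - u) = 1) (hl : l * (l - v) = 1)
    (hsx : s x = x⁻¹) (hsy : s y = y) (hty : t y = y⁻¹) (htx : t x = x) :
    altWord (m (u / (1 - x)) + m (k - u / (1 - x)) * S)
        (m (v / (1 - y)) + m (l - v / (1 - y)) * S') 2 =
      altWord (m (v / (1 - y)) + m (l - v / (1 - y)) * S')
        (m (u / (1 - x)) + m (k - u / (1 - x)) * S) 2 := by
  have d1 : 1 - x ≠ 0 := sub_ne_zero.2 hx.symm
  have d2 : 1 - y ≠ 0 := sub_ne_zero.2 hy.symm
  obtain ⟨A0, hA0⟩ : ∃ z, z = u / (1 - x) := ⟨_, rfl⟩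
  obtain ⟨B0, hB0⟩ : ∃ z, z = v / (1 - y) := ⟨_, rfl⟩
  have sA0 : s A0 = u - A0 := by
    rw [hA0, map_div₀, map_sub, map_one, hsu, hsx, reflect_coeff hx0 hx]
  have tB0 : t B0 = v - B0 := by
    rw [hB0, map_div₀, map_sub, map_one, htv, hty, reflect_coeff hy0 hy]
  have sB0 : s B0 = B0 := by
    rw [hB0, map_div₀, map_sub, map_one, hsv, hsy]
  have tA0 : t A0 = A0 := by
    rw [hA0, map_div₀, map_sub, map_one, htu, htx]
  rw [← hA0, ← hB0]
  refine altWord_braid_twist m hS hS2 hS' hS2' (by norm_num) h ?_ ?_ ?_ (fun j hj => ?_)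
    (fun j hj => ?_)
  · rw [map_sub, hsk, sA0]
    linear_combination hk
  · rw [map_sub, htl, tB0]
    linear_combination hl
  · simp only [altTwist, map_mul, map_sub, map_one, hsk, htk, hsl, htl, hsu, htu, hsv, htv,
      sA0, sB0, tA0, tB0]
    ring
  · interval_cases j
    all_goals
      simp only [braidCoeff, stepA, stepB, map_add, map_mul, map_sub, map_one, map_zero,
        sA0, sB0, tA0, tB0,
        hsu, hsv, htu, htv, Nat.reduceAdd, Nat.reduceEqDiff, if_true, if_false,
        OfNat.ofNat_ne_zero, one_ne_zero, OfNat.one_ne_ofNat, OfNat.zero_ne_ofNat, mul_zero,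
        add_zero, zero_add, mul_one, zero_ne_one, zero_mul, one_mul]
  · interval_cases j
    all_goals
      simp only [braidCoeff, stepA, stepB, map_add, map_mul, map_sub, map_one, map_zero,
        sA0, sB0, tA0, tB0,
        hsu, hsv, htu, htv, Nat.reduceAdd, Nat.reduceEqDiff, if_true, if_false,
        OfNat.ofNat_ne_zero, one_ne_zero, OfNat.one_ne_ofNat, OfNat.zero_ne_ofNat, mul_zero,
        add_zero, zero_add, mul_one, zero_ne_one, zero_mul, one_mul]
    all_goals
      ring

set_option linter.unusedSimpArgs false in
/-- The braid relation of type `A₂`, with positive coroots `x`, `y`, `xy`. -/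
lemma altWord_braid_three (m : F →+* A) {S S' : A} {s t : F →+* F} {x y u v k l : F}
    (hS : ∀ f, S * m f = m (s f) * S) (hS2 : S * S = 1)
    (hS' : ∀ f, S' * m f = m (t f) * S') (hS2' : S' * S' = 1)
    (h : altWord S S' 3 = altWord S' S 3)
    (hx0 : x ≠ 0) (hx : x ≠ 1) (hy0 : y ≠ 0) (hy : y ≠ 1)
    (hsu : s u = u) (hsv : s v = v) (htu : t u = u) (htv : t v = v)
    (hsk : s k = k) (hsl : s l = l) (htk : t k = k) (htl : t l = l)
    (hk : k * (k - u) = 1) (hl : l * (l - v) = 1) (huv : u = v) (hkl : k = l)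
    (hsx : s x = x⁻¹) (hsy : s y = x * y) (hty : t y = y⁻¹) (htx : t x = x * y) :
    altWord (m (u / (1 - x)) + m (k - u / (1 - x)) * S)
        (m (v / (1 - y)) + m (l - v / (1 - y)) * S') 3 =
      altWord (m (v / (1 - y)) + m (l - v / (1 - y)) * S')
        (m (u / (1 - x)) + m (k - u / (1 - x)) * S) 3 := by
  subst huv hkl
  have hs1 {z : F} (hz : z ≠ 1) : s z ≠ 1 := fun h => hz (s.injective (h.trans (map_one s).symm))
  have n1 : x * y ≠ 1 := hsy ▸ hs1 hy
  have d1 : 1 - x ≠ 0 := sub_ne_zero.2 hx.symm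
  have d2 : 1 - y ≠ 0 := sub_ne_zero.2 hy.symm
  have d3 : 1 - x * y ≠ 0 := sub_ne_zero.2 n1.symm
  obtain ⟨A0, hA0⟩ : ∃ z, z = u / (1 - x) := ⟨_, rfl⟩
  obtain ⟨A1, hA1⟩ : ∃ z, z = u / (1 - x * y) := ⟨_, rfl⟩
  obtain ⟨B0, hB0⟩ : ∃ z, z = u / (1 - y) := ⟨_, rfl⟩
  have sA0 : s A0 = u - A0 := by
    rw [hA0, map_div₀, map_sub, map_one, hsu, hsx, reflect_coeff hx0 hx]
  have tB0 : t B0 = u - B0 := by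
    rw [hB0, map_div₀, map_sub, map_one, htu, hty, reflect_coeff hy0 hy]
  have sB0 : s B0 = A1 := by
    rw [hB0, hA1, map_div₀, map_sub, map_one, hsu, hsy]
  have sA1 : s A1 = B0 := by
    rw [hB0, hA1, map_div₀, map_sub, map_one, hsu, map_mul, hsx, hsy]
    congr 2
    field_simp
  have tA0 : t A0 = A1 := by
    rw [hA0, hA1, map_div₀, map_sub, map_one, htu, htx]
  have tA1 : t A1 = A0 := by
    rw [hA0, hA1, map_div₀, map_sub, map_one, htu, map_mul, htx, hty]
    congr 2
    field_simp
  rw [← hA0, ← hB0]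
  refine altWord_braid_twist m hS hS2 hS' hS2' (by norm_num) h ?_ ?_ ?_ (fun j hj => ?_)
    (fun j hj => ?_)
  · rw [map_sub, hsk, sA0]
    linear_combination hk
  · rw [map_sub, htk, tB0]
    linear_combination hk
  · simp only [altTwist, map_mul, map_sub, map_one, hsk, htk, hsu, htu,
      sA0, sA1, sB0, tA0, tA1, tB0]
    ring
  · interval_cases j
    all_goals
      simp only [braidCoeff, stepA, stepB, map_add, map_mul, map_sub, map_one, map_zero,
        sA0, sA1, sB0, tA0, tA1, tB0,
        hsu, htu, Nat.reduceAdd, Nat.reduceEqDiff, if_true, if_false,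
        OfNat.ofNat_ne_zero, one_ne_zero, OfNat.one_ne_ofNat, OfNat.zero_ne_ofNat, mul_zero,
        add_zero, zero_add, mul_one, zero_ne_one, zero_mul, one_mul]
    all_goals
      subst hA0 hA1 hB0
      field_simp
      ring
  · interval_cases j
    all_goals
      simp only [braidCoeff, stepA, stepB, map_add, map_mul, map_sub, map_one, map_zero,
        sA0, sA1, sB0, tA0, tA1, tB0,
        hsu, htu, Nat.reduceAdd, Nat.reduceEqDiff, if_true, if_false,
        OfNat.ofNat_ne_zero, one_ne_zero, OfNat.one_ne_ofNat, OfNat.zero_ne_ofNat, mul_zero,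
        add_zero, zero_add, mul_one, zero_ne_one, zero_mul, one_mul]
    all_goals
      subst hA0 hA1 hB0
      field_simp
      ring

set_option linter.unusedSimpArgs false in
/-- The braid relation of type `B₂`, with positive coroots `x`, `y`, `xy`, `xy²`. -/
lemma altWord_braid_four (m : F →+* A) {S S' : A} {s t : F →+* F} {x y u v k l : F}
    (hS : ∀ f, S * m f = m (s f) * S) (hS2 : S * S = 1)
    (hS' : ∀ f, S' * m f = m (t f) * S') (hS2' : S' * S' = 1)
    (h : altWord S S' 4 = altWord S' S 4)
    (hx0 : x ≠ 0) (hx : x ≠ 1) (hy0 : y ≠ 0) (hy : y ≠ 1)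
    (hsu : s u = u) (hsv : s v = v) (htu : t u = u) (htv : t v = v)
    (hsk : s k = k) (hsl : s l = l) (htk : t k = k) (htl : t l = l)
    (hk : k * (k - u) = 1) (hl : l * (l - v) = 1)
    (hsx : s x = x⁻¹) (hsy : s y = x * y) (hty : t y = y⁻¹) (htx : t x = x * y ^ 2) :
    altWord (m (u / (1 - x)) + m (k - u / (1 - x)) * S)
        (m (v / (1 - y)) + m (l - v / (1 - y)) * S') 4 =
      altWord (m (v / (1 - y)) + m (l - v / (1 - y)) * S')
        (m (u / (1 - x)) + m (k - u / (1 - x)) * S) 4 := by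
  have hs1 {z : F} (hz : z ≠ 1) : s z ≠ 1 := fun h => hz (s.injective (h.trans (map_one s).symm))
  have ht1 {z : F} (hz : z ≠ 1) : t z ≠ 1 := fun h => hz (t.injective (h.trans (map_one t).symm))
  have n1 : x * y ≠ 1 := hsy ▸ hs1 hy
  have n2 : x * y ^ 2 ≠ 1 := htx ▸ ht1 hx
  have d1 : 1 - x ≠ 0 := sub_ne_zero.2 hx.symm
  have d2 : 1 - y ≠ 0 := sub_ne_zero.2 hy.symm
  have d3 : 1 - x * y ≠ 0 := sub_ne_zero.2 n1.symm
  have d4 : 1 - x * y ^ 2 ≠ 0 := sub_ne_zero.2 n2.symm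
  obtain ⟨A0, hA0⟩ : ∃ z, z = u / (1 - x) := ⟨_, rfl⟩
  obtain ⟨A1, hA1⟩ : ∃ z, z = u / (1 - x * y ^ 2) := ⟨_, rfl⟩
  obtain ⟨B0, hB0⟩ : ∃ z, z = v / (1 - y) := ⟨_, rfl⟩
  obtain ⟨B1, hB1⟩ : ∃ z, z = v / (1 - x * y) := ⟨_, rfl⟩
  have sA0 : s A0 = u - A0 := by
    rw [hA0, map_div₀, map_sub, map_one, hsu, hsx, reflect_coeff hx0 hx]
  have tB0 : t B0 = v - B0 := by
    rw [hB0, map_div₀, map_sub, map_one, htv, hty, reflect_coeff hy0 hy]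
  have sA1 : s A1 = A1 := by
    rw [hA1, map_div₀, map_sub, map_one, hsu, map_mul, map_pow, hsx, hsy]
    congr 2
    field_simp
  have sB0 : s B0 = B1 := by
    rw [hB0, hB1, map_div₀, map_sub, map_one, hsv, hsy]
  have sB1 : s B1 = B0 := by
    rw [hB0, hB1, map_div₀, map_sub, map_one, hsv, map_mul, hsx, hsy]
    congr 2
    field_simp
  have tA0 : t A0 = A1 := by
    rw [hA0, hA1, map_div₀, map_sub, map_one, htu, htx]
  have tA1 : t A1 = A0 := by
    rw [hA0, hA1, map_div₀, map_sub, map_one, htu, map_mul, map_pow, htx, hty]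
    congr 2
    field_simp
  have tB1 : t B1 = B1 := by
    rw [hB1, map_div₀, map_sub, map_one, htv, map_mul, htx, hty]
    congr 2
    field_simp
  rw [← hA0, ← hB0]
  refine altWord_braid_twist m hS hS2 hS' hS2' (by norm_num) h ?_ ?_ ?_ (fun j hj => ?_)
    (fun j hj => ?_)
  · rw [map_sub, hsk, sA0]
    linear_combination hk
  · rw [map_sub, htl, tB0]
    linear_combination hl
  · simp only [altTwist, map_mul, map_sub, map_one, hsk, htk, hsl, htl, hsu, htu, hsv, htv,
      sA0, sA1, sB0, sB1, tA0, tA1, tB0, tB1]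
    ring
  · interval_cases j
    all_goals
      simp only [braidCoeff, stepA, stepB, map_add, map_mul, map_sub, map_one, map_zero,
        sA0, sA1, sB0, sB1, tA0, tA1, tB0, tB1,
        hsu, hsv, htu, htv, Nat.reduceAdd, Nat.reduceEqDiff, if_true, if_false,
        OfNat.ofNat_ne_zero, one_ne_zero, OfNat.one_ne_ofNat, OfNat.zero_ne_ofNat, mul_zero,
        add_zero, zero_add, mul_one, zero_ne_one, zero_mul, one_mul]
    all_goals
      subst hA0 hA1 hB0 hB1
      field_simp
      ring
  · interval_cases j
    all_goals
      simp only [braidCoeff, stepA, stepB, map_add, map_mul, map_sub, map_one, map_zero,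
        sA0, sA1, sB0, sB1, tA0, tA1, tB0, tB1,
        hsu, hsv, htu, htv, Nat.reduceAdd, Nat.reduceEqDiff, if_true, if_false,
        OfNat.ofNat_ne_zero, one_ne_zero, OfNat.one_ne_ofNat, OfNat.zero_ne_ofNat, mul_zero,
        add_zero, zero_add, mul_one, zero_ne_one, zero_mul, one_mul]
    all_goals
      subst hA0 hA1 hB0 hB1
      field_simp
      ring

set_option linter.unusedSimpArgs false in
set_option maxHeartbeats 1000000 in
/-- The braid relation of type `G₂`, with positive coroots `x`, `y`, `xy`, `xy²`, `xy³`, `x²y³`. -/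
lemma altWord_braid_six (m : F →+* A) {S S' : A} {s t : F →+* F} {x y u v k l : F}
    (hS : ∀ f, S * m f = m (s f) * S) (hS2 : S * S = 1)
    (hS' : ∀ f, S' * m f = m (t f) * S') (hS2' : S' * S' = 1)
    (h : altWord S S' 6 = altWord S' S 6)
    (hx0 : x ≠ 0) (hx : x ≠ 1) (hy0 : y ≠ 0) (hy : y ≠ 1)
    (hsu : s u = u) (hsv : s v = v) (htu : t u = u) (htv : t v = v)
    (hsk : s k = k) (hsl : s l = l) (htk : t k = k) (htl : t l = l)
    (hk : k * (k - u) = 1) (hl : l * (l - v) = 1)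
    (hsx : s x = x⁻¹) (hsy : s y = x * y) (hty : t y = y⁻¹) (htx : t x = x * y ^ 3) :
    altWord (m (u / (1 - x)) + m (k - u / (1 - x)) * S)
        (m (v / (1 - y)) + m (l - v / (1 - y)) * S') 6 =
      altWord (m (v / (1 - y)) + m (l - v / (1 - y)) * S')
        (m (u / (1 - x)) + m (k - u / (1 - x)) * S) 6 := by
  have hs1 {z : F} (hz : z ≠ 1) : s z ≠ 1 := fun h => hz (s.injective (h.trans (map_one s).symm))
  have ht1 {z : F} (hz : z ≠ 1) : t z ≠ 1 := fun h => hz (t.injective (h.trans (map_one t).symm))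
  have n1 : x * y ≠ 1 := hsy ▸ hs1 hy
  have n2 : x * y ^ 3 ≠ 1 := htx ▸ ht1 hx
  have n3 : x ^ 2 * y ^ 3 ≠ 1 := by
    have := hs1 n2
    rw [map_mul, map_pow, hsx, hsy] at this
    convert this using 1
    field_simp
  have n4 : x * y ^ 2 ≠ 1 := by
    have := ht1 n1
    rw [map_mul, htx, hty] at this
    convert this using 1
    field_simp
  have d1 : 1 - x ≠ 0 := sub_ne_zero.2 hx.symm
  have d2 : 1 - y ≠ 0 := sub_ne_zero.2 hy.symm
  have d3 : 1 - x * y ≠ 0 := sub_ne_zero.2 n1.symm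
  have d4 : 1 - x * y ^ 3 ≠ 0 := sub_ne_zero.2 n2.symm
  have d5 : 1 - x ^ 2 * y ^ 3 ≠ 0 := sub_ne_zero.2 n3.symm
  have d6 : 1 - x * y ^ 2 ≠ 0 := sub_ne_zero.2 n4.symm
  obtain ⟨A0, hA0⟩ : ∃ z, z = u / (1 - x) := ⟨_, rfl⟩
  obtain ⟨A1, hA1⟩ : ∃ z, z = u / (1 - x * y ^ 3) := ⟨_, rfl⟩
  obtain ⟨A2, hA2⟩ : ∃ z, z = u / (1 - x ^ 2 * y ^ 3) := ⟨_, rfl⟩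
  obtain ⟨B0, hB0⟩ : ∃ z, z = v / (1 - y) := ⟨_, rfl⟩
  obtain ⟨B1, hB1⟩ : ∃ z, z = v / (1 - x * y) := ⟨_, rfl⟩
  obtain ⟨B2, hB2⟩ : ∃ z, z = v / (1 - x * y ^ 2) := ⟨_, rfl⟩
  have sA0 : s A0 = u - A0 := by
    rw [hA0, map_div₀, map_sub, map_one, hsu, hsx, reflect_coeff hx0 hx]
  have tB0 : t B0 = v - B0 := by
    rw [hB0, map_div₀, map_sub, map_one, htv, hty, reflect_coeff hy0 hy]
  have sA1 : s A1 = A2 := by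
    rw [hA1, hA2, map_div₀, map_sub, map_one, hsu, map_mul, map_pow, hsx, hsy]
    congr 2
    field_simp
  have sA2 : s A2 = A1 := by
    rw [hA1, hA2, map_div₀, map_sub, map_one, hsu, map_mul, map_pow, map_pow, hsx, hsy]
    congr 2
    field_simp
  have sB0 : s B0 = B1 := by
    rw [hB0, hB1, map_div₀, map_sub, map_one, hsv, hsy]
  have sB1 : s B1 = B0 := by
    rw [hB0, hB1, map_div₀, map_sub, map_one, hsv, map_mul, hsx, hsy]
    congr 2
    field_simp
  have sB2 : s B2 = B2 := by
    rw [hB2, map_div₀, map_sub, map_one, hsv, map_mul, map_pow, hsx, hsy]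
    congr 2
    field_simp
  have tA0 : t A0 = A1 := by
    rw [hA0, hA1, map_div₀, map_sub, map_one, htu, htx]
  have tA1 : t A1 = A0 := by
    rw [hA0, hA1, map_div₀, map_sub, map_one, htu, map_mul, map_pow, htx, hty]
    congr 2
    field_simp
  have tA2 : t A2 = A2 := by
    rw [hA2, map_div₀, map_sub, map_one, htu, map_mul, map_pow, map_pow, htx, hty]
    congr 2
    field_simp
  have tB1 : t B1 = B2 := by
    rw [hB1, hB2, map_div₀, map_sub, map_one, htv, map_mul, htx, hty]
    congr 2
    field_simp
  have tB2 : t B2 = B1 := by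
    rw [hB1, hB2, map_div₀, map_sub, map_one, htv, map_mul, map_pow, htx, hty]
    congr 2
    field_simp
  rw [← hA0, ← hB0]
  refine altWord_braid_twist m hS hS2 hS' hS2' (by norm_num) h ?_ ?_ ?_ (fun j hj => ?_)
    (fun j hj => ?_)
  · rw [map_sub, hsk, sA0]
    linear_combination hk
  · rw [map_sub, htl, tB0]
    linear_combination hl
  · simp only [altTwist, map_mul, map_sub, map_one, hsk, htk, hsl, htl, hsu, htu, hsv, htv,
      sA0, sA1, sA2,
        sB0, sB1, sB2, tA0, tA1, tA2, tB0, tB1, tB2]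
    ring
  · interval_cases j
    all_goals
      simp only [braidCoeff, stepA, stepB, map_add, map_mul, map_sub, map_one, map_zero,
        sA0, sA1, sA2,
        sB0, sB1, sB2, tA0, tA1, tA2, tB0, tB1, tB2,
        hsu, hsv, htu, htv, Nat.reduceAdd, Nat.reduceEqDiff, if_true, if_false,
        OfNat.ofNat_ne_zero, one_ne_zero, OfNat.one_ne_ofNat, OfNat.zero_ne_ofNat, mul_zero,
        add_zero, zero_add, mul_one, zero_ne_one, zero_mul, one_mul]
    all_goals
      subst hA0 hA1 hA2 hB0 hB1 hB2
      field_simp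
      ring
  · interval_cases j
    all_goals
      simp only [braidCoeff, stepA, stepB, map_add, map_mul, map_sub, map_one, map_zero,
        sA0, sA1, sA2,
        sB0, sB1, sB2, tA0, tA1, tA2, tB0, tB1, tB2,
        hsu, hsv, htu, htv, Nat.reduceAdd, Nat.reduceEqDiff, if_true, if_false,
        OfNat.ofNat_ne_zero, one_ne_zero, OfNat.one_ne_ofNat, OfNat.zero_ne_ofNat, mul_zero,
        add_zero, zero_add, mul_one, zero_ne_one, zero_mul, one_mul]
    all_goals
      subst hA0 hA1 hA2 hB0 hB1 hB2
      field_simp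
      ring

end DihedralBraid

/-! ### Lengths in the extended affine Weyl group -/

namespace BqKZDatum

variable {ι V : Type*} [NormedAddCommGroup V] [InnerProductSpace ℝ V] (D : BqKZDatum ι V)

lemma invSet_finite (g : D.W) : (D.invSet g).Finite := by
  classical
  have := D.finite
  refine Set.Finite.subset (s := ⋃ i : ι, (fun r : ℤ => (D.P.root i, (r : ℝ))) ''
    Set.Icc 0 ⌈⟪g.right • D.P.root i, (D.tr g : V)⟫⌉) ?_ ?_
  · exact Set.finite_iUnion fun i => (Set.finite_Icc _ _).image _
  · rintro a ⟨⟨i, r, rfl, hr⟩, hn⟩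
    refine Set.mem_iUnion.2 ⟨i, r, ⟨?_, ?_⟩, rfl⟩
    · split_ifs at hr <;> omega
    · have h := D.affCoord_nonneg ((D.mem_negAffRoots_iff _).1 hn) none
      simp only [affCoord_none, affAct, Prod.snd_neg] at h
      have h2 : (r : ℝ) ≤ ⟪g.right • D.P.root i, (D.tr g : V)⟫ := by linarith
      exact_mod_cast h2.trans (Int.le_ceil _)

lemma neg_pos_iff {a : V × ℝ} (ha : a ∈ D.affRoots) :
    -a ∈ D.posAffRoots ↔ a ∉ D.posAffRoots := by
  rw [← mem_negAffRoots_iff]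
  exact ⟨fun h => h.2, fun h => ⟨ha, h⟩⟩

lemma mem_neg_iff {a : V × ℝ} (ha : a ∈ D.affRoots) :
    a ∈ D.negAffRoots ↔ a ∉ D.posAffRoots := ⟨fun h => h.2, fun h => ⟨ha, h⟩⟩

lemma affAct_affSimple_mem (g : D.W) (i : D.I) : D.affAct g (D.affSimple i) ∈ D.affRoots :=
  D.affAct_mem_affRoots g (D.affSimple_mem_affRoots i)

lemma len_mul_s_of_neg {g : D.W} {i : D.I} (h : D.affAct g (D.affSimple i) ∉ D.posAffRoots) :
    D.len (g * D.s i) + 1 = D.len g := by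
  have hs : (D.s i)⁻¹ = D.s i := inv_eq_of_mul_eq_one_left (D.s_mul_s i)
  rw [← D.len_inv, mul_inv_rev, hs, ← D.len_inv g]
  refine D.len_s_mul_of_neg (D.invSet_finite _) ?_
  rw [inv_inv, D.mem_neg_iff (D.affAct_affSimple_mem g i)]
  exact h

lemma len_mul_s_of_pos {g : D.W} {i : D.I} (h : D.affAct g (D.affSimple i) ∈ D.posAffRoots) :
    D.len (g * D.s i) = D.len g + 1 := by
  have h1 : D.affAct (g * D.s i) (D.affSimple i) ∉ D.posAffRoots := by
    rw [← affAct_affAct, affAct_s_self, affAct_neg,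
      D.neg_pos_iff (D.affAct_affSimple_mem g i), not_not]
    exact h
  have := D.len_mul_s_of_neg h1
  rwa [mul_assoc, s_mul_s, mul_one, eq_comm] at this

lemma len_mul_s_le (g : D.W) (i : D.I) : D.len (g * D.s i) ≤ D.len g + 1 := by
  by_cases h : D.affAct g (D.affSimple i) ∈ D.posAffRoots
  · rw [D.len_mul_s_of_pos h]
  · have := D.len_mul_s_of_neg h
    omega

lemma pos_of_len_mul_s {g : D.W} {i : D.I} (h : D.len (g * D.s i) = D.len g + 1) :
    D.affAct g (D.affSimple i) ∈ D.posAffRoots := by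
  by_contra hn
  have := D.len_mul_s_of_neg hn
  omega

lemma len_mul_prod_le (g : D.W) (l : List D.I) :
    D.len (g * (l.map D.s).prod) ≤ D.len g + l.length := by
  induction l generalizing g with
  | nil => simp
  | cons i l ih =>
    rw [List.map_cons, List.prod_cons, ← mul_assoc, List.length_cons]
    have := ih (g * D.s i)
    have := D.len_mul_s_le g i
    omega

/-- Lengths add up in `gh` if every positive root that `h` makes negative is made negative
by `gh`. -/
lemma len_mul_of_forall {g h : D.W}
    (H : ∀ a ∈ D.posAffRoots, D.affAct h a ∉ D.posAffRoots →
      D.affAct (g * h) a ∉ D.posAffRoots) :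
    D.len (g * h) = D.len g + D.len h := by
  have hmem (k : D.W) {a : V × ℝ} (ha : a ∈ D.posAffRoots) :
      D.affAct k a ∈ D.affRoots := D.affAct_mem_affRoots k (D.posAffRoots_subset ha)
  have hinv (k : D.W) (a : V × ℝ) :
      a ∈ D.invSet k ↔ a ∈ D.posAffRoots ∧ D.affAct k a ∉ D.posAffRoots :=
    and_congr_right fun ha => D.mem_neg_iff (hmem k ha)
  have himg : ∀ b ∈ D.invSet g, D.affAct h⁻¹ b ∈ D.posAffRoots := fun b hb => by
    by_contra hn
    rw [hinv] at hb
    have h1 := (D.neg_pos_iff (hmem h⁻¹ hb.1)).2 hn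
    have h2 := H _ h1
    rw [← affAct_affAct, affAct_neg, affAct_affAct_inv, affAct_neg, D.neg_pos_iff (hmem g hb.1),
      D.neg_pos_iff (D.posAffRoots_subset hb.1), not_not] at h2
    exact h2 hb.1 hb.2
  have hset : D.invSet (g * h) = D.affAct h⁻¹ '' D.invSet g ∪ D.invSet h := by
    ext a
    constructor
    · intro ha
      rw [hinv] at ha
      by_cases hp : D.affAct h a ∈ D.posAffRoots
      · left
        refine ⟨D.affAct h a, ?_, D.affAct_inv_affAct h a⟩
        rw [hinv, affAct_affAct]
        exact ⟨hp, ha.2⟩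
      · exact Or.inr ((hinv _ _).2 ⟨ha.1, hp⟩)
    · rintro (⟨b, hb, rfl⟩ | ha)
      · have := himg b hb
        rw [hinv] at hb ⊢
        refine ⟨this, ?_⟩
        rw [← affAct_affAct, affAct_affAct_inv]
        exact hb.2
      · rw [hinv] at ha ⊢
        exact ⟨ha.1, H a ha.1 ha.2⟩
  have hdisj : Disjoint (D.affAct h⁻¹ '' D.invSet g) (D.invSet h) := by
    rw [Set.disjoint_left]
    rintro _ ⟨b, hb, rfl⟩ hb'
    rw [hinv, affAct_affAct_inv] at hb'
    exact hb'.2 hb.1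
  change (D.invSet (g * h)).ncard = (D.invSet g).ncard + (D.invSet h).ncard
  rw [hset, Set.ncard_union_eq hdisj ((D.invSet_finite g).image _) (D.invSet_finite h),
    Set.ncard_image_of_injective]
  intro a b hab
  have := congrArg (D.affAct h) hab
  simpa only [affAct_affAct_inv] using this

lemma affAct_pos_of_len_eq_zero {g : D.W} (hg : D.len g = 0) {a : V × ℝ}
    (ha : a ∈ D.posAffRoots) : D.affAct g a ∈ D.posAffRoots := by
  by_contra hn
  have h : D.invSet g = ∅ := (Set.ncard_eq_zero (D.invSet_finite g)).1 hg
  have : a ∈ D.invSet g :=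
    ⟨ha, (D.mem_neg_iff (D.affAct_mem_affRoots g (D.posAffRoots_subset ha))).2 hn⟩
  rw [h] at this
  exact this

/-- Elements of length zero permute the simple affine roots. -/
lemma exists_affAct_eq_affSimple {g : D.W} (hg : D.len g = 0) (i : D.I) :
    ∃ j, D.affAct g (D.affSimple i) = D.affSimple j := by
  classical
  have hg' : D.len g⁻¹ = 0 := by rw [D.len_inv, hg]
  have hpos := D.affAct_pos_of_len_eq_zero hg (D.affSimple_mem_pos i)
  obtain ⟨j, hj⟩ : ∃ j, D.affCoord j (D.affAct g (D.affSimple i)) ≠ 0 := by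
    by_contra! h
    exact D.ne_zero_of_mem_affRoots (D.posAffRoots_subset hpos) (D.eq_zero_of_affCoord h)
  have hjp : 0 < D.affCoord j (D.affAct g (D.affSimple i)) :=
    lt_of_le_of_ne (D.affCoord_nonneg hpos j) hj.symm
  refine ⟨j, ?_⟩
  have hpj (k) := D.affAct_pos_of_len_eq_zero hg' (D.affSimple_mem_pos k)
  have hsum : D.affSimple i = ∑ k, D.affCoord k (D.affAct g (D.affSimple i)) •
      D.affAct g⁻¹ (D.affSimple k) := by
    have := congrArg (D.affActLin g⁻¹) (D.eq_sum_affCoord (D.affAct g (D.affSimple i)))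
    simpa only [map_sum, map_smul, affActLin_apply, affAct_inv_affAct] using this
  have he : D.affAct g⁻¹ (D.affSimple j) = D.affSimple i := by
    refine D.eq_affSimple_of_affCoord (hpj j) i fun l hl => ?_
    have h := congrArg (D.affCoord l) hsum
    rw [affCoord_affSimple, if_neg hl, map_sum] at h
    have h2 := (Finset.sum_eq_zero_iff_of_nonneg (fun k _ => ?_)).1 h.symm j (Finset.mem_univ j)
    · rw [map_smul, smul_eq_mul, mul_eq_zero] at h2
      exact h2.resolve_left hj
    · rw [map_smul, smul_eq_mul]
      exact mul_nonneg (D.affCoord_nonneg hpos k) (D.affCoord_nonneg (hpj k) l)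
  rw [← he, affAct_affAct_inv]

/-- The action of the extended affine Weyl group on affine linear functions is faithful. -/
lemma eq_of_affAct_eq {g h : D.W} (H : ∀ a, D.affAct g a = D.affAct h a) : g = h := by
  have h0 (v : V) : g.right • v = h.right • v := congrArg Prod.fst (H (v, 0))
  have h1 : g.right = h.right := by
    apply Subtype.ext
    apply RootPairing.Equiv.weightHom_injective
    refine LinearEquiv.ext fun v => ?_
    exact h0 v
  have h2 : D.tr g = D.tr h := by
    apply Subtype.ext
    refine ext_inner_left ℝ fun v => ?_
    have := congrArg Prod.snd (H (g.right⁻¹ • v, 0))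
    simp only [affAct, ← h0, smul_inv_smul] at this
    linarith
  exact SemidirectProduct.ext h2 h1

/-- Conjugation of simple reflections. -/
lemma mul_s_eq_of_affAct {g : D.W} {i j : D.I}
    (h : D.affAct g (D.affSimple i) = D.affSimple j) : g * D.s i = D.s j * g := by
  have hro : g.right • D.P.root (D.simpleAff i).1 = D.P.root (D.simpleAff j).1 :=
    congrArg Prod.fst h
  have hco : g.right • D.P.coroot (D.simpleAff i).1 = D.P.coroot (D.simpleAff j).1 := by
    rw [D.coroot_eq, D.coroot_eq, ← hro, D.inner_smul_smul]
    exact (smul_comm _ _ _)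
  refine D.eq_of_affAct_eq fun a => ?_
  rw [← affAct_affAct, ← affAct_affAct, affAct_s, affAct_s, ← h, sub_eq_add_neg, affAct_add,
    ← neg_smul, affAct_smul, neg_smul, ← sub_eq_add_neg, ← hco]
  congr 2
  exact (D.inner_smul_smul _ _ _).symm

end BqKZDatum

/-! ### Pairs of simple affine reflections -/

namespace BqKZDatum

variable {ι V : Type*} [NormedAddCommGroup V] [InnerProductSpace ℝ V] (D : BqKZDatum ι V)

lemma mulOp_wOp (g : D.W) (f : D.RatT) : D.wOp g * D.mulOp f = D.mulOp (g • f) * D.wOp g := by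
  simp [wOp, mulOp, SkewMonoidAlgebra.of_apply, SkewMonoidAlgebra.single_mul_single]

/-- The linear form `a ↦ ⟨a, α_i^∨⟩`, for which `s_i(a) = a - ⟨a, α_i^∨⟩ a_i`. -/
noncomputable def affForm (i : D.I) : V × ℝ →ₗ[ℝ] ℝ :=
  (innerₗ V).flip (D.P.coroot (D.simpleAff i).1) ∘ₗ LinearMap.fst ℝ V ℝ

lemma affForm_apply (i : D.I) (a : V × ℝ) :
    D.affForm i a = ⟪a.1, D.P.coroot (D.simpleAff i).1⟫ := rfl

lemma affAct_s_eq (i : D.I) (a : V × ℝ) :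
    D.affAct (D.s i) a = a - D.affForm i a • D.affSimple i := D.affAct_s i a

lemma affForm_affSimple (i j : D.I) :
    D.affForm j (D.affSimple i) = D.P.pairing (D.simpleAff i).1 (D.simpleAff j).1 := by
  rw [affForm_apply, ← D.pairing_eq_inner]
  rfl

lemma affForm_affSimple_self (i : D.I) : D.affForm i (D.affSimple i) = 2 := by
  rw [affForm_affSimple, RootPairing.pairing_same]

/-- Otherwise `s_j(a_i)` would have coordinates of both signs. -/
lemma affForm_affSimple_nonpos {i j : D.I} (hij : i ≠ j) : D.affForm j (D.affSimple i) ≤ 0 := by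
  classical
  have h1 : 0 < D.affCoord i (D.affAct (D.s j) (D.affSimple i)) := by
    rw [affAct_s_eq, map_sub, map_smul, affCoord_affSimple, affCoord_affSimple, if_pos rfl,
      if_neg hij, smul_zero, sub_zero]
    exact one_pos
  have h2 := D.affCoord_nonneg (D.mem_pos_of_affCoord_pos (D.affAct_affSimple_mem _ _) h1) j
  rw [affAct_s_eq, map_sub, map_smul, affCoord_affSimple, affCoord_affSimple, if_pos rfl,
    if_neg hij.symm, zero_sub, smul_eq_mul, mul_one] at h2
  linarith

lemma affCoord_nonpos {a : V × ℝ} (ha : a ∈ D.affRoots) (h : a ∉ D.posAffRoots) (i : D.I) :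
    D.affCoord i a ≤ 0 := by
  have := D.affCoord_nonneg ((D.neg_pos_iff ha).2 h) i
  rw [map_neg] at this
  linarith

/-- If `g` makes `a_i` and `a_j` negative then also every affine root `g'(a_m)` spanned by them. -/
lemma affAct_mul_notMem_pos {g g' : D.W} {i j m : D.I}
    (hi : D.affAct g (D.affSimple i) ∉ D.posAffRoots)
    (hj : D.affAct g (D.affSimple j) ∉ D.posAffRoots) {x y : ℝ} (hx : 0 ≤ x) (hy : 0 ≤ y)
    (h : D.affAct g' (D.affSimple m) = x • D.affSimple i + y • D.affSimple j) :
    D.affAct (g * g') (D.affSimple m) ∉ D.posAffRoots := by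
  intro hp
  refine D.ne_zero_of_mem_affRoots (D.posAffRoots_subset hp) (D.eq_zero_of_affCoord fun l =>
    le_antisymm ?_ (D.affCoord_nonneg hp l))
  rw [← affAct_affAct, h, affAct_add, affAct_smul, affAct_smul, map_add, map_smul, map_smul]
  have h1 := mul_nonpos_of_nonneg_of_nonpos hx
    (D.affCoord_nonpos (D.affAct_affSimple_mem g i) hi l)
  have h2 := mul_nonpos_of_nonneg_of_nonpos hy
    (D.affCoord_nonpos (D.affAct_affSimple_mem g j) hj l)
  simp only [smul_eq_mul]
  linarith

lemma len_altWord_succ {g : D.W} {i j : D.I} {n : ℕ}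
    (hi : D.affAct g (D.affSimple i) ∉ D.posAffRoots)
    (h : D.len (g * D.s i * altWord (D.s j) (D.s i) n) + n = D.len (g * D.s i)) :
    D.len (g * altWord (D.s i) (D.s j) (n + 1)) + (n + 1) = D.len g := by
  have := D.len_mul_s_of_neg hi
  rw [altWord, ← mul_assoc]
  omega

lemma smul_algebraMap_complex (g : D.W) (z : ℂ) :
    g • algebraMap ℂ D.RatT z = algebraMap ℂ D.RatT z := by
  rw [Algebra.algebraMap_eq_smul_one, smul_comm, smul_one]

/-- The rational function `x_i = x^{a_i^∨}`. -/
noncomputable def xr (i : D.I) : D.RatT := algebraMap D.CT D.RatT (D.monoCo (D.simpleAff i) 1)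

lemma xr_ne_one (i : D.I) : D.xr i ≠ 1 := D.monoCo_ne_one _

lemma xr_ne_zero (i : D.I) : D.xr i ≠ 0 := by
  have : D.xr i * algebraMap D.CT D.RatT (D.monoCo (D.simpleAff i) (-1)) = 1 := by
    rw [xr, ← map_mul, D.monoCo_mul_neg, map_one]
  exact left_ne_zero_of_mul_eq_one this

lemma s_smul_xr_self (i : D.I) : D.s i • D.xr i = (D.xr i)⁻¹ := by
  rw [xr, smul_algebraMap_RatT, s, D.affRefl_smul_monoCo]
  refine eq_inv_of_mul_eq_one_right ?_
  rw [← map_mul, D.monoCo_mul_neg, map_one]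

/-- `s_b(x^{a^∨}) = x^{a^∨} (x^{b^∨})^n` if `⟨b, a^∨⟩ = -n`; this includes the powers of `q`. -/
lemma affRefl_smul_monoCo_of_pairing {a b : ι × ℤ} {n : ℕ} (h : D.P.pairing b.1 a.1 = -n) :
    D.affRefl b • D.monoCo a 1 = D.monoCo a 1 * D.monoCo b 1 ^ n := by
  have hne : ⟪D.P.root b.1, D.P.root b.1⟫ ≠ 0 := by
    rw [Ne, inner_self_eq_zero]
    exact D.P.ne_zero b.1
  have hp : ⟪D.P.root b.1, D.P.coroot a.1⟫ = -n := by
    rw [← D.pairing_eq_inner]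
    exact h
  have hrefl : (D.affRefl b).right • (D.P.coroot a.1) =
      D.P.coroot a.1 + (n : ℝ) • D.P.coroot b.1 := by
    change D.P.reflection b.1 (D.P.coroot a.1) = _
    rw [RootPairing.reflection_apply, RootPairing.coroot', LinearMap.flip_apply,
      D.pairing_eq_inner, D.coroot_eq b.1, inner_smul_right,
      real_inner_comm (D.P.root b.1) (D.P.coroot a.1), hp, smul_smul]
    module
  have htr : (D.tr (D.affRefl b) : V) = -(b.2 • D.P.coroot b.1) := rfl
  have hbb : ⟪D.P.coroot b.1, D.P.coroot b.1⟫ = 4 / ⟪D.P.root b.1, D.P.root b.1⟫ := by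
    rw [D.coroot_eq, inner_smul_left, inner_smul_right]
    simp only [RCLike.conj_to_real]
    field_simp
    norm_num
  have hab : ⟪D.P.coroot a.1, D.P.coroot b.1⟫ = -n * 2 / ⟪D.P.root b.1, D.P.root b.1⟫ := by
    rw [D.coroot_eq b.1, inner_smul_right, real_inner_comm (D.P.root b.1) (D.P.coroot a.1), hp]
    ring
  have hca : ((D.corootPv a.1 : D.Pv) : V) = D.P.coroot a.1 := rfl
  have hcb : ((D.corootPv b.1 : D.Pv) : V) = D.P.coroot b.1 := rfl
  rw [smul_CT_def, monoCo, regAct_single, monoCo, AddMonoidAlgebra.single_pow,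
    AddMonoidAlgebra.single_mul_single]
  congr 1
  · apply Subtype.ext
    simp only [one_smul, coe_smul_Pv, AddSubgroup.coe_add, AddSubgroup.coe_nsmul, hca, hcb, hrefl]
    rw [← Nat.cast_smul_eq_nsmul ℝ]
  · rw [one_smul, hca, hrefl, htr]
    simp only [qpow, MonoidHom.coe_mk, OneHom.coe_mk, Units.val_mk0, toAdd_ofAdd]
    rw [← Complex.ofReal_pow, ← Complex.ofReal_mul, ← Complex.ofReal_mul, ← Real.rpow_add D.q_pos,
      ← Real.rpow_natCast, ← Real.rpow_mul D.q_pos.le, ← Real.rpow_add D.q_pos]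
    congr 2
    rw [← Int.cast_smul_eq_zsmul ℝ, inner_neg_right, inner_smul_right, inner_add_left,
      inner_smul_left, hab, hbb]
    simp only [RCLike.conj_to_real]
    field_simp
    push_cast
    ring

lemma s_smul_xr {i j : D.I} {n : ℕ} (h : D.affForm j (D.affSimple i) = -n) :
    D.s i • D.xr j = D.xr j * D.xr i ^ n := by
  rw [affForm_affSimple] at h
  rw [xr, smul_algebraMap_RatT, s, D.affRefl_smul_monoCo_of_pairing h, map_mul, map_pow]
  rfl

lemma algebraMap_ki_mul (i : D.I) : algebraMap ℂ D.RatT (D.ki i) *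
    algebraMap ℂ D.RatT ((D.ki i)⁻¹ : ℂˣ) = 1 := by
  rw [← map_mul, ← Units.val_mul, mul_inv_cancel, Units.val_one, map_one]

/-- `T_i = κ/(1 - x_i) + (k_i - κ/(1 - x_i)) s_i` with `κ = k_i - k_i⁻¹`. -/
lemma Top_eq (i : D.I) :
    D.Top i = D.mulOp ((algebraMap ℂ D.RatT (D.ki i) - algebraMap ℂ D.RatT ((D.ki i)⁻¹ : ℂˣ)) /
        (1 - D.xr i)) +
      D.mulOp (algebraMap ℂ D.RatT (D.ki i) -
        (algebraMap ℂ D.RatT (D.ki i) - algebraMap ℂ D.RatT ((D.ki i)⁻¹ : ℂˣ)) /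
          (1 - D.xr i)) * D.wOp (D.s i) := by
  have h1 : 1 - D.xr i ≠ 0 := sub_ne_zero.2 (D.xr_ne_one i).symm
  have hc : D.c i = algebraMap ℂ D.RatT (D.ki i) -
        (algebraMap ℂ D.RatT (D.ki i) - algebraMap ℂ D.RatT ((D.ki i)⁻¹ : ℂˣ)) /
          (1 - D.xr i) := by
    change (_ - _ * D.xr i) / (1 - D.xr i) = _
    field_simp
    ring
  have hA : algebraMap ℂ D.A (D.ki i) = D.mulOp (algebraMap ℂ D.RatT (D.ki i)) := rfl
  rw [Top, ← hc, mul_sub, mul_one, hA, add_sub_left_comm, ← map_sub, add_comm]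
  congr 2
  rw [hc, sub_sub_cancel]

/-- The action of `g` on `ℂ(T)` as a ring homomorphism. -/
noncomputable def ratHom (g : D.W) : D.RatT →+* D.RatT := MulSemiringAction.toRingHom D.W D.RatT g

lemma ratHom_apply (g : D.W) (f : D.RatT) : D.ratHom g f = g • f := rfl

lemma wOp_s_mul_self (i : D.I) : D.wOp (D.s i) * D.wOp (D.s i) = 1 := by
  rw [← map_mul, s_mul_s, map_one]

lemma ki_eq_of_affForm {i j : D.I} (h1 : D.affForm j (D.affSimple i) = -1)
    (h2 : D.affForm i (D.affSimple j) = -1) : D.ki i = D.ki j := by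
  rw [affForm_affSimple] at h1 h2
  have h : D.P.reflectionPerm (D.simpleAff i).1
      (D.P.reflectionPerm (D.simpleAff j).1 (D.simpleAff i).1) = (D.simpleAff j).1 := by
    apply D.P.root.injective
    rw [RootPairing.root_reflectionPerm, RootPairing.root_reflectionPerm,
      RootPairing.reflection_apply_root, h1, map_sub, map_smul,
      RootPairing.reflection_apply_self, RootPairing.reflection_apply_root, h2]
    module
  rw [ki, ki, ← h, D.k_invariant, D.k_invariant]

/-- The braid relations of length `n` for `s_i`, `s_j` and for `T_i`, `T_j`, together with the fact
that an element which makes `a_i` and `a_j` negative has a reduced expression ending in the longest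
alternating word. -/
structure IsBraid (i j : D.I) (n : ℕ) : Prop where
  ne_zero : n ≠ 0
  group : altWord (D.s i) (D.s j) n = altWord (D.s j) (D.s i) n
  hecke : altWord (D.Top i) (D.Top j) n = altWord (D.Top j) (D.Top i) n
  len_add : ∀ g, D.affAct g (D.affSimple i) ∉ D.posAffRoots →
    D.affAct g (D.affSimple j) ∉ D.posAffRoots →
    D.len (g * altWord (D.s i) (D.s j) n) + n = D.len g

variable {D}

lemma IsBraid.symm {i j : D.I} {n : ℕ} (h : D.IsBraid i j n) : D.IsBraid j i n :=
  ⟨h.ne_zero, h.group.symm, h.hecke.symm, fun g hi hj => by rw [← h.group]; exact h.len_add g hj hi⟩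

lemma isBraid_two {i j : D.I} (h1 : D.affForm j (D.affSimple i) = 0)
    (h2 : D.affForm i (D.affSimple j) = 0) : D.IsBraid i j 2 := by
  have hgr : altWord (D.s i) (D.s j) 2 = altWord (D.s j) (D.s i) 2 := by
    refine D.eq_of_affAct_eq fun a => ?_
    simp only [altWord, mul_one, ← affAct_affAct, affAct_s_eq, map_sub, map_smul, h1, h2,
      smul_eq_mul]
    module
  refine ⟨two_ne_zero, hgr, ?_, fun g hi hj => ?_⟩
  · rw [Top_eq, Top_eq]
    refine altWord_braid_two D.mulOp (s := D.ratHom (D.s i)) (t := D.ratHom (D.s j))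
      (D.mulOp_wOp _) (D.wOp_s_mul_self i) (D.mulOp_wOp _) (D.wOp_s_mul_self j) ?_
      (D.xr_ne_zero i) (D.xr_ne_one i) (D.xr_ne_zero j) (D.xr_ne_one j) ?_ ?_ ?_ ?_ ?_ ?_ ?_ ?_ ?_
      ?_ (D.s_smul_xr_self i) ?_ (D.s_smul_xr_self j) ?_
    · rw [← map_altWord, hgr, map_altWord]
    all_goals simp only [ratHom_apply, smul_sub, smul_algebraMap_complex, sub_sub_cancel,
      algebraMap_ki_mul]
    · rw [D.s_smul_xr (n := 0) (by rw [h1]; simp), pow_zero, mul_one]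
    · rw [D.s_smul_xr (n := 0) (by rw [h2]; simp), pow_zero, mul_one]
  · have k1 : D.affAct (g * D.s i) (D.affSimple j) ∉ D.posAffRoots := by
      refine D.affAct_mul_notMem_pos hi hj (x := 0) (y := 1) (by norm_num) (by norm_num) ?_
      simp only [affAct_s_eq, h2]
      module
    refine D.len_altWord_succ hi (D.len_altWord_succ k1 ?_)
    simp [altWord]

lemma isBraid_three {i j : D.I} (h1 : D.affForm j (D.affSimple i) = -1)
    (h2 : D.affForm i (D.affSimple j) = -1) : D.IsBraid i j 3 := by
  have hgr : altWord (D.s i) (D.s j) 3 = altWord (D.s j) (D.s i) 3 := by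
    refine D.eq_of_affAct_eq fun a => ?_
    simp only [altWord, mul_one, ← affAct_affAct, affAct_s_eq, map_sub, map_smul, h1, h2,
      affForm_affSimple_self, smul_eq_mul]
    module
  refine ⟨three_ne_zero, hgr, ?_, fun g hi hj => ?_⟩
  · have hk := D.ki_eq_of_affForm h1 h2
    rw [Top_eq, Top_eq]
    refine altWord_braid_three D.mulOp (s := D.ratHom (D.s i)) (t := D.ratHom (D.s j))
      (D.mulOp_wOp _) (D.wOp_s_mul_self i) (D.mulOp_wOp _) (D.wOp_s_mul_self j) ?_
      (D.xr_ne_zero i) (D.xr_ne_one i) (D.xr_ne_zero j) (D.xr_ne_one j) ?_ ?_ ?_ ?_ ?_ ?_ ?_ ?_ ?_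
      ?_ ?_ ?_ (D.s_smul_xr_self i) ?_ (D.s_smul_xr_self j) ?_
    · rw [← map_altWord, hgr, map_altWord]
    all_goals simp only [ratHom_apply, smul_sub, smul_algebraMap_complex, sub_sub_cancel,
      algebraMap_ki_mul, hk]
    · rw [D.s_smul_xr (n := 1) (by rw [h1]; simp), pow_one, mul_comm]
    · rw [D.s_smul_xr (n := 1) (by rw [h2]; simp), pow_one]
  · have k1 : D.affAct (g * D.s i) (D.affSimple j) ∉ D.posAffRoots := by
      refine D.affAct_mul_notMem_pos hi hj (x := 1) (y := 1) (by norm_num) (by norm_num) ?_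
      simp only [affAct_s_eq, h2]
      module
    have k2 : D.affAct (g * D.s i * D.s j) (D.affSimple i) ∉ D.posAffRoots := by
      rw [mul_assoc]
      refine D.affAct_mul_notMem_pos hi hj (x := 0) (y := 1) (by norm_num) (by norm_num) ?_
      simp only [← affAct_affAct, affAct_s_eq, map_sub, map_smul, h1, h2, affForm_affSimple_self]
      module
    refine D.len_altWord_succ hi (D.len_altWord_succ k1 (D.len_altWord_succ k2 ?_))
    simp [altWord]

lemma isBraid_four {i j : D.I} (h1 : D.affForm j (D.affSimple i) = -1)
    (h2 : D.affForm i (D.affSimple j) = -2) : D.IsBraid i j 4 := by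
  have hgr : altWord (D.s i) (D.s j) 4 = altWord (D.s j) (D.s i) 4 := by
    refine D.eq_of_affAct_eq fun a => ?_
    simp only [altWord, mul_one, ← affAct_affAct, affAct_s_eq, map_sub, map_smul, h1, h2,
      affForm_affSimple_self, smul_eq_mul]
    module
  refine ⟨four_ne_zero, hgr, ?_, fun g hi hj => ?_⟩
  · rw [Top_eq, Top_eq]
    refine altWord_braid_four D.mulOp (s := D.ratHom (D.s i)) (t := D.ratHom (D.s j))
      (D.mulOp_wOp _) (D.wOp_s_mul_self i) (D.mulOp_wOp _) (D.wOp_s_mul_self j) ?_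
      (D.xr_ne_zero i) (D.xr_ne_one i) (D.xr_ne_zero j) (D.xr_ne_one j) ?_ ?_ ?_ ?_ ?_ ?_ ?_ ?_ ?_
      ?_ (D.s_smul_xr_self i) ?_ (D.s_smul_xr_self j) ?_
    · rw [← map_altWord, hgr, map_altWord]
    all_goals simp only [ratHom_apply, smul_sub, smul_algebraMap_complex, sub_sub_cancel,
      algebraMap_ki_mul]
    · rw [D.s_smul_xr (n := 1) (by rw [h1]; simp), pow_one, mul_comm]
    · rw [D.s_smul_xr (n := 2) (by rw [h2]; simp)]
  · have k1 : D.affAct (g * D.s i) (D.affSimple j) ∉ D.posAffRoots := by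
      refine D.affAct_mul_notMem_pos hi hj (x := 2) (y := 1) (by norm_num) (by norm_num) ?_
      simp only [affAct_s_eq, h2]
      module
    have k2 : D.affAct (g * D.s i * D.s j) (D.affSimple i) ∉ D.posAffRoots := by
      rw [mul_assoc]
      refine D.affAct_mul_notMem_pos hi hj (x := 1) (y := 1) (by norm_num) (by norm_num) ?_
      simp only [← affAct_affAct, affAct_s_eq, map_sub, map_smul, h1, h2, affForm_affSimple_self]
      module
    have k3 : D.affAct (g * D.s i * D.s j * D.s i) (D.affSimple j) ∉ D.posAffRoots := by
      rw [mul_assoc, mul_assoc]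
      refine D.affAct_mul_notMem_pos hi hj (x := 0) (y := 1) (by norm_num) (by norm_num) ?_
      simp only [← affAct_affAct, affAct_s_eq, map_sub, map_smul, h1, h2, affForm_affSimple_self]
      module
    refine D.len_altWord_succ hi (D.len_altWord_succ k1 (D.len_altWord_succ k2
      (D.len_altWord_succ k3 ?_)))
    simp [altWord]

lemma isBraid_six {i j : D.I} (h1 : D.affForm j (D.affSimple i) = -1)
    (h2 : D.affForm i (D.affSimple j) = -3) : D.IsBraid i j 6 := by
  have hgr : altWord (D.s i) (D.s j) 6 = altWord (D.s j) (D.s i) 6 := by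
    refine D.eq_of_affAct_eq fun a => ?_
    simp only [altWord, mul_one, ← affAct_affAct, affAct_s_eq, map_sub, map_smul, h1, h2,
      affForm_affSimple_self, smul_eq_mul]
    module
  refine ⟨by norm_num, hgr, ?_, fun g hi hj => ?_⟩
  · rw [Top_eq, Top_eq]
    refine altWord_braid_six D.mulOp (s := D.ratHom (D.s i)) (t := D.ratHom (D.s j))
      (D.mulOp_wOp _) (D.wOp_s_mul_self i) (D.mulOp_wOp _) (D.wOp_s_mul_self j) ?_
      (D.xr_ne_zero i) (D.xr_ne_one i) (D.xr_ne_zero j) (D.xr_ne_one j) ?_ ?_ ?_ ?_ ?_ ?_ ?_ ?_ ?_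
      ?_ (D.s_smul_xr_self i) ?_ (D.s_smul_xr_self j) ?_
    · rw [← map_altWord, hgr, map_altWord]
    all_goals simp only [ratHom_apply, smul_sub, smul_algebraMap_complex, sub_sub_cancel,
      algebraMap_ki_mul]
    · rw [D.s_smul_xr (n := 1) (by rw [h1]; simp), pow_one, mul_comm]
    · rw [D.s_smul_xr (n := 3) (by rw [h2]; simp)]
  · have k1 : D.affAct (g * D.s i) (D.affSimple j) ∉ D.posAffRoots := by
      refine D.affAct_mul_notMem_pos hi hj (x := 3) (y := 1) (by norm_num) (by norm_num) ?_
      simp only [affAct_s_eq, h2]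
      module
    have k2 : D.affAct (g * D.s i * D.s j) (D.affSimple i) ∉ D.posAffRoots := by
      rw [mul_assoc]
      refine D.affAct_mul_notMem_pos hi hj (x := 2) (y := 1) (by norm_num) (by norm_num) ?_
      simp only [← affAct_affAct, affAct_s_eq, map_sub, map_smul, h1, h2, affForm_affSimple_self]
      module
    have k3 : D.affAct (g * D.s i * D.s j * D.s i) (D.affSimple j) ∉ D.posAffRoots := by
      rw [mul_assoc, mul_assoc]
      refine D.affAct_mul_notMem_pos hi hj (x := 3) (y := 2) (by norm_num) (by norm_num) ?_
      simp only [← affAct_affAct, affAct_s_eq, map_sub, map_smul, h1, h2, affForm_affSimple_self]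
      module
    have k4 : D.affAct (g * D.s i * D.s j * D.s i * D.s j) (D.affSimple i) ∉ D.posAffRoots := by
      rw [mul_assoc, mul_assoc, mul_assoc]
      refine D.affAct_mul_notMem_pos hi hj (x := 1) (y := 1) (by norm_num) (by norm_num) ?_
      simp only [← affAct_affAct, affAct_s_eq, map_sub, map_smul, h1, h2, affForm_affSimple_self]
      module
    have k5 : D.affAct (g * D.s i * D.s j * D.s i * D.s j * D.s i) (D.affSimple j) ∉
        D.posAffRoots := by
      rw [mul_assoc, mul_assoc, mul_assoc, mul_assoc]
      refine D.affAct_mul_notMem_pos hi hj (x := 0) (y := 1) (by norm_num) (by norm_num) ?_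
      simp only [← affAct_affAct, affAct_s_eq, map_sub, map_smul, h1, h2, affForm_affSimple_self]
      module
    refine D.len_altWord_succ hi (D.len_altWord_succ k1 (D.len_altWord_succ k2
      (D.len_altWord_succ k3 (D.len_altWord_succ k4 (D.len_altWord_succ k5 ?_)))))
    simp [altWord]

/-- If some `g` makes both `a_i` and `a_j` negative then `s_i s_j` has finite order, as otherwise
`a_i + a_j` would be a positive constant, which `g` preserves. -/
lemma exists_isBraid {i j : D.I} (hij : i ≠ j) {g : D.W}
    (hi : D.affAct g (D.affSimple i) ∉ D.posAffRoots)
    (hj : D.affAct g (D.affSimple j) ∉ D.posAffRoots) : ∃ n, D.IsBraid i j n := by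
  classical
  have := D.finite
  have := D.isRootSystem
  have := D.isCrystallographic
  have := D.isReduced
  have n1 := D.affForm_affSimple_nonpos hij
  have n2 := D.affForm_affSimple_nonpos hij.symm
  have he : D.P.root (D.simpleAff i).1 ≠ D.P.root (D.simpleAff j).1 := fun h => by
    have h0 : (D.simpleAff i).1 = (D.simpleAff j).1 := D.P.root.injective h
    rw [affForm_affSimple, h0, RootPairing.pairing_same] at n1
    norm_num at n1
  have he' : D.P.root (D.simpleAff i).1 ≠ -D.P.root (D.simpleAff j).1 := fun h => by
    have hs : D.affAct g (D.affSimple i + D.affSimple j) = D.affSimple i + D.affSimple j := by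
      have h1 : (D.affSimple i + D.affSimple j).1 = 0 := by
        change D.P.root _ + D.P.root _ = 0
        rw [h, neg_add_cancel]
      refine Prod.ext ?_ ?_
      · simp only [affAct, h1, smul_zero]
      · simp only [affAct, h1, smul_zero, inner_zero_left, sub_zero]
    have h2 := congrArg (D.affCoord i) hs
    rw [affAct_add, map_add, map_add, affCoord_affSimple, affCoord_affSimple, if_pos rfl,
      if_neg hij, add_zero] at h2
    have h3 := D.affCoord_nonpos (D.affAct_affSimple_mem g i) hi i
    have h4 := D.affCoord_nonpos (D.affAct_affSimple_mem g j) hj i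
    linarith
  have key := D.P.pairingIn_pairingIn_mem_set_of_isCrystal_of_isRed' _ _ he he'
  have p1 := D.P.algebraMap_pairingIn ℤ (D.simpleAff i).1 (D.simpleAff j).1
  have p2 := D.P.algebraMap_pairingIn ℤ (D.simpleAff j).1 (D.simpleAff i).1
  rw [← affForm_affSimple] at p1 p2
  simp only [Set.mem_insert_iff, Set.mem_singleton_iff, Prod.mk.injEq] at key
  rw [← p1] at n1
  rw [← p2] at n2
  rcases key with h | h | h | h | h | h | h | h | h | h | h <;> obtain ⟨e1, e2⟩ := h <;>
    rw [e1] at p1 n1 <;> rw [e2] at p2 n2 <;>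
    first | (exfalso; revert n1; norm_num; done) | norm_num at p1 p2
  · exact ⟨2, isBraid_two p1.symm p2.symm⟩
  · exact ⟨3, isBraid_three p1.symm p2.symm⟩
  · exact ⟨4, isBraid_four p1.symm p2.symm⟩
  · exact ⟨4, (isBraid_four p2.symm p1.symm).symm⟩
  · exact ⟨6, isBraid_six p1.symm p2.symm⟩
  · exact ⟨6, (isBraid_six p2.symm p1.symm).symm⟩

end BqKZDatum

/-! ### The elements `T_w` -/

namespace BqKZDatum

variable {ι V : Type*} [NormedAddCommGroup V] [InnerProductSpace ℝ V] (D : BqKZDatum ι V)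

lemma k_eq_of_smul {w : D.W0} {i j : ι} (h : w • D.P.root i = D.P.root j) : D.k i = D.k j := by
  revert i j
  obtain ⟨g, hg⟩ := w
  induction hg using RootPairing.weylGroup.induction with
  | mem m =>
    intro i j h
    have : D.P.reflectionPerm m i = j := by
      apply D.P.root.injective
      rw [RootPairing.root_reflectionPerm]
      exact h
    rw [← this, D.k_invariant]
  | one =>
    intro i j h
    exact congrArg D.k (D.P.root.injective h)
  | mul g₁ g₂ hg₁ hg₂ h₁ h₂ =>
    intro i j h
    rw [← Submonoid.mk_mul_mk _ _ _ hg₁ hg₂, mul_smul] at h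
    have h3 : (⟨g₂, hg₂⟩ : D.W0) • D.P.root i = D.P.root _ := D.P.weylGroup_apply_root ⟨g₂, hg₂⟩ i
    rw [h3] at h
    exact (h₂ h3).trans (h₁ h)

lemma smul_coroot_of_smul_root {w : D.W0} {i j : ι} (h : w • D.P.root i = D.P.root j) :
    w • D.P.coroot i = D.P.coroot j := by
  rw [D.coroot_eq, D.coroot_eq, ← h, D.inner_smul_smul]
  exact smul_comm _ _ _

lemma smul_monoCo_of_affAct {g : D.W} {a b : ι × ℤ}
    (h : D.affAct g (D.P.root a.1, (a.2 : ℝ)) = (D.P.root b.1, (b.2 : ℝ))) :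
    g • D.monoCo a 1 = D.monoCo b 1 := by
  have h1 : g.right • D.P.root a.1 = D.P.root b.1 := congrArg Prod.fst h
  have h2 : (a.2 : ℝ) - ⟪g.right • D.P.root a.1, (D.tr g : V)⟫ = b.2 := congrArg Prod.snd h
  have hco := D.smul_coroot_of_smul_root h1
  have hn : ⟪D.P.root a.1, D.P.root a.1⟫ = ⟪D.P.root b.1, D.P.root b.1⟫ := by
    rw [← h1, D.inner_smul_smul]
  have hne : ⟪D.P.root b.1, D.P.root b.1⟫ ≠ 0 := by
    rw [Ne, inner_self_eq_zero]
    exact D.P.ne_zero b.1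
  have hca : ((D.corootPv a.1 : D.Pv) : V) = D.P.coroot a.1 := rfl
  rw [smul_CT_def, monoCo, regAct_single, monoCo]
  congr 1
  · apply Subtype.ext
    simp only [one_smul, coe_smul_Pv, hca, hco]
    rfl
  · rw [one_smul, hca, hco]
    simp only [qpow, MonoidHom.coe_mk, OneHom.coe_mk, Units.val_mk0, toAdd_ofAdd]
    rw [← Complex.ofReal_mul, ← Real.rpow_add D.q_pos]
    congr 2
    rw [D.coroot_eq, inner_smul_left, hn, ← h1, ← h2]
    rw [h1]
    simp only [RCLike.conj_to_real]
    field_simp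
    push_cast
    ring

/-- If `g(a_i) = a_j` then `g T_i = T_j g`. -/
lemma wOp_mul_Top {g : D.W} {i j : D.I} (h : D.affAct g (D.affSimple i) = D.affSimple j) :
    D.wOp g * D.Top i = D.Top j * D.wOp g := by
  have hk : D.ki i = D.ki j := D.k_eq_of_smul (w := g.right) (congrArg Prod.fst h)
  have hx : g • algebraMap D.CT D.RatT (D.monoCo (D.simpleAff i) 1) =
      algebraMap D.CT D.RatT (D.monoCo (D.simpleAff j) 1) := by
    rw [smul_algebraMap_RatT, D.smul_monoCo_of_affAct h]
  have hc : g • D.c i = D.c j := by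
    rw [c, c, smul_div₀', smul_sub, smul_sub, smul_mul', smul_algebraMap_complex,
      smul_algebraMap_complex, hx, smul_one, hk]
  rw [Top, Top, mul_add, ← mul_assoc, mulOp_wOp, hc, hk, add_mul, ← Algebra.commutes, mul_assoc,
    mul_assoc, mul_sub, sub_mul, mul_one, one_mul, ← map_mul, ← map_mul, D.mul_s_eq_of_affAct h]

/-- `T_g` as given by the (a priori not unique) reduced expressions of `g`. -/
inductive IsT : D.W → D.Aˣ → Prop
  | of_len_zero {g : D.W} (hg : D.len g = 0) : IsT g (D.wUnit g)
  | step {g : D.W} {x : D.Aˣ} {i : D.I} (h : IsT g x) (hl : D.len (g * D.s i) = D.len g + 1) :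
    IsT (g * D.s i) (x * D.TUnit i)

lemma exists_neg_of_len_ne_zero' {g : D.W} (h : D.len g ≠ 0) :
    ∃ i, D.affAct g (D.affSimple i) ∉ D.posAffRoots := by
  obtain ⟨i, hi⟩ := D.exists_neg_of_len_ne_zero (g := g⁻¹) (by rwa [D.len_inv])
  rw [inv_inv] at hi
  exact ⟨i, hi.2⟩

lemma exists_isT (g : D.W) : ∃ x, D.IsT g x := by
  induction hn : D.len g generalizing g with
  | zero => exact ⟨_, .of_len_zero hn⟩
  | succ n ih =>
    obtain ⟨i, hi⟩ := D.exists_neg_of_len_ne_zero' (g := g) (by omega)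
    have hl := D.len_mul_s_of_neg hi
    obtain ⟨x, hx⟩ := ih (g * D.s i) (by omega)
    have h2 : g * D.s i * D.s i = g := by rw [mul_assoc, s_mul_s, mul_one]
    have := IsT.step (i := i) hx (by rw [h2]; omega)
    rw [h2] at this
    exact ⟨_, this⟩

variable {D}

lemma IsT.append {g : D.W} {x : D.Aˣ} (hx : D.IsT g x) (l : List D.I)
    (hl : D.len (g * (l.map D.s).prod) = D.len g + l.length) :
    D.IsT (g * (l.map D.s).prod) (x * (l.map D.TUnit).prod) := by
  induction l generalizing g x with
  | nil => simpa using hx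
  | cons i l ih =>
    simp only [List.map_cons, List.prod_cons, ← mul_assoc, List.length_cons] at hl ⊢
    have h1 := D.len_mul_prod_le (g * D.s i) l
    have h2 := D.len_mul_s_le g i
    exact ih (.step hx (by omega)) (by omega)

lemma IsT.cases' {g : D.W} {x : D.Aˣ} (hx : D.IsT g x) : (D.len g = 0 ∧ x = D.wUnit g) ∨
    ∃ i y, D.affAct g (D.affSimple i) ∉ D.posAffRoots ∧ D.IsT (g * D.s i) y ∧
      x = y * D.TUnit i := by
  cases hx with
  | of_len_zero hg => exact Or.inl ⟨hg, rfl⟩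
  | @step g x i h hl =>
    refine Or.inr ⟨i, x, ?_, ?_, rfl⟩
    · rw [← affAct_affAct, affAct_s_self, affAct_neg,
        D.neg_pos_iff (D.affAct_affSimple_mem _ _), not_not]
      exact D.pos_of_len_mul_s hl
    · rwa [mul_assoc, s_mul_s, mul_one]

/-- The word `i, j, i, …` (`n` letters). -/
def altList (i j : D.I) : ℕ → List D.I
  | 0 => []
  | n + 1 => i :: altList j i n

lemma length_altList (i j : D.I) (n : ℕ) : (altList i j n).length = n := by
  induction n generalizing i j with
  | zero => rfl
  | succ n ih => rw [altList, List.length_cons, ih]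

lemma prod_altList {M : Type*} [Monoid M] (f : D.I → M) (i j : D.I) (n : ℕ) :
    ((altList i j n).map f).prod = altWord (f i) (f j) n := by
  induction n generalizing i j with
  | zero => rfl
  | succ n ih => rw [altList, List.map_cons, List.prod_cons, ih, altWord]

lemma altList_succ_eq_append (i j : D.I) (n : ℕ) :
    altList i j (n + 1) = altList i j n ++ [if Even n then i else j] := by
  induction n generalizing i j with
  | zero => simp [altList]
  | succ n ih =>
    rw [altList, ih, altList, List.cons_append]
    by_cases h : Even n <;> simp [h, Nat.even_add_one]

lemma reverse_altList (i j : D.I) (n : ℕ) :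
    (altList i j n).reverse = if Even n then altList j i n else altList i j n := by
  induction n generalizing i j with
  | zero => simp [altList]
  | succ n ih =>
    rw [altList, List.reverse_cons, ih]
    by_cases h : Even n
    · have h2 := altList_succ_eq_append i j n
      rw [if_pos h] at h2
      rw [if_pos h, if_neg (by simp [h, Nat.even_add_one]), ← h2, altList]
    · rw [if_neg h, if_pos (by simp [h, Nat.even_add_one]), altList_succ_eq_append, if_neg h]

lemma altWord_mul_prod_reverse (i j : D.I) (n : ℕ) : altWord (D.s i) (D.s j) n *
    ((altList i j n).reverse.map D.s).prod = 1 := by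
  induction n generalizing i j with
  | zero => simp [altWord, altList]
  | succ n ih =>
    have h3 := ih j i
    rw [altWord, altList, List.reverse_cons, List.map_append, List.prod_append, mul_assoc,
      ← mul_assoc (altWord _ _ n), h3]
    simp [s_mul_s]

/-- If `g` has a reduced expression ending in an alternating word of `i` and `j`, then omitting a
letter gives one of `g s_i`. -/
lemma IsT.of_altWord {g : D.W} {i j : D.I} {m : ℕ} {z : D.Aˣ}
    (hi : D.affAct g (D.affSimple i) ∉ D.posAffRoots)
    (hlen : D.len (g * altWord (D.s i) (D.s j) (m + 1)) + (m + 1) = D.len g)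
    (hz : D.IsT (g * altWord (D.s i) (D.s j) (m + 1)) z) :
    D.IsT (g * D.s i) (z * ((altList j i m).reverse.map D.TUnit).prod) := by
  have e1 : g * altWord (D.s i) (D.s j) (m + 1) * ((altList j i m).reverse.map D.s).prod =
      g * D.s i := by
    rw [mul_assoc, altWord, mul_assoc (D.s i), altWord_mul_prod_reverse, mul_one]
  have hli := D.len_mul_s_of_neg hi
  have := hz.append (altList j i m).reverse (by
    rw [e1, List.length_reverse, length_altList]
    omega)
  rwa [e1] at this

/-- The braid relation, for words read from the right. -/
lemma IsBraid.prod_reverse {i j : D.I} {m : ℕ} (h : D.IsBraid i j (m + 1)) :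
    ((altList j i m).reverse.map D.TUnit).prod * D.TUnit i =
      ((altList i j m).reverse.map D.TUnit).prod * D.TUnit j := by
  have hT : altWord (D.TUnit i) (D.TUnit j) (m + 1) = altWord (D.TUnit j) (D.TUnit i) (m + 1) := by
    refine Units.ext ?_
    have e (i j : D.I) : ((altWord (D.TUnit i) (D.TUnit j) (m + 1) : D.Aˣ) : D.A) =
        altWord (D.Top i) (D.Top j) (m + 1) :=
      map_altWord (Units.coeHom D.A) (D.TUnit i) (D.TUnit j) (m + 1)
    rw [e, e, h.hecke]
  have hr (i j : D.I) : ((altList j i m).reverse.map D.TUnit).prod * D.TUnit i =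
      ((altList i j (m + 1)).reverse.map D.TUnit).prod := by
    rw [altList, List.reverse_cons, List.map_append, List.prod_append, List.map_singleton,
      List.prod_singleton]
  rw [hr, hr, reverse_altList, reverse_altList]
  split_ifs
  · rw [prod_altList, prod_altList, hT]
  · rw [prod_altList, prod_altList, hT]

/-- The value of `T_g` does not depend on the reduced expression: two reduced expressions of `g`
ending in `i` and in `j` are compared with reduced expressions ending in the two longest
alternating words in `i` and `j`. -/
lemma IsT.unique {g : D.W} {x y : D.Aˣ} (hx : D.IsT g x) (hy : D.IsT g y) : x = y := by
  induction hn : D.len g using Nat.strong_induction_on generalizing g x y with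
  | _ n ih =>
  rcases hx.cases' with ⟨h0, rfl⟩ | ⟨i, x', hi, hx', rfl⟩
  · rcases hy.cases' with ⟨-, rfl⟩ | ⟨j, y', hj, hy', rfl⟩
    · rfl
    · have := D.len_mul_s_of_neg hj
      omega
  · have hli := D.len_mul_s_of_neg hi
    rcases hy.cases' with ⟨h0, rfl⟩ | ⟨j, y', hj, hy', rfl⟩
    · omega
    have hlj := D.len_mul_s_of_neg hj
    by_cases hij : i = j
    · subst hij
      rw [ih _ (by omega) hx' hy' rfl]
    obtain ⟨m, hm⟩ := exists_isBraid hij hi hj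
    have hlen := hm.len_add g hi hj
    obtain ⟨m, rfl⟩ := Nat.exists_eq_succ_of_ne_zero hm.ne_zero
    obtain ⟨z, hz⟩ := D.exists_isT (g * altWord (D.s i) (D.s j) (m + 1))
    have kx := IsT.of_altWord hi hlen hz
    have ky := IsT.of_altWord (i := j) (j := i) (m := m) (z := z) hj
      (by rw [← hm.group]; exact hlen) (by rw [← hm.group]; exact hz)
    rw [ih _ (by omega) hx' kx rfl, ih _ (by omega) hy' ky rfl, mul_assoc, mul_assoc,
      hm.prod_reverse]

variable (D)

lemma len_mul_of_len_eq_zero {g h : D.W} (hg : D.len g = 0) : D.len (g * h) = D.len h := by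
  rw [D.len_mul_of_forall, hg, zero_add]
  intro a ha hn
  rw [← D.neg_pos_iff (D.affAct_mem_affRoots _ (D.posAffRoots_subset ha))] at hn ⊢
  rw [← affAct_affAct, ← affAct_neg]
  exact D.affAct_pos_of_len_eq_zero hg hn

lemma len_mul_of_len_eq_zero_right {g h : D.W} (hh : D.len h = 0) : D.len (g * h) = D.len g := by
  rw [← D.len_inv, mul_inv_rev, D.len_mul_of_len_eq_zero (by rw [D.len_inv, hh]), D.len_inv]

variable {D}

lemma IsT.len_zero_mul {g h : D.W} {x : D.Aˣ} (hg : D.len g = 0) (hx : D.IsT h x) :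
    D.IsT (g * h) (D.wUnit g * x) := by
  induction hx with
  | of_len_zero hh =>
    rw [← map_mul]
    exact .of_len_zero (by rw [D.len_mul_of_len_eq_zero hg, hh])
  | step h hl ih =>
    rw [← mul_assoc, ← mul_assoc]
    refine .step ih ?_
    rw [mul_assoc, D.len_mul_of_len_eq_zero hg, D.len_mul_of_len_eq_zero hg, hl]

variable (D)

lemma s_inv (i : D.I) : (D.s i)⁻¹ = D.s i := inv_eq_of_mul_eq_one_left (D.s_mul_s i)

lemma inv_prod_map_s (l : List D.I) : ((l.map D.s).prod)⁻¹ = (l.reverse.map D.s).prod := by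
  rw [List.prod_inv_reverse, List.map_map, ← List.map_reverse]
  congr 2
  funext i
  exact D.s_inv i

lemma redExprL_spec (g : D.W) : g = (D.redExprL g).2.1 * ((D.redExprL g).1.map D.s).prod ∧
    (D.redExprL g).1.length = D.len g := by
  refine Classical.epsilon_spec (p := fun p : List D.I × D.Om =>
    g = p.2.1 * (p.1.map D.s).prod ∧ p.1.length = D.len g) ?_
  obtain ⟨p, hp, hl⟩ := D.exists_redExprR g⁻¹
  refine ⟨(p.1.reverse, ⟨p.2.1⁻¹, (D.len_inv _).trans p.2.2⟩), ?_, ?_⟩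
  · rw [← inv_inv g, hp, mul_inv_rev, inv_prod_map_s]
  · rw [List.length_reverse, hl, D.len_inv]

lemma isT_Tw (g : D.W) : D.IsT g (D.Tw g) := by
  obtain ⟨h1, h2⟩ := D.redExprL_spec g
  have h0 : D.len (D.redExprL g).2.1 = 0 := (D.redExprL g).2.2
  have := (IsT.of_len_zero h0).append (D.redExprL g).1 (by rw [← h1, h0, h2, zero_add])
  rwa [← h1] at this

lemma Tw_of_len_eq_zero {g : D.W} (hg : D.len g = 0) : D.Tw g = D.wUnit g :=
  (D.isT_Tw g).unique (.of_len_zero hg)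

lemma Tw_mul_s {g : D.W} {i : D.I} (hl : D.len (g * D.s i) = D.len g + 1) :
    D.Tw (g * D.s i) = D.Tw g * D.TUnit i :=
  (D.isT_Tw _).unique ((D.isT_Tw g).step hl)

lemma len_one : D.len 1 = 0 := by
  have := D.len_mul_prod_le 1 []
  obtain ⟨ω⟩ := (inferInstance : Nonempty D.Om)
  have h := D.len_mul_of_len_eq_zero (g := ω.1) (h := ω.1⁻¹) ω.2
  rw [mul_inv_cancel] at h
  rw [h, D.len_inv]
  exact ω.2

lemma Tw_one : D.Tw 1 = 1 := by rw [D.Tw_of_len_eq_zero D.len_one, map_one]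

lemma len_s (i : D.I) : D.len (D.s i) = 1 := by
  have := D.len_mul_s_of_pos (g := 1) (i := i) (by
    rw [affAct_one]
    exact D.affSimple_mem_pos i)
  rwa [one_mul, len_one, zero_add] at this

lemma Tw_s (i : D.I) : D.Tw (D.s i) = D.TUnit i := by
  have := D.Tw_mul_s (g := 1) (i := i) (by rw [one_mul, len_one, len_s])
  rwa [one_mul, Tw_one, one_mul] at this

lemma Tw_len_zero_mul {g h : D.W} (hg : D.len g = 0) : D.Tw (g * h) = D.wUnit g * D.Tw h :=
  (D.isT_Tw _).unique ((D.isT_Tw h).len_zero_mul hg)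

lemma Tw_mul_len_zero {g h : D.W} (hh : D.len h = 0) : D.Tw (g * h) = D.Tw g * D.wUnit h := by
  obtain ⟨x, hx⟩ := D.exists_isT g
  rw [(D.isT_Tw g).unique hx]
  induction hx with
  | of_len_zero hg => rw [D.Tw_len_zero_mul hg, D.Tw_of_len_eq_zero hh]
  | @step g x i hx hl ih =>
    obtain ⟨j, hj⟩ := D.exists_affAct_eq_affSimple (g := h⁻¹) (by rw [D.len_inv, hh]) i
    have hj' : D.affAct h (D.affSimple j) = D.affSimple i := by
      rw [← hj, affAct_affAct_inv]
    have hc : D.TUnit i * D.wUnit h = D.wUnit h * D.TUnit j :=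
      Units.ext (D.wOp_mul_Top hj').symm
    rw [mul_assoc, ← D.mul_s_eq_of_affAct hj', ← mul_assoc, D.Tw_mul_s, ih, mul_assoc, mul_assoc,
      hc]
    rw [mul_assoc, D.mul_s_eq_of_affAct hj', ← mul_assoc, D.len_mul_of_len_eq_zero_right hh,
      D.len_mul_of_len_eq_zero_right hh, hl]

lemma len_mul_le (g h : D.W) : D.len (g * h) ≤ D.len g + D.len h := by
  obtain ⟨p, hp, hl⟩ := D.exists_redExprR h
  rw [hp, ← mul_assoc, D.len_mul_of_len_eq_zero_right p.2.2, ← hl.trans (congrArg D.len hp)]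
  exact D.len_mul_prod_le _ _

/-- `T_{gh} = T_g T_h` if lengths add up. -/
lemma Tw_mul {g h : D.W} (hl : D.len (g * h) = D.len g + D.len h) :
    D.Tw (g * h) = D.Tw g * D.Tw h := by
  obtain ⟨x, hx⟩ := D.exists_isT h
  rw [(D.isT_Tw h).unique hx]
  induction hx with
  | of_len_zero hh => exact D.Tw_mul_len_zero hh
  | @step h x i hx hli ih =>
    have h1 := D.len_mul_le g h
    have h2 := D.len_mul_s_le (g * h) i
    rw [← mul_assoc] at hl ⊢
    rw [D.Tw_mul_s (by omega), ih (by omega), mul_assoc]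

end BqKZDatum

/-! ### The finite Weyl group and dominance -/

namespace BqKZDatum

variable {ι V : Type*} [NormedAddCommGroup V] [InnerProductSpace ℝ V] (D : BqKZDatum ι V)

/-- The inclusion of `W₀` in `W`. -/
noncomputable def fin (u : D.W0) : D.W := SemidirectProduct.inr u

lemma fin_mul (u v : D.W0) : D.fin (u * v) = D.fin u * D.fin v := map_mul _ u v

lemma fin_one : D.fin 1 = 1 := map_one _

lemma fin_inv (u : D.W0) : D.fin u⁻¹ = (D.fin u)⁻¹ := map_inv _ u

lemma affAct_fin (u : D.W0) (a : V × ℝ) : D.affAct (D.fin u) a = (u • a.1, a.2) := by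
  have : D.tr (D.fin u) = 0 := rfl
  refine Prod.ext rfl ?_
  simp [affAct, this]

lemma affAct_trans (l : D.Pv) (a : V × ℝ) :
    D.affAct (D.trans l) a = (a.1, a.2 - ⟪a.1, (l : V)⟫) := by
  refine Prod.ext (one_smul _ _) ?_
  change a.2 - ⟪(1 : D.W0) • a.1, (l : V)⟫ = _
  rw [one_smul]

lemma trans_add (l m : D.Pv) : D.trans (l + m) = D.trans l * D.trans m := by
  rw [trans, trans, trans, ← map_mul, ofAdd_add]

lemma fin_mul_trans (u : D.W0) (l : D.Pv) : D.fin u * D.trans l = D.trans (u • l) * D.fin u := by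
  refine D.eq_of_affAct_eq fun a => ?_
  simp only [← affAct_affAct, affAct_fin, affAct_trans, coe_smul_Pv, D.inner_smul_smul]

/-- The reflection `s_α` in `W₀`. -/
noncomputable def refl (i : ι) : D.W0 := RootPairing.weylGroup.ofIdx D.P i

lemma refl_smul (i : ι) (v : V) : D.refl i • v = v - ⟪v, D.P.coroot i⟫ • D.P.root i := by
  change D.P.reflection i v = _
  rw [RootPairing.reflection_apply, RootPairing.coroot', LinearMap.flip_apply, D.pairing_eq_inner]

lemma s_some (j : D.b.support) : D.s (some j) = D.fin (D.refl j) := by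
  refine SemidirectProduct.ext ?_ rfl
  change Multiplicative.ofAdd (-((0 : ℤ) • D.corootPv j)) = 1
  rw [zero_smul, neg_zero]
  rfl

lemma refl_mul_self (i : ι) : D.refl i * D.refl i = 1 :=
  congrArg SemidirectProduct.right (D.affRefl_mul_self (i, 0))

lemma refl_inv (i : ι) : (D.refl i)⁻¹ = D.refl i := inv_eq_of_mul_eq_one_left (D.refl_mul_self i)

lemma mul_refl_of_smul {u : D.W0} {i j : ι} (h : u • D.P.root i = D.P.root j) :
    u * D.refl i = D.refl j * u := by
  have hco := D.smul_coroot_of_smul_root h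
  apply SemidirectProduct.inr_injective (φ := D.latticeAction)
  refine D.eq_of_affAct_eq fun a => ?_
  change D.affAct (D.fin _) a = D.affAct (D.fin _) a
  rw [fin_mul, fin_mul, ← affAct_affAct, ← affAct_affAct, affAct_fin, affAct_fin, affAct_fin,
    affAct_fin, refl_smul, refl_smul, ← h, ← hco, D.inner_smul_smul, smul_sub]
  have hs (w : D.W0) (r : ℝ) (v : V) : w • (r • v) = r • (w • v) := smul_comm _ _ _
  rw [hs]

/-- Every root is conjugate to a simple one by a product of simple reflections. -/
lemma exists_simple_smul (i : ι) : ∃ (l : List D.b.support) (j : D.b.support),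
    (l.map fun j : D.b.support => D.refl j).prod • D.P.root j = D.P.root i := by
  have := D.finite
  have := D.isRootSystem
  have := D.isCrystallographic
  have := D.isReduced
  have key : ∀ i, D.b.IsPos i → ∃ (l : List D.b.support) (j : D.b.support),
    (l.map fun j : D.b.support => D.refl j).prod • D.P.root j = D.P.root i := by
    intro i hi
    refine hi.induction_on_reflect (p := fun i => ∃ (l : List D.b.support) (j : D.b.support),
      (l.map fun j : D.b.support => D.refl j).prod • D.P.root j = D.P.root i)
      (fun i hi => ⟨[], ⟨i, hi⟩, one_smul _ _⟩) ?_
    rintro i j ⟨l, m, h⟩ hj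
    refine ⟨⟨j, hj⟩ :: l, m, ?_⟩
    rw [List.map_cons, List.prod_cons, mul_smul, h, RootPairing.root_reflectionPerm]
    rfl
  by_cases hi : D.b.IsPos i
  · exact key i hi
  · obtain ⟨l, m, h⟩ := key _ ((RootPairing.Base.IsPos.neg_iff_not D.b i).2 hi)
    refine ⟨l ++ [m], m, ?_⟩
    have h2 : D.refl m • D.P.root m = -D.P.root m := D.P.reflection_apply_self m
    rw [List.map_append, List.prod_append, mul_smul, List.map_singleton, List.prod_singleton, h2,
      smul_neg, h]
    simp

lemma exists_list_refl (u : D.W0) :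
    ∃ l : List D.b.support, u = (l.map fun j : D.b.support => D.refl j).prod := by
  obtain ⟨g, hg⟩ := u
  induction hg using RootPairing.weylGroup.induction with
  | mem i =>
    obtain ⟨l, m, h⟩ := D.exists_simple_smul i
    have h2 := D.mul_refl_of_smul h
    refine ⟨l ++ m :: l.reverse, ?_⟩
    rw [List.map_append, List.prod_append, List.map_cons, List.prod_cons, ← mul_assoc, h2,
      List.map_reverse]
    have h3 : (l.map fun j : D.b.support => D.refl j) =
        (l.map fun j : D.b.support => D.refl j).map (·⁻¹) := by
      rw [List.map_map]
      congr 1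
      funext j
      exact (D.refl_inv j).symm
    have h4 : (l.map fun j : D.b.support => D.refl j).reverse.prod =
        ((l.map fun j : D.b.support => D.refl j).prod)⁻¹ := by
      rw [List.prod_inv_reverse, ← h3]
    rw [h4, mul_assoc, mul_inv_cancel, mul_one]
    rfl
  | one => exact ⟨[], rfl⟩
  | mul g₁ g₂ hg₁ hg₂ h₁ h₂ =>
    obtain ⟨l₁, h₁⟩ := h₁
    obtain ⟨l₂, h₂⟩ := h₂
    refine ⟨l₁ ++ l₂, ?_⟩
    rw [List.map_append, List.prod_append, ← h₁, ← h₂]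
    rfl

/-- The exchange condition. -/
lemma exists_exchange (l : List D.b.support) (i : D.b.support)
    (h : D.affAct ((l.map fun j => D.s (some j)).prod) (D.affSimple (some i)) ∉ D.posAffRoots) :
    ∃ l' : List D.b.support, (l.map fun j => D.s (some j)).prod * D.s (some i) =
      (l'.map fun j => D.s (some j)).prod ∧ l'.length + 1 = l.length := by
  induction l with
  | nil =>
    rw [List.map_nil, List.prod_nil, affAct_one] at h
    exact absurd (D.affSimple_mem_pos _) h
  | cons j l ih =>
    by_cases hp : D.affAct ((l.map fun j => D.s (some j)).prod) (D.affSimple (some i)) ∈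
      D.posAffRoots
    · have he : D.affAct ((l.map fun j => D.s (some j)).prod) (D.affSimple (some i)) =
          D.affSimple (some j) := by
        by_contra hne
        rw [List.map_cons, List.prod_cons, ← affAct_affAct] at h
        exact h (D.affAct_s_mem_pos hp hne)
      refine ⟨l, ?_, rfl⟩
      rw [List.map_cons, List.prod_cons, mul_assoc, D.mul_s_eq_of_affAct he, ← mul_assoc, s_mul_s,
        one_mul]
    · obtain ⟨l', h1, h2⟩ := ih hp
      refine ⟨j :: l', ?_, by simp [h2]⟩
      rw [List.map_cons, List.prod_cons, mul_assoc, h1, List.map_cons, List.prod_cons]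

lemma fin_prod (l : List D.b.support) :
    D.fin (l.map fun j : D.b.support => D.refl j).prod = (l.map fun j => D.s (some j)).prod := by
  induction l with
  | nil => exact D.fin_one
  | cons j l ih => rw [List.map_cons, List.prod_cons, fin_mul, ih, List.map_cons, List.prod_cons,
      s_some]

lemma eq_one_of_len_fin {u : D.W0} (hu : D.len (D.fin u) = 0) : u = 1 := by
  classical
  have hex := D.exists_list_refl u
  have hex' : ∃ n, ∃ l : List D.b.support, l.length = n ∧
      D.fin u = (l.map fun j => D.s (some j)).prod := by
    obtain ⟨l, hl⟩ := hex
    exact ⟨_, l, rfl, by rw [hl, fin_prod]⟩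
  obtain ⟨l, hl, hul⟩ := Nat.find_spec hex'
  rcases List.eq_nil_or_concat l with rfl | ⟨l, i, rfl⟩
  · exact SemidirectProduct.inr_injective hul
  · exfalso
    rw [List.concat_eq_append] at hl hul
    have hp := D.affAct_pos_of_len_eq_zero hu (D.affSimple_mem_pos (some i))
    rw [List.map_append, List.prod_append, List.map_singleton, List.prod_singleton] at hul
    have hn : D.affAct ((l.map fun j => D.s (some j)).prod) (D.affSimple (some i)) ∉
        D.posAffRoots := by
      rw [hul, ← affAct_affAct, affAct_s_self, affAct_neg,
        D.neg_pos_iff (D.affAct_affSimple_mem _ _)] at hp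
      exact hp
    obtain ⟨l', h1, h2⟩ := D.exists_exchange l i hn
    refine Nat.find_min hex' (m := l'.length) ?_ ⟨l', rfl, by rw [hul, h1]⟩
    rw [← hl, List.length_append]
    omega

/-- The roots of `R₊`, as vectors. -/
def posG : Set V := {v | (v, (0 : ℝ)) ∈ D.posAffRoots}

lemma mem_pos_iff {a : V × ℝ} (ha : a ∈ D.affRoots) :
    a ∈ D.posAffRoots ↔ 0 < a.2 ∨ (a.2 = 0 ∧ a.1 ∈ D.posG) := by
  classical
  obtain ⟨i, r, rfl⟩ := ha
  have h0 := D.mk_mem_posAffRoots i 0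
  rw [Int.cast_zero] at h0
  rw [mk_mem_posAffRoots, posG, Set.mem_ofPred_eq, h0]
  simp only [Int.cast_pos, Int.cast_eq_zero]
  split_ifs <;> omega

lemma root_mem_posG_or (i : ι) : D.P.root i ∈ D.posG ∨ -D.P.root i ∈ D.posG := by
  have h : (D.P.root i, (0 : ℝ)) ∈ D.affRoots := ⟨i, 0, by simp⟩
  have h2 := D.neg_pos_iff h
  rw [Prod.neg_mk, neg_zero] at h2
  by_cases hp : (D.P.root i, (0 : ℝ)) ∈ D.posAffRoots
  · exact Or.inl hp
  · exact Or.inr (h2.2 hp)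

lemma neg_mem_posG_iff (i : ι) : -D.P.root i ∈ D.posG ↔ D.P.root i ∉ D.posG := by
  have h : (D.P.root i, (0 : ℝ)) ∈ D.affRoots := ⟨i, 0, by simp⟩
  have h2 := D.neg_pos_iff h
  rwa [Prod.neg_mk, neg_zero] at h2

lemma exists_root_of_affRoots {a : V × ℝ} (ha : a ∈ D.affRoots) : ∃ i, a.1 = D.P.root i := by
  obtain ⟨i, r, rfl⟩ := ha
  exact ⟨i, rfl⟩

lemma simple_mem_posG (j : D.b.support) : D.P.root j ∈ D.posG := by
  have := D.affSimple_mem_pos (some j)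
  change (D.P.root j, (0 : ℝ)) ∈ D.posAffRoots
  simpa [affSimple, simpleAff] using this

/-- Every element of `W₀` has a reduced expression in `s_1, …, s_N`. -/
lemma W0_induction {p : D.W0 → Prop} (one : p 1)
    (step : ∀ u (i : D.b.support), p u →
      D.len (D.fin u * D.s (some i)) = D.len (D.fin u) + 1 → p (u * D.refl i)) (u : D.W0) :
    p u := by
  induction hn : D.len (D.fin u) generalizing u with
  | zero => rwa [D.eq_one_of_len_fin hn]
  | succ n ih =>
    obtain ⟨i, hi⟩ := D.exists_neg_of_len_ne_zero' (g := D.fin u) (by omega)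
    rcases i with _ | i
    · exfalso
      refine hi ((D.mem_pos_iff (D.affAct_affSimple_mem _ _)).2 (Or.inl ?_))
      simp [affAct_fin, affSimple, simpleAff]
    · have hl := D.len_mul_s_of_neg hi
      have he : D.fin (u * D.refl i) = D.fin u * D.s (some i) := by rw [fin_mul, s_some]
      have h2 : u * D.refl i * D.refl i = u := by rw [mul_assoc, refl_mul_self, mul_one]
      have := step (u * D.refl i) i (ih _ (by rw [he]; omega)) (by
        rw [he, mul_assoc, s_mul_s, mul_one]
        omega)
      rwa [h2] at this

/-- The coordinates of roots in the basis of simple roots are integers. -/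
lemma exists_coord_int (i : ι) (j : D.b.support) :
    haveI := D.isRootSystem
    ∃ n : ℤ, D.b.toWeightBasis.coord j (D.P.root i) = n := by
  have := D.isRootSystem
  have key : ∀ v ∈ AddSubmonoid.closure (D.P.root '' D.b.support),
      ∃ n : ℤ, D.b.toWeightBasis.coord j v = n := by
    classical
    intro v hv
    induction hv using AddSubmonoid.closure_induction with
    | mem x hx =>
      obtain ⟨k, hk, rfl⟩ := hx
      have : D.P.root k = D.b.toWeightBasis ⟨k, hk⟩ := (D.b.toWeightBasis_apply ⟨k, hk⟩).symm
      rw [this, Module.Basis.coord_apply, Module.Basis.repr_self, Finsupp.single_apply]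
      split_ifs
      · exact ⟨1, by simp⟩
      · exact ⟨0, by simp⟩
    | zero => exact ⟨0, by simp⟩
    | add x y _ _ hx hy =>
      obtain ⟨m, hm⟩ := hx
      obtain ⟨n, hn⟩ := hy
      exact ⟨m + n, by rw [map_add, hm, hn]; push_cast; rfl⟩
  rcases D.b.root_mem_or_neg_mem i with h | h
  · exact key _ h
  · obtain ⟨n, hn⟩ := key _ h
    refine ⟨-n, ?_⟩
    rw [map_neg] at hn
    rw [Int.cast_neg, ← hn, neg_neg]

lemma exists_fund (j : D.b.support) : ∃ w : D.Pv,
    haveI := D.isRootSystem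
    ∀ v, ⟪(w : V), v⟫ = D.b.toWeightBasis.coord j v := by
  have := D.finite
  have := D.isRootSystem
  have : Module.Finite ℝ V := Module.Finite.of_basis D.b.toWeightBasis
  have : CompleteSpace V := FiniteDimensional.complete ℝ V
  have h (v : V) : ⟪(InnerProductSpace.toDual ℝ V).symm
      (LinearMap.toContinuousLinearMap (D.b.toWeightBasis.coord j)), v⟫ =
      D.b.toWeightBasis.coord j v := by
    rw [InnerProductSpace.toDual_symm_apply]
    rfl
  refine ⟨⟨_, fun i => ?_⟩, h⟩
  obtain ⟨n, hn⟩ := D.exists_coord_int i j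
  exact ⟨n, by rw [h, hn]⟩

/-- The fundamental coweight dual to `α_j`. -/
noncomputable def fund (j : D.b.support) : D.Pv := (D.exists_fund j).choose

lemma inner_fund (j : D.b.support) (v : V) :
    haveI := D.isRootSystem
    ⟪(D.fund j : V), v⟫ = D.b.toWeightBasis.coord j v := (D.exists_fund j).choose_spec v

open Classical in
lemma inner_fund_root (j m : D.b.support) :
    ⟪(D.fund j : V), D.P.root m⟫ = if j = m then 1 else 0 := by
  have := D.isRootSystem
  rw [inner_fund, ← D.b.toWeightBasis_apply, Module.Basis.coord_apply, Module.Basis.repr_self,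
    Finsupp.single_apply]
  simp only [eq_comm]

lemma inner_eq_sum (l v : V) : ⟪l, v⟫ =
    ∑ j : D.b.support, ⟪(D.fund j : V), v⟫ * ⟪l, D.P.root j⟫ := by
  have := D.isRootSystem
  conv_lhs => rw [← D.b.toWeightBasis.sum_repr v, inner_sum]
  refine Finset.sum_congr rfl fun j _ => ?_
  rw [inner_smul_right, inner_fund, D.b.toWeightBasis_apply]
  rfl

lemma inner_fund_nonneg {v : V} (hv : v ∈ D.posG) (j : D.b.support) : 0 ≤ ⟪(D.fund j : V), v⟫ := by
  have h := D.affCoord_nonneg hv (some j)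
  rw [affCoord_some, mul_zero, add_zero] at h
  rwa [inner_fund]

lemma inner_nonneg_of_dominant {l : D.Pv} (hl : D.IsDominant l) {v : V} (hv : v ∈ D.posG) :
    0 ≤ ⟪(l : V), v⟫ := by
  rw [D.inner_eq_sum]
  exact Finset.sum_nonneg fun j _ => mul_nonneg (D.inner_fund_nonneg hv j) (hl j j.2)

lemma fund_dominant (j : D.b.support) : D.IsDominant (D.fund j) := fun i hi => by
  classical
  rw [D.inner_fund_root j ⟨i, hi⟩]
  split_ifs <;> norm_num

lemma IsDominant.add {l m : D.Pv} (hl : D.IsDominant l) (hm : D.IsDominant m) :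
    D.IsDominant (l + m) := fun i hi => by
  rw [AddSubgroup.coe_add, inner_add_left]
  exact add_nonneg (hl i hi) (hm i hi)

lemma sub_phi_nonneg (i : ι) (j : D.b.support) :
    0 ≤ ⟪(D.fund j : V), D.P.root D.φ - D.P.root i⟫ := by
  rw [inner_fund]
  exact D.coord_nonneg_of_mem_closure (D.isHighest i) j

/-- A root which is maximal in its orbit is dominant. -/
lemma inner_nonneg_of_maximal {i : ι} {j : D.b.support}
    (h : ⟪(D.fund j : V), D.refl j • D.P.root i⟫ ≤ ⟪(D.fund j : V), D.P.root i⟫) :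
    0 ≤ ⟪D.P.root i, D.P.root j⟫ := by
  classical
  have hne : 0 < ⟪D.P.root j, D.P.root j⟫ := real_inner_self_pos.2 (D.P.ne_zero _)
  rw [refl_smul, inner_sub_right, inner_smul_right, D.inner_fund_root, if_pos rfl, mul_one,
    D.coroot_eq, inner_smul_right] at h
  have h2 : 0 ≤ 2 / ⟪D.P.root j, D.P.root j⟫ * ⟪D.P.root i, D.P.root j⟫ := by linarith
  by_contra hn
  have := mul_neg_of_pos_of_neg (div_pos two_pos hne) (not_le.1 hn)
  linarith

lemma smul_root_eq (u : D.W0) (i : ι) : ∃ j, u • D.P.root i = D.P.root j :=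
  ⟨_, D.P.weylGroup_apply_root u i⟩

lemma inner_phi_simple_nonneg (j : D.b.support) : 0 ≤ ⟪D.P.root D.φ, D.P.root j⟫ := by
  refine D.inner_nonneg_of_maximal ?_
  obtain ⟨m, hm⟩ := D.smul_root_eq (D.refl j) D.φ
  have := D.sub_phi_nonneg m j
  rw [inner_sub_right] at this
  rw [hm]
  linarith

/-- The highest root is long. -/
lemma inner_phi_self : ⟪D.P.root D.φ, D.P.root D.φ⟫ = 2 := by
  classical
  have := D.finite
  refine le_antisymm (D.normSq_le_two _) ?_
  obtain ⟨i₀, h₀⟩ := D.exists_normSq_eq_two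
  -- a long root of maximal height is dominant, so its product with `φ` is at most `⟨φ,φ⟩` and at
  -- least its own squared length
  let S : Set ι := {i | ⟪D.P.root i, D.P.root i⟫ = 2}
  obtain ⟨i, hi, hmax⟩ := S.toFinite.exists_maximalFor
    (fun i => ∑ j : D.b.support, ⟪(D.fund j : V), D.P.root i⟫) S ⟨i₀, h₀⟩
  have hdom : ∀ j : D.b.support, 0 ≤ ⟪D.P.root i, D.P.root j⟫ := by
    intro j
    refine D.inner_nonneg_of_maximal ?_
    by_contra! hlt
    obtain ⟨m, hm⟩ := D.smul_root_eq (D.refl j) i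
    have hmS : m ∈ S := by
      change ⟪D.P.root m, D.P.root m⟫ = 2
      rw [← hm, D.inner_smul_smul]
      exact hi
    have hother (n : D.b.support) (hn : n ≠ j) :
        ⟪(D.fund n : V), D.P.root m⟫ = ⟪(D.fund n : V), D.P.root i⟫ := by
      rw [← hm, refl_smul, inner_sub_right, inner_smul_right, D.inner_fund_root, if_neg hn,
        mul_zero, sub_zero]
    have hlt' : ∑ n : D.b.support, ⟪(D.fund n : V), D.P.root i⟫ <
        ∑ n : D.b.support, ⟪(D.fund n : V), D.P.root m⟫ := by
      refine Finset.sum_lt_sum (fun n _ => ?_) ⟨j, Finset.mem_univ j, hm ▸ hlt⟩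
      by_cases hn : n = j
      · subst hn
        exact (hm ▸ hlt).le
      · exact (hother n hn).ge
    exact absurd (hmax hmS hlt'.le) (not_le.2 hlt')
  have hsum (v : V) (hv : ∀ j : D.b.support, 0 ≤ ⟪v, D.P.root j⟫) :
      0 ≤ ⟪v, D.P.root D.φ - D.P.root i⟫ := by
    rw [D.inner_eq_sum]
    exact Finset.sum_nonneg fun j _ => mul_nonneg (D.sub_phi_nonneg i j) (hv j)
  have h1 := hsum _ hdom
  have h2 := hsum _ D.inner_phi_simple_nonneg
  rw [inner_sub_right] at h1 h2
  have h3 : ⟪D.P.root i, D.P.root i⟫ = 2 := hi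
  rw [real_inner_comm] at h1
  linarith

/-- The highest root `φ = φ^∨` as an element of `P^∨`. -/
noncomputable def phi : D.Pv := D.corootPv D.φ

lemma coe_phi : (D.phi : V) = D.P.root D.φ := by
  change D.P.coroot D.φ = _
  rw [D.coroot_eq, inner_phi_self, div_self two_ne_zero, one_smul]

lemma phi_dominant : D.IsDominant D.phi := fun i hi => by
  rw [coe_phi]
  exact D.inner_phi_simple_nonneg ⟨i, hi⟩

lemma phi_mem_posG : D.P.root D.φ ∈ D.posG := by
  refine (D.root_mem_posG_or _).resolve_right fun hn => ?_
  have := D.inner_nonneg_of_dominant D.phi_dominant hn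
  rw [coe_phi, inner_neg_right, inner_phi_self] at this
  linarith

/-- The pairing of the highest root with a root `β ≠ ±φ` is `0`, `1` or `-1`. -/
lemma inner_phi_root (i : ι) : D.P.root i = D.P.root D.φ ∨ D.P.root i = -D.P.root D.φ ∨
    ⟪(D.phi : V), D.P.root i⟫ = 0 ∨ ⟪(D.phi : V), D.P.root i⟫ = 1 ∨
      ⟪(D.phi : V), D.P.root i⟫ = -1 := by
  obtain ⟨n, hn⟩ := D.phi.2 i
  have h1 := D.normSq_le_two i
  have h2 := D.inner_phi_self
  have key (v : V) (hv : ⟪v, v⟫ ≤ 2) (h : 2 ≤ ⟪D.P.root D.φ, v⟫) : v = D.P.root D.φ := by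
    rw [← sub_eq_zero, ← inner_self_eq_zero (𝕜 := ℝ)]
    refine le_antisymm ?_ real_inner_self_nonneg
    have hc := real_inner_comm v (D.P.root D.φ)
    rw [inner_sub_left, inner_sub_right, inner_sub_right, h2]
    linarith
  rw [coe_phi] at hn ⊢
  by_cases c1 : 2 ≤ n
  · left
    refine key _ h1 ?_
    rw [hn]
    exact_mod_cast c1
  by_cases c2 : n ≤ -2
  · right; left
    rw [← neg_eq_iff_eq_neg]
    refine key _ (by simpa using h1) ?_
    rw [inner_neg_right, hn]
    have : (n : ℝ) ≤ -2 := by exact_mod_cast c2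
    linarith
  right; right
  rw [hn]
  have : n = 0 ∨ n = 1 ∨ n = -1 := by omega
  rcases this with rfl | rfl | rfl <;> simp

end BqKZDatum

/-! ### The elements `Y^λ` and the Bernstein relations -/

namespace BqKZDatum

variable {ι V : Type*} [NormedAddCommGroup V] [InnerProductSpace ℝ V] (D : BqKZDatum ι V)

/-- The affine roots that `g` makes negative have a positive gradient after applying `g`; that is,
no hyperplane separating the alcove of `g` from the fundamental one separates it from
the dominant chamber at infinity. -/
def IsDeep (g : D.W) : Prop :=
  ∀ a ∈ D.posAffRoots, D.affAct g a ∉ D.posAffRoots → (D.affAct g a).1 ∈ D.posG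

lemma affAct_mem (g : D.W) {a : V × ℝ} (ha : a ∈ D.posAffRoots) : D.affAct g a ∈ D.affRoots :=
  D.affAct_mem_affRoots g (D.posAffRoots_subset ha)

lemma snd_neg_of_notMem {a : V × ℝ} (ha : a ∈ D.affRoots) (hn : a ∉ D.posAffRoots)
    (hp : a.1 ∈ D.posG) : a.2 < 0 := by
  rw [D.mem_pos_iff ha] at hn
  push Not at hn
  exact lt_of_le_of_ne hn.1 fun h => hn.2 h hp

lemma notMem_of_snd_neg {a : V × ℝ} (hn : a.2 < 0) : a ∉ D.posAffRoots := fun h => by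
  have := D.affCoord_nonneg h none
  rw [affCoord_none] at this
  linarith

lemma neg_mem_posG_of_notMem {v : V} (hv : ∃ i, v = D.P.root i) (hn : v ∉ D.posG) :
    -v ∈ D.posG := by
  obtain ⟨i, rfl⟩ := hv
  exact (D.root_mem_posG_or i).resolve_left hn

lemma snd_nonneg {a : V × ℝ} (ha : a ∈ D.posAffRoots) : 0 ≤ a.2 := D.affCoord_nonneg ha none

lemma snd_pos_of_notMem {a : V × ℝ} (ha : a ∈ D.posAffRoots) (hn : a.1 ∉ D.posG) : 0 < a.2 := by
  rcases (D.mem_pos_iff (D.posAffRoots_subset ha)).1 ha with h | h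
  · exact h
  · exact absurd h.2 hn

variable {D} in
lemma IsDeep.len_trans_mul {g : D.W} (hg : D.IsDeep g) {l : D.Pv} (hl : D.IsDominant l) :
    D.len (D.trans l * g) = D.len (D.trans l) + D.len g := by
  refine D.len_mul_of_forall fun a ha hn => D.notMem_of_snd_neg ?_
  have h1 := hg a ha hn
  have h2 := D.snd_neg_of_notMem (D.affAct_mem g ha) hn h1
  have h3 := D.inner_nonneg_of_dominant hl h1
  rw [← affAct_affAct, affAct_trans, real_inner_comm]
  simp only
  linarith

variable {D} in
lemma IsDeep.len_fin_mul {g : D.W} (hg : D.IsDeep g) (u : D.W0) :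
    D.len (D.fin u * g) = D.len (D.fin u) + D.len g := by
  refine D.len_mul_of_forall fun a ha hn => D.notMem_of_snd_neg ?_
  have h1 := hg a ha hn
  rw [← affAct_affAct, affAct_fin]
  exact D.snd_neg_of_notMem (a := D.affAct g a) (D.affAct_mem g ha) hn h1

variable {D} in
lemma IsDeep.trans_mul {g : D.W} (hg : D.IsDeep g) {l : D.Pv} (hl : D.IsDominant l) :
    D.IsDeep (D.trans l * g) := by
  intro a ha hn
  rw [← affAct_affAct, affAct_trans] at hn ⊢
  by_contra hp
  simp only at hp
  have h1 : D.affAct g a ∈ D.posAffRoots := by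
    by_contra h
    exact hp (hg a ha h)
  have h2 := D.snd_pos_of_notMem h1 hp
  have h3 := D.inner_nonneg_of_dominant hl
    (D.neg_mem_posG_of_notMem (D.exists_root_of_affRoots (D.affAct_mem g ha)) hp)
  rw [inner_neg_right, real_inner_comm] at h3
  refine hn ((D.mem_pos_iff ?_).2 (Or.inl ?_))
  · rw [← affAct_trans]
    exact D.affAct_mem _ h1
  · simp only
    linarith

lemma isDeep_one : D.IsDeep 1 := fun a ha hn => by
  rw [affAct_one] at hn
  exact absurd ha hn

lemma isDeep_trans {l : D.Pv} (hl : D.IsDominant l) : D.IsDeep (D.trans l) := by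
  have := D.isDeep_one.trans_mul hl
  rwa [mul_one] at this

/-- The sum of the fundamental coweights. -/
noncomputable def rho : D.Pv := ∑ j, D.fund j

lemma inner_rho (v : V) : ⟪(D.rho : V), v⟫ = ∑ j, ⟪(D.fund j : V), v⟫ := by
  rw [rho, AddSubgroup.val_finsetSum, sum_inner]

lemma inner_rho_simple (m : D.b.support) : ⟪(D.rho : V), D.P.root m⟫ = 1 := by
  classical
  rw [inner_rho]
  simp only [inner_fund_root, Finset.sum_ite_eq', Finset.mem_univ, if_true]

lemma one_le_inner_rho {i : ι} (hi : D.P.root i ∈ D.posG) : 1 ≤ ⟪(D.rho : V), D.P.root i⟫ := by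
  have := D.isRootSystem
  obtain ⟨n, hn⟩ := D.rho.2 i
  have h0 : 0 < ⟪(D.rho : V), D.P.root i⟫ := by
    rw [inner_rho]
    refine Finset.sum_pos' (fun j _ => D.inner_fund_nonneg hi j) ?_
    by_contra! h
    refine D.P.ne_zero i (D.b.toWeightBasis.ext_elem fun j => ?_)
    have h1 := le_antisymm (h j (Finset.mem_univ j)) (D.inner_fund_nonneg hi j)
    rw [inner_fund] at h1
    simpa using h1
  rw [hn] at h0 ⊢
  have : 0 < n := by exact_mod_cast h0
  exact_mod_cast this

lemma exists_nat_le_inner (l : D.Pv) : ∃ n : ℕ, ∀ i, |⟪D.P.root i, (l : V)⟫| ≤ n := by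
  have := D.finite
  obtain ⟨C, hC⟩ := (Set.finite_range fun i => |⟪D.P.root i, (l : V)⟫|).bddAbove
  obtain ⟨n, hn⟩ := exists_nat_ge C
  exact ⟨n, fun i => (hC ⟨i, rfl⟩).trans hn⟩

lemma rho_dominant : D.IsDominant D.rho := fun i hi => by
  rw [D.inner_rho_simple ⟨i, hi⟩]
  exact zero_le_one

variable {D} in
lemma IsDominant.nsmul {l : D.Pv} (hl : D.IsDominant l) (n : ℕ) : D.IsDominant (n • l) := by
  intro i hi
  rw [AddSubgroup.coe_nsmul, ← Nat.cast_smul_eq_nsmul ℝ, inner_smul_left]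
  exact mul_nonneg (by simp) (hl i hi)

/-- Sufficiently large multiples of the sum of the fundamental coweights will do for `λ`. -/
lemma exists_isDeep (g : D.W) : ∃ l, D.IsDominant l ∧ D.IsDeep (D.trans l * g) := by
  obtain ⟨n, hn⟩ := D.exists_nat_le_inner (D.tr g)
  refine ⟨(n + 1) • D.rho, D.rho_dominant.nsmul _, fun a ha hna => ?_⟩
  by_contra hp
  rw [← affAct_affAct, affAct_trans] at hna hp
  simp only at hp
  obtain ⟨i, hi⟩ := D.exists_root_of_affRoots (D.affAct_mem g ha)
  rw [hi] at hp
  have h1 : 1 ≤ ⟪(D.rho : V), -D.P.root i⟫ := by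
    have h := D.one_le_inner_rho (i := D.P.reflectionPerm i i)
    rw [RootPairing.root_reflectionPerm, RootPairing.reflection_apply_self] at h
    exact h ((D.root_mem_posG_or i).resolve_left hp)
  have h2 := D.snd_nonneg ha
  have h3 := (abs_le.1 (hn i)).2
  have hi' : g.right • a.1 = D.P.root i := hi
  refine hna ((D.mem_pos_iff ?_).2 (Or.inl ?_))
  · rw [← affAct_trans]
    exact D.affAct_mem_affRoots _ (D.affAct_mem _ ha)
  · simp only [hi]
    rw [AddSubgroup.coe_nsmul, ← Nat.cast_smul_eq_nsmul ℝ, inner_smul_right, real_inner_comm]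
    simp only [affAct, hi']
    rw [inner_neg_right] at h1
    have h4 : (0 : ℝ) ≤ n + 1 := by positivity
    have h5 := mul_le_mul_of_nonneg_left h1 h4
    push_cast
    nlinarith

lemma exists_dominant_sub (l : D.Pv) :
    ∃ m n : D.Pv, D.IsDominant m ∧ D.IsDominant n ∧ l = m - n := by
  obtain ⟨n, hn⟩ := D.exists_nat_le_inner l
  refine ⟨l + n • D.rho, n • D.rho, fun i hi => ?_, D.rho_dominant.nsmul n, by simp⟩
  have h1 := (abs_le.1 (hn i)).1
  rw [AddSubgroup.coe_add, AddSubgroup.coe_nsmul, ← Nat.cast_smul_eq_nsmul ℝ, inner_add_left,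
    inner_smul_left, D.inner_rho_simple ⟨i, hi⟩, real_inner_comm]
  simp
  linarith

lemma Tw_trans_add {l m : D.Pv} (hl : D.IsDominant l) (hm : D.IsDominant m) :
    D.Tw (D.trans (l + m)) = D.Tw (D.trans l) * D.Tw (D.trans m) := by
  rw [trans_add]
  exact D.Tw_mul ((D.isDeep_trans hm).len_trans_mul hl)

lemma commute_Tw_trans {l m : D.Pv} (hl : D.IsDominant l) (hm : D.IsDominant m) :
    Commute (D.Tw (D.trans l)) (D.Tw (D.trans m)) := by
  rw [Commute, SemiconjBy, ← D.Tw_trans_add hl hm, ← D.Tw_trans_add hm hl, add_comm]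

/-- `Y^λ` is independent of the presentation of `λ` as a difference of dominant coweights. -/
lemma Y_sub {m n : D.Pv} (hm : D.IsDominant m) (hn : D.IsDominant n) :
    D.Y (m - n) = D.Tw (D.trans m) * (D.Tw (D.trans n))⁻¹ := by
  have hs : D.IsDominant _ ∧ D.IsDominant _ ∧ m - n = _ :=
    Classical.epsilon_spec (p := fun p : D.Pv × D.Pv =>
      D.IsDominant p.1 ∧ D.IsDominant p.2 ∧ m - n = p.1 - p.2) ⟨(m, n), hm, hn, rfl⟩
  rw [Y]
  generalize (Classical.epsilon fun p : D.Pv × D.Pv =>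
      D.IsDominant p.1 ∧ D.IsDominant p.2 ∧ m - n = p.1 - p.2) = p at *
  obtain ⟨h1, h2, h3⟩ := hs
  have h4 : p.1 + n = m + p.2 := by
    rw [← sub_eq_zero] at h3 ⊢
    rw [← neg_eq_zero, ← h3]
    abel
  rw [eq_mul_inv_iff_mul_eq, mul_assoc, (D.commute_Tw_trans h2 hn).inv_left.eq, ← mul_assoc,
    mul_inv_eq_iff_eq_mul, ← D.Tw_trans_add h1 hn, ← D.Tw_trans_add hm h2, h4]

lemma dominant_zero : D.IsDominant 0 := fun i _ => by simp

lemma Y_zero : D.Y 0 = 1 := by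
  have := D.Y_sub D.dominant_zero D.dominant_zero
  rwa [sub_zero, mul_inv_cancel] at this

lemma trans_zero : D.trans 0 = 1 := by
  rw [trans, ofAdd_zero, map_one]

lemma Y_of_dominant {l : D.Pv} (hl : D.IsDominant l) : D.Y l = D.Tw (D.trans l) := by
  have := D.Y_sub hl D.dominant_zero
  rwa [sub_zero, trans_zero, Tw_one, inv_one, mul_one] at this

lemma Y_add (l m : D.Pv) : D.Y (l + m) = D.Y l * D.Y m := by
  obtain ⟨a, b, ha, hb, rfl⟩ := D.exists_dominant_sub l
  obtain ⟨c, d, hc, hd, rfl⟩ := D.exists_dominant_sub m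
  have h : a - b + (c - d) = a + c - (b + d) := by abel
  rw [h, D.Y_sub (ha.add D hc) (hb.add D hd), D.Y_sub ha hb, D.Y_sub hc hd,
    D.Tw_trans_add ha hc, add_comm b d, D.Tw_trans_add hd hb, mul_inv_rev]
  have := ((D.commute_Tw_trans hc hb).inv_right).eq
  simp only [mul_assoc]
  rw [← mul_assoc (D.Tw (D.trans c)), this, mul_assoc]

lemma Y_neg (l : D.Pv) : D.Y (-l) = (D.Y l)⁻¹ := by
  rw [eq_inv_iff_mul_eq_one, ← Y_add, neg_add_cancel, Y_zero]

lemma Y_comm (l m : D.Pv) : D.Y l * D.Y m = D.Y m * D.Y l := by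
  rw [← Y_add, add_comm, Y_add]

lemma Tw_fin_mul_Y (u : D.W0) {l : D.Pv} (hl : D.IsDominant l) :
    D.Tw (D.fin u) * D.Y l = D.Tw (D.fin u * D.trans l) := by
  rw [D.Y_of_dominant hl, D.Tw_mul ((D.isDeep_trans hl).len_fin_mul u)]

lemma refl_smul_of_inner_eq_zero {l : D.Pv} {i : ι} (h : ⟪(l : V), D.P.root i⟫ = 0) :
    D.refl i • l = l := by
  apply Subtype.ext
  rw [coe_smul_Pv, refl_smul, D.coroot_eq, inner_smul_right, h, mul_zero, zero_smul, sub_zero]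

/-- The Bernstein relation for `⟨λ, α_i⟩ = 0`. -/
lemma TUnit_mul_Y_of_eq_zero {l : D.Pv} {i : D.b.support} (h : ⟪(l : V), D.P.root i⟫ = 0) :
    D.TUnit (some i) * D.Y l = D.Y l * D.TUnit (some i) := by
  classical
  have key {l : D.Pv} (hl : D.IsDominant l) (h : ⟪(l : V), D.P.root i⟫ = 0) :
      Commute (D.TUnit (some i)) (D.Y l) := by
    have h1 := D.Tw_fin_mul_Y (D.refl i) hl
    rw [fin_mul_trans, D.refl_smul_of_inner_eq_zero h, ← s_some, D.Tw_s, D.Tw_mul_s] at h1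
    · rw [D.Y_of_dominant hl] at h1 ⊢
      exact h1
    · refine D.len_mul_s_of_pos ?_
      have h2 : ⟪D.P.root i, (l : V)⟫ = 0 := by rw [real_inner_comm, h]
      have h3 : D.affAct (D.trans l) (D.affSimple (some i)) = D.affSimple (some i) := by
        rw [affAct_trans]
        refine Prod.ext rfl ?_
        change _ - ⟪D.P.root i, (l : V)⟫ = _
        rw [h2, sub_zero]
      rw [h3]
      exact D.affSimple_mem_pos _
  obtain ⟨n, hn⟩ := D.exists_nat_le_inner l
  -- `N` is dominant and orthogonal to `α_i`, and large enough for `l + N` to be dominant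
  set N : D.Pv := n • (∑ j ∈ Finset.univ.erase i, D.fund j) with hN
  have hNi (m : D.b.support) : ⟪(N : V), D.P.root m⟫ = if m = i then 0 else (n : ℝ) := by
    rw [hN, AddSubgroup.coe_nsmul, ← Nat.cast_smul_eq_nsmul ℝ, inner_smul_left,
      AddSubgroup.val_finsetSum, sum_inner]
    simp only [inner_fund_root, Finset.sum_ite_eq', Finset.mem_erase, Finset.mem_univ, and_true,
      conj_trivial]
    split_ifs <;> simp_all
  have hNd : D.IsDominant N := fun m hm => by
    rw [hNi ⟨m, hm⟩]
    split_ifs <;> simp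
  have h1 := key (l := l + N) (fun m hm => by
    rw [AddSubgroup.coe_add, inner_add_left, hNi ⟨m, hm⟩]
    split_ifs with hmi
    · rw [← hmi] at h
      rw [h, add_zero]
    · have := (abs_le.1 (hn m)).1
      rw [real_inner_comm] at this
      linarith) (by
    rw [AddSubgroup.coe_add, inner_add_left, hNi i, if_pos rfl, h, add_zero])
  have h2 := key hNd (by rw [hNi i, if_pos rfl])
  have h3 : D.Y l = D.Y (l + N) * (D.Y N)⁻¹ := by rw [Y_add, mul_inv_cancel_right]
  rw [h3]
  exact h1.mul_right h2.inv_right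

lemma inner_coroot_simple_nonpos (i j : D.b.support) (hij : i ≠ j) :
    ⟪D.P.coroot i, D.P.root j⟫ ≤ 0 := by
  have h := D.affForm_affSimple_nonpos (i := some j) (j := some i) (by simp [hij.symm])
  rw [affForm_apply, real_inner_comm] at h
  exact h

lemma inner_coroot_self (i : ι) : ⟪D.P.coroot i, D.P.root i⟫ = 2 := by
  rw [real_inner_comm, ← D.pairing_eq_inner]
  exact D.P.root_coroot_two i

lemma refl_smul_Pv (i : ι) (l : D.Pv) :
    ((D.refl i • l : D.Pv) : V) = (l : V) - ⟪(l : V), D.P.root i⟫ • D.P.coroot i := by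
  rw [coe_smul_Pv, refl_smul, D.coroot_eq, inner_smul_right, smul_smul]
  congr 2
  ring

lemma refl_smul_mem_posG {i : D.b.support} {v : V} (hv : v ∈ D.posG) (hne : v ≠ D.P.root i) :
    D.refl i • v ∈ D.posG := by
  have h1 : (v, (0 : ℝ)) ≠ D.affSimple (some i) := fun h => hne (congrArg Prod.fst h)
  have := D.affAct_s_mem_pos hv h1
  rwa [s_some, affAct_fin] at this

/-- The Bernstein relation for `⟨λ, α_i⟩ = 1`. -/
lemma TUnit_inv_mul_Y_of_eq_one {l : D.Pv} {i : D.b.support} (h : ⟪(l : V), D.P.root i⟫ = 1) :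
    (D.TUnit (some i))⁻¹ * D.Y l = D.Y (D.refl i • l) * D.TUnit (some i) := by
  classical
  -- the case of the fundamental coweight: `t(w) s_i · t(w) = t(w + s_i w) s_i` is reduced
  have key : (D.TUnit (some i))⁻¹ * D.Y (D.fund i) =
      D.Y (D.refl i • D.fund i) * D.TUnit (some i) := by
    set w := D.fund i with hw
    have hwd : D.IsDominant w := D.fund_dominant i
    have hwi : ⟪(w : V), D.P.root i⟫ = 1 := by rw [hw, D.inner_fund_root, if_pos rfl]
    have hwi' : ⟪D.P.root i, (w : V)⟫ = 1 := by rw [real_inner_comm, hwi]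
    have hpd : D.IsDominant (w + D.refl i • w) := by
      intro j hj
      rw [AddSubgroup.coe_add, refl_smul_Pv, hwi, one_smul, inner_add_left, inner_sub_left]
      by_cases hij : (⟨j, hj⟩ : D.b.support) = i
      · subst hij
        rw [D.inner_coroot_self, hwi]
        norm_num
      · have h1 := hwd j hj
        have h2 := D.inner_coroot_simple_nonpos i ⟨j, hj⟩ (Ne.symm hij)
        linarith
    have hp0 : ⟪((w + D.refl i • w : D.Pv) : V), D.P.root i⟫ = 0 := by
      rw [AddSubgroup.coe_add, refl_smul_Pv, hwi, one_smul, inner_add_left, inner_sub_left,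
        D.inner_coroot_self, hwi]
      norm_num
    have e1 : D.trans w * D.s (some i) * D.trans w =
        D.trans (w + D.refl i • w) * D.s (some i) := by
      rw [s_some, mul_assoc, fin_mul_trans, ← mul_assoc, trans_add]
    have hneg : D.affAct (D.trans w) (D.affSimple (some i)) ∉ D.posAffRoots := by
      rw [affAct_trans]
      refine D.notMem_of_snd_neg ?_
      change ((0 : ℤ) : ℝ) - ⟪D.P.root i, (w : V)⟫ < 0
      rw [hwi']
      norm_num
    have hl1 := D.len_mul_s_of_neg hneg
    have l1 : D.Tw (D.trans w) = D.Tw (D.trans w * D.s (some i)) * D.TUnit (some i) := by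
      have h2 : D.trans w * D.s (some i) * D.s (some i) = D.trans w := by
        rw [mul_assoc, s_mul_s, mul_one]
      have := D.Tw_mul_s (g := D.trans w * D.s (some i)) (i := some i) (by rw [h2]; omega)
      rwa [h2] at this
    have l2 : D.Tw (D.trans (w + D.refl i • w) * D.s (some i)) =
        D.Tw (D.trans (w + D.refl i • w)) * D.TUnit (some i) := by
      refine D.Tw_mul_s (D.len_mul_s_of_pos ?_)
      have h2 : ⟪D.P.root i, ((w + D.refl i • w : D.Pv) : V)⟫ = 0 := by rw [real_inner_comm, hp0]
      have h3 : D.affAct (D.trans (w + D.refl i • w)) (D.affSimple (some i)) =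
          D.affSimple (some i) := by
        rw [affAct_trans]
        refine Prod.ext rfl ?_
        change _ - ⟪D.P.root i, ((w + D.refl i • w : D.Pv) : V)⟫ = _
        rw [h2, sub_zero]
      rw [h3]
      exact D.affSimple_mem_pos _
    have l3 : D.Tw (D.trans w * D.s (some i) * D.trans w) =
        D.Tw (D.trans w * D.s (some i)) * D.Tw (D.trans w) := by
      refine D.Tw_mul (D.len_mul_of_forall fun a ha hn => ?_)
      have h1 := D.isDeep_trans hwd a ha hn
      have h2 := D.snd_neg_of_notMem (D.affAct_mem _ ha) hn h1
      rw [← affAct_affAct, ← affAct_affAct]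
      rw [affAct_trans] at h1 h2 ⊢
      rw [s_some, affAct_fin, affAct_trans]
      simp only at h1 h2 ⊢
      by_cases he : a.1 = D.P.root i
      · -- `a = α_i`, and `t(w) s_i t(w)` maps `α_i` to `-α_i`
        have h3 : D.refl i • D.P.root i = -D.P.root i := D.P.reflection_apply_self i
        have h4 : a.2 = 0 := by
          have h5 := D.snd_nonneg ha
          obtain ⟨m, r, rfl⟩ := D.posAffRoots_subset ha
          simp only at he h2 h5 ⊢
          rw [he, hwi'] at h2
          have h6 : r < 1 := by
            have : (r : ℝ) < 1 := by linarith
            exact_mod_cast this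
          have h7 : 0 ≤ r := by exact_mod_cast h5
          have : r = 0 := by omega
          exact_mod_cast this
        have h5 : -D.affSimple (some i) ∉ D.posAffRoots := by
          rw [D.neg_pos_iff (D.posAffRoots_subset (D.affSimple_mem_pos _)), not_not]
          exact D.affSimple_mem_pos _
        have h6 : ((D.refl i • a.1, a.2 - ⟪a.1, (w : V)⟫ - ⟪D.refl i • a.1, (w : V)⟫) : V × ℝ) =
            -D.affSimple (some i) := by
          refine Prod.ext ?_ ?_
          · simp only [he, h3]
            rfl
          · simp only [he, h3, inner_neg_left, hwi', h4]
            change _ = -((0 : ℤ) : ℝ)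
            norm_num
        rw [h6]
        exact h5
      · refine D.notMem_of_snd_neg ?_
        have h3 := D.inner_nonneg_of_dominant hwd (D.refl_smul_mem_posG h1 he)
        rw [real_inner_comm] at h3
        simp only
        linarith
    rw [D.Y_of_dominant hwd]
    have l4 := l3
    rw [e1, l2, ← D.Y_of_dominant hpd, Y_add, mul_assoc] at l4
    have l5 : D.Tw (D.trans w * D.s (some i)) = D.Y w * (D.TUnit (some i))⁻¹ := by
      rw [D.Y_of_dominant hwd, l1, mul_inv_cancel_right]
    rw [l5, mul_assoc] at l4
    exact (mul_left_cancel l4).symm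
  have h0 : ⟪((l - D.fund i : D.Pv) : V), D.P.root i⟫ = 0 := by
    rw [AddSubgroup.coe_sub, inner_sub_left, h, D.inner_fund_root, if_pos rfl, sub_self]
  have h1 := D.TUnit_mul_Y_of_eq_zero h0
  have h2 : l = D.fund i + (l - D.fund i) := by abel
  rw [h2, smul_add, Y_add, Y_add, ← mul_assoc, key, D.refl_smul_of_inner_eq_zero h0, mul_assoc, h1,
    mul_assoc]

end BqKZDatum

/-! ### The elements `T_0` and `ω` in terms of `Y^λ` and `H₀` -/

namespace BqKZDatum

variable {ι V : Type*} [NormedAddCommGroup V] [InnerProductSpace ℝ V] (D : BqKZDatum ι V)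

lemma refl_neg_phi : D.refl (D.P.reflectionPerm D.φ D.φ) = D.refl D.φ := by
  refine SemidirectProduct.inr_injective (φ := D.latticeAction) (D.eq_of_affAct_eq fun a => ?_)
  change D.affAct (D.fin _) a = D.affAct (D.fin _) a
  rw [affAct_fin, affAct_fin, refl_smul, refl_smul]
  simp

lemma s_none : D.s none = D.trans D.phi * D.fin (D.refl D.φ) := by
  refine SemidirectProduct.ext ?_ ?_
  · change -((1 : ℤ) • D.corootPv (D.P.reflectionPerm D.φ D.φ)) = D.phi + (1 : D.W0) • 0
    rw [one_smul, smul_zero, add_zero]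
    refine Subtype.ext ?_
    change -D.P.coroot (D.P.reflectionPerm D.φ D.φ) = D.P.coroot D.φ
    simp
  · change D.refl (D.P.reflectionPerm D.φ D.φ) = 1 * D.refl D.φ
    rw [refl_neg_phi, one_mul]

lemma trans_phi : D.trans D.phi = D.s none * D.fin (D.refl D.φ) := by
  rw [s_none, mul_assoc, ← fin_mul, refl_mul_self, fin_one, mul_one]

lemma refl_phi_smul (v : V) : D.refl D.φ • v = v - ⟪(D.phi : V), v⟫ • D.P.root D.φ := by
  rw [refl_smul, real_inner_comm]
  rfl

/-- `Y^φ = T_0 T_{s_φ}`. -/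
lemma Y_phi : D.Y D.phi = D.TUnit none * D.Tw (D.fin (D.refl D.φ)) := by
  rw [D.Y_of_dominant D.phi_dominant, trans_phi, ← D.Tw_s]
  refine D.Tw_mul (D.len_mul_of_forall fun a ha hn => ?_)
  rw [← trans_phi, affAct_trans]
  refine D.notMem_of_snd_neg ?_
  rw [affAct_fin] at hn
  have ha' := D.affAct_mem (D.fin (D.refl D.φ)) ha
  rw [affAct_fin] at ha'
  rw [D.mem_pos_iff ha'] at hn
  push Not at hn
  have h0 : a.2 = 0 := le_antisymm hn.1 (D.snd_nonneg ha)
  have h1 := hn.2 h0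
  have h2 : a.1 ∈ D.posG := by
    rcases (D.mem_pos_iff (D.posAffRoots_subset ha)).1 ha with h | h
    · linarith
    · exact h.2
  have h3 := D.inner_nonneg_of_dominant D.phi_dominant h2
  have h4 : ⟪(D.phi : V), a.1⟫ ≠ 0 := fun h => by
    simp only [refl_phi_smul, h, zero_smul, sub_zero] at h1
    exact h1 h2
  have h5 := lt_of_le_of_ne h3 (Ne.symm h4)
  rw [real_inner_comm] at h5
  simp only [h0]
  linarith

lemma eq_trans_mul_fin (g : D.W) : g = D.trans (D.tr g) * D.fin g.right :=
  (SemidirectProduct.inl_left_mul_inr_right g).symm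

open Classical in
/-- The indicator function of the negative roots. -/
noncomputable def negG (v : V) : ℝ := if v ∈ D.posG then 0 else 1

lemma negG_of_mem {v : V} (h : v ∈ D.posG) : D.negG v = 0 := if_pos h

lemma negG_of_notMem {v : V} (h : v ∉ D.posG) : D.negG v = 1 := if_neg h

/-- An element `t(λ)u` of length zero is determined by its linear part, as
`⟨λ,β⟩ = [u⁻¹β < 0] - [β < 0]` for all roots `β`. -/
lemma inner_tr_of_len_eq_zero {g : D.W} (hg : D.len g = 0) (i : ι) :
    ⟪(D.tr g : V), D.P.root i⟫ = D.negG (g.right⁻¹ • D.P.root i) - D.negG (D.P.root i) := by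
  obtain ⟨n, hn⟩ := (D.tr g).2 i
  obtain ⟨j, hj⟩ := D.smul_root_eq g.right⁻¹ i
  have hj' : g.right • D.P.root j = D.P.root i := by rw [← hj, smul_inv_smul]
  have key (r : ℤ) : (D.P.root j, (r : ℝ)) ∈ D.posAffRoots ↔
      (D.P.root i, ((r - n : ℤ) : ℝ)) ∈ D.posAffRoots := by
    have h1 : D.affAct g (D.P.root j, (r : ℝ)) = (D.P.root i, ((r - n : ℤ) : ℝ)) := by
      refine Prod.ext hj' ?_
      simp only [affAct, hj']
      rw [real_inner_comm, hn]
      push_cast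
      rfl
    rw [← h1]
    refine ⟨D.affAct_pos_of_len_eq_zero hg, fun h => ?_⟩
    have := D.affAct_pos_of_len_eq_zero ((D.len_inv g).trans hg) h
    rwa [affAct_inv_affAct] at this
  simp only [D.mem_pos_iff ⟨j, _, rfl⟩, D.mem_pos_iff ⟨i, _, rfl⟩, Int.cast_pos,
    Int.cast_eq_zero] at key
  rw [hj, hn]
  have h0 := key 0
  have h1 := key 1
  have h2 := key n
  have h3 := key (n + 1)
  by_cases hp : D.P.root i ∈ D.posG <;> by_cases hq : D.P.root j ∈ D.posG <;>
  · first | rw [D.negG_of_mem hp] | rw [D.negG_of_notMem hp]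
    first | rw [D.negG_of_mem hq] | rw [D.negG_of_notMem hq]
    simp only [hp, hq, and_true, and_false, or_false, or_true, lt_irrefl, true_iff, sub_self,
      false_iff, iff_false, zero_lt_one, one_ne_zero, iff_true] at h0 h1 h2 h3
    first
    | (have : n = 0 := by omega
       rw [this]; norm_num)
    | (have : n = 1 := by omega
       rw [this]; norm_num)
    | (have : n = -1 := by omega
       rw [this]; norm_num)

lemma tr_dominant_of_len_eq_zero {g : D.W} (hg : D.len g = 0) : D.IsDominant (D.tr g) := by
  intro i hi
  rw [D.inner_tr_of_len_eq_zero hg, D.negG_of_mem (D.simple_mem_posG ⟨i, hi⟩), negG]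
  split_ifs <;> norm_num

/-- `Y^λ = ω T_{u⁻¹}` if `ω = t(λ)u` has length zero. -/
lemma Y_tr_of_len_eq_zero {g : D.W} (hg : D.len g = 0) :
    D.Y (D.tr g) = D.wUnit g * D.Tw (D.fin g.right⁻¹) := by
  rw [D.Y_of_dominant (D.tr_dominant_of_len_eq_zero hg), ← D.Tw_len_zero_mul hg]
  congr 1
  conv_rhs =>
    congr
    · rw [D.eq_trans_mul_fin g]
  rw [mul_assoc, ← fin_mul, mul_inv_cancel, fin_one, mul_one]

/-! ### The elements `Ψ(g) = Y^{-λ} T_{t(λ)g}` for `λ` deep in the dominant chamber -/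

/-- The limit of `Y^{-λ} T_{t(λ)g}` as `λ` goes to infinity in the dominant chamber. -/
noncomputable def Psi (g : D.W) : D.Aˣ :=
  (D.Y (D.exists_isDeep g).choose)⁻¹ * D.Tw (D.trans (D.exists_isDeep g).choose * g)

lemma Psi_eq {l : D.Pv} {g : D.W} (hl : D.IsDominant l) (hg : D.IsDeep (D.trans l * g)) :
    D.Psi g = (D.Y l)⁻¹ * D.Tw (D.trans l * g) := by
  obtain ⟨h1, h2⟩ := (D.exists_isDeep g).choose_spec
  rw [Psi]
  generalize (D.exists_isDeep g).choose = m at *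
  rw [inv_mul_eq_iff_eq_mul, ← mul_assoc, ← Y_neg, Y_comm, Y_neg, mul_assoc,
    eq_inv_mul_iff_mul_eq,
    D.Y_of_dominant hl, D.Y_of_dominant h1, ← D.Tw_mul (h2.len_trans_mul hl),
    ← D.Tw_mul (hg.len_trans_mul h1), ← mul_assoc, ← mul_assoc, ← trans_add, ← trans_add, add_comm]

lemma Psi_one : D.Psi 1 = 1 := by
  have h : D.IsDeep (D.trans 0 * 1) := by
    rw [trans_zero, one_mul]
    exact D.isDeep_one
  rw [D.Psi_eq D.dominant_zero h, Y_zero, trans_zero, mul_one, Tw_one, inv_one, one_mul]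

lemma Psi_trans_mul (m : D.Pv) (g : D.W) : D.Psi (D.trans m * g) = D.Y m * D.Psi g := by
  obtain ⟨a, b, ha, hb, rfl⟩ := D.exists_dominant_sub m
  obtain ⟨n, hn, hng⟩ := D.exists_isDeep g
  have h1 : D.trans (b + n) * (D.trans (a - b) * g) = D.trans a * (D.trans n * g) := by
    rw [← mul_assoc, ← mul_assoc, ← trans_add, ← trans_add]
    congr 2
    abel
  have h2 := hng.trans_mul ha
  rw [D.Psi_eq (hb.add D hn) (by rwa [h1]), h1, D.Psi_eq hn hng,
    D.Tw_mul (hng.len_trans_mul ha), ← D.Y_of_dominant ha, ← mul_assoc, ← mul_assoc, ← Y_neg,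
    ← Y_neg, ← Y_add, ← Y_add]
  congr 2
  abel

lemma Psi_trans (m : D.Pv) : D.Psi (D.trans m) = D.Y m := by
  rw [← mul_one (D.trans m), Psi_trans_mul, Psi_one, mul_one]

lemma exists_isDeep_pair (g h : D.W) :
    ∃ l, D.IsDominant l ∧ D.IsDeep (D.trans l * g) ∧ D.IsDeep (D.trans l * h) := by
  obtain ⟨a, ha, hag⟩ := D.exists_isDeep g
  obtain ⟨b, hb, hbh⟩ := D.exists_isDeep h
  refine ⟨a + b, ha.add D hb, ?_, ?_⟩
  · rw [add_comm, trans_add, mul_assoc]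
    exact hag.trans_mul hb
  · rw [trans_add, mul_assoc]
    exact hbh.trans_mul ha

lemma affAct_mul_s (g : D.W) (i : D.I) :
    D.affAct (g * D.s i) (D.affSimple i) = -D.affAct g (D.affSimple i) := by
  rw [← affAct_affAct, affAct_s_self, affAct_neg]

lemma affAct_trans_mul_fst (l : D.Pv) (g : D.W) (a : V × ℝ) :
    (D.affAct (D.trans l * g) a).1 = (D.affAct g a).1 := by
  rw [← affAct_affAct, affAct_trans]

/-- Unlike in `T_{g s_i}`, the exponent of `T_i` in `Ψ(g s_i)` is governed by the sign of the
gradient of `g(a_i)`. -/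
lemma Psi_mul_s_of_notMem {g : D.W} {i : D.I} (h : (D.affAct g (D.affSimple i)).1 ∉ D.posG) :
    D.Psi (g * D.s i) = D.Psi g * D.TUnit i := by
  obtain ⟨l, hl, hlg, hlh⟩ := D.exists_isDeep_pair g (g * D.s i)
  rw [D.Psi_eq hl hlg, D.Psi_eq hl hlh, ← mul_assoc, D.Tw_mul_s, mul_assoc]
  refine D.len_mul_s_of_pos ?_
  by_contra hn
  have := hlg _ (D.affSimple_mem_pos i) hn
  rw [affAct_trans_mul_fst] at this
  exact h this

lemma Psi_mul_s_of_mem {g : D.W} {i : D.I} (h : (D.affAct g (D.affSimple i)).1 ∈ D.posG) :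
    D.Psi (g * D.s i) = D.Psi g * (D.TUnit i)⁻¹ := by
  rw [eq_mul_inv_iff_mul_eq, ← D.Psi_mul_s_of_notMem, mul_assoc, s_mul_s, mul_one]
  rw [affAct_mul_s]
  intro h1
  obtain ⟨j, hj⟩ := D.exists_root_of_affRoots (D.affAct_affSimple_mem g i)
  rw [Prod.fst_neg, hj, D.neg_mem_posG_iff] at h1
  rw [hj] at h
  exact h1 h

lemma Psi_mul_len_zero (g : D.W) {w : D.W} (hw : D.len w = 0) :
    D.Psi (g * w) = D.Psi g * D.wUnit w := by
  obtain ⟨l, hl, hlg⟩ := D.exists_isDeep g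
  have h : D.IsDeep (D.trans l * (g * w)) := fun a ha hn => by
    rw [← mul_assoc, ← affAct_affAct] at hn ⊢
    exact hlg _ (D.affAct_pos_of_len_eq_zero hw ha) hn
  rw [D.Psi_eq hl hlg, D.Psi_eq hl h, ← mul_assoc, D.Tw_mul_len_zero hw, mul_assoc]

lemma Psi_fin (u : D.W0) : D.Psi (D.fin u) = (D.Tw (D.fin u⁻¹))⁻¹ := by
  induction u using D.W0_induction with
  | one => rw [inv_one, fin_one, Psi_one, Tw_one, inv_one]
  | step u i ih hl =>
    have h1 := D.pos_of_len_mul_s hl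
    have h2 : (D.affAct (D.fin u) (D.affSimple (some i))).1 ∈ D.posG := by
      rw [affAct_fin] at h1 ⊢
      have : (D.affSimple (some i)).2 = 0 := Int.cast_zero
      rw [this] at h1
      exact h1
    rw [fin_mul, ← s_some, D.Psi_mul_s_of_mem h2, ih, mul_inv_rev, refl_inv, fin_mul, ← s_some,
      D.Tw_mul, mul_inv_rev, D.Tw_s]
    have h3 : D.s (some i) * D.fin u⁻¹ = (D.fin u * D.s (some i))⁻¹ := by
      rw [mul_inv_rev, s_inv, fin_inv]
    rw [h3, len_inv, hl, fin_inv, len_inv, len_s, add_comm]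

end BqKZDatum

/-! ### Conjugation of `Y^λ` by monomials in `X` -/

namespace BqKZDatum

variable {ι V : Type*} [NormedAddCommGroup V] [InnerProductSpace ℝ V] (D : BqKZDatum ι V)

lemma smul_smul_CT (g : D.W) (z : ℂ) (f : D.CT) : g • (z • f) = z • (g • f) :=
  map_smul (D.regAct g) z f

lemma smul_mono (g : D.W) (l : D.Pv) : g • D.mono l =
    ((D.qpow (Multiplicative.ofAdd (-⟪g.right • (l : V), (D.tr g : V)⟫)) : ℂˣ) : ℂ) •
      D.mono (g.right • l) := by
  rw [smul_CT_def, mono, regAct_single, mono, AddMonoidAlgebra.smul_single, one_mul, smul_eq_mul,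
    mul_one]

lemma qpow_coe (x : ℝ) : ((D.qpow (Multiplicative.ofAdd x) : ℂˣ) : ℂ) = ((D.q ^ x : ℝ) : ℂ) := rfl

lemma affRefl_smul_mono_of_eq_zero {a : ι × ℤ} {l : D.Pv} (h : ⟪(l : V), D.P.root a.1⟫ = 0) :
    D.affRefl a • D.mono l = D.mono l := by
  have h1 : (D.affRefl a).right • l = l := D.refl_smul_of_inner_eq_zero h
  have htr : (D.tr (D.affRefl a) : V) = -(a.2 • D.P.coroot a.1) := rfl
  have h2 : (D.affRefl a).right • (l : V) = l := congrArg Subtype.val h1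
  rw [smul_mono, h1, h2, htr, D.coroot_eq, ← Int.cast_smul_eq_zsmul ℝ, inner_neg_right,
    inner_smul_right, inner_smul_right, h]
  simp

lemma affRefl_smul_mono_of_eq_one {a : ι × ℤ} {l : D.Pv} (h : ⟪(l : V), D.P.root a.1⟫ = 1) :
    D.affRefl a • D.mono l * D.monoCo a 1 = D.mono l := by
  have hne : ⟪D.P.root a.1, D.P.root a.1⟫ ≠ 0 := by
    rw [Ne, inner_self_eq_zero]
    exact D.P.ne_zero a.1
  have h1 : (((D.affRefl a).right • l : D.Pv) : V) = (l : V) - D.P.coroot a.1 := by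
    change ((D.refl a.1 • l : D.Pv) : V) = _
    rw [refl_smul_Pv, h, one_smul]
  have htr : (D.tr (D.affRefl a) : V) = -(a.2 • D.P.coroot a.1) := rfl
  have hco : (D.affRefl a).right • l + D.corootPv a.1 = l := by
    refine Subtype.ext ?_
    rw [AddSubgroup.coe_add, h1]
    exact sub_add_cancel _ _
  rw [smul_mono, mono, AddMonoidAlgebra.smul_single, monoCo, AddMonoidAlgebra.single_mul_single,
    one_smul, hco, qpow_coe, ← coe_smul_Pv, h1, htr, mono]
  congr 1
  rw [smul_eq_mul, mul_one, ← Complex.ofReal_mul, ← Real.rpow_add D.q_pos]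
  have h3 : -⟪(l : V) - D.P.coroot a.1, -(a.2 • D.P.coroot a.1)⟫ +
      ((1 : ℤ) : ℝ) * (2 * a.2 / ⟪D.P.root a.1, D.P.root a.1⟫) = 0 := by
    rw [← Int.cast_smul_eq_zsmul ℝ, inner_neg_right, inner_smul_right, D.coroot_eq, inner_sub_left,
      inner_smul_right, inner_smul_right, inner_smul_left, h, RCLike.conj_to_real]
    field_simp
    push_cast
    ring
  rw [h3, Real.rpow_zero, Complex.ofReal_one]

lemma inner_inv_smul (g : D.W0) (l : D.Pv) (v : V) :
    ⟪((g⁻¹ • l : D.Pv) : V), v⟫ = ⟪(l : V), g • v⟫ := by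
  rw [coe_smul_Pv, ← D.inner_smul_smul g, smul_inv_smul]

lemma s_smul_inv_smul_mono_of_eq_zero {g : D.W} {i : D.I} {l : D.Pv}
    (h : ⟪(l : V), (D.affAct g (D.affSimple i)).1⟫ = 0) :
    D.s i • g⁻¹ • D.mono l = g⁻¹ • D.mono l := by
  rw [smul_mono, smul_smul_CT, s, affRefl_smul_mono_of_eq_zero]
  rw [SemidirectProduct.inv_right, inner_inv_smul]
  exact h

lemma s_smul_inv_smul_mono_of_eq_one {g : D.W} {i : D.I} {l : D.Pv}
    (h : ⟪(l : V), (D.affAct g (D.affSimple i)).1⟫ = 1) :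
    D.s i • (g⁻¹ • D.mono l) * D.monoCo (D.simpleAff i) 1 = g⁻¹ • D.mono l := by
  rw [smul_mono, smul_smul_CT, s, smul_mul_assoc, affRefl_smul_mono_of_eq_one]
  rw [SemidirectProduct.inv_right, inner_inv_smul]
  exact h

/-- The difference `κ_i = k_i - k_i⁻¹ = T_i - T_i⁻¹`. -/
noncomputable def kappa (i : D.I) : ℂ := (D.ki i : ℂ) - ((D.ki i)⁻¹ : ℂˣ)

lemma TUnit_inv (i : D.I) :
    (((D.TUnit i)⁻¹ : D.Aˣ) : D.A) = D.TUnit i - algebraMap ℂ D.A (D.kappa i) := by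
  change D.Top i - _ + _ = D.Top i - _
  rw [kappa, map_sub]
  abel

lemma algebraMap_eq_mulOp (z : ℂ) : algebraMap ℂ D.A z = D.mulOp (algebraMap ℂ D.RatT z) := rfl

/-- `T_i f(X) = (s_i f)(X) T_i + κ_i (f - s_i f)/(1 - x_i)`. -/
lemma Top_mul_mulOp (i : D.I) (f : D.RatT) : D.Top i * D.mulOp f =
    D.mulOp (D.s i • f) * D.Top i +
      D.mulOp (algebraMap ℂ D.RatT (D.kappa i) * (f - D.s i • f) / (1 - D.xr i)) := by
  rw [Top_eq, kappa, map_sub (algebraMap ℂ D.RatT)]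
  generalize algebraMap ℂ D.RatT (D.ki i) = x
  generalize algebraMap ℂ D.RatT ((D.ki i)⁻¹ : ℂˣ) = y
  have h : (x - y) * (f - D.s i • f) / (1 - D.xr i) =
      (x - y) / (1 - D.xr i) * f - D.s i • f * ((x - y) / (1 - D.xr i)) := by ring
  rw [h]
  generalize (x - y) / (1 - D.xr i) = z
  rw [add_mul, mul_assoc, mulOp_wOp, mul_add, ← mul_assoc, ← mul_assoc, ← map_mul, ← map_mul,
    ← map_mul, ← map_mul, map_sub D.mulOp (z * f), mul_comm (x - z)]
  abel

lemma TUnit_mul_X_of_smul_eq {i : D.I} {f : D.CT} (h : D.s i • f = f) :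
    (D.TUnit i : D.A) * D.X f = D.X f * D.TUnit i := by
  change D.Top i * D.mulOp _ = D.mulOp _ * D.Top i
  rw [Top_mul_mulOp, smul_algebraMap_RatT, h, sub_self, mul_zero, zero_div, map_zero, add_zero]

lemma TUnit_mul_X_of_smul_mul_eq {i : D.I} {f : D.CT}
    (h : D.s i • f * D.monoCo (D.simpleAff i) 1 = f) :
    (D.TUnit i : D.A) * D.X f = D.X (D.s i • f) * ((D.TUnit i)⁻¹ : D.Aˣ) := by
  rw [TUnit_inv, mul_sub]
  change D.Top i * D.mulOp _ = D.mulOp _ * D.Top i - D.mulOp _ * _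
  have h1 : 1 - D.xr i ≠ 0 := sub_ne_zero.2 (D.xr_ne_one i).symm
  have h2 : algebraMap D.CT D.RatT f = algebraMap D.CT D.RatT (D.s i • f) * D.xr i := by
    conv_lhs => rw [← h, map_mul]
    rfl
  have h3 : algebraMap ℂ D.RatT (D.kappa i) *
      (algebraMap D.CT D.RatT f - algebraMap D.CT D.RatT (D.s i • f)) / (1 - D.xr i) =
      -(algebraMap D.CT D.RatT (D.s i • f) * algebraMap ℂ D.RatT (D.kappa i)) := by
    rw [h2]
    field_simp
    ring
  rw [Top_mul_mulOp, smul_algebraMap_RatT, algebraMap_eq_mulOp, ← map_mul, h3, map_neg,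
    sub_eq_add_neg]

/-- Conjugation of `Ψ(g)` by `x^λ`. The condition on the gradient `β` of `g(a_i)`, imposed for a
reduced expression of `g` that stays in `S`, is `⟨λ,β⟩ = [vβ < 0] - [β < 0]`: passing from `g` to
`vg` changes the exponent of `T_i` in `Ψ` exactly as moving `x^λ` past `T_i` does. The proof is by
induction on the length, with four cases according to the signs of `β` and `vβ`. -/
lemma Psi_crossing {l : D.Pv} {v : D.W0} (S : D.W → Prop)
    (hS : ∀ g i, S g → D.affAct g (D.affSimple i) ∉ D.posAffRoots → S (g * D.s i) ∧
      ⟪(l : V), (D.affAct g (D.affSimple i)).1⟫ =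
        D.negG (v • (D.affAct g (D.affSimple i)).1) - D.negG (D.affAct g (D.affSimple i)).1)
    {g : D.W} (hg : S g) :
    (D.Psi (D.fin v) : D.A) * D.X (D.mono (-l)) * D.Psi g * D.X (g⁻¹ • D.mono l) =
      D.Psi (D.fin v * g) := by
  induction hn : D.len g generalizing g with
  | zero =>
    have h1 := D.Psi_mul_len_zero 1 hn
    rw [one_mul, Psi_one, one_mul] at h1
    rw [D.Psi_mul_len_zero _ hn, h1, mul_assoc, Units.val_mul]
    change _ * (D.wOp g * _) = _ * D.wOp g
    have h2 : D.X (D.mono (-l)) * D.X (D.mono l) = 1 := by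
      rw [← map_mul, mono, mono, AddMonoidAlgebra.single_mul_single, neg_add_cancel, one_mul,
        ← AddMonoidAlgebra.one_def, map_one]
    rw [wOp_mul_X, smul_inv_smul, mul_assoc, ← mul_assoc (D.X _), h2, one_mul]
  | succ n ih =>
    obtain ⟨i, hi⟩ := D.exists_neg_of_len_ne_zero' (g := g) (by omega)
    obtain ⟨h1, h2⟩ := hS g i hg hi
    have ih := ih h1 (by have := D.len_mul_s_of_neg hi; omega)
    have hinv : (g * D.s i)⁻¹ • D.mono l = D.s i • g⁻¹ • D.mono l := by
      rw [mul_inv_rev, s_inv, mul_smul]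
    rw [hinv, ← mul_assoc] at ih
    have hfst : (D.affAct (D.fin v * g) (D.affSimple i)).1 =
        v • (D.affAct g (D.affSimple i)).1 := by
      rw [← affAct_affAct, affAct_fin]
    by_cases hp : (D.affAct g (D.affSimple i)).1 ∈ D.posG <;>
      by_cases hq : v • (D.affAct g (D.affSimple i)).1 ∈ D.posG
    · rw [D.negG_of_mem hp, D.negG_of_mem hq, sub_zero] at h2
      rw [← hfst] at hq
      have hf := D.s_smul_inv_smul_mono_of_eq_zero h2
      have h3 := D.TUnit_mul_X_of_smul_eq hf
      rw [D.Psi_mul_s_of_mem hp, D.Psi_mul_s_of_mem hq, hf, Units.val_mul, Units.val_mul,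
        ← Units.mul_inv_eq_iff_eq_mul] at ih
      rw [inv_inv] at ih
      rw [← ih]
      simp only [mul_assoc]
      rw [← h3, Units.inv_mul_cancel_left]
    · rw [D.negG_of_mem hp, D.negG_of_notMem hq, sub_zero] at h2
      rw [← hfst] at hq
      have h3 := D.TUnit_mul_X_of_smul_mul_eq (D.s_smul_inv_smul_mono_of_eq_one h2)
      rw [D.Psi_mul_s_of_mem hp, D.Psi_mul_s_of_notMem hq, Units.val_mul, Units.val_mul,
        ← Units.mul_inv_eq_iff_eq_mul] at ih
      rw [← ih]
      simp only [mul_assoc]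
      rw [← h3, Units.inv_mul_cancel_left]
    · rw [D.negG_of_notMem hp, D.negG_of_mem hq, zero_sub] at h2
      rw [← hfst] at hq
      have h4 : ⟪(l : V), (D.affAct (g * D.s i) (D.affSimple i)).1⟫ = 1 := by
        rw [affAct_mul_s, Prod.fst_neg, inner_neg_right, h2, neg_neg]
      have h3 := D.TUnit_mul_X_of_smul_mul_eq (D.s_smul_inv_smul_mono_of_eq_one h4)
      rw [hinv, ← mul_smul (D.s i) (D.s i), s_mul_s, one_smul] at h3
      rw [D.Psi_mul_s_of_notMem hp, D.Psi_mul_s_of_mem hq, Units.val_mul, Units.val_mul,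
        ← mul_assoc, mul_assoc _ _ (D.X _), h3, ← mul_assoc] at ih
      exact (D.TUnit i)⁻¹.mul_left_inj.1 ih
    · rw [D.negG_of_notMem hp, D.negG_of_notMem hq, sub_self] at h2
      rw [← hfst] at hq
      have hf := D.s_smul_inv_smul_mono_of_eq_zero h2
      have h3 := D.TUnit_mul_X_of_smul_eq hf
      rw [D.Psi_mul_s_of_notMem hp, D.Psi_mul_s_of_notMem hq, hf, Units.val_mul, Units.val_mul,
        ← Units.mul_inv_eq_iff_eq_mul] at ih
      rw [← ih]
      simp only [mul_assoc]
      rw [← mul_assoc (D.TUnit i : D.A), h3, mul_assoc, Units.mul_inv, mul_one]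

/-- Conjugation of `Y^μ` by `x^λ` if `t(λ)u` has length zero. -/
lemma Y_conj_of_len_eq_zero {g : D.W} (hg : D.len g = 0) (m : D.Pv) :
    D.X (D.mono (-D.tr g)) * D.Y m * D.X ((D.trans m)⁻¹ • D.mono (D.tr g)) =
      ((D.Tw (D.fin g.right) * D.Y (g.right⁻¹ • m) * (D.Tw (D.fin g.right))⁻¹ : D.Aˣ) : D.A) := by
  have h := D.Psi_crossing (l := D.tr g) (v := g.right⁻¹) (fun _ => True) (fun h i _ hi => by
    refine ⟨trivial, ?_⟩
    obtain ⟨j, hj⟩ := D.exists_root_of_affRoots (D.affAct_affSimple_mem h i)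
    rw [hj]
    exact D.inner_tr_of_len_eq_zero hg j) (g := D.trans m) trivial
  rw [fin_mul_trans, Psi_trans_mul, Psi_trans, Psi_fin, inv_inv, mul_assoc, mul_assoc] at h
  rw [mul_assoc (D.Tw _), Units.val_mul, ← h, Units.mul_inv_cancel_left, mul_assoc]

/-- The condition of the crossing lemma for `λ = φ` and `v = s_φ`, at a root `β ≠ ±φ`. -/
lemma negG_refl_phi {β : V} (hβ : ∃ i, β = D.P.root i) (h1 : β ≠ D.P.root D.φ)
    (h2 : β ≠ -D.P.root D.φ) :
    ⟪(D.phi : V), β⟫ = D.negG (D.refl D.φ • β) - D.negG β := by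
  obtain ⟨i, rfl⟩ := hβ
  -- `φ - β` is a nonnegative combination of simple roots, so it is positive if it is a root
  have key (i : ι) (h : ⟪(D.phi : V), D.P.root i⟫ = 1) :
      D.P.root i ∈ D.posG ∧ D.refl D.φ • D.P.root i ∉ D.posG := by
    obtain ⟨j, hj⟩ := D.smul_root_eq (D.refl D.φ) i
    have h3 : D.P.root i ∈ D.posG := by
      refine (D.root_mem_posG_or i).resolve_right fun hn => ?_
      have := D.inner_nonneg_of_dominant D.phi_dominant hn
      rw [inner_neg_right, h] at this
      norm_num at this
    refine ⟨h3, fun hp => ?_⟩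
    rw [refl_phi_smul, h, one_smul] at hj hp
    rw [hj] at hp
    have h4 : ∀ m : D.b.support, ⟪(D.fund m : V), D.P.root j⟫ = 0 := fun m => by
      refine le_antisymm ?_ (D.inner_fund_nonneg hp m)
      rw [← hj, ← neg_sub, inner_neg_right]
      linarith [D.sub_phi_nonneg i m]
    have h5 := D.inner_eq_sum (D.P.root j) (D.P.root j)
    simp only [h4, zero_mul, Finset.sum_const_zero] at h5
    exact D.P.ne_zero j (inner_self_eq_zero.1 h5)
  rcases D.inner_phi_root i with h | h | h | h | h
  · exact absurd h h1
  · exact absurd h h2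
  · rw [refl_phi_smul, h, zero_smul, sub_zero, sub_self]
  · rw [D.negG_of_mem (key i h).1, D.negG_of_notMem (key i h).2, h, sub_zero]
  · have h3 := key (D.P.reflectionPerm i i)
    rw [RootPairing.root_reflectionPerm, RootPairing.reflection_apply_self, inner_neg_right, h,
      smul_neg] at h3
    obtain ⟨h4, h5⟩ := h3 (neg_neg 1)
    obtain ⟨j, hj⟩ := D.smul_root_eq (D.refl D.φ) i
    rw [hj] at h5 ⊢
    rw [D.neg_mem_posG_iff] at h4 h5
    rw [D.negG_of_notMem h4, D.negG_of_mem (not_not.1 h5), h, zero_sub]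

/-- The elements `g` of `W` whose alcove lies in the strip `0 < φ < 1`. -/
def InStrip (g : D.W) : Prop :=
  D.affAct g⁻¹ (D.P.root D.φ, 0) ∈ D.posAffRoots ∧
    D.affAct g⁻¹ (-D.P.root D.φ, 1) ∈ D.posAffRoots

lemma affSimple_none : D.affSimple none = (-D.P.root D.φ, 1) := by
  refine Prod.ext ?_ ?_
  · change D.P.root (D.P.reflectionPerm D.φ D.φ) = _
    rw [RootPairing.root_reflectionPerm, RootPairing.reflection_apply_self]
  · change ((1 : ℤ) : ℝ) = 1
    norm_num

variable {D} in
lemma InStrip.mul_s {g : D.W} (hg : D.InStrip g) {i : D.I}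
    (hi : D.affAct g (D.affSimple i) ∉ D.posAffRoots) : D.InStrip (g * D.s i) := by
  have h1 : (-D.P.root D.φ, (1 : ℝ)) ∈ D.posAffRoots := by
    rw [← affSimple_none]
    exact D.affSimple_mem_pos none
  have key (a : V × ℝ) (ha : a ∈ D.posAffRoots) (hga : D.affAct g⁻¹ a ∈ D.posAffRoots) :
      D.affAct (g * D.s i)⁻¹ a ∈ D.posAffRoots := by
    rw [mul_inv_rev, s_inv, ← affAct_affAct]
    refine D.affAct_s_mem_pos hga fun h => hi ?_
    rw [← h, affAct_affAct_inv]
    exact ha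
  exact ⟨key _ D.phi_mem_posG hg.1, key _ h1 hg.2⟩

lemma affAct_const (g : D.W) (r : ℝ) : D.affAct g ((0 : V), r) = (0, r) := by
  simp [affAct]

variable {D} in
/-- No wall of the hyperplane arrangement perpendicular to `φ` is crossed inside the strip. -/
lemma InStrip.ne_phi {g : D.W} (hg : D.InStrip g) {i : D.I}
    (hi : D.affAct g (D.affSimple i) ∉ D.posAffRoots) :
    (D.affAct g (D.affSimple i)).1 ≠ D.P.root D.φ ∧
      (D.affAct g (D.affSimple i)).1 ≠ -D.P.root D.φ := by
  have hmem := D.affAct_affSimple_mem g i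
  obtain ⟨hg1, hg2⟩ := hg
  have hneg : ∀ r : ℝ, r ≤ 0 → -D.affSimple i + ((0 : V), r) ∉ D.posAffRoots := fun r hr h => by
    classical
    have h0 : 0 ≤ D.affCoord i ((0 : V), (1 : ℝ)) := by
      have h1 : ((0 : V), (1 : ℝ)) = (D.P.root D.φ, 0) + D.affSimple none := by
        rw [affSimple_none]
        simp
      rw [h1, map_add]
      exact add_nonneg (D.affCoord_nonneg D.phi_mem_posG i)
        (D.affCoord_nonneg (D.affSimple_mem_pos none) i)
    have h1 := D.affCoord_nonneg h i
    have h2 : ((0 : V), r) = r • ((0 : V), (1 : ℝ)) := by simp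
    rw [map_add, map_neg, D.affCoord_affSimple, if_pos rfl, h2, map_smul, smul_eq_mul] at h1
    have h3 := mul_nonpos_of_nonpos_of_nonneg hr h0
    linarith
  have hinv := D.affAct_inv_affAct g (D.affSimple i)
  have hr : ∃ r : ℤ, (D.affAct g (D.affSimple i)).2 = r := by
    obtain ⟨j, r, h⟩ := hmem
    exact ⟨r, by rw [h]⟩
  obtain ⟨r, hr⟩ := hr
  have h0 : (D.affAct g (D.affSimple i)).2 ≤ 0 := by
    rw [D.mem_pos_iff hmem] at hi
    push Not at hi
    exact hi.1
  constructor
  · intro h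
    have h1 := D.snd_neg_of_notMem hmem hi (by rw [h]; exact D.phi_mem_posG)
    have h2 : (-D.P.root D.φ, (1 : ℝ)) =
        -D.affAct g (D.affSimple i) + ((0 : V), 1 + (r : ℝ)) := by
      refine Prod.ext ?_ ?_
      · simp [h]
      · simp [hr]
    rw [h2, affAct_add, affAct_neg, hinv, affAct_const] at hg2
    refine hneg _ ?_ hg2
    rw [hr] at h1
    have : r < 0 := by exact_mod_cast h1
    have : 1 + r ≤ 0 := by omega
    exact_mod_cast this
  · intro h
    have h2 : (D.P.root D.φ, (0 : ℝ)) = -D.affAct g (D.affSimple i) + ((0 : V), (r : ℝ)) := by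
      refine Prod.ext ?_ ?_
      · simp [h]
      · simp [hr]
    rw [h2, affAct_add, affAct_neg, hinv, affAct_const] at hg1
    rw [hr] at h0
    exact hneg _ h0 hg1

/-- The element `T_{s_φ}⁻¹ X^{-φ}`, which turns out to be the image of `T_0` under the duality. -/
noncomputable def T0dual : D.A :=
  ((D.Tw (D.fin (D.refl D.φ)))⁻¹ : D.Aˣ) * D.X (D.mono (-D.phi))

lemma Psi_crossing_phi {g : D.W} (hg : D.InStrip g) :
    D.T0dual * D.Psi g * D.X (g⁻¹ • D.mono D.phi) = D.Psi (D.fin (D.refl D.φ) * g) := by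
  rw [← D.Psi_crossing D.InStrip (fun h i hh hi => ⟨hh.mul_s hi, ?_⟩) hg, T0dual, Psi_fin, refl_inv]
  exact D.negG_refl_phi (D.exists_root_of_affRoots (D.affAct_affSimple_mem h i)) (hh.ne_phi hi).1
    (hh.ne_phi hi).2

lemma X_mono_mul_neg (l : D.Pv) : D.X (D.mono l) * D.X (D.mono (-l)) = 1 := by
  rw [← map_mul, mono, mono, AddMonoidAlgebra.single_mul_single, add_neg_cancel, one_mul,
    ← AddMonoidAlgebra.one_def, map_one]

lemma trans_inv (l : D.Pv) : (D.trans l)⁻¹ = D.trans (-l) := by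
  rw [inv_eq_iff_mul_eq_one, ← trans_add, add_neg_cancel, trans_zero]

lemma trans_smul_mono (l m : D.Pv) : D.trans l • D.mono m =
    ((D.q ^ (-⟪(m : V), (l : V)⟫) : ℝ) : ℂ) • D.mono m := by
  rw [smul_mono]
  change ((D.q ^ (-⟪(1 : D.W0) • (m : V), (l : V)⟫) : ℝ) : ℂ) • D.mono ((1 : D.W0) • m) = _
  rw [one_smul, one_smul]

lemma fin_smul_mono (u : D.W0) (m : D.Pv) : D.fin u • D.mono m = D.mono (u • m) := by
  rw [smul_mono]
  change ((D.q ^ (-⟪u • (m : V), ((0 : D.Pv) : V)⟫) : ℝ) : ℂ) • D.mono (u • m) = _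
  simp

lemma affAct_trans_phi (l : D.Pv) (r : ℝ) : D.affAct (D.trans l)⁻¹ (D.P.root D.φ, r) =
    (D.P.root D.φ, r + ⟪(l : V), D.P.root D.φ⟫) := by
  rw [trans_inv, affAct_trans, AddSubgroup.coe_neg, inner_neg_right, sub_neg_eq_add,
    real_inner_comm]

lemma affAct_trans_neg_phi (l : D.Pv) (r : ℝ) : D.affAct (D.trans l)⁻¹ (-D.P.root D.φ, r) =
    (-D.P.root D.φ, r - ⟪(l : V), D.P.root D.φ⟫) := by
  rw [trans_inv, affAct_trans, AddSubgroup.coe_neg, inner_neg_right, inner_neg_left, neg_neg,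
    real_inner_comm]

/-- The relation dual to `T_0 X^λ = X^λ T_0` for `⟨λ,φ⟩ = 0`. -/
lemma T0dual_mul_Y_of_eq_zero {l : D.Pv} (h : ⟪(l : V), D.P.root D.φ⟫ = 0) :
    D.T0dual * D.Y l = D.Y l * D.T0dual := by
  have h0 : D.InStrip (D.trans l) := by
    constructor
    · rw [affAct_trans_phi, h, add_zero]
      exact D.phi_mem_posG
    · rw [affAct_trans_neg_phi, h, sub_zero, ← affSimple_none]
      exact D.affSimple_mem_pos none
  have h1 := D.Psi_crossing_phi h0
  rw [fin_mul_trans, D.refl_smul_of_inner_eq_zero h, Psi_trans_mul, Psi_trans, Psi_fin, refl_inv,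
    trans_inv, trans_smul_mono, D.coe_phi, AddSubgroup.coe_neg, inner_neg_right, real_inner_comm, h,
    neg_zero, neg_zero, Real.rpow_zero, Complex.ofReal_one, one_smul] at h1
  have h2 := congrArg (· * D.X (D.mono (-D.phi))) h1
  rw [mul_assoc, X_mono_mul_neg, mul_one] at h2
  rw [h2, T0dual, Units.val_mul, mul_assoc]

lemma refl_phi_smul_phi : D.refl D.φ • D.phi = -D.phi := by
  refine Subtype.ext ?_
  rw [coe_smul_Pv, coe_phi, AddSubgroup.coe_neg, coe_phi]
  exact D.P.reflection_apply_self D.φ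

/-- The relation dual to the one of `T_0` with `X^λ` for `⟨λ,φ⟩ = 1`; the factor `q` comes from the
constant term of `a_0 = -φ + c`. -/
lemma T0dual_mul_Y_mul_T0dual {l : D.Pv} (h : ⟪(l : V), D.P.root D.φ⟫ = 1) :
    ((D.q : ℝ) : ℂ) • (D.T0dual * D.Y l * D.T0dual) = D.Y (D.refl D.φ • l) := by
  have hφ : D.refl D.φ • D.P.root D.φ = -D.P.root D.φ := D.P.reflection_apply_self D.φ
  have h0 : D.InStrip (D.trans l * D.fin (D.refl D.φ)) := by
    constructor
    · rw [mul_inv_rev, ← affAct_affAct, affAct_trans_phi, h, zero_add, ← fin_inv, affAct_fin,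
        refl_inv]
      simp only [hφ]
      rw [← affSimple_none]
      exact D.affSimple_mem_pos none
    · rw [mul_inv_rev, ← affAct_affAct, affAct_trans_neg_phi, h, sub_self, ← fin_inv, affAct_fin,
        refl_inv]
      simp only [smul_neg, hφ, neg_neg]
      exact D.phi_mem_posG
  have h1 := D.Psi_crossing_phi h0
  have h2 : D.fin (D.refl D.φ) * (D.trans l * D.fin (D.refl D.φ)) = D.trans (D.refl D.φ • l) := by
    rw [← mul_assoc, fin_mul_trans, mul_assoc, ← fin_mul, refl_mul_self, fin_one, mul_one]
  rw [h2, Psi_trans_mul, Psi_trans, Psi_fin, refl_inv, mul_inv_rev, mul_smul,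
    trans_inv, trans_smul_mono, D.coe_phi, AddSubgroup.coe_neg, inner_neg_right, real_inner_comm, h,
    neg_neg, Real.rpow_one, smul_smul_CT, ← fin_inv, refl_inv, fin_smul_mono, refl_phi_smul_phi,
    map_smul, mul_smul_comm] at h1
  rw [← h1]
  conv_lhs =>
    enter [2, 2]
    rw [T0dual]
  rw [Units.val_mul]
  simp only [mul_assoc]

end BqKZDatum

/-! ### Linear independence of the elements `X^λ T_u Y^μ` -/

namespace BqKZDatum

variable {ι V : Type*} [NormedAddCommGroup V] [InnerProductSpace ℝ V] (D : BqKZDatum ι V)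

lemma c_ne_zero (i : D.I) : D.c i ≠ 0 := by
  have h1 : 1 - algebraMap D.CT D.RatT (D.monoCo (D.simpleAff i) 1) ≠ 0 :=
    sub_ne_zero.2 (D.monoCo_ne_one _).symm
  rw [c]
  refine div_ne_zero (fun h => ?_) h1
  rw [IsScalarTower.algebraMap_apply ℂ D.CT D.RatT, IsScalarTower.algebraMap_apply ℂ D.CT D.RatT,
    ← map_mul, ← map_sub, FaithfulSMul.algebraMap_eq_zero_iff] at h
  have hne : D.corootPv (D.simpleAff i).1 ≠ 0 := fun h0 =>
    D.P.ne_zero' (D.simpleAff i).1 (congrArg Subtype.val h0)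
  have h2 := congrArg (fun f : D.CT => f.coeff (D.corootPv (D.simpleAff i).1)) h
  rw [← Algebra.smul_def] at h2
  simp [monoCo, hne] at h2
  exact (Real.rpow_pos_of_pos D.q_pos _).ne' h2

/-- `T_g` is a combination of `g`, with a nonzero coefficient, and of shorter elements of `W`. -/
lemma coeff_Tw (g : D.W) : (D.Tw g : D.A).coeff g ≠ 0 ∧
    ∀ h, h ≠ g → D.len g ≤ D.len h → (D.Tw g : D.A).coeff h = 0 := by
  classical
  have hx := D.isT_Tw g
  generalize D.Tw g = x at *
  induction hx with
  | @of_len_zero g hg =>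
    change (SkewMonoidAlgebra.single g (1 : D.RatT)).coeff g ≠ 0 ∧ ∀ h, h ≠ g → _ →
      (SkewMonoidAlgebra.single g (1 : D.RatT)).coeff h = 0
    refine ⟨?_, fun h hne _ => ?_⟩
    · rw [SkewMonoidAlgebra.coeff_single_apply, if_pos rfl]
      exact one_ne_zero
    · rw [SkewMonoidAlgebra.coeff_single_apply, if_neg hne.symm]
  | @step g x i hx hl ih =>
    have key (h : D.W) : ((x * D.TUnit i : D.Aˣ) : D.A).coeff h =
        (x : D.A).coeff h * h • (algebraMap ℂ D.RatT (D.ki i) - D.c i) +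
          (x : D.A).coeff (h * D.s i) * (h * D.s i) • D.c i := by
      have h1 : (D.TUnit i : D.A) =
          SkewMonoidAlgebra.single 1 (algebraMap ℂ D.RatT (D.ki i) - D.c i) +
            SkewMonoidAlgebra.single (D.s i) (D.c i) := by
        have h2 : D.mulOp (D.c i) * D.wOp (D.s i) = SkewMonoidAlgebra.single (D.s i) (D.c i) := by
          change SkewMonoidAlgebra.single 1 (D.c i) * SkewMonoidAlgebra.single (D.s i) 1 = _
          rw [SkewMonoidAlgebra.single_mul_single, one_mul, one_smul, mul_one]
        change D.Top i = D.mulOp _ + _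
        rw [Top, mul_sub, h2, mul_one, map_sub]
        change D.mulOp _ + _ = _
        abel
      rw [Units.val_mul, h1, mul_add, SkewMonoidAlgebra.coeff_add, Finsupp.add_apply,
        SkewMonoidAlgebra.coeff_mul_single_one, SkewMonoidAlgebra.coeff_mul_single, s_inv]
    refine ⟨?_, fun h hne hh => ?_⟩
    · have hne : g * D.s i ≠ g := fun h => by
        rw [h] at hl
        omega
      rw [key, ih.2 _ hne (by omega), zero_mul, zero_add, mul_assoc, s_mul_s, mul_one]
      exact mul_ne_zero ih.1 ((smul_ne_zero_iff_ne _).2 (D.c_ne_zero i))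
    · have h1 := D.len_mul_s_le (h * D.s i) i
      rw [mul_assoc, s_mul_s, mul_one] at h1
      rw [key, ih.2 h (fun e => by rw [e] at hh; omega) (by omega),
        ih.2 (h * D.s i) (fun e => hne (by rw [← e, mul_assoc, s_mul_s, mul_one])) (by omega),
        zero_mul, zero_mul, add_zero]

/-- By triangularity with respect to the group elements, the `T_g` are independent over `ℂ(T)`. -/
lemma linearIndependent_Tw : LinearIndependent D.RatT (fun g : D.W => (D.Tw g : D.A)) := by
  classical
  rw [linearIndependent_iff']
  intro s f hs
  by_contra! hne
  have hne' : (s.filter fun g => f g ≠ 0).Nonempty := by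
    obtain ⟨g, hg, hf⟩ := hne
    exact ⟨g, Finset.mem_filter.2 ⟨hg, hf⟩⟩
  -- compare coefficients at an element of maximal length
  obtain ⟨g, hg, hmax⟩ := Finset.exists_max_image _ D.len hne'
  obtain ⟨hgs, hfg⟩ := Finset.mem_filter.1 hg
  have h1 := congrArg (SkewMonoidAlgebra.coeffLinearEquiv (S := D.RatT)) hs
  rw [map_sum, map_zero] at h1
  have h2 := DFunLike.congr_fun h1 g
  rw [Finsupp.finsetSum_apply, Finset.sum_eq_single g] at h2
  · exact mul_ne_zero hfg (D.coeff_Tw g).1 h2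
  · intro h hh hne
    by_cases hf : f h = 0
    · rw [hf, zero_smul, map_zero, Finsupp.zero_apply]
    · have h3 := (D.coeff_Tw h).2 g hne.symm (hmax h (Finset.mem_filter.2 ⟨hh, hf⟩))
      change f h * (D.Tw h : D.A).coeff g = 0
      rw [h3, mul_zero]
  · exact fun h => absurd hgs h

/-- The monomials form a basis of `ℂ[T]`. -/
noncomputable def basisMono : Module.Basis D.Pv ℂ D.CT := ⟨AddMonoidAlgebra.coeffLinearEquiv ℂ⟩

lemma basisMono_apply (l : D.Pv) : D.basisMono l = D.mono l := by
  rw [← Module.Basis.repr_symm_single_one]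
  rfl

lemma mono_linearIndependent :
    LinearIndependent ℂ (fun l : D.Pv => algebraMap D.CT D.RatT (D.mono l)) := by
  have h := D.basisMono.linearIndependent.map' (IsScalarTower.toAlgHom ℂ D.CT D.RatT).toLinearMap
    (LinearMap.ker_eq_bot.2 (IsFractionRing.injective D.CT D.RatT))
  have e : (fun l : D.Pv => algebraMap D.CT D.RatT (D.mono l)) =
      (IsScalarTower.toAlgHom ℂ D.CT D.RatT).toLinearMap ∘ D.basisMono := funext fun l => by
    rw [Function.comp_apply, basisMono_apply]
    rfl
  rw [e]
  exact h

lemma linearIndependent_X_mul_Tw :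
    LinearIndependent ℂ (fun p : D.Pv × D.W => D.X (D.mono p.1) * (D.Tw p.2 : D.A)) := by
  have : IsScalarTower ℂ D.RatT D.A := inferInstance
  have h := linearIndependent_smul D.mono_linearIndependent D.linearIndependent_Tw
  convert h using 2 with p
  refine SkewMonoidAlgebra.ext fun g => ?_
  exact SkewMonoidAlgebra.coeff_single_one_mul _ _ g

/-- The elements `X^λ T_u Y^μ` are linearly independent: right multiplication by `Y^ν` with `ν` deep
in the dominant chamber turns finitely many of them into elements `X^λ T_w`. -/
lemma linearIndependent_X_mul_Tw_mul_Y : LinearIndependent ℂ (fun p : (D.Pv × D.Pv) × D.W0 =>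
    D.X (D.mono p.1.1) * (D.Tw (D.fin p.2) : D.A) * (D.Y p.1.2 : D.A)) := by
  classical
  rw [linearIndependent_iff']
  intro s f hs
  obtain ⟨n, hn⟩ : ∃ n : D.Pv, ∀ p ∈ s, D.IsDominant (p.1.2 + n) := by
    clear hs
    induction s using Finset.induction_on with
    | empty => exact ⟨0, fun p hp => absurd hp (Finset.notMem_empty p)⟩
    | insert a s _ ih =>
      obtain ⟨n, hn⟩ := ih
      obtain ⟨m, r, hm, hr, h⟩ := D.exists_dominant_sub (a.1.2 + n)
      refine ⟨n + r, fun p hp => ?_⟩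
      rw [← add_assoc]
      rcases Finset.mem_insert.1 hp with rfl | hp
      · rw [h, sub_add_cancel]
        exact hm
      · exact (hn p hp).add D hr
  have hinj : Function.Injective (fun p : (D.Pv × D.Pv) × D.W0 =>
      ((p.1.1, D.fin p.2 * D.trans (p.1.2 + n)) : D.Pv × D.W)) := by
    rintro ⟨⟨a, b⟩, u⟩ ⟨⟨a', b'⟩, u'⟩ h
    obtain ⟨h1, h2⟩ := Prod.mk.inj h
    have h3 : u = u' := by
      have := congrArg SemidirectProduct.right h2
      change u * 1 = u' * 1 at this
      simpa using this
    simp only at h2 h1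
    rw [h3] at h2
    have h5 : D.trans (b + n) = D.trans (b' + n) := mul_left_cancel h2
    have h4 : b + n = b' + n := Multiplicative.ofAdd.injective (SemidirectProduct.inl_injective h5)
    rw [h1, h3, add_right_cancel h4]
  refine linearIndependent_iff'.1 (D.linearIndependent_X_mul_Tw.comp _ hinj) s f ?_
  have h := congrArg (· * (D.Y n : D.A)) hs
  rw [Finset.sum_mul, zero_mul] at h
  rw [← h]
  refine Finset.sum_congr rfl fun p hp => ?_
  rw [Function.comp_apply, ← D.Tw_fin_mul_Y _ (hn p hp), Y_add, smul_mul_assoc, Units.val_mul,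
    Units.val_mul]
  simp only [mul_assoc]

end BqKZDatum

/-! ### Commutation relations of `T_i` with `f(X)` and of dual elements with `f(Y)` -/

namespace BqKZDatum

variable {ι V : Type*} [NormedAddCommGroup V] [InnerProductSpace ℝ V] (D : BqKZDatum ι V)

/-- The relation `E(f) S = S E(s_i f) + E(p)` in an algebra `B` over `ℂ`, where `E : ℂ[T] → B`. -/
def CrossRel {B : Type*} [Ring B] [Algebra ℂ B] (i : D.I) (E : D.CT →ₐ[ℂ] B) (S : B)
    (f p : D.CT) : Prop := E f * S = S * E (D.s i • f) + E p

section CrossRel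

variable {D} {B : Type*} [Ring B] [Algebra ℂ B] {i : D.I} {E : D.CT →ₐ[ℂ] B} {S : B}
  {f g p r : D.CT}

lemma CrossRel.add (h : D.CrossRel i E S f p) (h' : D.CrossRel i E S g r) :
    D.CrossRel i E S (f + g) (p + r) := by
  rw [CrossRel] at *
  rw [map_add, add_mul, h, h', smul_add, map_add, map_add, mul_add]
  abel

lemma CrossRel.smul (h : D.CrossRel i E S f p) (z : ℂ) : D.CrossRel i E S (z • f) (z • p) := by
  rw [CrossRel] at *
  rw [map_smul E, smul_mul_assoc, h, smul_smul_CT, map_smul E, map_smul E, smul_add, mul_smul_comm]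

lemma CrossRel.mul (h : D.CrossRel i E S f p) (h' : D.CrossRel i E S g r) :
    D.CrossRel i E S (f * g) (p * D.s i • g + f * r) := by
  rw [CrossRel] at *
  rw [map_mul, mul_assoc, h', mul_add, ← mul_assoc, h, smul_mul', map_mul, map_add, map_mul,
    map_mul, add_mul, mul_assoc, add_assoc]

lemma CrossRel.inv (h : D.CrossRel i E S f p) (hfg : f * g = 1) :
    D.CrossRel i E S g (-(g * p * D.s i • g)) := by
  have h1 : E g * E f = 1 := by rw [← map_mul, mul_comm, hfg, map_one]
  have h2 : E (D.s i • f) * E (D.s i • g) = 1 := by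
    rw [← map_mul, ← smul_mul', hfg, smul_one, map_one]
  have h3 : S * E (D.s i • f) = E f * S - E p := by rw [h, add_sub_cancel_right]
  rw [CrossRel, map_neg, map_mul, map_mul]
  have h4 : E g * S = E g * (S * E (D.s i • f)) * E (D.s i • g) := by
    rw [mul_assoc, mul_assoc S, h2, mul_one]
  rw [h4, h3, mul_sub, ← mul_assoc, h1, one_mul, sub_mul, sub_eq_add_neg]

end CrossRel

lemma commute_X (f g : D.CT) : Commute (D.X f) (D.X g) := by
  rw [Commute, SemiconjBy, ← map_mul, mul_comm, map_mul]

/-- The map `f ↦ f(X)` as a homomorphism to the opposite algebra. -/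
noncomputable def opX : D.CT →ₐ[ℂ] D.Aᵐᵒᵖ := D.X.toOpposite D.commute_X

lemma crossRel_opX {i : D.I} {f p : D.CT} :
    D.CrossRel i D.opX (MulOpposite.op (D.TUnit i : D.A)) f p ↔
      (D.TUnit i : D.A) * D.X f = D.X (D.s i • f) * D.TUnit i + D.X p := by
  rw [← MulOpposite.op_injective.eq_iff]
  rfl

lemma crossRel_opX_of_eq_zero {i : D.I} {l : D.Pv}
    (h : ⟪(l : V), D.P.root (D.simpleAff i).1⟫ = 0) :
    D.CrossRel i D.opX (MulOpposite.op (D.TUnit i : D.A)) (D.mono l) 0 := by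
  have hl : D.s i • D.mono l = D.mono l := D.affRefl_smul_mono_of_eq_zero h
  rw [crossRel_opX, D.TUnit_mul_X_of_smul_eq hl, hl, map_zero, add_zero]

lemma crossRel_opX_of_eq_one {i : D.I} {m : D.Pv}
    (hm : ⟪(m : V), D.P.root (D.simpleAff i).1⟫ = 1) :
    D.CrossRel i D.opX (MulOpposite.op (D.TUnit i : D.A)) (D.mono m)
      (-(D.kappa i • D.s i • D.mono m)) := by
  have hl : D.s i • D.mono m * D.monoCo (D.simpleAff i) 1 = D.mono m :=
    D.affRefl_smul_mono_of_eq_one hm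
  rw [crossRel_opX, D.TUnit_mul_X_of_smul_mul_eq hl, TUnit_inv, mul_sub, map_neg, map_smul D.X,
    ← Algebra.commutes, ← Algebra.smul_def, sub_eq_add_neg]

/-- If `S` satisfies the relations of `T_i` with generators of the lattice, then it satisfies the
relations of `T_i` with all `f ∈ ℂ[T]`, with the same correction terms. -/
lemma exists_crossRel {B : Type*} [Ring B] [Algebra ℂ B] {i : D.I} {E : D.CT →ₐ[ℂ] B} {S : B}
    (h0 : ∀ l : D.Pv, ⟪(l : V), D.P.root (D.simpleAff i).1⟫ = 0 → D.CrossRel i E S (D.mono l) 0)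
    {m : D.Pv} (hm : ⟪(m : V), D.P.root (D.simpleAff i).1⟫ = 1)
    (h1 : D.CrossRel i E S (D.mono m) (-(D.kappa i • D.s i • D.mono m))) (f : D.CT) :
    ∃ p, (D.TUnit i : D.A) * D.X f = D.X (D.s i • f) * D.TUnit i + D.X p ∧
      D.CrossRel i E S f p := by
  simp only [← crossRel_opX]
  set E' := D.opX
  set S' := MulOpposite.op (D.TUnit i : D.A)
  have h0' (l : D.Pv) (h : ⟪(l : V), D.P.root (D.simpleAff i).1⟫ = 0) :
      D.CrossRel i E' S' (D.mono l) 0 := D.crossRel_opX_of_eq_zero h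
  have h1' : D.CrossRel i E' S' (D.mono m) (-(D.kappa i • D.s i • D.mono m)) :=
    D.crossRel_opX_of_eq_one hm
  let G : AddSubgroup D.Pv :=
    { carrier := {l | ∃ p, D.CrossRel i E' S' (D.mono l) p ∧ D.CrossRel i E S (D.mono l) p}
      zero_mem' := ⟨0, h0' 0 (by simp), h0 0 (by simp)⟩
      add_mem' := by
        rintro a b ⟨p, hp, hp'⟩ ⟨r, hr, hr'⟩
        have h : D.mono (a + b) = D.mono a * D.mono b := by
          rw [mono, mono, mono, AddMonoidAlgebra.single_mul_single, mul_one]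
        change ∃ p, _ ∧ _
        rw [h]
        exact ⟨_, hp.mul hr, hp'.mul hr'⟩
      neg_mem' := by
        rintro a ⟨p, hp, hp'⟩
        have h : D.mono a * D.mono (-a) = 1 := by
          rw [mono, mono, AddMonoidAlgebra.single_mul_single, mul_one, add_neg_cancel]
          rfl
        exact ⟨_, hp.inv h, hp'.inv h⟩ }
  have hG (l : D.Pv) : l ∈ G := by
    obtain ⟨n, hn⟩ := l.2 (D.simpleAff i).1
    have h2 : l - n • m ∈ G := by
      have h3 : ⟪((l - n • m : D.Pv) : V), D.P.root (D.simpleAff i).1⟫ = 0 := by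
        rw [AddSubgroup.coe_sub, AddSubgroup.coe_zsmul, ← Int.cast_smul_eq_zsmul ℝ, inner_sub_left,
          inner_smul_left, hm, hn]
        simp
      exact ⟨0, h0' _ h3, h0 _ h3⟩
    have h3 : m ∈ G := ⟨_, h1', h1⟩
    rw [← sub_add_cancel l (n • m)]
    exact add_mem h2 (zsmul_mem h3 n)
  have hf := D.basisMono.mem_span f
  induction hf using Submodule.span_induction with
  | mem x hx =>
    obtain ⟨l, rfl⟩ := hx
    rw [basisMono_apply]
    exact hG l
  | zero =>
    exact ⟨0, by simp [CrossRel], by simp [CrossRel]⟩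
  | add x y _ _ hx hy =>
    obtain ⟨p, hp, hp'⟩ := hx
    obtain ⟨r, hr, hr'⟩ := hy
    exact ⟨_, hp.add hr, hp'.add hr'⟩
  | smul z x _ hx =>
    obtain ⟨p, hp, hp'⟩ := hx
    exact ⟨_, hp.smul z, hp'.smul z⟩

lemma exists_inner_phi_eq_one : ∃ l : D.Pv, ⟪(l : V), D.P.root D.φ⟫ = 1 := by
  classical
  obtain ⟨u, j, h⟩ := D.exists_simple_smul D.φ
  refine ⟨(u.map fun j : D.b.support => D.refl j).prod • D.fund j, ?_⟩
  rw [← h, coe_smul_Pv, inner_smul_smul, inner_fund_root, if_pos rfl]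

lemma exists_inner_simpleAff_eq_one (i : D.I) :
    ∃ m : D.Pv, ⟪(m : V), D.P.root (D.simpleAff i).1⟫ = 1 := by
  classical
  rcases i with _ | j
  · obtain ⟨l, hl⟩ := D.exists_inner_phi_eq_one
    refine ⟨-l, ?_⟩
    change ⟪((-l : D.Pv) : V), D.P.root (D.P.reflectionPerm D.φ D.φ)⟫ = 1
    rw [RootPairing.root_reflectionPerm, RootPairing.reflection_apply_self, AddSubgroup.coe_neg,
      inner_neg_neg, hl]
  · exact ⟨D.fund j, by
      change ⟪(D.fund j : V), D.P.root j⟫ = 1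
      rw [D.inner_fund_root, if_pos rfl]⟩

lemma exists_TUnit_mul_X (i : D.I) (f : D.CT) :
    ∃ p, (D.TUnit i : D.A) * D.X f = D.X (D.s i • f) * D.TUnit i + D.X p := by
  obtain ⟨m, hm⟩ := D.exists_inner_simpleAff_eq_one i
  obtain ⟨p, hp, -⟩ := D.exists_crossRel (i := i) (E := D.opX)
    (S := MulOpposite.op (D.TUnit i : D.A))
    (fun l h => D.crossRel_opX_of_eq_zero h) hm (D.crossRel_opX_of_eq_one hm) f
  exact ⟨p, hp⟩

/-- The homomorphism `f ↦ f(Y)` of algebras. -/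
noncomputable def evalYA : D.CT →ₐ[ℂ] D.A :=
  AddMonoidAlgebra.lift ℂ D.A D.Pv
    { toFun := fun m => (D.Y (Multiplicative.toAdd m) : D.A)
      map_one' := by rw [toAdd_one, Y_zero, Units.val_one]
      map_mul' := fun m n => by rw [toAdd_mul, Y_add, Units.val_mul] }

lemma evalYA_mono (l : D.Pv) : D.evalYA (D.mono l) = D.Y l := by
  simp [evalYA, mono, AddMonoidAlgebra.lift_single]

lemma coe_evalY (f : D.CT) : ((D.evalY f : D.DAHA) : D.A) = D.evalYA f := by
  have : D.DAHA.val.toLinearMap ∘ₗ D.evalY = D.evalYA.toLinearMap := by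
    refine AddMonoidAlgebra.lhom_ext' fun l => LinearMap.ext_ring ?_
    change ((D.evalY (AddMonoidAlgebra.single l 1) : D.DAHA) : D.A) = D.evalYA (D.mono l)
    rw [evalY_single, one_smul, evalYA_mono]
    rfl
  exact LinearMap.congr_fun this f

/-- The homomorphism `f ↦ f^⋄(Y)`, which is dual to `f ↦ f(X)`. -/
noncomputable def dualY : D.CT →ₐ[ℂ] D.A := D.evalYA.comp D.diamondCT

lemma diamondCT_mono (l : D.Pv) : D.diamondCT (D.mono l) = D.mono (-l) := D.diamondCT_single l 1

lemma dualY_mono (l : D.Pv) : D.dualY (D.mono l) = D.Y (-l) := by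
  rw [dualY, AlgHom.comp_apply, diamondCT_mono, evalYA_mono]

/-- The Bernstein-Lusztig relations in `X` and in `Y` have the same correction terms. -/
lemma exists_crossRel_some (j : D.b.support) (f : D.CT) :
    ∃ p, (D.TUnit (some j) : D.A) * D.X f = D.X (D.s (some j) • f) * D.TUnit (some j) + D.X p ∧
      D.dualY f * D.TUnit (some j) = D.TUnit (some j) * D.dualY (D.s (some j) • f) + D.dualY p := by
  classical
  have hw : ⟪(D.fund j : V), D.P.root j⟫ = 1 := by rw [D.inner_fund_root, if_pos rfl]
  refine D.exists_crossRel (i := some j) (E := D.dualY) (m := D.fund j) (fun l h => ?_) hw ?_ f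
  · have hl : D.s (some j) • D.mono l = D.mono l := D.affRefl_smul_mono_of_eq_zero h
    have h' : ⟪((-l : D.Pv) : V), D.P.root j⟫ = 0 := by
      rw [AddSubgroup.coe_neg, inner_neg_left, neg_eq_zero]
      exact h
    rw [CrossRel, hl, dualY_mono, map_zero, add_zero, ← Units.val_mul, ← Units.val_mul,
      D.TUnit_mul_Y_of_eq_zero h']
  · have h1 := D.TUnit_inv_mul_Y_of_eq_one hw
    have h2 : (D.Y (D.fund j))⁻¹ * D.TUnit (some j) =
        (D.TUnit (some j))⁻¹ * (D.Y (D.refl j • D.fund j))⁻¹ := by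
      rw [← mul_inv_rev, ← h1, mul_inv_rev, inv_inv]
    have h3 := congrArg (Units.val) h2
    rw [CrossRel, s_some, fin_smul_mono, dualY_mono, map_neg, map_smul D.dualY, dualY_mono, Y_neg,
      Y_neg]
    rw [Units.val_mul, Units.val_mul, TUnit_inv, sub_mul, ← Algebra.smul_def, sub_eq_add_neg] at h3
    exact h3

end BqKZDatum

/-! ### The Poincaré-Birkhoff-Witt theorem -/

namespace BqKZDatum

variable {ι V : Type*} [NormedAddCommGroup V] [InnerProductSpace ℝ V] (D : BqKZDatum ι V)

lemma TUnit_mem_H0 (j : D.b.support) : (D.TUnit (some j) : D.A) ∈ D.H0 :=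
  Algebra.subset_adjoin ⟨j, rfl⟩

lemma Tw_fin_mem_H0 (u : D.W0) : (D.Tw (D.fin u) : D.A) ∈ D.H0 := by
  induction u using D.W0_induction with
  | one =>
    rw [fin_one, Tw_one]
    exact one_mem _
  | step u i ih hl =>
    rw [fin_mul, ← s_some, D.Tw_mul_s hl, Units.val_mul]
    exact mul_mem ih (D.TUnit_mem_H0 i)

lemma Tw_fin_inv_mem_H0 (u : D.W0) : (((D.Tw (D.fin u))⁻¹ : D.Aˣ) : D.A) ∈ D.H0 := by
  induction u using D.W0_induction with
  | one =>
    rw [fin_one, Tw_one, inv_one]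
    exact one_mem _
  | step u i ih hl =>
    rw [fin_mul, ← s_some, D.Tw_mul_s hl, mul_inv_rev, Units.val_mul, TUnit_inv]
    exact mul_mem (sub_mem (D.TUnit_mem_H0 i) (D.H0.algebraMap_mem _)) ih

lemma TUnit_mul_self (i : D.I) :
    (D.TUnit i : D.A) * D.TUnit i = 1 + D.kappa i • (D.TUnit i : D.A) := by
  have h := (D.TUnit i).mul_inv
  rw [TUnit_inv, mul_sub, sub_eq_iff_eq_add, ← Algebra.commutes, ← Algebra.smul_def] at h
  exact h

/-- Left multiplication by `T_i` on the basis `T_u` of `H₀`, together with its mirror image. -/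
lemma TUnit_mul_Tw_fin (i : D.b.support) (u : D.W0) : ∃ z : ℂ,
    (D.TUnit (some i) : D.A) * D.Tw (D.fin u) =
      D.Tw (D.fin (D.refl i * u)) + z • (D.Tw (D.fin u) : D.A) ∧
    (D.Tw (D.fin u⁻¹) : D.A) * D.TUnit (some i) =
      D.Tw (D.fin (D.refl i * u)⁻¹) + z • (D.Tw (D.fin u⁻¹) : D.A) := by
  have aux (u : D.W0)
      (h : D.affAct (D.fin u⁻¹) (D.affSimple (some i)) ∈ D.posAffRoots) :
      D.TUnit (some i) * D.Tw (D.fin u) = D.Tw (D.fin (D.refl i * u)) ∧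
        D.Tw (D.fin u⁻¹) * D.TUnit (some i) = D.Tw (D.fin (D.refl i * u)⁻¹) := by
    have h1 := D.len_mul_s_of_pos h
    constructor
    · rw [fin_mul, ← s_some, ← D.Tw_s, D.Tw_mul]
      rw [← len_inv, mul_inv_rev, s_inv, ← fin_inv, h1, len_s, fin_inv, len_inv, add_comm]
    · rw [mul_inv_rev, refl_inv, fin_mul, ← s_some, D.Tw_mul_s h1]
  by_cases h : D.affAct (D.fin u⁻¹) (D.affSimple (some i)) ∈ D.posAffRoots
  · refine ⟨0, ?_, ?_⟩
    · rw [zero_smul, add_zero, ← (aux u h).1, Units.val_mul]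
    · rw [zero_smul, add_zero, ← (aux u h).2, Units.val_mul]
  · have hv : D.affAct (D.fin (D.refl i * u)⁻¹) (D.affSimple (some i)) ∈ D.posAffRoots := by
      rw [mul_inv_rev, refl_inv, fin_mul, ← s_some, affAct_mul_s,
        D.neg_pos_iff (D.affAct_affSimple_mem _ _)]
      exact h
    obtain ⟨h1, h2⟩ := aux _ hv
    rw [← mul_assoc, refl_mul_self, one_mul] at h1 h2
    refine ⟨D.kappa (some i), ?_, ?_⟩
    · rw [← h1, Units.val_mul, ← mul_assoc, TUnit_mul_self, add_mul, one_mul, smul_mul_assoc]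
    · rw [← h2, Units.val_mul, mul_assoc, TUnit_mul_self, mul_add, mul_one, mul_smul_comm]

lemma H0_le_span : D.H0.toSubmodule ≤
    Submodule.span ℂ (Set.range fun u : D.W0 => (D.Tw (D.fin u) : D.A)) := by
  set M := Submodule.span ℂ (Set.range fun u : D.W0 => (D.Tw (D.fin u) : D.A)) with hM
  have h1 (a : D.A) (ha : a ∈ D.H0) : ∀ m ∈ M, a * m ∈ M := by
    induction ha using Algebra.adjoin_induction with
    | mem x hx =>
      obtain ⟨i, rfl⟩ := hx
      intro m hm
      induction hm using Submodule.span_induction with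
      | mem x hx =>
        obtain ⟨u, rfl⟩ := hx
        obtain ⟨z, hz, -⟩ := D.TUnit_mul_Tw_fin i u
        change (D.TUnit (some i) : D.A) * _ ∈ M
        rw [hz]
        exact add_mem (Submodule.subset_span ⟨_, rfl⟩)
          (Submodule.smul_mem _ _ (Submodule.subset_span ⟨_, rfl⟩))
      | zero => rw [mul_zero]; exact zero_mem _
      | add x y _ _ hx hy => rw [mul_add]; exact add_mem hx hy
      | smul z x _ hx => rw [mul_smul_comm]; exact Submodule.smul_mem _ _ hx
    | algebraMap z =>
      intro m hm
      rw [← Algebra.smul_def]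
      exact Submodule.smul_mem _ _ hm
    | add x y _ _ hx hy => exact fun m hm => by rw [add_mul]; exact add_mem (hx m hm) (hy m hm)
    | mul x y _ _ hx hy => exact fun m hm => by rw [mul_assoc]; exact hx _ (hy m hm)
  intro a ha
  have h2 := h1 a ha 1 (Submodule.subset_span ⟨1, by simp only [fin_one, Tw_one, Units.val_one]⟩)
  rwa [mul_one] at h2

/-- The elements `T_u` of `H₀`. -/
noncomputable def TwH0 (u : D.W0) : D.H0 := ⟨D.Tw (D.fin u), D.Tw_fin_mem_H0 u⟩

lemma linearIndependent_TwH0 : LinearIndependent ℂ D.TwH0 := by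
  have hinj : Function.Injective (fun u : D.W0 => ((0, D.fin u) : D.Pv × D.W)) := fun u v h =>
    SemidirectProduct.inr_injective (congrArg Prod.snd h)
  have h := D.linearIndependent_X_mul_Tw.comp _ hinj
  have h1 : D.X (D.mono 0) = 1 := map_one D.X
  have e : D.H0.val.toLinearMap ∘ D.TwH0 =
      (fun p : D.Pv × D.W => D.X (D.mono p.1) * (D.Tw p.2 : D.A)) ∘
      fun u : D.W0 => ((0, D.fin u) : D.Pv × D.W) := by
    funext u
    rw [Function.comp_apply, Function.comp_apply, h1, one_mul]
    rfl
  refine LinearIndependent.of_comp D.H0.val.toLinearMap ?_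
  rw [e]
  exact h

/-- The elements `T_u` form a basis of `H₀`. -/
noncomputable def basisH0 : Module.Basis D.W0 ℂ D.H0 :=
  Module.Basis.mk D.linearIndependent_TwH0 (by
    rintro ⟨a, ha⟩ -
    have h := D.H0_le_span ha
    have h1 : Submodule.span ℂ (Set.range fun u : D.W0 => (D.Tw (D.fin u) : D.A)) =
        (Submodule.span ℂ (Set.range D.TwH0)).map D.H0.val.toLinearMap := by
      rw [Submodule.map_span, ← Set.range_comp]
      rfl
    rw [h1] at h
    obtain ⟨b, hb, hab⟩ := h
    have : b = ⟨a, ha⟩ := Subtype.ext hab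
    rwa [this] at hb)

lemma basisH0_apply (u : D.W0) : D.basisH0 u = D.TwH0 u := Module.Basis.mk_apply _ _ u

lemma pbw_injective : Function.Injective D.pbw := by
  set B := (D.basisMono.tensorProduct D.basisMono).tensorProduct D.basisH0
  have h : LinearIndependent ℂ (fun p => D.pbw (B p)) := by
    refine LinearIndependent.of_comp D.DAHA.val.toLinearMap ?_
    have e : D.DAHA.val.toLinearMap ∘ (fun p => D.pbw (B p)) =
        fun p : (D.Pv × D.Pv) × D.W0 =>
          D.X (D.mono p.1.1) * (D.Tw (D.fin p.2) : D.A) * (D.Y p.1.2 : D.A) := by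
      funext p
      have h1 : B p = (D.mono p.1.1 ⊗ₜ D.mono p.1.2) ⊗ₜ D.TwH0 p.2 := by
        rw [Module.Basis.tensorProduct_apply', Module.Basis.tensorProduct_apply', basisMono_apply,
          basisMono_apply, basisH0_apply]
      rw [Function.comp_apply, h1, pbw_tmul]
      change D.X _ * (D.Tw _ : D.A) * ((D.evalY (D.mono _) : D.DAHA) : D.A) = _
      rw [coe_evalY, evalYA_mono]
    rw [e]
    exact D.linearIndependent_X_mul_Tw_mul_Y
  have h2 := B.injective_constr_of_linearIndependent (R₂ := ℂ) h
  rwa [Module.Basis.constr_self] at h2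

/-- The span of the products `f(X) h g(Y)` with `h ∈ H₀`. -/
noncomputable def pbwSpan : Submodule ℂ D.A :=
  Submodule.span ℂ {a | ∃ f h g, h ∈ D.H0 ∧ a = D.X f * h * D.evalYA g}

lemma mem_pbwSpan {f g : D.CT} {h : D.A} (hh : h ∈ D.H0) :
    D.X f * h * D.evalYA g ∈ D.pbwSpan :=
  Submodule.subset_span ⟨f, h, g, hh, rfl⟩

lemma pbwSpan_induction {p : D.A → Prop} {a : D.A} (ha : a ∈ D.pbwSpan)
    (h1 : ∀ f g h, h ∈ D.H0 → p (D.X f * h * D.evalYA g)) (h0 : p 0)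
    (hadd : ∀ a b, p a → p b → p (a + b)) : p a := by
  induction ha using Submodule.closure_induction with
  | zero => exact h0
  | add a b _ _ ha hb => exact hadd a b ha hb
  | smul_mem z a ha =>
    obtain ⟨f, h, g, hh, rfl⟩ := ha
    rw [← smul_mul_assoc, ← smul_mul_assoc, ← map_smul D.X]
    exact h1 _ _ _ hh

lemma X_mul_mem_pbwSpan (f : D.CT) {a : D.A} (ha : a ∈ D.pbwSpan) : D.X f * a ∈ D.pbwSpan := by
  refine D.pbwSpan_induction (p := fun x => D.X f * x ∈ D.pbwSpan) ha
    (fun f' g h hh => ?_) ?_ fun a b ha hb => ?_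
  · rw [← mul_assoc, ← mul_assoc, ← map_mul]
    exact D.mem_pbwSpan hh
  · rw [mul_zero]; exact zero_mem _
  · rw [mul_add]; exact add_mem ha hb

lemma mul_evalYA_mem_pbwSpan (f : D.CT) {a : D.A} (ha : a ∈ D.pbwSpan) :
    a * D.evalYA f ∈ D.pbwSpan := by
  refine D.pbwSpan_induction (p := fun x => x * D.evalYA f ∈ D.pbwSpan) ha
    (fun f' g h hh => ?_) ?_ fun a b ha hb => ?_
  · rw [mul_assoc, ← map_mul]
    exact D.mem_pbwSpan hh
  · rw [zero_mul]; exact zero_mem _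
  · rw [add_mul]; exact add_mem ha hb

lemma dualY_diamondCT (g : D.CT) : D.dualY (D.diamondCT g) = D.evalYA g := by
  rw [dualY, AlgHom.comp_apply, diamondCT_diamondCT]

lemma mul_TUnit_mem_pbwSpan (j : D.b.support) {a : D.A} (ha : a ∈ D.pbwSpan) :
    a * D.TUnit (some j) ∈ D.pbwSpan := by
  refine D.pbwSpan_induction (p := fun x => x * D.TUnit (some j) ∈ D.pbwSpan) ha
    (fun f g h hh => ?_) ?_ fun a b ha hb => ?_
  · obtain ⟨p, -, hp⟩ := D.exists_crossRel_some j (D.diamondCT g)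
    rw [dualY_diamondCT] at hp
    rw [mul_assoc, hp, mul_add, ← mul_assoc, mul_assoc (D.X f)]
    exact add_mem (D.mem_pbwSpan (mul_mem hh (D.TUnit_mem_H0 j))) (D.mem_pbwSpan hh)
  · rw [zero_mul]; exact zero_mem _
  · rw [add_mul]; exact add_mem ha hb

lemma mul_mem_pbwSpan_of_mem_H0 {a h : D.A} (ha : a ∈ D.pbwSpan) (hh : h ∈ D.H0) :
    a * h ∈ D.pbwSpan := by
  induction hh using Algebra.adjoin_induction generalizing a with
  | mem x hx =>
    obtain ⟨j, rfl⟩ := hx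
    exact D.mul_TUnit_mem_pbwSpan j ha
  | algebraMap z =>
    rw [← Algebra.commutes, ← Algebra.smul_def]
    exact Submodule.smul_mem _ _ ha
  | add x y _ _ hx hy => rw [mul_add]; exact add_mem (hx ha) (hy ha)
  | mul x y _ _ hx hy => rw [← mul_assoc]; exact hy (hx ha)

lemma one_mem_pbwSpan : (1 : D.A) ∈ D.pbwSpan := by
  have := D.mem_pbwSpan (f := 1) (g := 1) (one_mem D.H0)
  rwa [map_one, map_one, one_mul, one_mul] at this

lemma evalYA_mul_mem_pbwSpan (f g : D.CT) {h : D.A} (hh : h ∈ D.H0) :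
    D.evalYA f * h * D.evalYA g ∈ D.pbwSpan := by
  refine D.mul_evalYA_mem_pbwSpan g (D.mul_mem_pbwSpan_of_mem_H0 ?_ hh)
  have := D.mul_evalYA_mem_pbwSpan f D.one_mem_pbwSpan
  rwa [one_mul] at this

/-- `T_0 = Y^φ T_{s_φ}⁻¹`. -/
lemma TUnit_none : D.TUnit none = D.Y D.phi * (D.Tw (D.fin (D.refl D.φ)))⁻¹ := by
  rw [Y_phi, mul_inv_cancel_right]

/-- `ω = Y^λ T_{u⁻¹}⁻¹` if `ω = t(λ)u` has length zero. -/
lemma wUnit_of_len_eq_zero {g : D.W} (hg : D.len g = 0) :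
    D.wUnit g = D.Y (D.tr g) * (D.Tw (D.fin g.right⁻¹))⁻¹ := by
  rw [D.Y_tr_of_len_eq_zero hg, mul_inv_cancel_right]

/-- The span of the products `f(X) h g(Y)` is stable under left multiplication by `ℍ`. -/
lemma mul_mem_pbwSpan {a : D.A} (ha : a ∈ D.DAHA) : ∀ m ∈ D.pbwSpan, a * m ∈ D.pbwSpan := by
  -- the elements stabilizing the span form a subalgebra
  let S : Subalgebra ℂ D.A :=
    { carrier := {a | ∀ m ∈ D.pbwSpan, a * m ∈ D.pbwSpan}
      mul_mem' := fun {a b} ha hb m hm => by rw [mul_assoc]; exact ha _ (hb m hm)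
      add_mem' := fun {a b} ha hb m hm => by rw [add_mul]; exact add_mem (ha m hm) (hb m hm)
      algebraMap_mem' := fun z m hm => by
        rw [← Algebra.smul_def]
        exact Submodule.smul_mem _ _ hm }
  have hX (f : D.CT) : D.X f ∈ S := fun m hm => D.X_mul_mem_pbwSpan f hm
  -- an element `s` with `s f(X) = f'(X) s + p(X)` need only be considered on `H₀ ℂ[Y]`
  have key (s : D.A) (hs : ∀ f, ∃ f' p, s * D.X f = D.X f' * s + D.X p)
      (hs' : ∀ h g, h ∈ D.H0 → s * h * D.evalYA g ∈ D.pbwSpan) : s ∈ S := by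
    intro m hm
    refine D.pbwSpan_induction (p := fun x => s * x ∈ D.pbwSpan) hm
      (fun f g h hh => ?_) ?_ fun a b ha hb => ?_
    · obtain ⟨f', p, hp⟩ := hs f
      rw [← mul_assoc, ← mul_assoc, hp, add_mul, add_mul, mul_assoc _ s, mul_assoc (D.X f')]
      exact add_mem (D.X_mul_mem_pbwSpan f' (hs' h g hh)) (D.mem_pbwSpan hh)
    · rw [mul_zero]; exact zero_mem _
    · rw [mul_add]; exact add_mem ha hb
  have hT (i : D.I) : D.Top i ∈ S := by
    refine key _ (fun f => ⟨_, D.exists_TUnit_mul_X i f⟩) fun h g hh => ?_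
    rcases i with _ | j
    · change (D.TUnit none : D.A) * _ * _ ∈ _
      rw [TUnit_none, Units.val_mul, mul_assoc _ _ h, ← evalYA_mono]
      exact D.evalYA_mul_mem_pbwSpan _ g (mul_mem (D.Tw_fin_inv_mem_H0 _) hh)
    · have := D.mem_pbwSpan (f := 1) (g := g) (mul_mem (D.TUnit_mem_H0 j) hh)
      rwa [map_one, one_mul] at this
  have hO (g : D.W) (hg : D.len g = 0) : D.wOp g ∈ S := by
    refine key _ (fun f => ⟨g • f, 0, ?_⟩) fun h f hh => ?_
    · rw [wOp_mul_X, map_zero, add_zero]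
    · change (D.wUnit g : D.A) * _ * _ ∈ _
      rw [D.wUnit_of_len_eq_zero hg, Units.val_mul, mul_assoc _ _ h, ← evalYA_mono]
      exact D.evalYA_mul_mem_pbwSpan _ f (mul_mem (D.Tw_fin_inv_mem_H0 _) hh)
  have hH : D.H ≤ S := by
    refine Algebra.adjoin_le ?_
    rintro _ (⟨i, rfl⟩ | ⟨w, rfl⟩)
    · exact hT i
    · exact hO w.1 w.2
  have hD : D.DAHA ≤ S := by
    refine Algebra.adjoin_le ?_
    rintro _ (h | ⟨f, rfl⟩)
    · exact hH h
    · exact hX f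
  exact hD ha

/-- The Poincaré-Birkhoff-Witt theorem for the double affine Hecke algebra. -/
lemma pbw_bijective : Function.Bijective D.pbw := by
  refine ⟨D.pbw_injective, fun a => ?_⟩
  have h := D.mul_mem_pbwSpan a.2 1 D.one_mem_pbwSpan
  rw [mul_one] at h
  have h2 : ∃ t, (D.pbw t : D.A) = a := by
    refine D.pbwSpan_induction (p := fun a => ∃ t, (D.pbw t : D.A) = a) h
      (fun f g h hh => ?_) ⟨0, ?_⟩ ?_
    · exact ⟨(f ⊗ₜ g) ⊗ₜ ⟨h, hh⟩, by rw [← coe_evalY, pbw_tmul]; rfl⟩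
    · rw [map_zero]
      rfl
    · rintro x y ⟨s, rfl⟩ ⟨t, rfl⟩
      exact ⟨s + t, by rw [map_add]; rfl⟩
  obtain ⟨t, ht⟩ := h2
  exact ⟨t, Subtype.ext ht⟩

end BqKZDatum

/-! ### The duality anti-involution -/

namespace BqKZDatum

variable {ι V : Type*} [NormedAddCommGroup V] [InnerProductSpace ℝ V] (D : BqKZDatum ι V)

/-- The generator `T_j` of `H₀`. -/
noncomputable def TH0 (j : D.b.support) : D.H0 := ⟨D.TUnit (some j), D.TUnit_mem_H0 j⟩

/-- The anti-involution `T_u ↦ T_{u⁻¹}` of `H₀`. -/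
noncomputable def starH0 : D.H0 →ₗ[ℂ] D.H0 := D.basisH0.constr ℂ fun u => D.TwH0 u⁻¹

lemma starH0_TwH0 (u : D.W0) : D.starH0 (D.TwH0 u) = D.TwH0 u⁻¹ := by
  rw [← basisH0_apply, starH0, Module.Basis.constr_basis]

lemma TwH0_one : D.TwH0 1 = 1 := by
  refine Subtype.ext ?_
  change (D.Tw (D.fin 1) : D.A) = 1
  rw [fin_one, Tw_one, Units.val_one]

lemma starH0_one : D.starH0 1 = 1 := by
  rw [← TwH0_one, starH0_TwH0, inv_one]

lemma starH0_starH0 (h : D.H0) : D.starH0 (D.starH0 h) = h := by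
  have : D.starH0 ∘ₗ D.starH0 = LinearMap.id := by
    refine D.basisH0.ext fun u => ?_
    rw [LinearMap.comp_apply, basisH0_apply, starH0_TwH0, starH0_TwH0, inv_inv, LinearMap.id_apply]
  exact LinearMap.congr_fun this h

lemma starH0_TH0_mul (j : D.b.support) (h : D.H0) :
    D.starH0 (D.TH0 j * h) = D.starH0 h * D.TH0 j := by
  have : D.starH0 ∘ₗ LinearMap.mulLeft ℂ (D.TH0 j) =
      LinearMap.mulRight ℂ (D.TH0 j) ∘ₗ D.starH0 := by
    refine D.basisH0.ext fun u => ?_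
    obtain ⟨z, h1, h2⟩ := D.TUnit_mul_Tw_fin j u
    have h1' : D.TH0 j * D.TwH0 u = D.TwH0 (D.refl j * u) + z • D.TwH0 u := Subtype.ext h1
    have h2' : D.TwH0 u⁻¹ * D.TH0 j = D.TwH0 (D.refl j * u)⁻¹ + z • D.TwH0 u⁻¹ := Subtype.ext h2
    rw [LinearMap.comp_apply, LinearMap.comp_apply, basisH0_apply, LinearMap.mulLeft_apply,
      LinearMap.mulRight_apply, starH0_TwH0, h1', h2', map_add, map_smul, starH0_TwH0, starH0_TwH0]
  exact LinearMap.congr_fun this h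

lemma starH0_TH0 (j : D.b.support) : D.starH0 (D.TH0 j) = D.TH0 j := by
  have h := D.starH0_TH0_mul j 1
  rwa [mul_one, starH0_one, one_mul] at h

lemma H0_induction {p : D.H0 → Prop} (hT : ∀ j, p (D.TH0 j))
    (hz : ∀ z, p (algebraMap ℂ D.H0 z)) (hadd : ∀ a b, p a → p b → p (a + b))
    (hmul : ∀ a b, p a → p b → p (a * b)) (a : D.H0) : p a := by
  obtain ⟨a, ha⟩ := a
  induction ha using Algebra.adjoin_induction with
  | mem x hx =>
    obtain ⟨j, rfl⟩ := hx
    exact hT j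
  | algebraMap z => exact hz z
  | add x y hx hy h1 h2 => exact hadd ⟨x, hx⟩ ⟨y, hy⟩ h1 h2
  | mul x y hx hy h1 h2 => exact hmul ⟨x, hx⟩ ⟨y, hy⟩ h1 h2

lemma starH0_mul (a h : D.H0) : D.starH0 (a * h) = D.starH0 h * D.starH0 a := by
  induction a using D.H0_induction generalizing h with
  | hT j => rw [starH0_TH0_mul, starH0_TH0]
  | hz z =>
    rw [← Algebra.smul_def, map_smul, Algebra.algebraMap_eq_smul_one, map_smul, starH0_one,
      mul_smul_comm, mul_one]
  | hadd a b ha hb => rw [add_mul, map_add, ha, hb, map_add, mul_add]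
  | hmul a b ha hb => rw [mul_assoc, ha, hb, ha b, mul_assoc]

/-- The inverse of `T_u` in `H₀`. -/
noncomputable def TwInvH0 (u : D.W0) : D.H0 :=
  ⟨((D.Tw (D.fin u))⁻¹ : D.Aˣ), D.Tw_fin_inv_mem_H0 u⟩

lemma starH0_TwInvH0 (u : D.W0) : D.starH0 (D.TwInvH0 u) = D.TwInvH0 u⁻¹ := by
  have h1 : D.TwH0 u * D.TwInvH0 u = 1 := Subtype.ext (Units.mul_inv _)
  have h2 : D.TwH0 u⁻¹ * D.TwInvH0 u⁻¹ = 1 := Subtype.ext (Units.mul_inv _)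
  have h3 := congrArg D.starH0 h1
  rw [starH0_mul, starH0_one, starH0_TwH0] at h3
  exact left_inv_eq_right_inv h3 h2

lemma evalY_one : D.evalY 1 = 1 := Subtype.ext (by rw [coe_evalY, map_one]; rfl)

lemma evalY_mul (f g : D.CT) : D.evalY (f * g) = D.evalY f * D.evalY g := Subtype.ext (by
  change _ = ((D.evalY f : D.DAHA) : D.A) * (D.evalY g : D.DAHA)
  rw [coe_evalY, coe_evalY, coe_evalY, map_mul])

lemma XH_one : D.XH 1 = 1 := Subtype.ext (map_one D.X)

/-- The anti-involution `f(X) h g(Y) ↦ g^⋄(X) h^* f^⋄(Y)`. -/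
noncomputable def dualMap : D.DAHA →ₗ[ℂ] D.DAHA :=
  D.pbw ∘ₗ TensorProduct.map (TensorProduct.map D.diamondCT.toLinearMap D.diamondCT.toLinearMap ∘ₗ
    (TensorProduct.comm ℂ D.CT D.CT).toLinearMap) D.starH0 ∘ₗ
    (LinearEquiv.ofBijective D.pbw D.pbw_bijective).symm.toLinearMap

lemma dualMap_pbw (f g : D.CT) (h : D.H0) :
    D.dualMap (D.XH f * D.inclH0 h * D.evalY g) =
      D.XH (D.diamondCT g) * D.inclH0 (D.starH0 h) * D.evalY (D.diamondCT f) := by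
  have h1 : (LinearEquiv.ofBijective D.pbw D.pbw_bijective).symm
      (D.XH f * D.inclH0 h * D.evalY g) = (f ⊗ₜ g) ⊗ₜ h := by
    rw [LinearEquiv.symm_apply_eq]
    rfl
  rw [dualMap, LinearMap.comp_apply, LinearMap.comp_apply, LinearEquiv.coe_coe, h1]
  rfl

lemma DAHA_induction {p : D.DAHA → Prop}
    (h1 : ∀ f h g, p (D.XH f * D.inclH0 h * D.evalY g)) (hadd : ∀ a b, p a → p b → p (a + b))
    (a : D.DAHA) : p a := by
  obtain ⟨t, rfl⟩ := D.pbw_bijective.2 a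
  have h0 : p 0 := by
    have := h1 0 0 0
    rwa [map_zero, mul_zero, zero_mul] at this
  induction t using TensorProduct.induction_on with
  | zero => rwa [map_zero]
  | add a b ha hb => rw [map_add]; exact hadd _ _ ha hb
  | tmul t h =>
    induction t using TensorProduct.induction_on with
    | zero => rwa [TensorProduct.zero_tmul, map_zero]
    | add a b ha hb => rw [TensorProduct.add_tmul, map_add]; exact hadd _ _ ha hb
    | tmul f g => exact h1 f h g

lemma dualMap_inclH0 (h : D.H0) : D.dualMap (D.inclH0 h) = D.inclH0 (D.starH0 h) := by
  have := D.dualMap_pbw 1 1 h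
  rwa [XH_one, evalY_one, map_one D.diamondCT, XH_one, evalY_one, one_mul, mul_one, one_mul,
    mul_one] at this

lemma dualMap_XH (f : D.CT) : D.dualMap (D.XH f) = D.evalY (D.diamondCT f) := by
  have := D.dualMap_pbw f 1 1
  rwa [map_one D.diamondCT, starH0_one, map_one D.inclH0, XH_one, evalY_one, mul_one, mul_one,
    one_mul, one_mul] at this

lemma dualMap_evalY (f : D.CT) : D.dualMap (D.evalY f) = D.XH (D.diamondCT f) := by
  have := D.dualMap_pbw 1 f 1
  rwa [map_one D.diamondCT, starH0_one, map_one D.inclH0, XH_one, evalY_one, mul_one, one_mul,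
    mul_one, mul_one] at this

lemma dualMap_one : D.dualMap 1 = 1 := by
  rw [← XH_one, dualMap_XH, map_one, evalY_one, XH_one]

lemma dualMap_dualMap (a : D.DAHA) : D.dualMap (D.dualMap a) = a := by
  induction a using D.DAHA_induction with
  | h1 f h g =>
    rw [dualMap_pbw, dualMap_pbw, diamondCT_diamondCT, diamondCT_diamondCT, starH0_starH0]
  | hadd a b ha hb => rw [map_add, map_add, ha, hb]

lemma dualMap_algebraMap (z : ℂ) : D.dualMap (algebraMap ℂ D.DAHA z) = algebraMap ℂ D.DAHA z := by
  rw [Algebra.algebraMap_eq_smul_one, map_smul, dualMap_one]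

/-- The elements `a` with `(ab)^* = b^* a^*` for all `b`. -/
noncomputable def leftAnti : Subalgebra ℂ D.DAHA where
  carrier := {a | ∀ b, D.dualMap (a * b) = D.dualMap b * D.dualMap a}
  mul_mem' {a a'} ha ha' b := by rw [mul_assoc, ha, ha', ha a', mul_assoc]
  add_mem' {a a'} ha ha' b := by rw [add_mul, map_add, ha, ha', map_add, mul_add]
  algebraMap_mem' z b := by
    rw [dualMap_algebraMap, ← Algebra.smul_def, map_smul, Algebra.smul_def, Algebra.commutes]

/-- The elements `b` with `(ab)^* = b^* a^*` for all `a`. -/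
noncomputable def rightAnti : Subalgebra ℂ D.DAHA where
  carrier := {b | ∀ a, D.dualMap (a * b) = D.dualMap b * D.dualMap a}
  mul_mem' {b b'} hb hb' a := by rw [← mul_assoc, hb', hb, hb', mul_assoc]
  add_mem' {b b'} hb hb' a := by rw [mul_add, map_add, hb, hb', map_add, add_mul]
  algebraMap_mem' z a := by
    rw [dualMap_algebraMap, ← Algebra.commutes, ← Algebra.smul_def, map_smul, Algebra.smul_def]

lemma XH_mem_leftAnti (f : D.CT) : D.XH f ∈ D.leftAnti := fun b => by
  induction b using D.DAHA_induction with
  | h1 f' h g =>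
    rw [← mul_assoc, ← mul_assoc, ← XH_mul, dualMap_pbw, dualMap_pbw, dualMap_XH, map_mul,
      mul_comm (D.diamondCT f), evalY_mul, mul_assoc _ (D.evalY _)]
  | hadd a b ha hb => rw [mul_add, map_add, ha, hb, map_add, add_mul]

lemma evalY_mem_rightAnti (g : D.CT) : D.evalY g ∈ D.rightAnti := fun a => by
  induction a using D.DAHA_induction with
  | h1 f h g' =>
    rw [mul_assoc _ (D.evalY g'), ← evalY_mul, dualMap_pbw, dualMap_pbw, dualMap_evalY, map_mul,
      mul_comm (D.diamondCT g'), XH_mul]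
    simp only [mul_assoc]
  | hadd a b ha hb => rw [add_mul, map_add, ha, hb, map_add, mul_add]

lemma TH0_mem_rightAnti (j : D.b.support) : D.inclH0 (D.TH0 j) ∈ D.rightAnti := fun a => by
  induction a using D.DAHA_induction with
  | h1 f h g =>
    obtain ⟨p, hp, hp'⟩ := D.exists_crossRel_some j (D.diamondCT g)
    have h1 : D.inclH0 (D.TH0 j) * D.XH (D.diamondCT g) =
        D.XH (D.s (some j) • D.diamondCT g) * D.inclH0 (D.TH0 j) + D.XH p := Subtype.ext hp
    have h2 : D.evalY g * D.inclH0 (D.TH0 j) =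
        D.inclH0 (D.TH0 j) * D.evalY (D.diamondCT (D.s (some j) • D.diamondCT g)) +
          D.evalY (D.diamondCT p) := by
      refine Subtype.ext ?_
      change ((D.evalY g : D.DAHA) : D.A) * D.TUnit (some j) = (D.TUnit (some j) : D.A) *
        (D.evalY _ : D.DAHA) + (D.evalY _ : D.DAHA)
      rw [coe_evalY, coe_evalY, coe_evalY, ← dualY_diamondCT, hp']
      rfl
    rw [mul_assoc _ (D.evalY g), h2, mul_add, ← mul_assoc, mul_assoc (D.XH f), ← map_mul, map_add,
      dualMap_pbw, dualMap_pbw, diamondCT_diamondCT, diamondCT_diamondCT, dualMap_pbw,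
      dualMap_inclH0, starH0_mul, starH0_TH0, map_mul, ← mul_assoc, ← mul_assoc, ← mul_assoc,
      h1, add_mul, add_mul]
  | hadd a b ha hb => rw [add_mul, map_add, ha, hb, map_add, mul_add]

lemma inclH0_mem_rightAnti (h : D.H0) : D.inclH0 h ∈ D.rightAnti := by
  induction h using D.H0_induction with
  | hT j => exact D.TH0_mem_rightAnti j
  | hz z => rw [AlgHom.commutes]; exact D.rightAnti.algebraMap_mem z
  | hadd a b ha hb => rw [map_add]; exact add_mem ha hb
  | hmul a b ha hb => rw [map_mul]; exact mul_mem ha hb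

/-- It suffices to compare the commutation relations of `a` with `f(X)` and of `a^*` with the dual
elements `f^⋄(Y)`. -/
lemma mem_leftAnti {a : D.DAHA} (ha : ∀ f, ∃ f' p, D.X f' * (a : D.A) + D.X p = a * D.X f ∧
    D.dualY f * (D.dualMap a : D.A) = D.dualMap a * D.dualY f' + D.dualY p) :
    a ∈ D.leftAnti := fun b => by
  induction b using D.DAHA_induction with
  | h1 f h g =>
    obtain ⟨f', p, h1, h2⟩ := ha f
    have h1' : a * D.XH f = D.XH f' * a + D.XH p := Subtype.ext h1.symm
    have h2' : D.evalY (D.diamondCT f) * D.dualMap a =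
        D.dualMap a * D.evalY (D.diamondCT f') + D.evalY (D.diamondCT p) := by
      refine Subtype.ext ?_
      change ((D.evalY _ : D.DAHA) : D.A) * D.dualMap a = (D.dualMap a : D.A) *
        (D.evalY _ : D.DAHA) + (D.evalY _ : D.DAHA)
      rw [coe_evalY, coe_evalY, coe_evalY]
      exact h2
    have hR : D.inclH0 h * D.evalY g ∈ D.rightAnti :=
      mul_mem (D.inclH0_mem_rightAnti h) (D.evalY_mem_rightAnti g)
    rw [mul_assoc, ← mul_assoc a, h1', hR, hR, map_add, D.XH_mem_leftAnti, dualMap_XH, dualMap_XH,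
      dualMap_XH, mul_assoc _ _ (D.dualMap a), h2']
  | hadd a b ha hb => rw [mul_add, map_add, ha, hb, map_add, add_mul]

/-- `T_i` as an element of the double affine Hecke algebra. -/
noncomputable def TDAHA (i : D.I) : D.DAHA := ⟨D.TUnit i, D.H_le_DAHA (D.Top_mem_H i)⟩

lemma TDAHA_some_mem_leftAnti (j : D.b.support) : D.TDAHA (some j) ∈ D.leftAnti := by
  refine D.mem_leftAnti fun f => ?_
  obtain ⟨p, hp, hp'⟩ := D.exists_crossRel_some j f
  have h : D.dualMap (D.TDAHA (some j)) = D.TDAHA (some j) := by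
    change D.dualMap (D.inclH0 (D.TH0 j)) = D.inclH0 (D.TH0 j)
    rw [dualMap_inclH0, starH0_TH0]
  rw [h]
  exact ⟨_, p, hp.symm, hp'⟩

/-- The dual of an element `Y^λ T_u⁻¹`. -/
lemma dualMap_evalY_mul_inclH0 (l : D.Pv) (u : D.W0) :
    (D.dualMap (D.evalY (D.mono l) * D.inclH0 (D.TwInvH0 u)) : D.A) =
      ((D.Tw (D.fin u⁻¹))⁻¹ : D.Aˣ) * D.X (D.mono (-l)) := by
  rw [D.inclH0_mem_rightAnti, dualMap_inclH0, starH0_TwInvH0, dualMap_evalY, diamondCT_mono]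
  rfl

lemma TDAHA_none :
    D.TDAHA none = D.evalY (D.mono D.phi) * D.inclH0 (D.TwInvH0 (D.refl D.φ)) := by
  refine Subtype.ext ?_
  change (D.TUnit none : D.A) = ((D.evalY _ : D.DAHA) : D.A) * ((D.Tw (D.fin _))⁻¹ : D.Aˣ)
  rw [coe_evalY, evalYA_mono, TUnit_none, Units.val_mul]

/-- The duality maps `T_0` to `T_{s_φ}⁻¹ X^{-φ}`. -/
lemma dualMap_TDAHA_none : (D.dualMap (D.TDAHA none) : D.A) = D.T0dual := by
  rw [TDAHA_none, dualMap_evalY_mul_inclH0, refl_inv]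
  rfl

/-- The quadratic relation of `T_0`, transported by the map `*`. -/
lemma T0dual_mul_self : D.T0dual * D.T0dual = 1 + D.kappa none • D.T0dual := by
  have h : D.TDAHA none * D.TDAHA none = 1 + D.kappa none • D.TDAHA none :=
    Subtype.ext (D.TUnit_mul_self none)
  have hR : D.TDAHA none ∈ D.rightAnti := by
    rw [TDAHA_none]
    exact mul_mem (D.evalY_mem_rightAnti _) (D.inclH0_mem_rightAnti _)
  have h1 := congrArg (fun a => (D.dualMap a : D.A)) h
  simp only [hR (D.TDAHA none), map_add, map_smul, dualMap_one] at h1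
  rw [← dualMap_TDAHA_none]
  exact h1

/-- The relations of `T_0` with `f(X)` and of its dual with `f^⋄(Y)` have the same correction
terms. -/
lemma exists_crossRel_none (f : D.CT) :
    ∃ p, (D.TUnit none : D.A) * D.X f = D.X (D.s none • f) * D.TUnit none + D.X p ∧
      D.dualY f * D.T0dual = D.T0dual * D.dualY (D.s none • f) + D.dualY p := by
  obtain ⟨l, hl⟩ := D.exists_inner_phi_eq_one
  have hroot (v : V) : ⟪v, D.P.root (D.simpleAff none).1⟫ = -⟪v, D.P.root D.φ⟫ := by
    change ⟪v, D.P.root (D.P.reflectionPerm D.φ D.φ)⟫ = _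
    rw [RootPairing.root_reflectionPerm, RootPairing.reflection_apply_self, inner_neg_right]
  have hm : ⟪((-l : D.Pv) : V), D.P.root (D.simpleAff none).1⟫ = 1 := by
    rw [hroot, AddSubgroup.coe_neg, inner_neg_left, neg_neg, hl]
  refine D.exists_crossRel (i := none) (E := D.dualY) (S := D.T0dual) (fun m h => ?_) hm ?_ f
  · have h1 : D.s none • D.mono m = D.mono m := D.affRefl_smul_mono_of_eq_zero h
    have h2 : ⟪((-m : D.Pv) : V), D.P.root D.φ⟫ = 0 := by
      rw [AddSubgroup.coe_neg, inner_neg_left, ← hroot, h]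
    rw [CrossRel, h1, dualY_mono, map_zero, add_zero, D.T0dual_mul_Y_of_eq_zero h2]
  · have h1 : ⟪((D.refl D.φ • l : D.Pv) : V), (D.phi : V)⟫ = -1 := by
      have h2 : D.refl D.φ • (D.phi : V) = -(D.phi : V) := congrArg Subtype.val D.refl_phi_smul_phi
      have h3 := D.inner_smul_smul (D.refl D.φ) l D.phi
      rw [h2, inner_neg_right, D.coe_phi, hl] at h3
      rw [coe_smul_Pv, D.coe_phi]
      linarith
    have h2 : D.s none • D.mono (-l) = ((D.q : ℝ) : ℂ)⁻¹ • D.mono (-(D.refl D.φ • l)) := by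
      rw [s_none, mul_smul, fin_smul_mono, trans_smul_mono, smul_neg, AddSubgroup.coe_neg,
        inner_neg_left, neg_neg, h1, Real.rpow_neg_one, Complex.ofReal_inv]
    have hq : ((D.q : ℝ) : ℂ) ≠ 0 := Complex.ofReal_ne_zero.2 D.q_pos.ne'
    have h3 : D.dualY (D.s none • D.mono (-l)) = D.T0dual * D.Y l * D.T0dual := by
      rw [h2, map_smul D.dualY, dualY_mono, neg_neg, ← D.T0dual_mul_Y_mul_T0dual hl,
        inv_smul_smul₀ hq]
    rw [CrossRel, map_neg, map_smul D.dualY, h3, dualY_mono, neg_neg, ← mul_assoc, ← mul_assoc,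
      T0dual_mul_self, add_mul, add_mul, one_mul, smul_mul_assoc, smul_mul_assoc,
      add_neg_cancel_right]

lemma TDAHA_none_mem_leftAnti : D.TDAHA none ∈ D.leftAnti := by
  refine D.mem_leftAnti fun f => ?_
  obtain ⟨p, hp, hp'⟩ := D.exists_crossRel_none f
  rw [dualMap_TDAHA_none]
  exact ⟨_, p, hp.symm, hp'⟩

/-- The commutation relation dual to `ω f(X) = (ωf)(X) ω`, for `ω = t(λ)u` of length zero. -/
lemma dualY_mul_of_len_eq_zero {g : D.W} (hg : D.len g = 0) (f : D.CT) :
    D.dualY f * (((D.Tw (D.fin g.right))⁻¹ : D.Aˣ) * D.X (D.mono (-D.tr g))) =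
      ((D.Tw (D.fin g.right))⁻¹ : D.Aˣ) * D.X (D.mono (-D.tr g)) * D.dualY (g • f) := by
  have hf := D.basisMono.mem_span f
  induction hf using Submodule.span_induction with
  | mem x hx =>
    obtain ⟨l, rfl⟩ := hx
    rw [basisMono_apply]
    have h := D.Y_conj_of_len_eq_zero hg (g.right • -l)
    rw [inv_smul_smul, trans_inv, trans_smul_mono, map_smul D.X, AddSubgroup.coe_neg,
      inner_neg_right, neg_neg] at h
    have h1 : D.dualY (g • D.mono l) =
        ((D.q ^ ⟪(D.tr g : V), ((g.right • -l : D.Pv) : V)⟫ : ℝ) : ℂ) • D.Y (g.right • -l) := by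
      conv_lhs => rw [D.eq_trans_mul_fin g]
      rw [mul_smul, fin_smul_mono, trans_smul_mono, map_smul D.dualY, dualY_mono, smul_neg,
        AddSubgroup.coe_neg, inner_neg_right, real_inner_comm]
    have h2 := congrArg (fun a => ((D.Tw (D.fin g.right))⁻¹ : D.Aˣ) * a *
      D.X (D.mono (-D.tr g))) h
    simp only [mul_smul_comm, smul_mul_assoc, mul_assoc, X_mono_mul_neg, mul_one, Units.val_mul,
      Units.inv_mul_cancel_left] at h2
    rw [h1, dualY_mono, ← h2, mul_smul_comm, mul_assoc]
  | zero => rw [smul_zero, map_zero, zero_mul, mul_zero]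
  | add x y _ _ hx hy => rw [smul_add, map_add, map_add, add_mul, mul_add, hx, hy]
  | smul z x _ hx => rw [smul_smul_CT, map_smul D.dualY, map_smul D.dualY, smul_mul_assoc,
      mul_smul_comm, hx]

lemma wOp_mem_leftAnti (g : D.Om) :
    (⟨D.wOp g.1, D.H_le_DAHA (Algebra.subset_adjoin (Or.inr ⟨g, rfl⟩))⟩ : D.DAHA) ∈
      D.leftAnti := by
  refine D.mem_leftAnti fun f => ?_
  set a : D.DAHA := ⟨D.wOp g.1, D.H_le_DAHA (Algebra.subset_adjoin (Or.inr ⟨g, rfl⟩))⟩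
  have h : a = D.evalY (D.mono (D.tr g.1)) * D.inclH0 (D.TwInvH0 g.1.right⁻¹) := by
    refine Subtype.ext ?_
    change (D.wUnit g.1 : D.A) = ((D.evalY _ : D.DAHA) : D.A) * ((D.Tw (D.fin _))⁻¹ : D.Aˣ)
    rw [coe_evalY, evalYA_mono, D.wUnit_of_len_eq_zero g.2, Units.val_mul]
  have h1 : (D.dualMap a : D.A) =
      ((D.Tw (D.fin g.1.right))⁻¹ : D.Aˣ) * D.X (D.mono (-D.tr g.1)) := by
    rw [h, dualMap_evalY_mul_inclH0, inv_inv]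
  refine ⟨g.1 • f, 0, ?_, ?_⟩
  · rw [map_zero, add_zero]
    exact (D.wOp_mul_X g.1 f).symm
  · rw [h1, map_zero, add_zero, D.dualY_mul_of_len_eq_zero g.2]

lemma leftAnti_eq_top : D.leftAnti = ⊤ := by
  have hH : D.H ≤ D.leftAnti.map D.DAHA.val := by
    refine Algebra.adjoin_le ?_
    rintro _ (⟨_ | j, rfl⟩ | ⟨g, rfl⟩)
    · exact ⟨_, D.TDAHA_none_mem_leftAnti, rfl⟩
    · exact ⟨_, D.TDAHA_some_mem_leftAnti j, rfl⟩
    · exact ⟨_, D.wOp_mem_leftAnti g, rfl⟩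
  have hD : D.DAHA ≤ D.leftAnti.map D.DAHA.val := by
    refine Algebra.adjoin_le ?_
    rintro _ (h | ⟨f, rfl⟩)
    · exact hH h
    · exact ⟨_, D.XH_mem_leftAnti f, rfl⟩
  refine eq_top_iff.2 fun a _ => ?_
  obtain ⟨b, hb, hab⟩ := hD a.2
  have : b = a := Subtype.ext hab
  exact this ▸ hb

lemma isDuality_dualMap : D.IsDuality D.dualMap where
  map_one := D.dualMap_one
  map_mul a b := by
    have : a ∈ D.leftAnti := D.leftAnti_eq_top ▸ Algebra.mem_top
    exact this b
  involutive := D.dualMap_dualMap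
  map_Tw u := by
    have h (u : D.W0) : D.TwH (SemidirectProduct.inr u) = D.inclH0 (D.TwH0 u) := rfl
    rw [h, h, dualMap_inclH0, starH0_TwH0]
  map_Y l := by
    have h : D.YH l = D.evalY (D.mono l) := by
      rw [mono, evalY_single, one_smul]
    rw [h, dualMap_evalY, diamondCT_mono]
  map_X l := by
    rw [dualMap_XH, diamondCT_mono, mono, evalY_single, one_smul]

/-- `D.dual` is chosen among the dualities, which exist. -/
lemma isDuality_dual : D.IsDuality D.dual := by
  have h : ∃ σ, D.IsDuality σ := ⟨_, D.isDuality_dualMap⟩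
  rw [dual, dif_pos h]
  exact h.choose_spec

end BqKZDatum

/-! ### The representation `τ` -/

namespace BqKZDatum

variable {ι V : Type*} [NormedAddCommGroup V] [InnerProductSpace ℝ V] {D : BqKZDatum ι V}

lemma IsDuality.map_XH {σ : D.DAHA →ₗ[ℂ] D.DAHA} (hσ : D.IsDuality σ) (f : D.CT) :
    σ (D.XH f) = D.evalY (D.diamondCT f) := by
  have : σ ∘ₗ D.evalX = D.evalY ∘ₗ D.diamondCT.toLinearMap := by
    refine AddMonoidAlgebra.lhom_ext' fun l => LinearMap.ext_ring ?_
    change σ (D.XH (D.mono l)) = D.evalY (D.diamondCT (AddMonoidAlgebra.single l 1))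
    rw [hσ.map_X, diamondCT_single, evalY_single, one_smul]
  exact DFunLike.congr_fun this f

lemma IsDuality.map_evalY {σ : D.DAHA →ₗ[ℂ] D.DAHA} (hσ : D.IsDuality σ) (f : D.CT) :
    σ (D.evalY f) = D.XH (D.diamondCT f) := by
  rw [← hσ.involutive (D.XH _), hσ.map_XH, diamondCT_diamondCT]

lemma IsDuality.map_Stw_mul_evalY {σ : D.DAHA →ₗ[ℂ] D.DAHA} (hσ : D.IsDuality σ) (g : D.W)
    (f : D.CT) : D.evalY f * σ (D.Stw g) =
      σ (D.Stw g) * D.evalY (D.diamondCT (g • D.diamondCT f)) := by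
  have h := congrArg σ (D.Stw_mul_XH g (D.diamondCT f))
  rwa [hσ.map_mul, hσ.map_mul, hσ.map_XH, hσ.map_XH, diamondCT_diamondCT] at h

/-- The image of `BqKZDatum.Stw_mul_Stw` under the duality. -/
lemma IsDuality.map_Stw_mul_Stw {σ : D.DAHA →ₗ[ℂ] D.DAHA} (hσ : D.IsDuality σ) (g h : D.W) :
    σ (D.Stw h) * σ (D.Stw g) * D.evalY (D.diamondCT (D.dw (g * h))) =
      σ (D.Stw (g * h)) * D.evalY (D.diamondCT (D.dw g * g • D.dw h)) := by
  have h := congrArg σ (D.Stw_mul_Stw g h)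
  rwa [hσ.map_mul, hσ.map_mul, hσ.map_mul, hσ.map_XH, hσ.map_XH] at h

variable (D)

lemma toH0K_pbw (f g : D.CT) (h : D.H0) :
    D.toH0K (D.XH f * D.inclH0 h * D.evalY g) = (D.toKx f * D.toKy g) ⊗ₜ h := by
  have h1 : (LinearEquiv.ofBijective D.pbw D.pbw_bijective).symm
      (D.XH f * D.inclH0 h * D.evalY g) = (f ⊗ₜ g) ⊗ₜ h := by
    rw [LinearEquiv.symm_apply_eq]
    rfl
  rw [toH0K, dif_pos D.pbw_bijective]
  simp [h1]

lemma toH0K_mul (f g : D.CT) (x : D.DAHA) :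
    D.toH0K (D.XH f * x * D.evalY g) = (D.toKx f * D.toKy g) • D.toH0K x := by
  obtain ⟨y, rfl⟩ := D.pbw_bijective.2 x
  induction y using TensorProduct.induction_on with
  | zero => simp
  | add a b ha hb => simp only [map_add, mul_add, add_mul, smul_add, ha, hb]
  | tmul a h =>
    induction a using TensorProduct.induction_on with
    | zero => simp
    | add a b ha hb => simp only [map_add, mul_add, add_mul, smul_add, ha, hb,
      TensorProduct.add_tmul]
    | tmul f' g' =>
      have h1 : D.XH f * (D.XH f' * D.inclH0 h * D.evalY g') * D.evalY g =
          D.XH (f * f') * D.inclH0 h * D.evalY (g' * g) := by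
        rw [XH_mul, evalY_mul]
        simp only [mul_assoc]
      rw [pbw_tmul, h1, D.toH0K_pbw, D.toH0K_pbw, TensorProduct.smul_tmul', smul_eq_mul,
        map_mul, map_mul]
      congr 1
      ring

lemma toH0K_inclH0 (h : D.H0) : D.toH0K (D.inclH0 h) = 1 ⊗ₜ h := by
  have h1 := D.toH0K_pbw 1 1 h
  rwa [XH_one, evalY_one, one_mul, mul_one, map_one, map_one, mul_one] at h1

/-- A map of `ℍ` that intertwines the actions of `ℂ[T] ⊗ ℂ[T]` up to `w` agrees on the image of `ℍ`
with its semilinear extension, which is defined through its values on `H₀`. -/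
lemma semiExt_toH0K (w : D.WW)
    (ρ : D.DAHA →ₗ[ℂ] D.DAHA) (hρ : ∀ f g x, D.toH0K (ρ (D.XH f * x * D.evalY g)) =
      (w • (D.toKx f * D.toKy g)) • D.toH0K (ρ x)) (x : D.DAHA) :
    D.semiExt w ρ (D.toH0K x) = D.toH0K (ρ x) := by
  obtain ⟨y, rfl⟩ := D.pbw_bijective.2 x
  induction y using TensorProduct.induction_on with
  | zero => simp
  | add a b ha hb => simp only [map_add, ha, hb]
  | tmul a h =>
    induction a using TensorProduct.induction_on with
    | zero => simp
    | add a b ha hb => simp only [map_add, ha, hb, TensorProduct.add_tmul]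
    | tmul f g => rw [pbw_tmul, D.toH0K_pbw, semiExt_tmul, hρ]

/-- Two semilinear maps agree if they agree on the image of `ℍ`. -/
lemma semilinear_ext (w : D.WW)
    {A B : D.H0K →ₗ[ℂ] D.H0K} (hA : ∀ (F : D.K) f, A (F • f) = (w • F) • A f)
    (hB : ∀ (F : D.K) f, B (F • f) = (w • F) • B f)
    (h : ∀ x, A (D.toH0K x) = B (D.toH0K x)) : A = B := by
  refine TensorProduct.ext' fun F y => ?_
  have h1 : F ⊗ₜ[ℂ] y = F • ((1 : D.K) ⊗ₜ[ℂ] y) := by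
    rw [TensorProduct.smul_tmul', smul_eq_mul, mul_one]
  rw [h1, hA, hB, ← D.toH0K_inclH0, h]

lemma sigma_apply (g g' : D.W) (x : D.DAHA) :
    D.sigma g g' x = D.Stw g * x * D.dual (D.Stw g') := (mul_assoc _ _ _).symm

lemma tauPair_toH0K (g g' : D.W)
    (x : D.DAHA) : D.tauPair g g' (D.toH0K x) =
      ((D.toKx (D.dw g))⁻¹ * (D.toKy (D.diamondCT (D.dw g')))⁻¹) •
        D.toH0K (D.Stw g * x * D.dual (D.Stw g')) := by
  rw [← sigma_apply, ← D.semiExt_toH0K (D.pair g g')]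
  · rfl
  intro f f' x
  rw [sigma_apply, sigma_apply, smul_mul', pair_smul_toKx, pair_smul_toKy,
    ← D.toH0K_mul]
  have h1 : D.Stw g * (D.XH f * x * D.evalY f') * D.dual (D.Stw g') =
      (D.Stw g * D.XH f) * x * (D.evalY f' * D.dual (D.Stw g')) := by
    simp only [mul_assoc]
  rw [h1, Stw_mul_XH, D.isDuality_dual.map_Stw_mul_evalY]
  simp only [mul_assoc]

lemma tauInv_toH0K (x : D.DAHA) :
    D.tauInv (D.toH0K x) = D.toH0K (D.dual x) := by
  refine D.semiExt_toH0K _ _ (fun f f' x => ?_) x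
  have hσ := D.isDuality_dual
  rw [hσ.map_mul, hσ.map_mul, hσ.map_XH, hσ.map_evalY, ← mul_assoc, D.toH0K_mul, smul_mul',
    inv_smul_toKx, inv_smul_toKy, mul_comm]

lemma tauPair_smul (g g' : D.W) (F : D.K) (f : D.H0K) :
    D.tauPair g g' (F • f) = (D.pair g g' • F) • D.tauPair g g' f := by
  simp only [tauPair, LinearMap.coe_mk, AddHom.coe_mk]
  rw [semiExt_smul, smul_comm]

lemma tauInv_smul (F : D.K) (f : D.H0K) : D.tauInv (F • f) = (D.inv • F) • D.tauInv f :=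
  D.semiExt_smul _ _ F f

lemma pair_mul_pair (g g' h h' : D.W) : D.pair g g' * D.pair h h' = D.pair (g * h) (g' * h') :=
  (map_mul (SemidirectProduct.inl (φ := D.swapAction)) (g, g') (h, h')).symm

lemma inv_mul_inv : D.inv * D.inv = 1 := by
  rw [← inv_inv_WW, inv_mul_eq_one, inv_inv_WW]

lemma inv_mul_pair (g g' : D.W) : D.inv * D.pair g g' = D.pair g' g * D.inv := by
  refine SemidirectProduct.ext ?_ ?_
  · change 1 * D.swapAction (-1) (g, g') = (g', g) * D.swapAction 1 1
    rw [swapAction_neg_one, map_one, one_mul, mul_one]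
  · rfl

/-- The rational factors by which `S̃_g S̃_h` differs from `S̃_{gh}` are absorbed by the
normalization of `τ` with `d_w⁻¹`. -/
lemma tauPair_mul (g g' h h' : D.W) :
    D.tauPair g g' ∘ₗ D.tauPair h h' = D.tauPair (g * h) (g' * h') := by
  refine D.semilinear_ext (D.pair (g * h) (g' * h')) (fun F f => ?_)
    (D.tauPair_smul _ _) fun x => ?_
  · rw [LinearMap.comp_apply, LinearMap.comp_apply, tauPair_smul, tauPair_smul, ← mul_smul,
      pair_mul_pair]
  rw [LinearMap.comp_apply, D.tauPair_toH0K, tauPair_smul, D.tauPair_toH0K,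
    D.tauPair_toH0K, smul_smul, smul_mul', smul_inv'', smul_inv'', pair_smul_toKx,
    pair_smul_toKy, diamondCT_diamondCT]
  have key := D.toH0K_mul (D.dw (g * h)) (D.diamondCT (D.dw (g' * h')))
    (D.Stw g * (D.Stw h * x * D.dual (D.Stw h')) * D.dual (D.Stw g'))
  have h1 : D.XH (D.dw (g * h)) * (D.Stw g * (D.Stw h * x * D.dual (D.Stw h')) *
      D.dual (D.Stw g')) * D.evalY (D.diamondCT (D.dw (g' * h'))) =
      D.XH (D.dw g * g • D.dw h) * (D.Stw (g * h) * x * D.dual (D.Stw (g' * h'))) *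
        D.evalY (D.diamondCT (D.dw g' * g' • D.dw h')) := by
    have e1 := D.Stw_mul_Stw g h
    have e2 := D.isDuality_dual.map_Stw_mul_Stw g' h'
    simp only [mul_assoc] at e1 e2 ⊢
    rw [e2]
    simp only [← mul_assoc] at e1 ⊢
    rw [e1]
  rw [h1, D.toH0K_mul] at key
  have n1 := D.toKx_dw_ne_zero g
  have n2 := D.toKx_dw_ne_zero (g * h)
  have n3 := D.toKy_diamond_dw_ne_zero g'
  have n4 := D.toKy_diamond_dw_ne_zero (g' * h')
  have n5 : D.toKx (g • D.dw h) ≠ 0 := by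
    rw [← D.pair_smul_toKx g 1]
    exact (smul_ne_zero_iff_ne _).2 (D.toKx_dw_ne_zero h)
  have n6 : D.toKy (D.diamondCT (g' • D.dw h')) ≠ 0 := by
    have := D.pair_smul_toKy 1 g' (D.diamondCT (D.dw h'))
    rw [diamondCT_diamondCT] at this
    rw [← this]
    exact (smul_ne_zero_iff_ne _).2 (D.toKy_diamond_dw_ne_zero h')
  simp only [map_mul] at key
  rw [← inv_smul_eq_iff₀ (mul_ne_zero n2 n4), smul_smul] at key
  rw [← key, smul_smul]
  congr 1
  field_simp

lemma tauInv_comp_tauInv :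
    D.tauInv ∘ₗ D.tauInv = LinearMap.id := by
  refine D.semilinear_ext 1 (fun F f => ?_) (fun F f => ?_) fun x => ?_
  · rw [LinearMap.comp_apply, LinearMap.comp_apply, tauInv_smul, tauInv_smul, ← mul_smul,
      inv_mul_inv]
  · rw [one_smul]
    rfl
  · rw [LinearMap.comp_apply, D.tauInv_toH0K, D.tauInv_toH0K, D.isDuality_dual.involutive]
    rfl

lemma tauInv_comp_tauPair (g g' : D.W) :
    D.tauInv ∘ₗ D.tauPair g g' = D.tauPair g' g ∘ₗ D.tauInv := by
  refine D.semilinear_ext (D.inv * D.pair g g') (fun F f => ?_) (fun F f => ?_)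
    fun x => ?_
  · rw [LinearMap.comp_apply, LinearMap.comp_apply, tauPair_smul, tauInv_smul, mul_smul]
  · rw [LinearMap.comp_apply, LinearMap.comp_apply, tauInv_smul, tauPair_smul, inv_mul_pair,
      mul_smul]
  · rw [LinearMap.comp_apply, LinearMap.comp_apply, D.tauPair_toH0K, tauInv_smul,
      D.tauInv_toH0K, D.tauInv_toH0K, D.tauPair_toH0K, D.isDuality_dual.map_mul,
      D.isDuality_dual.map_mul, D.isDuality_dual.involutive, smul_mul', smul_inv'', smul_inv'',
      inv_smul_toKx, inv_smul_toKy, diamondCT_diamondCT, mul_comm (D.toKy _)⁻¹, mul_assoc]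

lemma tau_pair (g g' : D.W) : D.tau (D.pair g g') = D.tauPair g g' := rfl

lemma tau_pair_mul_inv (g g' : D.W) :
    D.tau (D.pair g g' * D.inv) = D.tauPair g g' ∘ₗ D.tauInv := by
  have h : (⟨(g, g'), -1⟩ : D.WW) = D.pair g g' * D.inv := SemidirectProduct.mk_eq_inl_mul_inr _ _
  have h1 : (-1 : ℤˣ) ≠ 1 := by decide
  rw [← h, tau]
  simp only [h1, if_false]

lemma exists_pair (w : D.WW) : ∃ g g', w = D.pair g g' ∨ w = D.pair g g' * D.inv := by
  obtain ⟨⟨a, c⟩, e⟩ := w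
  refine ⟨a, c, ?_⟩
  rcases Int.units_eq_one_or e with rfl | rfl
  · exact Or.inl rfl
  · exact Or.inr (SemidirectProduct.mk_eq_inl_mul_inr _ _)

/-- `τ` is multiplicative. -/
lemma tau_mul (v w : D.WW) :
    D.tau (v * w) = D.tau v ∘ₗ D.tau w := by
  obtain ⟨a, b, rfl | rfl⟩ := D.exists_pair v <;> obtain ⟨c, d, rfl | rfl⟩ := D.exists_pair w
  · rw [pair_mul_pair, tau_pair, tau_pair, tau_pair, D.tauPair_mul]
  · rw [← mul_assoc, pair_mul_pair, tau_pair, tau_pair_mul_inv, tau_pair_mul_inv,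
      ← LinearMap.comp_assoc, D.tauPair_mul]
  · rw [mul_assoc, inv_mul_pair, ← mul_assoc, pair_mul_pair, tau_pair, tau_pair_mul_inv,
      tau_pair_mul_inv, LinearMap.comp_assoc, D.tauInv_comp_tauPair, ← LinearMap.comp_assoc,
      D.tauPair_mul]
  · have h : D.pair a b * D.inv * (D.pair c d * D.inv) = D.pair (a * d) (b * c) := by
      rw [mul_assoc, ← mul_assoc D.inv, inv_mul_pair, mul_assoc, inv_mul_inv, mul_one,
        pair_mul_pair]
    rw [h, tau_pair, tau_pair_mul_inv, tau_pair_mul_inv, ← LinearMap.comp_assoc,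
      LinearMap.comp_assoc _ _ (D.tauPair a b), D.tauInv_comp_tauPair, LinearMap.comp_assoc,
      LinearMap.comp_assoc, D.tauInv_comp_tauInv, LinearMap.comp_id, D.tauPair_mul]

/-! ### The cocycle `C` and the solution space -/

lemma leg_mul (v w : D.WW) (f : D.H0K) : D.leg (v * w) f = D.leg v (D.leg w f) := by
  induction f using TensorProduct.induction_on with
  | zero => simp
  | add a b ha hb => simp only [map_add, ha, hb]
  | tmul F h =>
    change ((v * w) • F) ⊗ₜ[ℂ] h = (v • w • F) ⊗ₜ h
    rw [mul_smul]

lemma leg_one (f : D.H0K) : D.leg 1 f = f := by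
  induction f using TensorProduct.induction_on with
  | zero => simp
  | add a b ha hb => simp only [map_add, ha, hb]
  | tmul F h =>
    change ((1 : D.WW) • F) ⊗ₜ[ℂ] h = F ⊗ₜ h
    rw [one_smul]

lemma leg_inv_leg (w : D.WW) (f : D.H0K) : D.leg w⁻¹ (D.leg w f) = f := by
  rw [← leg_mul, inv_mul_cancel, leg_one]

lemma transPair_comm (l m n x : D.Pv) :
    D.transPair l m * D.transPair n x = D.transPair n x * D.transPair l m := by
  have h : ∀ a b : D.Pv, D.trans a * D.trans b = D.trans b * D.trans a := fun a b => by
    have h := congrArg (SemidirectProduct.inl (φ := D.latticeAction))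
      (mul_comm (Multiplicative.ofAdd a) (Multiplicative.ofAdd b))
    rwa [map_mul, map_mul] at h
  rw [transPair, transPair, pair_mul_pair, pair_mul_pair, h, h m]

/-- The translations form a normal subgroup of `𝕎`. -/
lemma exists_transPair_mul (w : D.WW) (l m : D.Pv) :
    ∃ l' m', D.transPair l m * w = w * D.transPair l' m' := by
  have h : ∀ (g : D.W) (a : D.Pv), D.trans a * g = g * D.trans (g.right⁻¹ • a) := fun g a => by
    refine SemidirectProduct.ext ?_ ?_
    · change a + (1 : D.W0) • D.tr g = D.tr g + g.right • (g.right⁻¹ • a)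
      rw [one_smul, smul_inv_smul, add_comm]
    · change 1 * g.right = g.right * 1
      rw [one_mul, mul_one]
  obtain ⟨a, b, rfl | rfl⟩ := D.exists_pair w
  · refine ⟨a.right⁻¹ • l, b.right⁻¹ • m, ?_⟩
    rw [transPair, transPair, pair_mul_pair, pair_mul_pair, h, h]
  · refine ⟨b.right⁻¹ • m, a.right⁻¹ • l, ?_⟩
    rw [transPair, transPair, ← mul_assoc, mul_assoc, mul_assoc (D.pair a b), inv_mul_pair,
      ← mul_assoc, ← mul_assoc, pair_mul_pair, pair_mul_pair, h, h]

/-- `C` is a cocycle because `τ` is a representation. -/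
lemma C_mul (v w : D.WW) :
    D.C v * D.legEnd v (D.C w) = D.C (v * w) := by
  refine LinearMap.ext fun f => ?_
  change D.tau v (D.leg v⁻¹ (D.leg v (D.tau w (D.leg w⁻¹ (D.leg v⁻¹ f))))) =
    D.tau (v * w) (D.leg (v * w)⁻¹ f)
  rw [leg_inv_leg, ← leg_mul, ← mul_inv_rev, tau_mul]
  rfl

lemma mem_SOL {f : D.H0K} : f ∈ D.SOL ↔ ∀ l m, D.tau (D.transPair l m) f = f := by
  refine forall₂_congr fun l m => ?_
  change D.tau _ (D.leg _ (D.leg _ f)) = f ↔ _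
  rw [leg_inv_leg]

end BqKZDatum

theorem mainTheorem2 {ι V : Type*} [NormedAddCommGroup V] [InnerProductSpace ℝ V]
    (D : BqKZDatum ι V) :
    (∀ lam mu nu xi : D.Pv,
      D.Cq lam mu * D.shiftEnd lam mu (D.Cq nu xi) =
        D.Cq nu xi * D.shiftEnd nu xi (D.Cq lam mu)) ∧
    ∃ S : Submodule D.F D.H0K, (S : Set D.H0K) = D.SOL ∧
      ∀ w ∈ D.WW0, ∀ f ∈ S, D.tau w f ∈ S := by
  refine ⟨fun l m n x => ?_, ?_⟩
  · rw [BqKZDatum.Cq, BqKZDatum.Cq, BqKZDatum.shiftEnd, BqKZDatum.shiftEnd, D.C_mul, D.C_mul,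
      D.transPair_comm]
  · refine ⟨{ carrier := D.SOL
              add_mem' := ?_
              zero_mem' := ?_
              smul_mem' := ?_ }, rfl, ?_⟩
    · intro f g hf hg
      rw [D.mem_SOL] at *
      intro l m
      rw [map_add, hf, hg]
    · rw [D.mem_SOL]
      exact fun l m => map_zero _
    · intro F f hf
      rw [D.mem_SOL] at *
      intro l m
      change D.tau _ ((F : D.K) • f) = (F : D.K) • f
      rw [D.tau_smul, hf, F.2 l m]
    · intro w _ f hf
      change f ∈ D.SOL at hf
      change D.tau w f ∈ D.SOL
      rw [D.mem_SOL] at *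
      intro l m
      obtain ⟨l', m', h⟩ := D.exists_transPair_mul w l m
      rw [← LinearMap.comp_apply, ← D.tau_mul, h, D.tau_mul, LinearMap.comp_apply, hf]
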